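/- **Red-blue dominance counting.** Let $R=(R(1),\dots,R(N))$ (red) and $L=(L(1),\dots,L(N))$ (blue) be lists of real numbers, identified with the planar points $(i,R(i))$ and $(j,L(j))$. A pair consisting of a red point $(i,R(i))$ and a blue point $(j,L(j))$ is a *domination pair* if $i<j$ and $L(j)<R(i)$. Let $K^*$ be the number of domination pairs. The *$K$-capped problem*, for an integer $K\ge 0$, asks to output $K^*$, where the algorithm may instead report failure if $K^*>K$. **Model.** In the I/O-model the machine has a main memory of $M$ words and a disk that is divided into blocks of $B$ words, where $B\ge 1$ and $M\ge 2B$. A word holds either a real input value, which can only be copied and compared with other input values, or an integer of $O(\log(N+M))$ bits; the processor has in addition $O(1)$ registers for such integers. One I/O reads a disk block into memory or writes $B$ words of memory to a disk block. Only I/Os are counted; (computable) internal computation is free. Initially each of the two lists is stored on the disk in its given order in $\lceil N/B\rceil$ consecutive blocks. **Theorem.** There are a single deterministic comparison-based algorithm in this model and an absolute constant $C$ such that for all integers $N,K\ge 0$, $B\ge 1$, $M\ge 2B$ and all red and blue lists of length $N$, the algorithm solves the $K$-capped problem with at most $$C\left(1+\frac NB+\frac NB\,\max\Big\{0,\ \log_{M/B}\frac{K}{NB}\Big\}\right)$$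 I/Os, where the maximum is read as $0$ if $N=0$ or $K=0$. -/

import Mathlib

/-!
The external-memory model (main memory of `M` words, disk of blocks of `B` words, cost = number
of block transfers) and the capped red-blue dominance counting problem.
-/

namespace ExtMem

/-- A machine word: an (indivisible) real input value, or a natural number. -/
inductive Word where
  | key (x : ℝ)
  | num (n : ℕ)

/-- The numbers the algorithm is told: list length, memory size, block size, cap. -/
abbrev Params := ℕ × ℕ × ℕ × ℕ

/-- What the processor sees in one memory cell: `Sum.inl n` if the cell holds the number `n`,
`Sum.inr r` if it holds a real value, where `r` is the number of memory cells that hold a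
strictly smaller real value. -/
abbrev Seen := ℕ ⊕ ℕ

/-- How one memory cell is refilled by internal computation: `Sum.inl n` puts the number `n`,
`Sum.inr i` puts a copy of the old content of cell `i`. -/
abbrev Refill := ℕ ⊕ ℕ

/-- One round of the machine, `(registers, refill, isRead, address, position)`: the registers and
the memory are overwritten as described by the first two components, and then there is one block
transfer between disk block `address` and the memory cells
`position, …, position + B - 1`; it is a read if `isRead`, and a write otherwise. -/
abbrev Command := List ℕ × List Refill × Bool × ℕ × ℕ

/-- A comparison-based external-memory algorithm: one computable rule for all parameters, that
chooses from the parameters, the registers and the visible part of the memory whether to halt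
(with answer `some k`, or with `none` for "failure") or which command to carry out.
It has a constant number `regs` of registers, and
its numbers are smaller than `(N + M) ^ wordExp`, i.e. have `O(log (N + M))` bits. -/
structure Algorithm where
  regs : ℕ
  wordExp : ℕ
  next : Params × List ℕ × List Seen → Option ℕ ⊕ Command
  computable_next : Computable next

/-- Everything that is stored: registers, main memory, disk (block address ↦ content). -/
structure Config where
  registers : List ℕ
  memory : List Word
  disk : ℕ → List Word

open Classical in
/-- The number of cells of `mem` that hold a real value smaller than `x`. -/
noncomputable def keyRank (mem : List Word) (x : ℝ) : ℕ :=
  mem.countP fun w => decide (∃ y, w = Word.key y ∧ y < x)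

/-- What the processor sees of a word `w` stored in `mem`. -/
noncomputable def see (mem : List Word) : Word → Seen
  | Word.num n => Sum.inl n
  | Word.key x => Sum.inr (keyRank mem x)

/-- What the processor sees of the memory: numbers, and the outcomes of all comparisons. -/
noncomputable def view (mem : List Word) : List Seen :=
  mem.map (see mem)

/-- New content of a cell. -/
def refillCell (mem : List Word) : Refill → Word
  | Sum.inl n => Word.num n
  | Sum.inr i => mem.getD i (Word.num 0)

/-- A command respects the sizes of the machine: `regs` registers, `M` memory cells, all
numbers and the disk address smaller than `W`, and a block that lies inside the memory. -/
def Command.Valid (regs W M B : ℕ) : Command → Prop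
  | (regsNew, refill, _, addr, pos) =>
    regsNew.length = regs ∧ (∀ n ∈ regsNew, n < W) ∧
    refill.length = M ∧ (∀ n, Sum.inl n ∈ refill → n < W) ∧ (∀ i, Sum.inr i ∈ refill → i < M) ∧
    addr < W ∧ pos + B ≤ M

/-- Effect of a command, with blocks of `B` words. -/
def Command.exec (B : ℕ) (cfg : Config) : Command → Config
  | (regsNew, refill, isRead, addr, pos) =>
    let mem := refill.map (refillCell cfg.memory)
    if isRead then
      ⟨regsNew, mem.take pos ++ cfg.disk addr ++ mem.drop (pos + B), cfg.disk⟩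
    else
      ⟨regsNew, mem, Function.update cfg.disk addr ((mem.drop pos).take B)⟩

/-- `A.Run N M B K t cfg out`: started in `cfg` with list length `N`, memory size `M`, block size
`B` and cap `K`, the algorithm halts with answer `out` after exactly `t` block transfers, never
exceeding the sizes of the machine. -/
inductive Algorithm.Run (A : Algorithm) (N M B K : ℕ) : ℕ → Config → Option ℕ → Prop
  | halt (cfg : Config) (out : Option ℕ)
      (h : A.next ((N, M, B, K), cfg.registers, view cfg.memory) = Sum.inl out) :
      Algorithm.Run A N M B K 0 cfg out
  | step (t : ℕ) (cfg : Config) (cmd : Command) (out : Option ℕ)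
      (h : A.next ((N, M, B, K), cfg.registers, view cfg.memory) = Sum.inr cmd)
      (hv : Command.Valid A.regs ((N + M) ^ A.wordExp) M B cmd)
      (hr : Algorithm.Run A N M B K t (Command.exec B cfg cmd) out) :
      Algorithm.Run A N M B K (t + 1) cfg out

/-- Entry `i` of a list of `N` reals as a disk word; the padding after the end is `0`. -/
def listWord {N : ℕ} (L : Fin N → ℝ) (i : ℕ) : Word :=
  if h : i < N then Word.key (L ⟨i, h⟩) else Word.num 0

/-- Number of blocks that a list of `N` words occupies, `⌈N / B⌉`. -/
def numBlocks (N B : ℕ) : ℕ := N ⌈/⌉ B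

/-- Initial disk: the red list in blocks `0, …, ⌈N/B⌉ - 1`, the blue list in the next `⌈N/B⌉`
blocks, each list in its given order, `B` values to a block; all else is `0`. -/
def inputDisk {N : ℕ} (B : ℕ) (red blue : Fin N → ℝ) (addr : ℕ) : List Word :=
  (List.range B).map fun j =>
    if addr < numBlocks N B then listWord red (addr * B + j)
    else listWord blue ((addr - numBlocks N B) * B + j)

/-- Initial configuration: registers and memory are `0`, the input is on the disk. -/
def initial {N : ℕ} (regs M B : ℕ) (red blue : Fin N → ℝ) : Config where
  registers := List.replicate regs 0
  memory := List.replicate M (Word.num 0)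
  disk := inputDisk B red blue

end ExtMem

/-- `K*`, the number of domination pairs: the red point `(i, red i)` is dominated by the blue
point `(j, blue j)` if the latter has larger first and smaller second coordinate. -/
noncomputable def dominationCount {N : ℕ} (red blue : Fin N → ℝ) : ℕ :=
  Nat.card {p : Fin N × Fin N // p.1 < p.2 ∧ blue p.2 < red p.1}

/-- Correct answers of the capped counting problem: `K*`, or failure if `K* > K`. -/
def CappedAnswer {N : ℕ} (K : ℕ) (red blue : Fin N → ℝ) (out : Option ℕ) : Prop :=
  out = some (dominationCount red blue) ∨ (out = none ∧ K < dominationCount red blue)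

namespace ExtMem

/-! ### A generic while language -/

/-! List the blue and the red point of each abscissa next to each other, blue first. The domination
pairs become inversions of one list of coloured values: a red cell and a later, smaller blue cell
(`dominationCount_eq`). Merge sort counts inversions, but with a logarithm of the list length. The
logarithm of K/(NB) is obtained by sorting only short lists.

Fix a number s. Read the list in groups of s cells and remember a list T of the s largest cells of
the dominating colour met before the group (of all of them, as long as they are fewer). If fewer
than s cells of T dominate a cell of the group, then T contains as many dominators of it as the
whole prefix does. The pairs of such cells are therefore counted by sorting T together with the
group (`cross_counted`, `inv_screen`). All other dominated cells are heavy, and each of them lies in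
at least s bad pairs (`mul_countP_kept_le`). They are kept for the next pass, together with all
dominating cells, and exactly their pairs are still missing.

Let hv be the number of heavy cells of a pass. If hv * s > K, failure may be reported. Otherwise,
since s is at least about K/N times 2^p in pass p, at most N/2^p heavy cells remain
(`mul_pow_le_of_screen`). Reversing the list exchanges the roles of the colours (`inv_reverse`), so
the next pass thins out the other colour, and s is doubled. Pass p thus handles O(N/2^p) cells and
sorts lists of at most 2 * s cells. If Λ levels of merging suffice for the initial s, then Λ + p +
O(1) suffice in pass p. The series of (Λ + p + 2)/2^p converges to O(Λ + 1), so all passes together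
cost O(N/B * (Λ + 1)) transfers, up to an additive constant (`pass_cost_le`, `wp_screenLoop`).
Blocks of the store have h cells, where h is B up to a constant factor, and the fan-in k satisfies
M/B ≤ k^8, so Λ is O(1 + log_{M/B}(K/(NB))) when the logarithm is nonnegative and O(1) otherwise
(`exists_levels`).

The rest makes this an algorithm of the model, in three layers. The abstract program works on a
store of cells that are accessed through streams, and pays for loading blocks; potentials that
depend on the position in a block make sequential access cheap. The store is implemented on the
machine either with one memory frame for each stream (`Cached.simulate`) or, for M < 256, with O(1)
transfers for each access (`Direct.simulate`). Finally, the machine program is flattened to code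
with jumps, and the rule of the algorithm executes this code symbolically on the visible part of the
memory up to the next transfer. A terminating execution never repeats a symbolic state, so the
number of these states is an explicit step bound, and the rule is computable, even primitive
recursive (`iterate_eq_of_finite`, `primrec_interpret`, `run_of_exec`). -/

inductive BinOp
  | add | sub | mul | div | mod | lt | eq

def BinOp.eval : BinOp → ℕ → ℕ → ℕ
  | add, a, b => a + b
  | sub, a, b => a - b
  | mul, a, b => a * b
  | div, a, b => a / b
  | mod, a, b => a % b
  | lt, a, b => if a < b then 1 else 0
  | eq, a, b => if a = b then 1 else 0

/-- Arithmetic expressions over variables `V` and the four parameters `N`, `M`, `B`, `K`. -/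
inductive Expr (V : Type)
  | lit (n : ℕ)
  | par (i : ℕ)
  | var (v : V)
  | bin (o : BinOp) (a b : Expr V)

def paramAt (P : Params) : ℕ → ℕ
  | 0 => P.1
  | 1 => P.2.1
  | 2 => P.2.2.1
  | _ => P.2.2.2

namespace Expr

variable {V V' : Type}

def eval (P : Params) (ρ : V → ℕ) : Expr V → ℕ
  | lit n => n
  | par i => paramAt P i
  | var v => ρ v
  | bin o a b => o.eval (a.eval P ρ) (b.eval P ρ)

def map (f : V → V') : Expr V → Expr V'
  | lit n => lit n
  | par i => par i
  | var v => var (f v)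
  | bin o a b => bin o (a.map f) (b.map f)

instance : Add (Expr V) := ⟨bin .add⟩
instance : Sub (Expr V) := ⟨bin .sub⟩
instance : Mul (Expr V) := ⟨bin .mul⟩
instance : Div (Expr V) := ⟨bin .div⟩
instance : Mod (Expr V) := ⟨bin .mod⟩
instance (n : ℕ) : OfNat (Expr V) n := ⟨lit n⟩

def lt (a b : Expr V) : Expr V := bin .lt a b
def eq (a b : Expr V) : Expr V := bin .eq a b
def min (a b : Expr V) : Expr V := a - (a - b)
def max (a b : Expr V) : Expr V := a + (b - a)

variable (P : Params) (ρ : V → ℕ) (a b : Expr V)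

@[simp] theorem eval_lit (n : ℕ) : (lit n : Expr V).eval P ρ = n := rfl
@[simp] theorem eval_ofNat (n : ℕ) : (no_index (OfNat.ofNat n) : Expr V).eval P ρ = n := rfl
@[simp] theorem eval_zero : (0 : Expr V).eval P ρ = 0 := rfl
@[simp] theorem eval_one : (1 : Expr V).eval P ρ = 1 := rfl
@[simp] theorem eval_par (i : ℕ) : (par i : Expr V).eval P ρ = paramAt P i := rfl
@[simp] theorem eval_var (v : V) : (var v).eval P ρ = ρ v := rfl
@[simp] theorem eval_add : (a + b).eval P ρ = a.eval P ρ + b.eval P ρ := rfl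
@[simp] theorem eval_sub : (a - b).eval P ρ = a.eval P ρ - b.eval P ρ := rfl
@[simp] theorem eval_mul : (a * b).eval P ρ = a.eval P ρ * b.eval P ρ := rfl
@[simp] theorem eval_div : (a / b).eval P ρ = a.eval P ρ / b.eval P ρ := rfl
@[simp] theorem eval_mod : (a % b).eval P ρ = a.eval P ρ % b.eval P ρ := rfl
@[simp] theorem eval_lt :
    (a.lt b).eval P ρ = if a.eval P ρ < b.eval P ρ then 1 else 0 := rfl
@[simp] theorem eval_eq :
    (a.eq b).eval P ρ = if a.eval P ρ = b.eval P ρ then 1 else 0 := rfl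
@[simp] theorem eval_min : (a.min b).eval P ρ = Min.min (a.eval P ρ) (b.eval P ρ) := by
  simp only [min, eval_sub]; omega
@[simp] theorem eval_max : (a.max b).eval P ρ = Max.max (a.eval P ρ) (b.eval P ρ) := by
  simp only [max, eval_sub, eval_add]; omega

theorem eval_map (f : V → V') (ρ' : V' → ℕ) (e : Expr V) :
    (e.map f).eval P ρ' = e.eval P (fun v => ρ' (f v)) := by
  induction e <;> simp_all [map, eval]

end Expr

/-- Structured programs over primitive instructions `ι`. -/
inductive Stmt (V ι : Type)
  | skip
  | prim (i : ι)
  | seq (p q : Stmt V ι)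
  | ite (c : Expr V) (p q : Stmt V ι)
  | loop (c : Expr V) (p : Stmt V ι)

infixr:60 " ;; " => Stmt.seq

/-- A deterministic interpretation of primitive instructions and of tests on states `S`. -/
structure Lang (V ι S : Type) where
  ok : ι → S → Prop
  run : ι → S → S
  test : Expr V → S → ℕ

variable {V ι S V' ι' S' : Type}

/-- Big-step semantics (terminating executions). -/
inductive Exec (L : Lang V ι S) : Stmt V ι → S → S → Prop
  | skip (σ) : Exec L .skip σ σ
  | prim (i σ) (h : L.ok i σ) : Exec L (.prim i) σ (L.run i σ)
  | seq {p q σ σ₁ σ₂} (h₁ : Exec L p σ σ₁) (h₂ : Exec L q σ₁ σ₂) : Exec L (.seq p q) σ σ₂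
  | iteT {c p q σ σ₁} (hc : L.test c σ ≠ 0) (h : Exec L p σ σ₁) : Exec L (.ite c p q) σ σ₁
  | iteF {c p q σ σ₁} (hc : L.test c σ = 0) (h : Exec L q σ σ₁) : Exec L (.ite c p q) σ σ₁
  | loopT {c p σ σ₁ σ₂} (hc : L.test c σ ≠ 0) (h₁ : Exec L p σ σ₁)
      (h₂ : Exec L (.loop c p) σ₁ σ₂) : Exec L (.loop c p) σ σ₂
  | loopF {c p σ} (hc : L.test c σ = 0) : Exec L (.loop c p) σ σ

/-- The program terminates in a state that satisfies `Q`. -/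
def Wp (L : Lang V ι S) (p : Stmt V ι) (Q : S → Prop) (σ : S) : Prop :=
  ∃ σ', Exec L p σ σ' ∧ Q σ'

/-! ### Rules for weakest preconditions -/

section Wp

variable {L : Lang V ι S} {Q Q' : S → Prop} {σ : S} {p q : Stmt V ι}

theorem Wp.mono (h : Wp L p Q σ) (hQ : ∀ σ', Q σ' → Q' σ') : Wp L p Q' σ :=
  let ⟨σ', h₁, h₂⟩ := h; ⟨σ', h₁, hQ _ h₂⟩

@[simp] theorem wp_skip : Wp L .skip Q σ ↔ Q σ := by
  constructor
  · rintro ⟨_, ⟨⟩, h⟩; exact h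
  · exact fun h => ⟨_, .skip _, h⟩

@[simp] theorem wp_prim {i : ι} : Wp L (.prim i) Q σ ↔ L.ok i σ ∧ Q (L.run i σ) := by
  constructor
  · rintro ⟨_, ⟨⟩, h⟩; exact ⟨‹_›, h⟩
  · exact fun h => ⟨_, .prim _ _ h.1, h.2⟩

@[simp] theorem wp_seq : Wp L (p ;; q) Q σ ↔ Wp L p (Wp L q Q) σ := by
  constructor
  · rintro ⟨_, h, hQ⟩
    cases h with | seq h₁ h₂ => exact ⟨_, h₁, _, h₂, hQ⟩
  · rintro ⟨_, h₁, _, h₂, hQ⟩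
    exact ⟨_, .seq h₁ h₂, hQ⟩

@[simp] theorem wp_ite {c : Expr V} :
    Wp L (.ite c p q) Q σ ↔ (L.test c σ ≠ 0 → Wp L p Q σ) ∧ (L.test c σ = 0 → Wp L q Q σ) := by
  constructor
  · rintro ⟨_, h, hQ⟩
    cases h with
    | iteT hc h => exact ⟨fun _ => ⟨_, h, hQ⟩, fun h' => absurd h' hc⟩
    | iteF hc h => exact ⟨fun h' => absurd hc h', fun _ => ⟨_, h, hQ⟩⟩
  · rintro ⟨h₁, h₂⟩
    by_cases hc : L.test c σ = 0
    · obtain ⟨_, h, hQ⟩ := h₂ hc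
      exact ⟨_, .iteF hc h, hQ⟩
    · obtain ⟨_, h, hQ⟩ := h₁ hc
      exact ⟨_, .iteT hc h, hQ⟩

/-- Total correctness of a loop, from an invariant and a variant. -/
theorem wp_loop {c : Expr V} (I : S → Prop) (μ : S → ℕ) (h₀ : I σ)
    (hb : ∀ τ, I τ → L.test c τ ≠ 0 → Wp L p (fun τ' => I τ' ∧ μ τ' < μ τ) τ)
    (he : ∀ τ, I τ → L.test c τ = 0 → Q τ) : Wp L (.loop c p) Q σ := by
  induction hn : μ σ using Nat.strong_induction_on generalizing σ with
  | _ n ih =>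
    by_cases hc : L.test c σ = 0
    · exact ⟨_, .loopF hc, he _ h₀ hc⟩
    · obtain ⟨σ₁, h₁, hI, hμ⟩ := hb σ h₀ hc
      obtain ⟨σ₂, h₂, hQ⟩ := ih _ (hn ▸ hμ) hI rfl
      exact ⟨σ₂, .loopT hc h₁ h₂, hQ⟩

/-- A loop whose body carries out the step from `I i` to `I (i + 1)`, for `i < n`. -/
theorem wp_for {c : Expr V} (I : ℕ → S → Prop) (n : ℕ) (h₀ : I 0 σ)
    (hb : ∀ i τ, i < n → I i τ → L.test c τ ≠ 0 ∧ Wp L p (I (i + 1)) τ)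
    (he : ∀ τ, I n τ → L.test c τ = 0 ∧ Q τ) : Wp L (.loop c p) Q σ := by
  have key : ∀ m i σ, i + m = n → I i σ → Wp L (.loop c p) Q σ := by
    intro m
    induction m with
    | zero =>
      rintro i σ rfl hI
      exact ⟨_, .loopF (he _ hI).1, (he _ hI).2⟩
    | succ m ih =>
      intro i σ hi hI
      obtain ⟨hc, σ₁, h₁, hI₁⟩ := hb i σ (by omega) hI
      obtain ⟨σ₂, h₂, hQ⟩ := ih (i + 1) σ₁ (by omega) hI₁
      exact ⟨σ₂, .loopT hc h₁ h₂, hQ⟩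
  exact key n 0 σ (by omega) h₀

end Wp

/-- Replace every primitive instruction by a program. -/
def Stmt.subst (f : V → V') (tr : ι → Stmt V' ι') : Stmt V ι → Stmt V' ι'
  | skip => skip
  | prim i => tr i
  | seq p q => seq (p.subst f tr) (q.subst f tr)
  | ite c p q => ite (c.map f) (p.subst f tr) (q.subst f tr)
  | loop c p => loop (c.map f) (p.subst f tr)

/-- Simulation of primitive instructions extends to programs. -/
theorem Exec.subst {L : Lang V ι S} {L' : Lang V' ι' S'} {f : V → V'} {tr : ι → Stmt V' ι'}
    (Rel : S → S' → Prop)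
    (htest : ∀ c σ τ, Rel σ τ → L'.test (c.map f) τ = L.test c σ)
    (hprim : ∀ i σ τ, Rel σ τ → L.ok i σ → Wp L' (tr i) (Rel (L.run i σ)) τ)
    {p : Stmt V ι} {σ σ' : S} (h : Exec L p σ σ') {τ : S'} (hτ : Rel σ τ) :
    Wp L' (p.subst f tr) (Rel σ') τ := by
  induction h generalizing τ with
  | skip => simpa [Stmt.subst] using hτ
  | prim i σ hok => exact hprim _ _ _ hτ hok
  | seq _ _ ih₁ ih₂ =>
    simp only [Stmt.subst, wp_seq]
    exact (ih₁ hτ).mono fun _ h => ih₂ h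
  | iteT hc _ ih =>
    simp only [Stmt.subst, wp_ite, htest _ _ _ hτ]
    exact ⟨fun _ => ih hτ, fun h => absurd h hc⟩
  | iteF hc _ ih =>
    simp only [Stmt.subst, wp_ite, htest _ _ _ hτ]
    exact ⟨fun h => absurd hc h, fun _ => ih hτ⟩
  | loopT hc _ _ ih₁ ih₂ =>
    obtain ⟨τ₁, h₁, hR₁⟩ := ih₁ hτ
    obtain ⟨τ₂, h₂, hR₂⟩ := ih₂ hR₁
    exact ⟨τ₂, .loopT (by rwa [htest _ _ _ hτ]) h₁ h₂, hR₂⟩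
  | loopF hc => exact ⟨τ, .loopF (by rwa [htest _ _ _ hτ]), hτ⟩

/-! ### The machine language -/

/-- Primitive instructions of the machine: assign a variable; move a piece of memory; write a
number into a cell; read the number in a cell; compare the real values in two cells; transfer a
block. -/
inductive MInstr
  | set (v : ℕ) (e : Expr ℕ)
  | copy (d s l : Expr ℕ)
  | num (d e : Expr ℕ)
  | get (v : ℕ) (e : Expr ℕ)
  | cmp (v : ℕ) (a b : Expr ℕ)
  | io (isRead : Bool) (a p : Expr ℕ)

structure MState where
  var : ℕ → ℕ
  cells : List Word
  disk : ℕ → List Word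
  io : ℕ

def Word.toNum : Word → ℕ
  | key _ => 0
  | num n => n

open Classical in
/-- `1` for "smaller", `2` for "larger", `0` for "equal" (or not comparable). -/
noncomputable def Word.compare : Word → Word → ℕ
  | key x, key y => if x < y then 1 else if y < x then 2 else 0
  | _, _ => 0

/-- Number of variables, bound for numbers, and parameters. -/
structure MEnv where
  P : Params
  R : ℕ
  W : ℕ

abbrev MEnv.M (E : MEnv) : ℕ := paramAt E.P 1
abbrev MEnv.B (E : MEnv) : ℕ := paramAt E.P 2

def cellAt (l : List Word) (i : ℕ) : Word := l.getD i (.num 0)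

/-- Refill data for `MInstr.copy`. -/
def copyCells {α : Type} (z : α) (M : ℕ) (l : List α) (d s n : ℕ) : List α :=
  (List.range M).map fun i => if d ≤ i ∧ i < d + n then l.getD (s + (i - d)) z else l.getD i z

open Function

/-- These conditions ensure that every emitted command is `Command.Valid` and that the numbers in
registers stay below the word bound. A comparison has the outcomes 0, 1 and 2, hence `2 < E.W`. -/
def MInstr.ok (E : MEnv) : MInstr → MState → Prop
  | set v e, σ => v < E.R ∧ e.eval E.P σ.var < E.W
  | copy _ _ _, _ => True
  | num _ e, σ => e.eval E.P σ.var < E.W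
  | get v e, σ => v < E.R ∧ (cellAt σ.cells (e.eval E.P σ.var)).toNum < E.W
  | cmp v _ _, _ => v < E.R ∧ 2 < E.W
  | io _ a p, σ => a.eval E.P σ.var < E.W ∧ p.eval E.P σ.var + E.B ≤ E.M

noncomputable def MInstr.run (E : MEnv) : MInstr → MState → MState
  | set v e, σ => { σ with var := update σ.var v (e.eval E.P σ.var) }
  | copy d s l, σ => { σ with
      cells := copyCells (.num 0) E.M σ.cells (d.eval E.P σ.var) (s.eval E.P σ.var)
        (l.eval E.P σ.var) }
  | num d e, σ => { σ with cells := σ.cells.set (d.eval E.P σ.var) (.num (e.eval E.P σ.var)) }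
  | get v e, σ => { σ with var := update σ.var v (cellAt σ.cells (e.eval E.P σ.var)).toNum }
  | cmp v a b, σ => { σ with
      var := update σ.var v
        ((cellAt σ.cells (a.eval E.P σ.var)).compare (cellAt σ.cells (b.eval E.P σ.var))) }
  | io true a p, σ => { σ with
      cells := σ.cells.take (p.eval E.P σ.var) ++ σ.disk (a.eval E.P σ.var) ++
        σ.cells.drop (p.eval E.P σ.var + E.B)
      io := σ.io + 1 }
  | io false a p, σ => { σ with
      disk := update σ.disk (a.eval E.P σ.var) ((σ.cells.drop (p.eval E.P σ.var)).take E.B)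
      io := σ.io + 1 }

noncomputable def mLang (E : MEnv) : Lang ℕ MInstr MState where
  ok := MInstr.ok E
  run := MInstr.run E
  test e σ := e.eval E.P σ.var

theorem mLang_ok (E : MEnv) (i : MInstr) (σ : MState) : (mLang E).ok i σ = i.ok E σ := rfl

theorem mLang_run (E : MEnv) (i : MInstr) (σ : MState) : (mLang E).run i σ = i.run E σ := rfl

theorem mLang_test (E : MEnv) (e : Expr ℕ) (σ : MState) :
    (mLang E).test e σ = e.eval E.P σ.var := rfl

/-! ### Flat code -/

inductive FInstr
  | prim (i : MInstr)
  | jz (e : Expr ℕ) (t : ℕ)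
  | jmp (t : ℕ)

def Stmt.size : Stmt ℕ MInstr → ℕ
  | skip => 0
  | prim _ => 1
  | seq p q => p.size + q.size
  | ite _ p q => p.size + q.size + 2
  | loop _ p => p.size + 2

/-- Flat code, to be placed at address `o`. -/
def Stmt.code : Stmt ℕ MInstr → ℕ → List FInstr
  | skip, _ => []
  | prim i, _ => [.prim i]
  | seq p q, o => p.code o ++ q.code (o + p.size)
  | ite c p q, o => .jz c (o + p.size + 2) :: (p.code (o + 1) ++
      .jmp (o + p.size + q.size + 2) :: q.code (o + p.size + 2))
  | loop c p, o => .jz c (o + p.size + 2) :: (p.code (o + 1) ++ [.jmp o])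

theorem Stmt.length_code (p : Stmt ℕ MInstr) (o : ℕ) : (p.code o).length = p.size := by
  induction p generalizing o <;> (simp_all [Stmt.code, Stmt.size]; try omega)

/-- One step of flat code. -/
inductive FStep (E : MEnv) (C : List FInstr) : ℕ × MState → ℕ × MState → Prop
  | prim {pc σ i} (h : C[pc]? = some (.prim i)) (hok : i.ok E σ) :
      FStep E C (pc, σ) (pc + 1, i.run E σ)
  | jz {pc σ e t} (h : C[pc]? = some (.jz e t)) :
      FStep E C (pc, σ) (if e.eval E.P σ.var = 0 then t else pc + 1, σ)
  | jmp {pc σ t} (h : C[pc]? = some (.jmp t)) : FStep E C (pc, σ) (t, σ)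

open Relation

/-- The surrounding code `C₁` and `C₂` is arbitrary, so that the induction hypotheses apply to a
subprogram in the place where it occurs. -/
theorem Exec.flat {E : MEnv} {p : Stmt ℕ MInstr} {σ σ' : MState} (h : Exec (mLang E) p σ σ')
    (C₁ C₂ : List FInstr) :
    ReflTransGen (FStep E (C₁ ++ p.code C₁.length ++ C₂)) (C₁.length, σ)
      (C₁.length + p.size, σ') := by
  induction h generalizing C₁ C₂ with
  | skip σ => exact .refl
  | prim i σ hok =>
    refine .single (.prim ?_ hok)
    simp [Stmt.code]
  | @seq p q σ σ₁ σ₂ _ _ ih₁ ih₂ =>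
    have h₁ := ih₁ C₁ (q.code (C₁.length + p.size) ++ C₂)
    have h₂ := ih₂ (C₁ ++ p.code C₁.length) C₂
    simp only [List.length_append, Stmt.length_code, List.append_assoc] at h₁ h₂
    simp only [Stmt.code, Stmt.size, List.append_assoc]
    refine h₁.trans ?_
    rw [← Nat.add_assoc]; exact h₂
  | @iteT c p q σ σ₁ hc _ ih =>
    have h₁ := ih (C₁ ++ [.jz c (C₁.length + p.size + 2)])
      (.jmp (C₁.length + p.size + q.size + 2) :: q.code (C₁.length + p.size + 2) ++ C₂)
    simp only [List.length_append, List.length_singleton, List.append_assoc, List.cons_append,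
      List.nil_append] at h₁
    simp only [Stmt.code, Stmt.size, List.append_assoc, List.cons_append]
    refine .head (b := (C₁.length + 1, σ)) ?_ (h₁.tail ?_)
    · have := FStep.jz (E := E) (C := C₁ ++ (FInstr.jz c (C₁.length + p.size + 2) ::
        (p.code (C₁.length + 1) ++ (.jmp (C₁.length + p.size + q.size + 2) ::
          (q.code (C₁.length + p.size + 2) ++ C₂))))) (pc := C₁.length) (σ := σ) (e := c)
        (t := C₁.length + p.size + 2) (by simp)
      rwa [if_neg (show c.eval E.P σ.var ≠ 0 from hc)] at this
    · have e : C₁.length + (p.size + q.size + 2) = C₁.length + p.size + q.size + 2 := by omega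
      rw [e]
      refine .jmp ?_
      rw [List.getElem?_append_right (by omega), List.getElem?_cons, if_neg (by omega),
        List.getElem?_append_right (by simp [Stmt.length_code]; omega)]
      simp only [Stmt.length_code]
      rw [show C₁.length + 1 + p.size - C₁.length - 1 - p.size = 0 by omega]; rfl
  | @iteF c p q σ σ₁ hc _ ih =>
    have h₁ := ih (C₁ ++ (.jz c (C₁.length + p.size + 2) :: (p.code (C₁.length + 1) ++
      [.jmp (C₁.length + p.size + q.size + 2)]))) C₂
    have e₁ : C₁.length + (p.size + 1 + 1) = C₁.length + p.size + 2 := by omega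
    have e₂ : C₁.length + p.size + 2 + q.size = C₁.length + (p.size + q.size + 2) := by omega
    simp only [List.length_append, List.length_cons, List.length_nil, List.append_assoc,
      List.cons_append, List.nil_append, Stmt.length_code, Nat.zero_add,
      e₁, e₂] at h₁
    simp only [Stmt.code, Stmt.size, List.append_assoc, List.cons_append]
    refine .head ?_ h₁
    have := FStep.jz (E := E) (C := C₁ ++ (FInstr.jz c (C₁.length + p.size + 2) ::
        (p.code (C₁.length + 1) ++ (.jmp (C₁.length + p.size + q.size + 2) ::
          (q.code (C₁.length + p.size + 2) ++ C₂))))) (pc := C₁.length) (σ := σ) (e := c)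
        (t := C₁.length + p.size + 2) (by simp)
    rwa [if_pos (show c.eval E.P σ.var = 0 from hc)] at this
  | @loopT c p σ σ₁ σ₂ hc _ _ ih₁ ih₂ =>
    have h₁ := ih₁ (C₁ ++ [.jz c (C₁.length + p.size + 2)]) (.jmp C₁.length :: C₂)
    have h₂ := ih₂ C₁ C₂
    simp only [List.length_append, List.length_singleton, List.append_assoc, List.cons_append,
      List.nil_append] at h₁
    simp only [Stmt.code, Stmt.size, List.append_assoc, List.cons_append, List.nil_append] at h₂ ⊢
    refine .head (b := (C₁.length + 1, σ)) ?_ (h₁.trans (.head (b := (C₁.length, σ₁)) ?_ h₂))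
    · have := FStep.jz (E := E) (C := C₁ ++ (FInstr.jz c (C₁.length + p.size + 2) ::
        (p.code (C₁.length + 1) ++ (.jmp C₁.length :: C₂)))) (pc := C₁.length) (σ := σ) (e := c)
        (t := C₁.length + p.size + 2) (by simp)
      rwa [if_neg (show c.eval E.P σ.var ≠ 0 from hc)] at this
    · refine .jmp ?_
      rw [List.getElem?_append_right (by omega), List.getElem?_cons, if_neg (by omega),
        List.getElem?_append_right (by simp [Stmt.length_code]; omega)]
      simp only [Stmt.length_code]
      rw [show C₁.length + 1 + p.size - C₁.length - 1 - p.size = 0 by omega]; rfl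
  | @loopF c p σ hc =>
    simp only [Stmt.code, Stmt.size, List.append_assoc, List.cons_append, List.nil_append]
    have := FStep.jz (E := E) (C := C₁ ++ (FInstr.jz c (C₁.length + p.size + 2) ::
        (p.code (C₁.length + 1) ++ (.jmp C₁.length :: C₂)))) (pc := C₁.length) (σ := σ) (e := c)
        (t := C₁.length + p.size + 2) (by simp)
    rw [if_pos (show c.eval E.P σ.var = 0 from hc)] at this
    exact .single this

open Function Relation

/-! ### Interpreting flat code on what the processor sees -/

/-- Registers and pending refill. -/
abbrev Sym := List ℕ × List Refill

def symAt (v : List Seen) : Refill → Seen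
  | .inl n => .inl n
  | .inr j => v.getD j (.inl 0)

def Seen.toNum (s : Seen) : ℕ := Sum.casesOn s (fun n => n) fun _ => 0

def Seen.compare (s t : Seen) : ℕ :=
  Sum.casesOn s (fun _ => 0) fun a => Sum.casesOn t (fun _ => 0) fun b =>
    if a < b then 1 else if b < a then 2 else 0

/-- Register 0 is the program counter. -/
def regVar (regs : List ℕ) (v : ℕ) : ℕ := regs.getD (v + 1) 0

/-- Variable 0 encodes the answer: 0 is failure and k + 1 is the number k. -/
def haltOut (regs : List ℕ) : Option ℕ :=
  if regVar regs 0 = 0 then none else some (regVar regs 0 - 1)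

/-- Content of the cell at `e`, as far as it is visible. -/
def cellSeen (P : Params) (view : List Seen) (s : Sym) (e : Expr ℕ) : Seen :=
  symAt view (s.2.getD (e.eval P (regVar s.1)) (.inl 0))

def jumpTo (s : Sym) (t : ℕ) : Sym := (s.1.set 0 t, s.2)

def assignReg (s : Sym) (v x : ℕ) : Sym := ((s.1.set 0 (s.1.getD 0 0 + 1)).set (v + 1) x, s.2)

/-- Moving words only changes the pending refill, whose entries point to the cells as they were
after the last transfer. This is why any number of internal instructions fits into one command, and
why the old view decides all comparisons. -/
def MInstr.sym (P : Params) (view : List Seen) (s : Sym) : MInstr → Sym ⊕ (Option ℕ ⊕ Command)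
  | set v e => .inl (assignReg s v (e.eval P (regVar s.1)))
  | copy d a l => .inl (s.1.set 0 (s.1.getD 0 0 + 1),
      copyCells (.inl 0) (paramAt P 1) s.2 (d.eval P (regVar s.1)) (a.eval P (regVar s.1))
        (l.eval P (regVar s.1)))
  | num d e => .inl (s.1.set 0 (s.1.getD 0 0 + 1),
      s.2.set (d.eval P (regVar s.1)) (.inl (e.eval P (regVar s.1))))
  | get v e => .inl (assignReg s v (cellSeen P view s e).toNum)
  | cmp v a b => .inl (assignReg s v ((cellSeen P view s a).compare (cellSeen P view s b)))
  | io r a p => .inr (.inr (s.1.set 0 (s.1.getD 0 0 + 1), s.2, r, a.eval P (regVar s.1),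
      p.eval P (regVar s.1)))

def FInstr.sym (P : Params) (view : List Seen) (s : Sym) : FInstr → Sym ⊕ (Option ℕ ⊕ Command)
  | prim i => i.sym P view s
  | jz e t => .inl (jumpTo s (if e.eval P (regVar s.1) = 0 then t else s.1.getD 0 0 + 1))
  | jmp t => .inl (jumpTo s t)

/-- Execute the instruction at address `pc`; halt if there is none. -/
def symStep (P : Params) (view : List Seen) (s : Sym) :
    List FInstr → ℕ → Sym ⊕ (Option ℕ ⊕ Command)
  | [], _ => .inr (.inl (haltOut s.1))
  | i :: C, pc => if pc = 0 then i.sym P view s else symStep P view s C (pc - 1)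

def symIter (C : List FInstr) (P : Params) (view : List Seen) (x : Sym ⊕ (Option ℕ ⊕ Command)) :
    Sym ⊕ (Option ℕ ⊕ Command) :=
  Sum.casesOn x (fun s => symStep P view s C (s.1.getD 0 0)) fun r => .inr r

def wordBound (e : ℕ) (P : Params) : ℕ := (P.1 + P.2.1) ^ e

/-- A bound for the number of internal steps between two transfers. -/
def fuel (R e : ℕ) (P : Params) : ℕ :=
  wordBound e P ^ (R + 1) * (wordBound e P + P.2.1) ^ P.2.1

/-- The pending refill starts as the identity. The value `none` after the last unit of fuel is a
default, which no terminating execution reaches. -/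
def interpret (C : List FInstr) (R e : ℕ) (x : Params × List ℕ × List Seen) : Option ℕ ⊕ Command :=
  Sum.casesOn ((symIter C x.1 x.2.2)^[fuel R e x.1]
    (.inl (x.2.1, (List.range x.1.2.1).map Sum.inr))) (fun _ => .inl none) fun r => r

/-! ### Computability -/

section Computability

open Primrec

variable {α : Type} [Primcodable α]

theorem primrec_natPow : Primrec₂ ((· ^ ·) : ℕ → ℕ → ℕ) := by
  have : Primrec₂ fun (a n : ℕ) => (fun m => a * m)^[n] 1 := by
    refine Primrec₂.mk (nat_iterate snd (const 1) ?_)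
    exact nat_mul.comp (fst.comp fst) snd
  refine this.of_eq fun a n => ?_
  induction n with
  | zero => rfl
  | succ n ih => rw [iterate_succ_apply', ih, pow_succ']

theorem primrec_paramAt (i : ℕ) : Primrec fun P : Params => paramAt P i := by
  rcases i with _ | _ | _ | i
  · exact fst
  · exact fst.comp snd
  · exact fst.comp (snd.comp snd)
  · exact snd.comp (snd.comp snd)

theorem primrec_eval {P : α → Params} {r : α → List ℕ} (hP : Primrec P) (hr : Primrec r)
    (e : Expr ℕ) : Primrec fun a => e.eval (P a) (regVar (r a)) := by
  induction e with
  | lit n => exact const n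
  | par i => exact (primrec_paramAt i).comp hP
  | var v => exact (list_getD 0).comp hr (const (v + 1))
  | bin o a b iha ihb =>
    cases o with
    | add => exact nat_add.comp iha ihb
    | sub => exact nat_sub.comp iha ihb
    | mul => exact nat_mul.comp iha ihb
    | div => exact nat_div.comp iha ihb
    | mod => exact nat_mod.comp iha ihb
    | lt => exact Primrec.ite (nat_lt.comp iha ihb) (const 1) (const 0)
    | eq => exact Primrec.ite (Primrec.eq.comp iha ihb) (const 1) (const 0)

theorem primrec_copyCells {z : Refill} {M d s n : α → ℕ} {l : α → List Refill} (hM : Primrec M)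
    (hl : Primrec l) (hd : Primrec d) (hs : Primrec s) (hn : Primrec n) :
    Primrec fun a => copyCells z (M a) (l a) (d a) (s a) (n a) := by
  refine list_map (list_range.comp hM) (Primrec₂.mk ?_)
  refine Primrec.ite (PrimrecPred.and (nat_le.comp (hd.comp fst) snd)
    (nat_lt.comp snd (nat_add.comp (hd.comp fst) (hn.comp fst)))) ?_ ?_
  · exact (list_getD z).comp (hl.comp fst)
      (nat_add.comp (hs.comp fst) (nat_sub.comp snd (hd.comp fst)))
  · exact (list_getD z).comp (hl.comp fst) snd

theorem primrec_symAt : Primrec₂ symAt := by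
  have : Primrec₂ fun (v : List Seen) (r : Refill) =>
      (Sum.casesOn r (fun n => .inl n) fun j => v.getD j (.inl 0) : Seen) :=
    Primrec₂.mk (sumCasesOn snd (Primrec₂.mk (sumInl.comp snd))
      (Primrec₂.mk ((list_getD _).comp (fst.comp fst) snd)))
  exact this.of_eq fun v r => by cases r <;> rfl

theorem primrec_seenToNum : Primrec Seen.toNum :=
  sumCasesOn Primrec.id (Primrec₂.mk snd) (Primrec₂.mk (const 0))

theorem primrec_seenCompare : Primrec₂ Seen.compare := by
  refine Primrec₂.mk (sumCasesOn fst (Primrec₂.mk (const 0)) (Primrec₂.mk ?_))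
  refine sumCasesOn (snd.comp fst) (Primrec₂.mk (const 0)) (Primrec₂.mk ?_)
  exact Primrec.ite (nat_lt.comp (snd.comp fst) snd) (const 1)
    (Primrec.ite (nat_lt.comp snd (snd.comp fst)) (const 2) (const 0))

theorem primrec_haltOut : Primrec haltOut := by
  have h : Primrec fun r : List ℕ => regVar r 0 := (list_getD 0).comp Primrec.id (const 1)
  exact Primrec.ite (Primrec.eq.comp h (const 0)) (const none)
    (option_some.comp (nat_sub.comp h (const 1)))

theorem primrec_listSet {β : Type} [Primcodable β] {l : α → List β} {i : α → ℕ} {x : α → β}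
    (hl : Primrec l) (hi : Primrec i) (hx : Primrec x) :
    Primrec fun a => (l a).set (i a) (x a) :=
  list_set.comp hl (hi.pair hx)

variable {P : α → Params} {v : α → List Seen} {s : α → Sym}

theorem primrec_nextReg (hs : Primrec s) :
    Primrec fun a => (s a).1.set 0 ((s a).1.getD 0 0 + 1) :=
  primrec_listSet (fst.comp hs) (const 0)
    (succ.comp ((list_getD 0).comp (fst.comp hs) (const 0)))

theorem primrec_assignReg {x : α → ℕ} (hs : Primrec s) (i : ℕ) (hx : Primrec x) :
    Primrec fun a => assignReg (s a) i (x a) :=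
  (primrec_listSet (primrec_nextReg hs) (const (i + 1)) hx).pair (snd.comp hs)

theorem primrec_cellSeen (hP : Primrec P) (hv : Primrec v) (hs : Primrec s) (e : Expr ℕ) :
    Primrec fun a => cellSeen (P a) (v a) (s a) e :=
  primrec_symAt.comp hv ((list_getD _).comp (snd.comp hs) (primrec_eval hP (fst.comp hs) e))

theorem MInstr.primrec_sym (hP : Primrec P) (hv : Primrec v) (hs : Primrec s) (i : MInstr) :
    Primrec fun a => i.sym (P a) (v a) (s a) := by
  have he (e : Expr ℕ) := primrec_eval hP (fst.comp hs) e
  cases i with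
  | set v e => exact sumInl.comp (primrec_assignReg hs v (he e))
  | copy d a l =>
    exact sumInl.comp ((primrec_nextReg hs).pair (primrec_copyCells ((primrec_paramAt 1).comp hP)
      (snd.comp hs) (he d) (he a) (he l)))
  | num d e =>
    exact sumInl.comp ((primrec_nextReg hs).pair (primrec_listSet (snd.comp hs) (he d)
      (sumInl.comp (he e))))
  | get i e =>
    exact sumInl.comp (primrec_assignReg hs i (primrec_seenToNum.comp
      (primrec_cellSeen hP hv hs e)))
  | cmp i a b =>
    exact sumInl.comp (primrec_assignReg hs i (primrec_seenCompare.comp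
      (primrec_cellSeen hP hv hs a) (primrec_cellSeen hP hv hs b)))
  | io r a p =>
    exact sumInr.comp (sumInr.comp ((primrec_nextReg hs).pair ((snd.comp hs).pair
      ((Primrec.const r).pair ((he a).pair (he p))))))

theorem FInstr.primrec_sym (hP : Primrec P) (hv : Primrec v) (hs : Primrec s) (i : FInstr) :
    Primrec fun a => i.sym (P a) (v a) (s a) := by
  have hj {t : α → ℕ} (ht : Primrec t) : Primrec fun a => jumpTo (s a) (t a) :=
    (primrec_listSet (fst.comp hs) (const 0) ht).pair (snd.comp hs)
  cases i with
  | prim i => exact i.primrec_sym hP hv hs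
  | jz e t =>
    exact sumInl.comp (hj (Primrec.ite (Primrec.eq.comp (primrec_eval hP (fst.comp hs) e) (const 0))
      (const t) (succ.comp ((list_getD 0).comp (fst.comp hs) (const 0)))))
  | jmp t => exact sumInl.comp (hj (const t))

theorem primrec_symStep (hP : Primrec P) (hv : Primrec v) (hs : Primrec s) (C : List FInstr)
    {pc : α → ℕ} (hpc : Primrec pc) : Primrec fun a => symStep (P a) (v a) (s a) C (pc a) := by
  induction C generalizing pc with
  | nil => exact sumInr.comp (sumInl.comp (primrec_haltOut.comp (fst.comp hs)))
  | cons i C ih =>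
    exact Primrec.ite (Primrec.eq.comp hpc (const 0)) (i.primrec_sym hP hv hs)
      (ih (nat_sub.comp hpc (const 1)))

theorem primrec_fuel (R e : ℕ) : Primrec (fuel R e) := by
  have hW : Primrec (wordBound e) :=
    primrec_natPow.comp (nat_add.comp fst (fst.comp snd)) (const e)
  exact nat_mul.comp (primrec_natPow.comp hW (const (R + 1)))
    (primrec_natPow.comp (nat_add.comp hW (fst.comp snd)) (fst.comp snd))

/-- The number of iterations is bounded in advance by `fuel`, and the code is a constant. Searching
for the halting step instead would make the rule only partial recursive at first sight. -/
theorem primrec_interpret (C : List FInstr) (R e : ℕ) : Primrec (interpret C R e) := by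
  refine sumCasesOn (nat_iterate ((primrec_fuel R e).comp fst) ?_ (Primrec₂.mk ?_))
    (Primrec₂.mk (const _)) (Primrec₂.mk snd)
  · exact sumInl.comp ((fst.comp snd).pair (list_map (list_range.comp (fst.comp (snd.comp fst)))
      (Primrec₂.mk (sumInr.comp snd))))
  · refine sumCasesOn snd (Primrec₂.mk ?_) (Primrec₂.mk (sumInr.comp snd))
    exact primrec_symStep (fst.comp (fst.comp fst)) (snd.comp (snd.comp (fst.comp fst)))
      snd C ((list_getD 0).comp (fst.comp snd) (const 0))

end Computability

/-- The machine that runs flat code with `R` variables. -/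
def algorithmOf (C : List FInstr) (R e : ℕ) : Algorithm where
  regs := R + 1
  wordExp := e
  next := interpret C R e
  computable_next := (primrec_interpret C R e).to_comp

/-! ### Terminating orbits in a finite set are short -/

/-- A state that occurs twice makes the orbit periodic, so that it never ends. The states before the
end are therefore distinct, and the pigeonhole principle bounds their number. The results on the
right are fixed points, so surplus iterations do no harm. -/
theorem iterate_eq_of_finite {α β γ : Type*} [Fintype γ] (g : α ⊕ β → α ⊕ β)
    (hg : ∀ r, g (.inr r) = .inr r) (φ : α → γ) {S : Set α} (hφ : Set.InjOn φ S) {x : α ⊕ β}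
    {n : ℕ} {r : β} (hn : g^[n] x = .inr r) (hS : ∀ i < n, ∃ s ∈ S, g^[i] x = .inl s) {F : ℕ}
    (hF : Fintype.card γ ≤ F) : g^[F] x = .inr r := by
  have hstay : ∀ m, g^[m] (.inr r) = .inr r := by
    intro m
    induction m with
    | zero => rfl
    | succ m ih => rw [iterate_succ_apply, hg, ih]
  have hle : n ≤ F := by
    by_contra hlt
    have : Nonempty α := ⟨(hS 0 (by omega)).choose⟩
    choose! s hs using hS
    obtain ⟨i, j, hij, he⟩ := Fintype.exists_ne_map_eq_of_card_lt
      (fun i : Fin n => φ (s i)) (by simpa using lt_of_le_of_lt hF (not_le.mp hlt))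
    have key : ∀ i j : Fin n, i < j → φ (s i) = φ (s j) → False := by
      intro i j hij he
      have hse := hφ (hs i i.2).1 (hs j j.2).1 he
      -- Continue both occurrences for n - j steps: the later one arrives at the result at time n,
      -- the earlier one is still an unfinished state.
      have h₁ : g^[n - j + i] x = g^[n - j + j] x := by
        rw [iterate_add_apply, iterate_add_apply, (hs i i.2).2, (hs j j.2).2, hse]
      have hij' : (i : ℕ) < j := hij
      rw [Nat.sub_add_cancel j.2.le, hn, (hs (n - j + i) (by omega)).2] at h₁
      exact absurd h₁ (by simp)
    rcases lt_or_gt_of_ne hij with h | h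
    · exact key i j h he
    · exact key j i h he.symm
  rw [← Nat.sub_add_cancel hle, iterate_add_apply, hn, hstay]

/-! ### What the processor sees determines all tests -/

/-- Ranks are monotone. Moreover, if x < y, then the occurrence of x itself is counted for y but not
for x. -/
theorem keyRank_lt_iff {mem : List Word} {x y : ℝ} (hx : Word.key x ∈ mem)
    (hy : Word.key y ∈ mem) : keyRank mem x < keyRank mem y ↔ x < y := by
  have hmono : ∀ {x y : ℝ}, x ≤ y → keyRank mem x ≤ keyRank mem y := by
    intro x y hxy
    refine List.countP_mono_left fun w _ h => ?_
    simp only [decide_eq_true_eq] at h ⊢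
    obtain ⟨z, hz, hlt⟩ := h
    exact ⟨z, hz, hlt.trans_le hxy⟩
  constructor
  · intro h
    by_contra hxy
    exact absurd (hmono (not_lt.mp hxy)) (not_le.mpr h)
  · intro hxy
    obtain ⟨l₁, l₂, rfl⟩ := List.append_of_mem hx
    have h₁ : ∀ l : List Word, keyRank l x ≤ keyRank l y := by
      intro l
      refine List.countP_mono_left fun w _ h => ?_
      simp only [decide_eq_true_eq] at h ⊢
      obtain ⟨z, hz, hlt⟩ := h
      exact ⟨z, hz, hlt.trans hxy⟩
    have e₁ := h₁ l₁
    have e₂ := h₁ l₂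
    simp only [keyRank] at e₁ e₂ ⊢
    rw [List.countP_append, List.countP_append, List.countP_cons_of_neg (by simp),
      List.countP_cons_of_pos (by simpa using hxy)]
    omega

theorem see_toNum (mem : List Word) (w : Word) : (see mem w).toNum = w.toNum := by
  cases w <;> rfl

theorem see_compare {mem : List Word} {v w : Word} (hv : ∀ x, v = .key x → v ∈ mem)
    (hw : ∀ x, w = .key x → w ∈ mem) : (see mem v).compare (see mem w) = v.compare w := by
  rcases v with x | m <;> rcases w with y | n
  · simp only [see, Seen.compare, Word.compare]
    rw [if_congr (keyRank_lt_iff (hv x rfl) (hw y rfl)) rfl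
      (if_congr (keyRank_lt_iff (hw y rfl) (hv x rfl)) rfl rfl)]
  all_goals rfl

theorem symAt_view {mem : List Word} {r : Refill} (hr : ∀ j, r = .inr j → j < mem.length) :
    symAt (view mem) r = see mem (refillCell mem r) := by
  rcases r with n | j
  · rfl
  · have := hr j rfl
    simp [symAt, refillCell, view, List.getD_eq_getElem?_getD, this]

theorem refillCell_mem {mem : List Word} {r : Refill} (hr : ∀ j, r = .inr j → j < mem.length)
    {x : ℝ} (h : refillCell mem r = .key x) : refillCell mem r ∈ mem := by
  rcases r with n | j
  · simp [refillCell] at h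
  · have := hr j rfl
    simp [refillCell, List.getD_eq_getElem?_getD, this]

theorem map_copyCells {α β : Type} (f : α → β) (z : α) (M : ℕ) (l : List α) (d s n : ℕ) :
    (copyCells z M l d s n).map f = copyCells (f z) M (l.map f) d s n := by
  simp only [copyCells, List.map_map]
  refine List.map_congr_left fun i _ => ?_
  simp only [comp_apply, apply_ite f, List.getD_map]

theorem cellAt_map (mem : List Word) (l : List Refill) (i : ℕ) :
    cellAt (l.map (refillCell mem)) i = refillCell mem (l.getD i (.inl 0)) := by
  rw [cellAt, show Word.num 0 = refillCell mem (.inl 0) from rfl, List.getD_map]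

/-! ### Correctness of the interpreter -/

/-- Refill data for a memory of `M` cells, with numbers below `W`. -/
def RefillOk (W M : ℕ) (l : List Refill) : Prop :=
  l.length = M ∧ ∀ r ∈ l, (∀ n, r = .inl n → n < W) ∧ ∀ j, r = .inr j → j < M

theorem RefillOk.getD {W M : ℕ} {l : List Refill} (h : RefillOk W M l) (hW : 0 < W) (i : ℕ) :
    (∀ n, l.getD i (.inl 0) = .inl n → n < W) ∧ ∀ j, l.getD i (.inl 0) = .inr j → j < M := by
  by_cases hi : i < l.length
  · have := h.2 l[i] (List.getElem_mem hi)
    simpa [List.getD_eq_getElem?_getD, hi] using this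
  · have : l.getD i (.inl 0) = .inl 0 := by simp [List.getD_eq_getElem?_getD, hi]
    rw [this]
    exact ⟨fun n hn => by cases hn; exact hW, fun j hj => by cases hj⟩

def SymBounded (E : MEnv) (s : Sym) : Prop :=
  s.1.length = E.R + 1 ∧ (∀ n ∈ s.1, n < E.W) ∧ RefillOk E.W E.M s.2

/-- `s` describes the state `(pc, σ)`, relative to the memory content `mem`. -/
structure SymRep (E : MEnv) (mem : List Word) (s : Sym) (pc : ℕ) (σ : MState) : Prop where
  regs : s.1 = pc :: (List.range E.R).map σ.var
  cells : σ.cells = s.2.map (refillCell mem)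
  refill : RefillOk E.W E.M s.2
  mem : mem.length = E.M
  pc : pc < E.W
  var : ∀ v, σ.var v < E.W
  zero : ∀ v, E.R ≤ v → σ.var v = 0
  disk : ∀ a, (σ.disk a).length = E.B

theorem SymRep.bounded {E : MEnv} {mem : List Word} {s : Sym} {pc : ℕ} {σ : MState}
    (h : SymRep E mem s pc σ) : SymBounded E s := by
  refine ⟨by simp [h.regs], ?_, h.refill⟩
  rw [h.regs]
  intro n hn
  rcases List.mem_cons.mp hn with rfl | hn
  · exact h.pc
  · obtain ⟨v, _, rfl⟩ := List.mem_map.mp hn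
    exact h.var v

/-! ### Symbolic execution of single instructions -/

section

variable {E : MEnv} {mem : List Word} {s : Sym} {pc : ℕ} {σ : MState} {C : List FInstr}

theorem SymRep.regVar (h : SymRep E mem s pc σ) : regVar s.1 = σ.var := by
  funext v
  rw [h.regs]
  by_cases hv : v < E.R
  · simp [ExtMem.regVar, List.getD_eq_getElem?_getD, hv]
  · simp [ExtMem.regVar, List.getD_eq_getElem?_getD, hv, h.zero v (not_lt.mp hv)]

theorem SymRep.getD_zero (h : SymRep E mem s pc σ) : s.1.getD 0 0 = pc := by simp [h.regs]

theorem SymRep.set_pc (h : SymRep E mem s pc σ) (t : ℕ) :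
    s.1.set 0 t = t :: (List.range E.R).map σ.var := by simp [h.regs]

theorem SymRep.set_var (h : SymRep E mem s pc σ) (t v x : ℕ) :
    (s.1.set 0 t).set (v + 1) x = t :: (List.range E.R).map (update σ.var v x) := by
  rw [h.set_pc, List.set_cons_succ]
  congr 1
  refine List.ext_getElem (by simp) fun i h₁ h₂ => ?_
  simp only [List.getElem_set, List.getElem_map, List.getElem_range, update_apply, eq_comm]

theorem SymRep.assign (h : SymRep E mem s pc σ) {v x : ℕ} (hv : v < E.R) (hx : x < E.W)
    (hpc : pc + 1 < E.W) :
    SymRep E mem (assignReg s v x) (pc + 1) { σ with var := update σ.var v x } where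
  regs := by rw [assignReg, h.getD_zero]; exact h.set_var _ _ _
  cells := h.cells
  refill := h.refill
  mem := h.mem
  pc := hpc
  var w := by simp only [update_apply]; split_ifs; exacts [hx, h.var w]
  zero w hw := by simp only [update_apply]; rw [if_neg (by omega)]; exact h.zero w hw
  disk := h.disk

theorem SymRep.jump (h : SymRep E mem s pc σ) {t : ℕ} (ht : t < E.W) :
    SymRep E mem (jumpTo s t) t σ where
  regs := h.set_pc t
  cells := h.cells
  refill := h.refill
  mem := h.mem
  pc := ht
  var := h.var
  zero := h.zero
  disk := h.disk

theorem SymRep.write (h : SymRep E mem s pc σ) {l : List Refill} (hl : RefillOk E.W E.M l)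
    (hpc : pc + 1 < E.W) :
    SymRep E mem (s.1.set 0 (s.1.getD 0 0 + 1), l) (pc + 1)
      { σ with cells := l.map (refillCell mem) } where
  regs := by rw [h.getD_zero]; exact h.set_pc _
  cells := rfl
  refill := hl
  mem := h.mem
  pc := hpc
  var := h.var
  zero := h.zero
  disk := h.disk

theorem SymRep.cellSeen (h : SymRep E mem s pc σ) (e : Expr ℕ) :
    cellSeen E.P (view mem) s e = see mem (cellAt σ.cells (e.eval E.P σ.var)) := by
  have hW := h.pc.pos
  rw [ExtMem.cellSeen, h.regVar, h.cells, cellAt_map, symAt_view]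
  rw [h.mem]
  exact (h.refill.getD hW _).2

theorem SymRep.cell_mem (h : SymRep E mem s pc σ) {i : ℕ} {x : ℝ}
    (hx : cellAt σ.cells i = .key x) : cellAt σ.cells i ∈ mem := by
  have hW := h.pc.pos
  rw [h.cells, cellAt_map] at hx ⊢
  refine refillCell_mem ?_ hx
  rw [h.mem]
  exact (h.refill.getD hW _).2

theorem symStep_of_getElem? {P : Params} {view : List Seen} {i : FInstr} {pc : ℕ}
    (h : C[pc]? = some i) : symStep P view s C pc = i.sym P view s := by
  induction C generalizing pc with
  | nil => simp at h
  | cons j C ih =>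
    rcases pc with _ | pc
    · simp at h; simp [symStep, h]
    · simp only [List.getElem?_cons_succ] at h
      simp [symStep, ih h]

theorem symStep_of_length_le {P : Params} {view : List Seen} {pc : ℕ} (h : C.length ≤ pc) :
    symStep P view s C pc = .inr (.inl (haltOut s.1)) := by
  induction C generalizing pc with
  | nil => rfl
  | cons j C ih =>
    simp only [List.length_cons] at h
    rw [symStep, if_neg (by omega), ih (by omega)]

/-- All jumps stay in the range of numbers. -/
def CodeOk (W : ℕ) (C : List FInstr) : Prop :=
  C.length < W ∧ ∀ i ∈ C, match i with
    | .prim _ => True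
    | .jz _ t => t < W
    | .jmp t => t < W

/-- An internal instruction keeps a description relative to the same memory. A transfer yields a
command whose effect is the machine state itself; the old registers in `regs` are arbitrary because
a command overwrites them all. -/
theorem FStep.sym {st st' : ℕ × MState} (hst : FStep E C st st') (hC : CodeOk E.W C)
    (h : SymRep E mem s st.1 st.2) :
    (∃ s', symStep E.P (view mem) s C st.1 = .inl s' ∧ SymRep E mem s' st'.1 st'.2 ∧
      st'.2.io = st.2.io) ∨
    ∃ cmd : Command, symStep E.P (view mem) s C st.1 = .inr (.inr cmd) ∧
      Command.Valid (E.R + 1) E.W E.M E.B cmd ∧ st'.2.io = st.2.io + 1 ∧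
      (∀ regs, Command.exec E.B ⟨regs, mem, st.2.disk⟩ cmd =
        ⟨st'.1 :: (List.range E.R).map st'.2.var, st'.2.cells, st'.2.disk⟩) ∧
      st'.1 < E.W ∧ (∀ v, st'.2.var v < E.W) ∧ (∀ v, E.R ≤ v → st'.2.var v = 0) ∧
      (∀ a, (st'.2.disk a).length = E.B) ∧ st'.2.cells.length = E.M := by
  have hW : 0 < E.W := h.pc.pos
  cases hst with
  | @prim pc σ i hi hok =>
    have hpc : pc + 1 < E.W := by
      have := hC.1
      have := (List.getElem?_eq_some_iff.mp hi).1
      omega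
    rw [symStep_of_getElem? hi]
    dsimp only at h ⊢
    cases i with
    | set v e =>
      refine .inl ⟨_, rfl, ?_, rfl⟩
      rw [h.regVar]
      exact h.assign hok.1 hok.2 hpc
    | copy d a l =>
      refine .inl ⟨_, rfl, ?_, rfl⟩
      rw [h.regVar]
      have := h.write (l := copyCells (.inl 0) E.M s.2 (d.eval E.P σ.var) (a.eval E.P σ.var)
        (l.eval E.P σ.var)) ⟨by simp [copyCells], ?_⟩ hpc
      · rw [map_copyCells, ← h.cells] at this
        exact this
      · intro r hr
        obtain ⟨i, _, rfl⟩ := List.mem_map.mp hr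
        split_ifs
        · exact h.refill.getD hW _
        · exact h.refill.getD hW _
    | num d e =>
      refine .inl ⟨_, rfl, ?_, rfl⟩
      rw [h.regVar]
      have := h.write (l := s.2.set (d.eval E.P σ.var) (.inl (e.eval E.P σ.var)))
        ⟨by simp [h.refill.1], ?_⟩ hpc
      · rw [List.map_set, ← h.cells] at this
        exact this
      · intro r hr
        rcases List.mem_or_eq_of_mem_set hr with hr | rfl
        · exact h.refill.2 r hr
        · exact ⟨fun n hn => by cases hn; exact hok, fun j hj => by cases hj⟩
    | get v e =>
      refine .inl ⟨_, rfl, ?_, rfl⟩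
      rw [h.cellSeen, see_toNum]
      exact h.assign hok.1 hok.2 hpc
    | cmp v a b =>
      refine .inl ⟨_, rfl, ?_, rfl⟩
      rw [h.cellSeen, h.cellSeen, see_compare (fun x hx => h.cell_mem hx)
        (fun x hx => h.cell_mem hx)]
      refine h.assign hok.1 (lt_of_le_of_lt ?_ hok.2) hpc
      rcases cellAt σ.cells (a.eval E.P σ.var) with x | m <;>
        rcases cellAt σ.cells (b.eval E.P σ.var) with y | n <;> simp only [Word.compare]
      · split_ifs <;> omega
      all_goals omega
    | io r a p =>
      refine .inr ⟨_, rfl, ?_, ?_⟩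
      · rw [h.regVar, h.getD_zero, h.set_pc]
        refine ⟨by simp, ?_, h.refill.1, fun n hn => (h.refill.2 _ hn).1 n rfl,
          fun j hj => (h.refill.2 _ hj).2 j rfl, hok.1, hok.2⟩
        intro n hn
        rcases List.mem_cons.mp hn with rfl | hn
        · exact hpc
        · obtain ⟨v, _, rfl⟩ := List.mem_map.mp hn
          exact h.var v
      · rw [h.regVar, h.getD_zero, h.set_pc]
        have hlen : σ.cells.length = E.M := by rw [h.cells, List.length_map, h.refill.1]
        have hp := hok.2
        cases r with
        | true =>
          refine ⟨rfl, fun regs => ?_, hpc, h.var, h.zero, h.disk, ?_⟩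
          · simp only [Command.exec, MInstr.run, if_true, h.cells]
          · simp only [MInstr.run, List.length_append, List.length_take, List.length_drop, h.disk,
              hlen]
            omega
        | false =>
          refine ⟨rfl, fun regs => ?_, hpc, h.var, h.zero, ?_, hlen⟩
          · simp only [Command.exec, MInstr.run, h.cells]
            rfl
          · intro b
            simp only [MInstr.run, update_apply]
            split_ifs
            · simp only [List.length_take, List.length_drop, hlen]
              omega
            · exact h.disk b
  | @jz pc σ e t hi =>
    have hpc : pc + 1 < E.W := by
      have := hC.1
      have := (List.getElem?_eq_some_iff.mp hi).1
      omega
    have ht := hC.2 _ (List.mem_of_getElem? hi)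
    rw [symStep_of_getElem? hi]
    dsimp only at h ht ⊢
    refine .inl ⟨_, rfl, ?_, rfl⟩
    rw [h.regVar, h.getD_zero]
    split_ifs
    · exact h.jump ht
    · exact h.jump hpc
  | @jmp pc σ t hi =>
    have ht := hC.2 _ (List.mem_of_getElem? hi)
    rw [symStep_of_getElem? hi]
    exact .inl ⟨_, rfl, h.jump ht, rfl⟩

end

/-- The remainders only force the values into a finite type; on bounded states they change nothing.
The cardinality of this type is `fuel`. -/
theorem symBounded_injOn (E : MEnv) (hW : 0 < E.W) (hM : 0 < E.M) :
    Set.InjOn (fun s : Sym => ((fun i : Fin (E.R + 1) => (⟨s.1.getD i 0 % E.W,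
      Nat.mod_lt _ hW⟩ : Fin E.W)), fun i : Fin E.M =>
        (Sum.map (fun n => ⟨n % E.W, Nat.mod_lt _ hW⟩) (fun n => ⟨n % E.M, Nat.mod_lt _ hM⟩)
          (s.2.getD i (.inl 0)) : Fin E.W ⊕ Fin E.M))) {s | SymBounded E s} := by
  rintro ⟨r, l⟩ ⟨hr, hrW, hl⟩ ⟨r', l'⟩ ⟨hr', hrW', hl'⟩ h
  simp only [Prod.mk.injEq, funext_iff, Fin.mk.injEq] at h ⊢
  dsimp only at hr hrW hl hr' hrW' hl'
  obtain ⟨h₁, h₂⟩ := h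
  constructor
  · refine List.ext_getElem (by omega) fun i hi hi' => ?_
    have := h₁ ⟨i, by omega⟩
    simp only [List.getD_eq_getElem?_getD, hi, hi', List.getElem?_eq_getElem,
      Option.getD_some] at this
    rwa [Nat.mod_eq_of_lt (hrW _ (List.getElem_mem hi)),
      Nat.mod_eq_of_lt (hrW' _ (List.getElem_mem hi'))] at this
  · refine List.ext_getElem (by rw [hl.1, hl'.1]) fun i hi hi' => ?_
    have := h₂ ⟨i, by rw [← hl.1]; exact hi⟩
    simp only [List.getD_eq_getElem?_getD, hi, hi', List.getElem?_eq_getElem,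
      Option.getD_some] at this
    have b := hl.2 _ (List.getElem_mem hi)
    have b' := hl'.2 _ (List.getElem_mem hi')
    rcases e : l[i] with n | j <;> rcases e' : l'[i] with n' | j' <;> rw [e, e'] at this <;>
      simp only [Sum.map_inl, Sum.map_inr, Sum.inl.injEq, Sum.inr.injEq, Fin.mk.injEq,
        reduceCtorEq] at this
    · rw [Nat.mod_eq_of_lt (b.1 _ e), Nat.mod_eq_of_lt (b'.1 _ e')] at this
      rw [this]
    · rw [Nat.mod_eq_of_lt (b.2 _ e), Nat.mod_eq_of_lt (b'.2 _ e')] at this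
      rw [this]

def outOf (σ : MState) : Option ℕ := if σ.var 0 = 0 then none else some (σ.var 0 - 1)

/-- Induction from the first step of the execution. The conclusion describes the symbolic
computation up to the next transfer with its exact length `n`, and it bounds all states on the way,
so that `iterate_eq_of_finite` can later replace `n` by the fuel; it also provides the run after
that transfer. -/
theorem run_of_steps {C : List FInstr} {R e N M B K : ℕ} {E : MEnv}
    (hE : E = ⟨(N, M, B, K), R, (N + M) ^ e⟩) (hC : CodeOk E.W C) (hM : 0 < M)
    {st st' : ℕ × MState} (hst : ReflTransGen (FStep E C) st st') (hend : C.length ≤ st'.1)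
    {mem : List Word} {s : Sym} (h : SymRep E mem s st.1 st.2) :
    ∃ n res, (symIter C E.P (view mem))^[n] (.inl s) = .inr res ∧
      (∀ i < n, ∃ s' ∈ {s | SymBounded E s},
        (symIter C E.P (view mem))^[i] (.inl s) = .inl s') ∧
      ((res = .inl (outOf st'.2) ∧ st'.2.io = st.2.io) ∨
        ∃ cmd, res = .inr cmd ∧ Command.Valid (R + 1) E.W M B cmd ∧ ∃ t,
          st'.2.io = st.2.io + 1 + t ∧ ∀ regs, (algorithmOf C R e).Run N M B K t
            (Command.exec B ⟨regs, mem, st.2.disk⟩ cmd) (outOf st'.2)) := by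
  have hstep : ∀ (mem) (s : Sym) (pc : ℕ), s.1.getD 0 0 = pc →
      symIter C E.P (view mem) (.inl s) = symStep E.P (view mem) s C pc := by
    rintro mem s pc rfl; rfl
  induction hst using ReflTransGen.head_induction_on generalizing mem s with
  | refl =>
    refine ⟨1, _, ?_, ?_, .inl ⟨rfl, rfl⟩⟩
    · rw [iterate_one, hstep _ _ _ h.getD_zero, symStep_of_length_le hend, haltOut, h.regVar]; rfl
    · intro i hi
      obtain rfl : i = 0 := by omega
      exact ⟨s, h.bounded, rfl⟩
  | @head a c hac hcb ih =>
    rcases hac.sym hC h with ⟨s', hs, hrep, hio⟩ | ⟨cmd, hs, hval, hio, hexec, hr⟩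
    · obtain ⟨n, res, hn, hbd, hres⟩ := ih hrep
      refine ⟨n + 1, res, ?_, ?_, ?_⟩
      · rw [iterate_succ_apply, hstep _ _ _ h.getD_zero, hs, hn]
      · intro i hi
        rcases i with _ | i
        · exact ⟨s, h.bounded, rfl⟩
        · rw [iterate_succ_apply, hstep _ _ _ h.getD_zero, hs]
          exact hbd i (by omega)
      · rw [← hio]
        have hdisk : c.2.disk = a.2.disk := by
          cases hac with
          | @prim pc σ i hi hok =>
            rw [symStep_of_getElem? hi] at hs
            cases i with
            | io r a p => simp [FInstr.sym, MInstr.sym] at hs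
            | _ => rfl
          | jz => rfl
          | jmp => rfl
        rwa [hdisk] at hres
    · refine ⟨1, _, ?_, ?_, .inr ⟨cmd, rfl, ?_⟩⟩
      · rw [iterate_one, hstep _ _ _ h.getD_zero, hs]
      · intro i hi
        obtain rfl : i = 0 := by omega
        exact ⟨s, h.bounded, rfl⟩
      · obtain ⟨hpc, hvar, hzero, hdisk, hlen⟩ := hr
        have hEM : E.M = M := by rw [hE]; rfl
        have hEB : E.B = B := by rw [hE]; rfl
        have hER : E.R = R := by rw [hE]
        have hEP : E.P = (N, M, B, K) := by rw [hE]
        -- After a transfer the description starts afresh: the new memory is the reference and the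
        -- refill is the identity.
        have hrep : SymRep E c.2.cells (c.1 :: (List.range E.R).map c.2.var,
            (List.range E.M).map Sum.inr) c.1 c.2 := by
          refine ⟨rfl, ?_, ⟨by simp, ?_⟩, hlen, hpc, hvar, hzero, hdisk⟩
          · refine List.ext_getElem (by simp [hlen]) fun i h₁ h₂ => ?_
            simp [refillCell, List.getD_eq_getElem?_getD, h₁]
          · intro r hr
            obtain ⟨j, hj, rfl⟩ := List.mem_map.mp hr
            exact ⟨fun n hn => (by cases hn), fun n hn => (by cases hn; simpa using hj)⟩
        obtain ⟨n, res, hn, hbd, hres⟩ := ih hrep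
        have hnext : ∀ regs, regs = c.1 :: (List.range E.R).map c.2.var →
            (algorithmOf C R e).next ((N, M, B, K), regs, view c.2.cells) = res := by
          rintro regs rfl
          have := iterate_eq_of_finite (symIter C E.P (view c.2.cells)) (fun r => rfl) _
            (symBounded_injOn E hpc.pos (by rw [hEM]; exact hM)) hn hbd (F := fuel R e E.P) (by
              simp only [Fintype.card_prod, Fintype.card_fun, Fintype.card_fin, Fintype.card_sum,
                hE, fuel, wordBound, MEnv.M, paramAt]
              exact le_rfl)
          rw [hEP, hEM] at this
          simp only [algorithmOf, interpret, this]
        rw [hEB] at hexec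
        rw [hEM, hEB, hER] at hval
        refine ⟨hval, ?_⟩
        rcases hres with ⟨rfl, hio'⟩ | ⟨cmd', rfl, hval', t, hio', hrun⟩
        · refine ⟨0, by omega, fun regs => ?_⟩
          rw [hexec]
          exact .halt _ _ (hnext _ rfl)
        · refine ⟨t + 1, by omega, fun regs => ?_⟩
          rw [hexec]
          refine .step t _ cmd' _ (hnext _ rfl) ?_ (hrun _)
          rw [hE] at hval'
          exact hval'

/-- A correct program of the machine language yields a correct algorithm. -/
theorem run_of_exec {p : Stmt ℕ MInstr} {R e N M B K : ℕ} (hM : 2 ≤ M)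
    (he : p.size < 2 ^ e) {red blue : Fin N → ℝ} {σ' : MState}
    (h : Exec (mLang ⟨(N, M, B, K), R, (N + M) ^ e⟩) p
      ⟨fun _ => 0, List.replicate M (.num 0), inputDisk B red blue, 0⟩ σ') :
    (algorithmOf (p.code 0) R e).Run N M B K σ'.io
      (initial (algorithmOf (p.code 0) R e).regs M B red blue) (outOf σ') := by
  set E : MEnv := ⟨(N, M, B, K), R, (N + M) ^ e⟩ with hE
  have hflat := h.flat [] []
  simp only [List.nil_append, List.append_nil, List.length_nil, Nat.zero_add] at hflat
  -- The program counter is kept in a register and must fit into a word; N + M ≥ 2 turns the bound 2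
  -- ^ e into the word bound.
  have hW : p.size < E.W := he.trans_le (Nat.pow_le_pow_left (by omega) e)
  have hjump : ∀ (p : Stmt ℕ MInstr) (o : ℕ), ∀ i ∈ p.code o, match i with
      | .prim _ => True
      | .jz _ t => t ≤ o + p.size
      | .jmp t => t ≤ o + p.size := by
    have hmono : ∀ (i : FInstr) {a b : ℕ}, a ≤ b → (match i with
        | .prim _ => True
        | .jz _ t => t ≤ a
        | .jmp t => t ≤ a) → match i with
        | .prim _ => True
        | .jz _ t => t ≤ b
        | .jmp t => t ≤ b := by
      intro i a b hab h
      cases i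
      · trivial
      · exact le_trans h hab
      · exact le_trans h hab
    intro p
    induction p with
    | skip => simp [Stmt.code]
    | prim i => intro o j hj; simp only [Stmt.code, List.mem_singleton] at hj; subst hj; trivial
    | seq p q ihp ihq =>
      intro o i hi
      simp only [Stmt.code, List.mem_append] at hi
      simp only [Stmt.size]
      rcases hi with hi | hi
      · exact hmono i (by omega) (ihp o i hi)
      · exact hmono i (by omega) (ihq _ i hi)
    | ite c p q ihp ihq =>
      intro o i hi
      simp only [Stmt.code, List.mem_append, List.mem_cons] at hi
      simp only [Stmt.size]
      rcases hi with rfl | hi | rfl | hi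
      · dsimp only; omega
      · exact hmono i (by omega) (ihp _ i hi)
      · dsimp only; omega
      · exact hmono i (by omega) (ihq _ i hi)
    | loop c p ihp =>
      intro o i hi
      simp only [Stmt.code, List.mem_append, List.mem_cons, List.not_mem_nil, or_false] at hi
      simp only [Stmt.size]
      rcases hi with rfl | hi | rfl
      · dsimp only; omega
      · exact hmono i (by omega) (ihp _ i hi)
      · dsimp only; omega
  have hC : CodeOk E.W (p.code 0) := by
    refine ⟨by rw [Stmt.length_code]; exact hW, fun i hi => ?_⟩
    have := hjump p 0 i hi
    cases i
    · trivial
    · dsimp only at this ⊢; omega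
    · dsimp only at this ⊢; omega
  have hrep : SymRep E (List.replicate M (.num 0)) (0 :: (List.range E.R).map fun _ => 0,
      (List.range E.M).map Sum.inr) 0 ⟨fun _ => 0, List.replicate M (.num 0),
        inputDisk B red blue, 0⟩ := by
    refine ⟨rfl, ?_, ⟨by simp, ?_⟩, by simp [hE, MEnv.M, paramAt], by omega,
      fun _ => by dsimp only; omega, fun _ _ => rfl, fun a => by simp [inputDisk, hE, MEnv.B, paramAt]⟩
    · refine List.ext_getElem (by simp [hE, MEnv.M, paramAt]) fun i h₁ h₂ => ?_
      simp only [List.length_replicate] at h₁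
      simp [refillCell, h₁]
    · intro r hr
      obtain ⟨j, hj, rfl⟩ := List.mem_map.mp hr
      exact ⟨fun n hn => (by cases hn), fun n hn => (by cases hn; simpa using hj)⟩
  obtain ⟨n, res, hn, hbd, hres⟩ := run_of_steps hE hC (by omega) hflat
    (by simp [Stmt.length_code]) hrep
  have hnext : (algorithmOf (p.code 0) R e).next ((N, M, B, K), List.replicate (R + 1) 0,
      view (List.replicate M (.num 0))) = res := by
    have := iterate_eq_of_finite (symIter (p.code 0) E.P (view (List.replicate M (.num 0))))
      (fun r => rfl) _ (symBounded_injOn E (by omega) (by simp only [hE, MEnv.M, paramAt]; omega)) hn hbd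
      (F := fuel R e E.P) (by
        simp only [Fintype.card_prod, Fintype.card_fun, Fintype.card_fin, Fintype.card_sum,
          hE, fuel, wordBound, MEnv.M, paramAt]
        exact le_rfl)
    have e₁ : 0 :: (List.range E.R).map (fun _ => 0) = List.replicate (R + 1) 0 := by
      simp [hE, List.replicate_succ]
    rw [e₁] at this
    simp only [algorithmOf, interpret]
    simp only [hE, MEnv.M, paramAt] at this
    rw [this]
  rcases hres with ⟨rfl, hio⟩ | ⟨cmd, rfl, hval, t, hio, hrun⟩
  · dsimp only at hio
    rw [hio]
    exact .halt _ _ hnext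
  · have : σ'.io = t + 1 := by dsimp only at hio; omega
    rw [this]
    exact .step t _ cmd _ hnext hval (hrun _)

/-! ### The abstract language

The store consists of regions of cells; a cell holds a number and a word. Cells are accessed
through streams, and the cost of an access depends on the blocks that the streams hold. -/

/-- Program variables. -/
inductive AVar
  | out | i | n | s | f | x | y | a | d | m | hv | tn | len | g | c | w | t | q | p | pb | cb | best
  | S | SB | nr | tot | o | j | r | kk | sel | ans | fail
  deriving DecidableEq

def AVar.idx (v : AVar) : ℕ := v.ctorIdx

theorem AVar.idx_lt (v : AVar) : v.idx < 40 := by cases v <;> decide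

theorem AVar.idx_injective : Injective AVar.idx := by
  have h : ∀ v : AVar, AVar.ofNat v.idx = v := fun v => by cases v <;> rfl
  exact fun v₁ v₂ e => by rw [← h v₁, ← h v₂, e]

/-- Primitive instructions; `s` is a stream, `ρ` a region and `e` an index. `load` puts the number
of a cell into a variable and its word into the accumulator, `store` writes a number and the
accumulator, `cmp` compares the accumulator with the word of a cell, and `raw` loads an input
word. -/
inductive AInstr
  | set (v : AVar) (e : Expr AVar)
  | load (s ρ e : Expr AVar) (v : AVar)
  | store (s ρ e n : Expr AVar)
  | cmp (v : AVar) (s ρ e : Expr AVar)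
  | raw (s e : Expr AVar)

/-- The block held by each stream (plus one), and the cost incurred so far. -/
structure Cache where
  tag : ℕ → ℕ
  cost : ℕ

structure AState where
  var : AVar → ℕ
  acc : Word
  mem : ℕ → ℕ → ℕ × Word
  cache : Cache

/-- Parameters; a block holds `h` cells, there are `F` streams, numbers and indices are below
`cap`, an access costs `β`, and loading a block costs `2 * h`. -/
structure AEnv where
  P : Params
  h : ℕ
  F : ℕ
  cap : ℕ
  β : ℕ
  raw : ℕ → Word

-- The tag 0 marks an empty stream. Finding the block in any stream is a hit, so no block is ever
-- held twice and there are no copies to keep consistent.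
open Classical in
noncomputable def Cache.touch (E : AEnv) (s q : ℕ) (κ : Cache) : Cache :=
  if ∃ s', κ.tag s' = q + 1 then { κ with cost := κ.cost + E.β }
  else ⟨update κ.tag s (q + 1), κ.cost + E.β + 2 * E.h⟩

/-- The block of a cell. -/
def AEnv.blk (E : AEnv) (ρ i : ℕ) : ℕ := 7 * (i / E.h) + ρ

/-- The input acts as a seventh region. Its entries are single words, so a block holds `2 * h` of
them. -/
def AEnv.rawBlk (E : AEnv) (i : ℕ) : ℕ := 7 * (i / (2 * E.h)) + 6

def AInstr.ok (E : AEnv) : AInstr → AState → Prop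
  | set _ e, σ => e.eval E.P σ.var < E.cap
  | load s ρ e _, σ => s.eval E.P σ.var < E.F ∧ ρ.eval E.P σ.var < 6 ∧ e.eval E.P σ.var < E.cap
  | store s ρ e n, σ => s.eval E.P σ.var < E.F ∧ ρ.eval E.P σ.var < 6 ∧
      e.eval E.P σ.var < E.cap ∧ n.eval E.P σ.var < E.cap
  | cmp _ s ρ e, σ => s.eval E.P σ.var < E.F ∧ ρ.eval E.P σ.var < 6 ∧ e.eval E.P σ.var < E.cap
  | raw s e, σ => s.eval E.P σ.var < E.F ∧ e.eval E.P σ.var < E.cap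

def setMem (mem : ℕ → ℕ → ℕ × Word) (ρ i : ℕ) (z : ℕ × Word) : ℕ → ℕ → ℕ × Word :=
  update mem ρ (update (mem ρ) i z)

noncomputable def AInstr.run (E : AEnv) : AInstr → AState → AState
  | set v e, σ => { σ with var := update σ.var v (e.eval E.P σ.var) }
  | load s ρ e v, σ =>
    { σ with
      var := update σ.var v (σ.mem (ρ.eval E.P σ.var) (e.eval E.P σ.var)).1
      acc := (σ.mem (ρ.eval E.P σ.var) (e.eval E.P σ.var)).2
      cache := σ.cache.touch E (s.eval E.P σ.var)
        (E.blk (ρ.eval E.P σ.var) (e.eval E.P σ.var)) }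
  | store s ρ e n, σ =>
    { σ with
      mem := setMem σ.mem (ρ.eval E.P σ.var) (e.eval E.P σ.var) (n.eval E.P σ.var, σ.acc)
      cache := σ.cache.touch E (s.eval E.P σ.var)
        (E.blk (ρ.eval E.P σ.var) (e.eval E.P σ.var)) }
  | cmp v s ρ e, σ =>
    { σ with
      var := update σ.var v (σ.acc.compare (σ.mem (ρ.eval E.P σ.var) (e.eval E.P σ.var)).2)
      cache := σ.cache.touch E (s.eval E.P σ.var)
        (E.blk (ρ.eval E.P σ.var) (e.eval E.P σ.var)) }
  | raw s e, σ =>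
    { σ with
      acc := E.raw (e.eval E.P σ.var)
      cache := σ.cache.touch E (s.eval E.P σ.var) (E.rawBlk (e.eval E.P σ.var)) }

noncomputable def aLang (E : AEnv) : Lang AVar AInstr AState where
  ok := AInstr.ok E
  run := AInstr.run E
  test e σ := e.eval E.P σ.var

theorem aLang_ok (E : AEnv) (i : AInstr) (σ : AState) : (aLang E).ok i σ = i.ok E σ := rfl

theorem aLang_run (E : AEnv) (i : AInstr) (σ : AState) : (aLang E).run i σ = i.run E σ := rfl

theorem aLang_test (E : AEnv) (e : Expr AVar) (σ : AState) :
    (aLang E).test e σ = e.eval E.P σ.var := rfl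

/-! ### Derived parameters as expressions -/

section

variable {V : Type}

/-- The divisors 128 and 64 are chosen so that all frames fit into the memory (`frames_le`) while h
and the fan-in remain comparable to B and, up to a power, to M/B. The stride rounds B up to a
multiple of `2 * h`, so that every input block begins a new block of the store. -/
def cellsE : Expr V := Expr.max 1 (.par 2 / 128)
def fanE : Expr V := Expr.max 2 (.par 1 / (64 * .par 2))
def strideE : Expr V := (.par 2 + 2 * cellsE - 1) / (2 * cellsE) * (2 * cellsE)
def blocksE : Expr V := (.par 0 + .par 2 - 1) / .par 2

/-- Cells to a block. -/
def cellsOf (P : Params) : ℕ := max 1 (paramAt P 2 / 128)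
/-- The fan-in of merging. -/
def fanOf (P : Params) : ℕ := max 2 (paramAt P 1 / (64 * paramAt P 2))
/-- The number of words that are reserved for a block of the input. -/
def strideOf (P : Params) : ℕ :=
  (paramAt P 2 + 2 * cellsOf P - 1) / (2 * cellsOf P) * (2 * cellsOf P)
/-- The number of blocks of each input list. -/
def blocksOf (P : Params) : ℕ := (paramAt P 0 + paramAt P 2 - 1) / paramAt P 2

variable (P : Params) (ρ : V → ℕ)

@[simp] theorem eval_cellsE : (cellsE : Expr V).eval P ρ = cellsOf P := by
  simp [cellsE, cellsOf]

@[simp] theorem eval_fanE : (fanE : Expr V).eval P ρ = fanOf P := by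
  simp [fanE, fanOf]

@[simp] theorem eval_strideE : (strideE : Expr V).eval P ρ = strideOf P := by
  simp [strideE, strideOf]

@[simp] theorem eval_blocksE : (blocksE : Expr V).eval P ρ = blocksOf P := by
  simp [blocksE, blocksOf]

theorem cellsOf_pos : 0 < cellsOf P := by simp only [cellsOf]; omega

theorem two_le_fanOf : 2 ≤ fanOf P := by simp only [fanOf]; omega

end

/-! ### Words of the store -/

/-- Word `o` of block `X`. -/
def AState.word (E : AEnv) (α : AState) (X o : ℕ) : Word :=
  if X % 7 < 6 then
    if o % 2 = 0 then .num (α.mem (X % 7) (X / 7 * E.h + o / 2)).1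
    else (α.mem (X % 7) (X / 7 * E.h + o / 2)).2
  else E.raw (X / 7 * (2 * E.h) + o)

section word

variable {E : AEnv} {α : AState} {ρ i : ℕ}

theorem AEnv.blk_mod (hρ : ρ < 6) : E.blk ρ i % 7 = ρ := by simp only [blk]; omega

theorem AEnv.blk_div (hρ : ρ < 6) : E.blk ρ i / 7 = i / E.h := by simp only [blk]; omega

theorem word_num (hρ : ρ < 6) :
    α.word E (E.blk ρ i) (2 * (i % E.h)) = .num (α.mem ρ i).1 := by
  rw [AState.word, AEnv.blk_mod hρ, AEnv.blk_div hρ, if_pos hρ, if_pos (by omega),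
    Nat.mul_div_cancel_left _ (by omega), Nat.div_add_mod']

theorem word_key (hρ : ρ < 6) :
    α.word E (E.blk ρ i) (2 * (i % E.h) + 1) = (α.mem ρ i).2 := by
  rw [AState.word, AEnv.blk_mod hρ, AEnv.blk_div hρ, if_pos hρ, if_neg (by omega),
    show (2 * (i % E.h) + 1) / 2 = i % E.h by omega, Nat.div_add_mod']

theorem word_raw : α.word E (E.rawBlk i) (i % (2 * E.h)) = E.raw i := by
  have h₁ : E.rawBlk i % 7 = 6 := by simp only [AEnv.rawBlk]; omega
  have h₂ : E.rawBlk i / 7 = i / (2 * E.h) := by simp only [AEnv.rawBlk]; omega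
  rw [AState.word, h₁, h₂, if_neg (by omega), Nat.div_add_mod']

/-- The words of the store after writing a cell. -/
theorem word_setMem (hh : 0 < E.h) (hρ : ρ < 6) (z : ℕ × Word) (κ : Cache) (X o : ℕ)
    (ho : o < 2 * E.h) :
    AState.word E { α with mem := setMem α.mem ρ i z, cache := κ } X o =
      if X = E.blk ρ i ∧ o = 2 * (i % E.h) then .num z.1
      else if X = E.blk ρ i ∧ o = 2 * (i % E.h) + 1 then z.2 else α.word E X o := by
  have hdm := Nat.div_add_mod' i E.h
  by_cases hX : X = E.blk ρ i
  · subst hX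
    have hmod := AEnv.blk_mod (E := E) (i := i) hρ
    have hdiv := AEnv.blk_div (E := E) (i := i) hρ
    have hlt := Nat.mod_lt i hh
    by_cases h₁ : o = 2 * (i % E.h)
    · subst h₁
      rw [word_num hρ, if_pos ⟨rfl, rfl⟩]
      simp [setMem]
    · by_cases h₂ : o = 2 * (i % E.h) + 1
      · subst h₂
        rw [word_key hρ, if_neg (by omega), if_pos ⟨rfl, rfl⟩]
        simp [setMem]
      · rw [if_neg (by omega), if_neg (by omega)]
        have : i / E.h * E.h + o / 2 ≠ i := by omega
        simp only [AState.word, hmod, hdiv, setMem, update_self, update_of_ne this]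
  · rw [if_neg (by tauto), if_neg (by tauto)]
    simp only [AState.word, setMem]
    by_cases hm : X % 7 = ρ
    · have : X / 7 * E.h + o / 2 ≠ i := by
        intro h
        apply hX
        have : X / 7 = i / E.h := by
          rw [← h, Nat.add_comm, Nat.add_mul_div_right _ _ hh,
            Nat.div_eq_of_lt (a := o / 2) (by omega), Nat.zero_add]
        simp only [AEnv.blk, ← this]
        omega
      rw [hm, update_self, update_of_ne this]
    · rw [update_of_ne hm]

end word

/-! ### Memory cells after the machine instructions -/

theorem cellAt_of_length_le {l : List Word} {i : ℕ} (h : l.length ≤ i) : cellAt l i = .num 0 := by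
  simp [cellAt, List.getD_eq_getElem?_getD, h]

theorem cellAt_set {l : List Word} {d i : ℕ} {w : Word} (hd : d < l.length) :
    cellAt (l.set d w) i = if i = d then w else cellAt l i := by
  simp only [cellAt, List.getD_eq_getElem?_getD, List.getElem?_set]
  by_cases h : i = d
  · subst h; simp [hd]
  · rw [if_neg (Ne.symm h), if_neg h]

theorem cellAt_copyCells {l : List Word} {M d s n i : ℕ} (hl : l.length = M) :
    cellAt (copyCells (.num 0) M l d s n) i =
      if d ≤ i ∧ i < d + n ∧ i < M then cellAt l (s + (i - d)) else cellAt l i := by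
  by_cases hi : i < M
  · simp only [cellAt, copyCells, List.getD_eq_getElem?_getD, List.getElem?_map]
    rw [List.getElem?_range hi]
    simp only [Option.map_some, Option.getD_some]
    by_cases h : d ≤ i ∧ i < d + n
    · rw [if_pos h, if_pos ⟨h.1, h.2, hi⟩]
    · rw [if_neg h, if_neg (by tauto)]
  · rw [if_neg (by omega), cellAt_of_length_le (l := l) (by omega), cellAt_of_length_le]
    simp only [copyCells, List.length_map, List.length_range]; omega

theorem cellAt_read {l b : List Word} {B i : ℕ} (hb : b.length = B) :
    cellAt (l.take 0 ++ b ++ l.drop (0 + B)) i = if i < B then cellAt b i else cellAt l i := by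
  simp only [cellAt, List.getD_eq_getElem?_getD, List.take_zero, List.nil_append, Nat.zero_add]
  split_ifs with h
  · rw [List.getElem?_append_left (by omega)]
  · rw [List.getElem?_append_right (by omega), List.getElem?_drop, hb,
      Nat.add_sub_cancel' (by omega)]

theorem cellAt_write {l : List Word} {B i : ℕ} (hi : i < B) :
    cellAt ((l.drop 0).take B) i = cellAt l i := by
  simp [cellAt, List.getD_eq_getElem?_getD, hi]

theorem length_copyCells {l : List Word} {M d s n : ℕ} :
    (copyCells (.num 0) M l d s n).length = M := by simp [copyCells]

/-! ### Implementation with one buffer for each stream -/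

namespace Cached

def liftE (e : Expr AVar) : Expr ℕ := e.map AVar.idx

abbrev vBlk : ℕ := 40
abbrev vFrame : ℕ := 41
abbrev vTag : ℕ := 42
abbrev vStream : ℕ := 43
abbrev vOff : ℕ := 44

open ExtMem.Expr (var par)

/-- Position of the tag of a frame; the data follow it. -/
def tagE (e : Expr ℕ) : Expr ℕ := par 2 + 1 + e * (2 * cellsE + 1)

def framesE : Expr ℕ := 3 * fanE + 8

/-- The store begins behind the input. Its block X occupies the two disk blocks `base + 2 * X` and
`base + 2 * X + 1`, with h words in each: a cell has two words, so for B = 1 a single disk block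
could not hold even one cell. -/
def baseE : Expr ℕ := 2 * blocksE

/-- Make sure that block `X` is in some frame, and find it. -/
def access (s X : Expr ℕ) : Stmt ℕ MInstr :=
  .prim (.set vBlk X) ;;
  .prim (.set vStream s) ;;
  .prim (.set vFrame framesE) ;;
  .prim (.set vTag 0) ;;
  .loop (var vFrame * (1 - (var vTag).eq (var vBlk + 1)))
    (.prim (.set vFrame (var vFrame - 1)) ;;
     .prim (.get vTag (tagE (var vFrame)))) ;;
  .ite ((var vTag).eq (var vBlk + 1)) .skip
    (.prim (.set vFrame (var vStream)) ;;
     .prim (.get vTag (tagE (var vFrame))) ;;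
     .ite (var vTag)
       (.prim (.copy 0 (tagE (var vFrame) + 1) cellsE) ;;
        .prim (.io false (baseE + 2 * (var vTag - 1)) 0) ;;
        .prim (.copy 0 (tagE (var vFrame) + 1 + cellsE) cellsE) ;;
        .prim (.io false (baseE + 2 * (var vTag - 1) + 1) 0) ;;
        .prim (.num (tagE (var vFrame)) 0)) .skip ;;
     .prim (.io true (baseE + 2 * var vBlk) 0) ;;
     .prim (.copy (tagE (var vFrame) + 1) 0 cellsE) ;;
     .prim (.io true (baseE + 2 * var vBlk + 1) 0) ;;
     .prim (.copy (tagE (var vFrame) + 1 + cellsE) 0 cellsE) ;;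
     .prim (.num (tagE (var vFrame)) (var vBlk + 1)))

def cellBlkE (ρ e : Expr ℕ) : Expr ℕ := 7 * (e / cellsE) + ρ

def translate : AInstr → Stmt ℕ MInstr
  | .set v e => .prim (.set v.idx (liftE e))
  | .load s ρ e v =>
    access (liftE s) (cellBlkE (liftE ρ) (liftE e)) ;;
    .prim (.set vOff (tagE (var vFrame) + 1 + 2 * (liftE e % cellsE))) ;;
    .prim (.get v.idx (var vOff)) ;;
    .prim (.copy (par 2) (var vOff + 1) 1)
  | .store s ρ e n =>
    access (liftE s) (cellBlkE (liftE ρ) (liftE e)) ;;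
    .prim (.set vOff (tagE (var vFrame) + 1 + 2 * (liftE e % cellsE))) ;;
    .prim (.num (var vOff) (liftE n)) ;;
    .prim (.copy (var vOff + 1) (par 2) 1)
  | .cmp v s ρ e =>
    access (liftE s) (cellBlkE (liftE ρ) (liftE e)) ;;
    .prim (.set vOff (tagE (var vFrame) + 1 + 2 * (liftE e % cellsE))) ;;
    .prim (.cmp v.idx (par 2) (var vOff + 1))
  | .raw s e =>
    access (liftE s) (7 * (liftE e / (2 * cellsE)) + 6) ;;
    .prim (.set vOff (tagE (var vFrame) + 1 + liftE e % (2 * cellsE))) ;;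
    .prim (.copy (par 2) (var vOff) 1)

/-- The sizes fit. -/
structure SizeOk (E : AEnv) (ME : MEnv) : Prop where
  P : ME.P = E.P
  R : 50 ≤ ME.R
  h : E.h = cellsOf E.P
  F : E.F = 3 * fanOf E.P + 8
  block : E.h ≤ ME.B
  memory : ME.B + 1 + E.F * (2 * E.h + 1) ≤ ME.M
  cap : E.cap + ME.M + 10 ≤ ME.W
  addr : 2 * blocksOf E.P + 14 * E.cap + 20 ≤ ME.W
  free : E.β = 0

/-- The first B memory cells are the buffer of all transfers, the next one is the accumulator, and
then come the frames: a tag and `2 * h` words each. -/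
def slot (E : AEnv) (ME : MEnv) (f o : ℕ) : ℕ := ME.B + 1 + f * (2 * E.h + 1) + o

/-- The machine state `μ` represents the abstract state `α`. -/
structure Rel (E : AEnv) (ME : MEnv) (io₀ : ℕ) (α : AState) (μ : MState) : Prop where
  var : ∀ v, μ.var (AVar.idx v) = α.var v
  length : μ.cells.length = ME.M
  acc : cellAt μ.cells ME.B = α.acc
  tag : ∀ f < E.F, cellAt μ.cells (slot E ME f 0) = .num (α.cache.tag f)
  tag_zero : ∀ f, E.F ≤ f → α.cache.tag f = 0
  tag_inj : ∀ f f', α.cache.tag f = α.cache.tag f' → α.cache.tag f ≠ 0 → f = f'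
  tag_le : ∀ f, α.cache.tag f ≤ 7 * E.cap + 7
  frame : ∀ f < E.F, ∀ X, α.cache.tag f = X + 1 → ∀ o < 2 * E.h,
    cellAt μ.cells (slot E ME f (o + 1)) = α.word E X o
  onDisk : ∀ X, (∀ f, α.cache.tag f ≠ X + 1) → ∀ o < E.h,
    cellAt (μ.disk (2 * blocksOf E.P + 2 * X)) o = α.word E X o ∧
    cellAt (μ.disk (2 * blocksOf E.P + 2 * X + 1)) o = α.word E X (E.h + o)
  disk : ∀ a, (μ.disk a).length = ME.B
  num : ∀ ρ i, (α.mem ρ i).1 < E.cap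
  -- A miss costs `2 * h` in the abstract store and at most four transfers: two to write back the
  -- old block and two to read the new one.
  cost : 2 * E.h * μ.io ≤ 2 * E.h * io₀ + 4 * α.cache.cost

/-! ### Simulation of the store with buffers -/

section

variable {E : AEnv} {ME : MEnv} {io₀ : ℕ} {α : AState} {μ : MState}

theorem SizeOk.lt_R (hs : SizeOk E ME) {n : ℕ} (hn : n < 50) : n < ME.R := hn.trans_le hs.R

theorem slot_lt (hs : SizeOk E ME) {f o : ℕ} (hf : f < E.F) (ho : o < 2 * E.h + 1) :
    slot E ME f o < ME.M := by
  have := hs.memory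
  have : (f + 1) * (2 * E.h + 1) ≤ E.F * (2 * E.h + 1) := Nat.mul_le_mul_right _ hf
  rw [Nat.add_mul, Nat.one_mul] at this
  simp only [slot]
  omega

theorem slot_inj {f f' o o' : ℕ} (ho : o < 2 * E.h + 1) (ho' : o' < 2 * E.h + 1) :
    slot E ME f o = slot E ME f' o' ↔ f = f' ∧ o = o' := by
  constructor
  · intro h
    have h : f * (2 * E.h + 1) + o = f' * (2 * E.h + 1) + o' := by simp only [slot] at h; omega
    have e₁ : (f * (2 * E.h + 1) + o) / (2 * E.h + 1) = f := by
      rw [Nat.add_comm, Nat.add_mul_div_right _ _ (by omega), Nat.div_eq_of_lt ho, Nat.zero_add]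
    have e₂ : (f' * (2 * E.h + 1) + o') / (2 * E.h + 1) = f' := by
      rw [Nat.add_comm, Nat.add_mul_div_right _ _ (by omega), Nat.div_eq_of_lt ho', Nat.zero_add]
    rw [h, e₂] at e₁
    subst e₁
    omega
  · rintro ⟨rfl, rfl⟩; rfl

@[simp] theorem eval_tagE (P : Params) (ρ : ℕ → ℕ) (e : Expr ℕ) :
    (tagE e).eval P ρ = paramAt P 2 + 1 + e.eval P ρ * (2 * cellsOf P + 1) := by
  simp [tagE]

@[simp] theorem eval_framesE (P : Params) (ρ : ℕ → ℕ) :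
    framesE.eval P ρ = 3 * fanOf P + 8 := by simp [framesE]

@[simp] theorem eval_baseE (P : Params) (ρ : ℕ → ℕ) :
    baseE.eval P ρ = 2 * blocksOf P := by simp [baseE]

theorem idx_ne (v : AVar) {n : ℕ} (hn : 40 ≤ n) : v.idx ≠ n := by
  have := v.idx_lt; omega

theorem Rel.eval_liftE (hs : SizeOk E ME) (h : Rel E ME io₀ α μ) (e : Expr AVar) :
    (liftE e).eval ME.P μ.var = e.eval E.P α.var := by
  rw [liftE, Expr.eval_map, hs.P]
  simp only [h.var]

/-- Auxiliary variables do not matter. -/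
theorem Rel.congr_var (h : Rel E ME io₀ α μ) {ρ : ℕ → ℕ} (hρ : ∀ v : AVar, ρ v.idx = μ.var v.idx) :
    Rel E ME io₀ α { μ with var := ρ } :=
  { h with var := fun v => (hρ v).trans (h.var v) }

/-- Searching the frames. -/
theorem search (hs : SizeOk E ME) (h : Rel E ME io₀ α μ) {X : ℕ} (hX : μ.var vBlk = X)
    (hframe : μ.var vFrame = E.F) (htag : μ.var vTag = 0) :
    Wp (mLang ME) (.loop (var vFrame * (1 - (var vTag).eq (var vBlk + 1)))
      (.prim (.set vFrame (var vFrame - 1)) ;;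
       .prim (.get vTag (tagE (var vFrame)))))
      (fun μ' => ∃ ρ, μ' = { μ with var := ρ } ∧
        (∀ v, v ≠ vFrame → v ≠ vTag → ρ v = μ.var v) ∧
        (ρ vTag = X + 1 → ρ vFrame < E.F ∧ α.cache.tag (ρ vFrame) = X + 1) ∧
        (ρ vTag ≠ X + 1 → ∀ f, α.cache.tag f ≠ X + 1)) μ := by
  refine wp_loop (fun μ' => ∃ ρ, μ' = { μ with var := ρ } ∧
      (∀ v, v ≠ vFrame → v ≠ vTag → ρ v = μ.var v) ∧ ρ vFrame ≤ E.F ∧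
        (ρ vTag = X + 1 → ρ vFrame < E.F ∧ α.cache.tag (ρ vFrame) = X + 1) ∧
        (ρ vTag ≠ X + 1 → ∀ f < E.F, ρ vFrame ≤ f → α.cache.tag f ≠ X + 1))
      (fun μ' => μ'.var vFrame) ?_ ?_ ?_
  · exact ⟨μ.var, rfl, fun _ _ _ => rfl, by omega, by omega, fun _ f' h₁ h₂ => by omega⟩
  · rintro _ ⟨ρ, rfl, hρ, hf, h₁, h₂⟩ hc
    have hblk : ρ vBlk = X := (hρ _ (by decide) (by decide)).trans hX
    -- The loop condition is a product that vanishes as soon as no frame is left or the tag is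
    -- found.
    have hc' : 0 < ρ vFrame ∧ ρ vTag ≠ X + 1 := by
      simp only [mLang_test, Expr.eval_mul, Expr.eval_sub, Expr.eval_eq, Expr.eval_var, Expr.eval_add,
        Expr.eval_one, ne_eq, mul_eq_zero, not_or, hblk] at hc
      constructor
      · omega
      · intro h
        simp [h] at hc
    have hlt : ρ vFrame - 1 < E.F := by omega
    have hslot := h.tag _ hlt
    have htle := h.tag_le (ρ vFrame - 1)
    have haddr := hs.addr
    have hFM : ρ vFrame - 1 < ME.M := by
      have := slot_lt hs (o := 0) hlt (by omega)
      simp only [slot] at this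
      have := Nat.le_mul_of_pos_right (ρ vFrame - 1) (show 0 < 2 * E.h + 1 by omega)
      omega
    have hcap := hs.cap
    rw [slot, hs.h, ← hs.P, Nat.add_zero] at hslot
    simp only [wp_seq, wp_prim, mLang_ok, mLang_run, MInstr.ok, MInstr.run, eval_tagE, Expr.eval_sub,
      Expr.eval_var, Expr.eval_one, update_self]
    rw [hslot]
    simp only [Word.toNum]
    refine ⟨⟨hs.lt_R (by decide), by omega⟩, ⟨hs.lt_R (by decide), by omega⟩, ⟨_, rfl, fun v h₁ h₂ => ?_, ?_⟩, ?_⟩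
    · rw [update_of_ne h₂, update_of_ne h₁, hρ v h₁ h₂]
    · rw [update_self, update_of_ne (by decide), update_self]
      refine ⟨by omega, fun ht => ⟨by omega, ht⟩, fun ht f' hf' hle => ?_⟩
      rcases Nat.eq_or_lt_of_le hle with rfl | hlt
      · exact ht
      · exact h₂ hc'.2 f' hf' (by omega)
    · rw [update_of_ne (by decide), update_self]; omega
  · rintro _ ⟨ρ, rfl, hρ, hf, h₁, h₂⟩ hc
    have hblk : ρ vBlk = X := (hρ _ (by decide) (by decide)).trans hX
    refine ⟨ρ, rfl, hρ, h₁, fun ht f' => ?_⟩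
    have hf0 : ρ vFrame = 0 := by
      simp only [mLang_test, Expr.eval_mul, Expr.eval_sub, Expr.eval_eq, Expr.eval_var, Expr.eval_add,
        Expr.eval_one, hblk, if_neg ht] at hc
      simpa using hc
    by_cases hlt : f' < E.F
    · exact h₂ ht f' hlt (by omega)
    · rw [h.tag_zero f' (by omega)]; omega

/-- Effect of writing `n` words from position `s`. -/
theorem cellAt_writeCells {l : List Word} {M B n s : ℕ} (hl : l.length = M) (hn : n ≤ B)
    (hB : B ≤ M) :
    ((((copyCells (.num 0) M l 0 s n).drop 0).take B).length = B ∧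
      ∀ o < n, cellAt (((copyCells (.num 0) M l 0 s n).drop 0).take B) o = cellAt l (s + o)) ∧
    ∀ i, n ≤ i → cellAt (copyCells (.num 0) M l 0 s n) i = cellAt l i := by
  refine ⟨⟨?_, fun o ho => ?_⟩, fun i hi => ?_⟩
  · simp only [List.length_take, List.length_drop, length_copyCells]; omega
  · rw [cellAt_write (by omega), cellAt_copyCells hl, if_pos (by omega), Nat.sub_zero]
  · rw [cellAt_copyCells hl, if_neg (by omega)]

/-- Effect of reading `n` words to position `d`. -/
theorem cellAt_readCells {l b : List Word} {M B n d : ℕ} (hl : l.length = M) (hb : b.length = B)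
    (hn : n ≤ B) (hd : B ≤ d) (hM : d + n ≤ M) :
    (∀ o < n, cellAt (copyCells (.num 0) M (l.take 0 ++ b ++ l.drop (0 + B)) d 0 n) (d + o) =
      cellAt b o) ∧
    ∀ i, B ≤ i → (i < d ∨ d + n ≤ i) →
      cellAt (copyCells (.num 0) M (l.take 0 ++ b ++ l.drop (0 + B)) d 0 n) i = cellAt l i := by
  have hl' : (l.take 0 ++ b ++ l.drop (0 + B)).length = M := by
    simp only [List.length_append, List.length_take, List.length_drop]; omega
  refine ⟨fun o ho => ?_, fun i hi h => ?_⟩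
  · rw [cellAt_copyCells hl', if_pos (by omega), cellAt_read hb, if_pos (by omega)]
    congr 1; omega
  · rw [cellAt_copyCells hl', if_neg (by omega), cellAt_read hb, if_neg (by omega)]

/-- Write back the content of a frame. -/
theorem evict (hs : SizeOk E ME) (h : Rel E ME io₀ α μ) {f : ℕ} (hf : f < E.F)
    (hframe : μ.var vFrame = f) (htag : μ.var vTag = α.cache.tag f) :
    Wp (mLang ME) (.ite (var vTag)
        (.prim (.copy 0 (tagE (var vFrame) + 1) cellsE) ;;
         .prim (.io false (baseE + 2 * (var vTag - 1)) 0) ;;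
         .prim (.copy 0 (tagE (var vFrame) + 1 + cellsE) cellsE) ;;
         .prim (.io false (baseE + 2 * (var vTag - 1) + 1) 0) ;;
         .prim (.num (tagE (var vFrame)) 0)) .skip)
      (fun μ' => Rel E ME (io₀ + 2)
        { α with cache := { α.cache with tag := update α.cache.tag f 0 } } μ' ∧
        μ'.var = μ.var) μ := by
  have hPh : cellsOf ME.P = E.h := by rw [hs.P, hs.h]
  have hblocks : blocksOf ME.P = blocksOf E.P := by rw [hs.P]
  have hlt := h.tag_le f
  have haddr := hs.addr
  have hcost := h.cost
  have hmem := hs.memory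
  have hblk := hs.block
  have hlen := h.length
  have hBM : ME.B ≤ ME.M := by omega
  simp only [wp_ite, wp_skip, wp_seq, wp_prim, mLang_ok, mLang_run, mLang_test, Expr.eval_var, htag]
  constructor
  · intro ht
    simp only [MInstr.ok, MInstr.run, Expr.eval_add, Expr.eval_sub, Expr.eval_var, eval_baseE,
      eval_tagE, Expr.eval_ofNat, Expr.eval_mul, eval_cellsE, htag,
      hPh, hblocks, hframe, true_and, Nat.zero_add]
    have hslot : ME.B + 1 + f * (2 * E.h + 1) + 1 = slot E ME f 1 := rfl
    have hslot₀ : ME.B + 1 + f * (2 * E.h + 1) = slot E ME f 0 := rfl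
    rw [hslot, hslot₀]
    set X := α.cache.tag f - 1 with hX
    have hXf : α.cache.tag f = X + 1 := by omega
    set l := copyCells (.num 0) ME.M μ.cells 0 (slot E ME f 1) E.h with hl
    have hll : l.length = ME.M := length_copyCells
    obtain ⟨⟨hd₁, hd₁'⟩, hl₁⟩ := cellAt_writeCells (s := slot E ME f 1) hlen hblk hBM
    obtain ⟨⟨hd₂, hd₂'⟩, hl₂⟩ := cellAt_writeCells (s := slot E ME f 1 + E.h) hll hblk hBM
    rw [← hl] at hd₁ hd₁' hl₁
    set l' := copyCells (.num 0) ME.M l 0 (slot E ME f 1 + E.h) E.h with hl'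
    have hll' : l'.length = ME.M := length_copyCells
    have hs₀ : slot E ME f 0 < ME.M := slot_lt hs hf (by omega)
    have hc₂ : ∀ i, E.h ≤ i → cellAt (l'.set (slot E ME f 0) (.num 0)) i =
        if i = slot E ME f 0 then .num 0 else cellAt μ.cells i := by
      intro i hi
      rw [cellAt_set (show slot E ME f 0 < l'.length by omega), hl₂ i hi, hl₁ i hi]
    refine ⟨⟨by omega, by omega⟩, ⟨by omega, by omega⟩, by omega,
      ⟨h.var, by rw [List.length_set, hll'], ?_, ?_, ?_, ?_, ?_, ?_, ?_, ?_,
      h.num, ?_⟩, trivial⟩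
    · rw [hc₂ _ hblk, if_neg (by simp only [slot]; omega)]; exact h.acc
    · intro f' hf'
      dsimp only
      rw [hc₂ _ (by simp only [slot]; omega)]
      by_cases hff : f' = f
      · subst hff; simp
      · rw [if_neg, update_of_ne hff]
        · exact h.tag f' hf'
        · rw [slot_inj (by omega) (by omega)]; tauto
    · intro f' hf'
      dsimp only
      rw [update_of_ne (by omega)]
      exact h.tag_zero f' hf'
    · intro f₁ f₂
      dsimp only
      simp only [update_apply]
      split_ifs with h₁ h₂
      · omega
      · omega
      · intro e₁ e₂; omega
      · exact h.tag_inj f₁ f₂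
    · intro f'
      dsimp only
      simp only [update_apply]
      split_ifs
      · omega
      · exact h.tag_le f'
    · intro f' hf' Y hY o ho
      dsimp only at hY ⊢
      rw [update_apply] at hY
      split_ifs at hY with hff
      rw [hc₂ _ (by simp only [slot]; omega), if_neg]
      · exact h.frame f' hf' Y hY o ho
      · rw [slot_inj (by omega) (by omega)]; omega
    · intro Y hY o ho
      dsimp only at hY ⊢
      change _ = α.word E Y o ∧ _ = α.word E Y (E.h + o)
      by_cases hYX : Y = X
      · rw [hYX, update_of_ne (by omega), update_self, update_self, hd₁' o ho, hd₂' o ho,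
          hl₁ _ (by simp only [slot]; omega), ← h.frame f hf X hXf o (by omega),
          ← h.frame f hf X hXf (E.h + o) (by omega)]
        constructor <;> (congr 1; simp only [slot]; omega)
      · rw [update_of_ne (by omega), update_of_ne (by omega), update_of_ne (by omega),
          update_of_ne (by omega)]
        refine h.onDisk Y (fun f' hf' => ?_) o ho
        have := hY f'
        rw [update_apply] at this
        split_ifs at this with hff
        · subst hff; omega
        · exact this hf'
    · intro a
      dsimp only
      rw [update_apply, update_apply]
      split_ifs
      · exact hd₂
      · exact hd₁
      · exact h.disk a
    · dsimp only
      rw [Nat.add_assoc, Nat.mul_add, Nat.mul_add _ io₀]; omega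
  · intro ht
    have hupd : update α.cache.tag f 0 = α.cache.tag := by rw [← ht, update_eq_self]
    rw [hupd]
    exact ⟨{ h with cost := by dsimp only; rw [Nat.mul_add]; omega }, trivial⟩

/-- Read a block into an empty frame. -/
theorem fetch (hs : SizeOk E ME) (h : Rel E ME (io₀ + 2) α μ) {f X : ℕ} (hf : f < E.F)
    (hframe : μ.var vFrame = f) (hX : μ.var vBlk = X) (hXcap : X ≤ 7 * E.cap + 6)
    (hempty : α.cache.tag f = 0) (hnot : ∀ f, α.cache.tag f ≠ X + 1) :
    Wp (mLang ME) (.prim (.io true (baseE + 2 * var vBlk) 0) ;;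
        .prim (.copy (tagE (var vFrame) + 1) 0 cellsE) ;;
        .prim (.io true (baseE + 2 * var vBlk + 1) 0) ;;
        .prim (.copy (tagE (var vFrame) + 1 + cellsE) 0 cellsE) ;;
        .prim (.num (tagE (var vFrame)) (var vBlk + 1)))
      (fun μ' => Rel E ME io₀
        { α with cache := ⟨update α.cache.tag f (X + 1), α.cache.cost + 2 * E.h⟩ } μ' ∧
        μ'.var = μ.var) μ := by
  have hPh : cellsOf ME.P = E.h := by rw [hs.P, hs.h]
  have hblocks : blocksOf ME.P = blocksOf E.P := by rw [hs.P]
  have haddr := hs.addr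
  have hcost := h.cost
  have hcap := hs.cap
  have hmem := hs.memory
  have hblk := hs.block
  have hlen := h.length
  have hBM : ME.B ≤ ME.M := by omega
  simp only [wp_seq, wp_prim, mLang_ok, mLang_run, MInstr.ok, MInstr.run, Expr.eval_add, Expr.eval_var,
    eval_baseE, eval_tagE, Expr.eval_ofNat, Expr.eval_mul, eval_cellsE, hX, hPh,
    hblocks, hframe, true_and]
  have hslot : ME.B + 1 + f * (2 * E.h + 1) + 1 = slot E ME f 1 := rfl
  have hslot₀ : ME.B + 1 + f * (2 * E.h + 1) = slot E ME f 0 := rfl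
  rw [hslot, hslot₀]
  have hs₀ : slot E ME f 0 < ME.M := slot_lt hs hf (by omega)
  have hs₂ : slot E ME f (2 * E.h) < ME.M := slot_lt hs hf (by omega)
  obtain ⟨hr₁, hr₁'⟩ := cellAt_readCells (d := slot E ME f 1) hlen
    (h.disk (2 * blocksOf E.P + 2 * X)) hblk (by simp only [slot]; omega)
    (by simp only [slot] at hs₂ ⊢; omega)
  set l := copyCells (.num 0) ME.M (μ.cells.take 0 ++ μ.disk (2 * blocksOf E.P + 2 * X) ++
    μ.cells.drop (0 + ME.B)) (slot E ME f 1) 0 E.h with hl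
  have hll : l.length = ME.M := length_copyCells
  obtain ⟨hr₂, hr₂'⟩ := cellAt_readCells (d := slot E ME f 1 + E.h) hll
    (h.disk (2 * blocksOf E.P + 2 * X + 1)) hblk (by simp only [slot]; omega)
    (by simp only [slot] at hs₂ ⊢; omega)
  set l' := copyCells (.num 0) ME.M (l.take 0 ++ μ.disk (2 * blocksOf E.P + 2 * X + 1) ++
    l.drop (0 + ME.B)) (slot E ME f 1 + E.h) 0 E.h with hl'
  have hll' : l'.length = ME.M := length_copyCells
  have hc : ∀ i, ME.B ≤ i → (∀ o < 2 * E.h, i ≠ slot E ME f (o + 1)) → i ≠ slot E ME f 0 →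
      cellAt (l'.set (slot E ME f 0) (.num (X + 1))) i = cellAt μ.cells i := by
    intro i hi h₁ h₂
    have h₃ : i < slot E ME f 1 ∨ slot E ME f 1 + 2 * E.h ≤ i := by
      by_contra hcon
      exact h₁ (i - slot E ME f 1) (by omega) (by simp only [slot] at hcon ⊢; omega)
    rw [cellAt_set (by omega), if_neg h₂, hr₂' i hi (by omega), hr₁' i hi (by omega)]
  have hdata : ∀ o < 2 * E.h, cellAt (l'.set (slot E ME f 0) (.num (X + 1)))
      (slot E ME f (o + 1)) = α.word E X o := by
    intro o ho
    rw [cellAt_set (by omega), if_neg (by simp only [slot]; omega),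
      show slot E ME f (o + 1) = slot E ME f 1 + o by simp only [slot]; omega]
    by_cases hoh : o < E.h
    · rw [hr₂' _ (by simp only [slot]; omega) (by omega), hr₁ o hoh]
      exact (h.onDisk X hnot o hoh).1
    · have := hr₂ (o - E.h) (by omega)
      rw [Nat.add_assoc, Nat.add_sub_cancel' (by omega)] at this
      rw [this, (h.onDisk X hnot (o - E.h) (by omega)).2, Nat.add_sub_cancel' (by omega)]
  refine ⟨⟨by omega, by omega⟩, ⟨by omega, by omega⟩, by omega,
    ⟨h.var, by rw [List.length_set, hll'], ?_, ?_, ?_, ?_,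
    ?_, ?_, ?_, h.disk, h.num, ?_⟩, trivial⟩
  · rw [hc _ le_rfl (by intro o _; simp only [slot]; omega) (by simp only [slot]; omega)]
    exact h.acc
  · intro f' hf'
    dsimp only
    by_cases hff : f' = f
    · subst hff
      rw [cellAt_set (by omega), if_pos rfl, update_self]
    · rw [hc _ (by simp only [slot]; omega), update_of_ne hff]
      · exact h.tag f' hf'
      · intro o ho; rw [ne_eq, slot_inj (by omega) (by omega)]; omega
      · rw [ne_eq, slot_inj (by omega) (by omega)]; tauto
  · intro f' hf'
    dsimp only
    rw [update_of_ne (by omega)]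
    exact h.tag_zero f' hf'
  · intro f₁ f₂
    dsimp only
    simp only [update_apply]
    split_ifs with h₁ h₂
    · omega
    · intro e; exact absurd e.symm (hnot f₂)
    · intro e; exact absurd e (hnot f₁)
    · exact h.tag_inj f₁ f₂
  · intro f'
    dsimp only
    simp only [update_apply]
    split_ifs
    · omega
    · exact h.tag_le f'
  · intro f' hf' Y hY o ho
    dsimp only at hY ⊢
    change _ = α.word E Y o
    rw [update_apply] at hY
    split_ifs at hY with hff
    · subst hff
      obtain rfl : X = Y := by omega
      exact hdata o ho
    · rw [hc _ (by simp only [slot]; omega)]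
      · exact h.frame f' hf' Y hY o ho
      · intro o ho; rw [ne_eq, slot_inj (by omega) (by omega)]; omega
      · rw [ne_eq, slot_inj (by omega) (by omega)]; tauto
  · intro Y hY o ho
    dsimp only at hY ⊢
    change _ = α.word E Y o ∧ _ = α.word E Y (E.h + o)
    refine h.onDisk Y (fun f' hf' => ?_) o ho
    have := hY f'
    rw [update_apply] at this
    split_ifs at this with hff
    · subst hff; omega
    · exact this hf'
  -- The cost `2 * h` of the load pays four transfers: the two reads made here and the two writes of
  -- `evict`, which so far were granted on credit as `io₀ + 2`.
  · dsimp only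
    rw [Nat.mul_add] at hcost
    rw [Nat.add_assoc, Nat.mul_add]; omega

/-- The block `X` is in a frame after `access`. -/
theorem wp_access (hs : SizeOk E ME) (h : Rel E ME io₀ α μ) {s X : Expr ℕ} {sv Xv : ℕ}
    (hX : X.eval ME.P μ.var = Xv)
    (hsv : ∀ ρ : ℕ → ℕ, (∀ v : AVar, ρ v.idx = μ.var v.idx) → s.eval ME.P ρ = sv)
    (hsF : sv < E.F) (hXcap : Xv ≤ 7 * E.cap + 6) :
    Wp (mLang ME) (access s X) (fun μ' =>
      Rel E ME io₀ { α with cache := α.cache.touch E sv Xv } μ' ∧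
      μ'.var vFrame < E.F ∧ (α.cache.touch E sv Xv).tag (μ'.var vFrame) = Xv + 1) μ := by
  have hPh : cellsOf ME.P = E.h := by rw [hs.P, hs.h]
  have haddr := hs.addr
  have hF : ∀ ρ, framesE.eval ME.P ρ = E.F := by
    intro ρ; rw [eval_framesE, hs.P, hs.F]
  have hFM : E.F ≤ ME.M := by
    have := hs.memory
    have := Nat.le_mul_of_pos_right E.F (show 0 < 2 * E.h + 1 by omega)
    omega
  have hcap := hs.cap
  simp only [access, wp_seq, wp_prim]
  set ρ₁ := update μ.var vBlk Xv with hρ₁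
  set ρ₂ := update ρ₁ vStream sv with hρ₂
  set ρ₃ := update (update ρ₂ vFrame E.F) vTag 0 with hρ₃
  have hi : ∀ v : AVar, ρ₃ v.idx = μ.var v.idx := by
    intro v
    rw [hρ₃, update_of_ne (idx_ne v (by decide)), update_of_ne (idx_ne v (by decide)), hρ₂,
      update_of_ne (idx_ne v (by decide)), hρ₁, update_of_ne (idx_ne v (by decide))]
  have hs₁ : s.eval ME.P ρ₁ = sv := hsv ρ₁ fun v => by
    rw [hρ₁, update_of_ne (idx_ne v (by decide))]
  simp only [mLang_ok, mLang_run, MInstr.ok, MInstr.run, hX, ← hρ₁, hs₁, ← hρ₂, hF, Expr.eval_ofNat, ← hρ₃]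
  refine ⟨⟨hs.lt_R (by decide), by omega⟩, ⟨hs.lt_R (by decide), by omega⟩,
    ⟨hs.lt_R (by decide), by omega⟩, ⟨hs.lt_R (by decide), by omega⟩, ?_⟩
  have hrel : Rel E ME io₀ α { μ with var := ρ₃ } := h.congr_var hi
  have hb₃ : ρ₃ vBlk = Xv := by simp [hρ₃, hρ₂, hρ₁]
  have hs₃ : ρ₃ vStream = sv := by simp [hρ₃, hρ₂]
  refine (search hs hrel (X := Xv) hb₃ (by simp [hρ₃]) (by simp [hρ₃])).mono ?_
  rintro _ ⟨ρ, rfl, hρ, hhit, hmiss⟩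
  have hbρ : ρ vBlk = Xv := (hρ _ (by decide) (by decide)).trans hb₃
  have hsρ : ρ vStream = sv := (hρ _ (by decide) (by decide)).trans hs₃
  have hiρ : ∀ v : AVar, ρ v.idx = μ.var v.idx := fun v =>
    (hρ _ (idx_ne v (by decide)) (idx_ne v (by decide))).trans (hi v)
  rw [wp_ite]
  constructor
  · intro ht
    have ht : ρ vTag = Xv + 1 := by
      simpa [mLang_test, hbρ] using ht
    obtain ⟨h₁, h₂⟩ := hhit ht
    rw [wp_skip]
    have e : α.cache.touch E sv Xv = α.cache := by
      simp only [Cache.touch, if_pos (⟨_, h₂⟩ : ∃ s', α.cache.tag s' = Xv + 1), hs.free]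
      rfl
    rw [e]
    exact ⟨h.congr_var hiρ, h₁, h₂⟩
  · intro ht
    have ht : ρ vTag ≠ Xv + 1 := by
      simpa [mLang_test, hbρ] using ht
    have hnot := hmiss ht
    have e : α.cache.touch E sv Xv =
        ⟨update α.cache.tag sv (Xv + 1), α.cache.cost + 2 * E.h⟩ := by
      simp only [Cache.touch, if_neg (not_exists.mpr hnot), hs.free, Nat.add_zero]
    have htag := hrel.tag sv hsF
    rw [slot, Nat.add_zero, ← hPh] at htag
    simp only [wp_seq, wp_prim, mLang_ok, mLang_run, MInstr.ok, MInstr.run, Expr.eval_var, hsρ, eval_tagE, update_self]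
    rw [htag]
    have htl := h.tag_le sv
    refine ⟨⟨hs.lt_R (by decide), by omega⟩, ⟨hs.lt_R (by decide), by simp only [Word.toNum]; omega⟩, ?_⟩
    have hrel' : Rel E ME io₀ α { μ with
        var := update (update ρ vFrame sv) vTag (Word.num (α.cache.tag sv)).toNum } :=
      h.congr_var fun v => by
        rw [update_of_ne (idx_ne v (by decide)), update_of_ne (idx_ne v (by decide)), hiρ]
    refine (evict hs hrel' hsF (by simp) (by simp [Word.toNum])).mono ?_
    rintro μ₁ ⟨h₁, hv₁⟩
    refine (fetch hs h₁ (X := Xv) hsF (by simp [hv₁]) (by simp [hv₁, hbρ]) hXcap (by simp) ?_).mono ?_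
    · intro f
      dsimp only
      rw [update_apply]
      split_ifs
      · omega
      · exact hnot f
    · rintro μ₂ ⟨h₂, hv₂⟩
      rw [e, hv₂, hv₁]
      dsimp only
      rw [update_of_ne (by decide), update_self, update_self]
      refine ⟨?_, hsF, rfl⟩
      simpa using h₂

/-- Position of a word of block `X` in the memory. -/
theorem Rel.frame_word (hs : SizeOk E ME) (h : Rel E ME io₀ α μ) {X f o : ℕ} (hf : f < E.F)
    (htag : α.cache.tag f = X + 1) (ho : o < 2 * E.h) :
    cellAt μ.cells (paramAt ME.P 2 + 1 + f * (2 * cellsOf ME.P + 1) + 1 + o) = α.word E X o := by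
  rw [← h.frame f hf X htag o ho, hs.P, ← hs.h]
  congr 1
  simp only [slot, MEnv.B, hs.P]; omega

theorem eval_cellBlkE (hs : SizeOk E ME) (h : Rel E ME io₀ α μ) (ρ e : Expr AVar) :
    (cellBlkE (liftE ρ) (liftE e)).eval ME.P μ.var =
      E.blk (ρ.eval E.P α.var) (e.eval E.P α.var) := by
  simp only [cellBlkE, Expr.eval_add, Expr.eval_mul, Expr.eval_div, Expr.eval_ofNat, eval_cellsE,
    h.eval_liftE hs]
  simp only [AEnv.blk, hs.h, hs.P]

theorem blk_le (E : AEnv) {ρ i : ℕ} (hρ : ρ < 6) (hi : i < E.cap) : E.blk ρ i ≤ 7 * E.cap + 6 := by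
  have := Nat.div_le_self i E.h
  simp only [AEnv.blk]; omega

theorem eval_off (hs : SizeOk E ME) {ρ' : ℕ → ℕ} (hρ : ∀ v : AVar, ρ' v.idx = α.var v)
    (e : Expr AVar) :
    (tagE (var vFrame) + 1 + 2 * (liftE e % cellsE)).eval ME.P ρ' =
      paramAt ME.P 2 + 1 + ρ' vFrame * (2 * cellsOf ME.P + 1) + 1 +
        2 * (e.eval E.P α.var % E.h) := by
  simp only [Expr.eval_add, Expr.eval_mul, Expr.eval_mod, Expr.eval_ofNat, eval_cellsE, eval_tagE,
    Expr.eval_var]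
  rw [liftE, Expr.eval_map]
  simp only [hρ, hs.h, hs.P]

theorem Rel.assign (h : Rel E ME io₀ α μ) (v : AVar) (x : ℕ) {ρ : ℕ → ℕ}
    (hρ : ∀ v : AVar, ρ v.idx = α.var v) :
    Rel E ME io₀ { α with var := update α.var v x } { μ with var := update ρ v.idx x } :=
  { h with
    var := fun u => by
      simp only [update_apply, AVar.idx_injective.eq_iff]
      split_ifs
      · rfl
      · exact hρ u }

theorem Rel.set_acc (hs : SizeOk E ME) (h : Rel E ME io₀ α μ) {d : ℕ} {w : Word}
    (hd : cellAt μ.cells d = w) {ρ : ℕ → ℕ} (hρ : ∀ v : AVar, ρ v.idx = α.var v) :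
    Rel E ME io₀ { α with acc := w }
      { μ with var := ρ, cells := copyCells (.num 0) ME.M μ.cells ME.B d 1 } := by
  have hmem := hs.memory
  have hc : ∀ i, cellAt (copyCells (.num 0) ME.M μ.cells ME.B d 1) i =
      if i = ME.B then w else cellAt μ.cells i := by
    intro i
    rw [cellAt_copyCells h.length]
    by_cases hi : i = ME.B
    · rw [if_pos (by omega), if_pos hi, hi, Nat.sub_self, Nat.add_zero, hd]
    · rw [if_neg (by omega), if_neg hi]
  have hsl : ∀ f o, cellAt (copyCells (.num 0) ME.M μ.cells ME.B d 1) (slot E ME f o) =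
      cellAt μ.cells (slot E ME f o) := by
    intro f o
    rw [hc, if_neg (by simp only [slot]; omega)]
  refine ⟨hρ, length_copyCells, by rw [hc, if_pos rfl], ?_, h.tag_zero, h.tag_inj, h.tag_le, ?_,
    h.onDisk, h.disk, h.num, h.cost⟩
  · intro f hf; rw [hsl]; exact h.tag f hf
  · intro f hf X hX o ho
    rw [hsl]; exact h.frame f hf X hX o ho

theorem Rel.write (hs : SizeOk E ME) (hh : 0 < E.h) (h : Rel E ME io₀ α μ) {f ρ i n : ℕ}
    (hf : f < E.F) (hρ : ρ < 6) (htag : α.cache.tag f = E.blk ρ i + 1) (hn : n < E.cap)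
    {ρ' : ℕ → ℕ} (hρ' : ∀ v : AVar, ρ' v.idx = α.var v) {d : ℕ}
    (hd : d = slot E ME f (2 * (i % E.h) + 1)) :
    Rel E ME io₀ { α with mem := setMem α.mem ρ i (n, α.acc) }
      { μ with var := ρ',
               cells := copyCells (.num 0) ME.M (μ.cells.set d (.num n)) (d + 1) ME.B 1 } := by
  have hlt := Nat.mod_lt i hh
  have hmem := hs.memory
  have hd₁ : d < ME.M := by rw [hd]; exact slot_lt hs hf (by omega)
  have hd₂ : d + 1 < ME.M := by
    have := slot_lt hs hf (show 2 * (i % E.h) + 2 < 2 * E.h + 1 by omega)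
    simp only [slot] at this hd
    omega
  have hBd : ME.B < d := by simp only [slot] at hd; omega
  have hc : ∀ j, cellAt (copyCells (.num 0) ME.M (μ.cells.set d (.num n)) (d + 1) ME.B 1) j =
      if j = d then .num n else if j = d + 1 then α.acc else cellAt μ.cells j := by
    intro j
    have hl := h.length
    rw [cellAt_copyCells (by rw [List.length_set, hl])]
    by_cases hj : j = d + 1
    · rw [if_pos (by omega), if_neg (by omega), if_pos hj, hj, Nat.sub_self, Nat.add_zero,
        cellAt_set (by omega), if_neg (by omega), h.acc]
    · rw [if_neg (by omega), if_neg hj, cellAt_set (by omega)]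
  refine ⟨hρ', length_copyCells, by rw [hc, if_neg (by omega), if_neg (by omega), h.acc], ?_,
    h.tag_zero, h.tag_inj, h.tag_le, ?_, ?_, h.disk, ?_, h.cost⟩
  · intro f' hf'
    rw [hc, hd, if_neg, if_neg]
    · exact h.tag f' hf'
    · intro e
      have : slot E ME f (2 * (i % E.h) + 1) + 1 = slot E ME f (2 * (i % E.h) + 2) := by
        simp only [slot]; omega
      rw [this, slot_inj (by omega) (by omega)] at e
      omega
    · rw [slot_inj (by omega) (by omega)]; omega
  · intro f' hf' X hX o ho
    rw [word_setMem (α := α) hh hρ (n, α.acc) α.cache X o ho, hc, hd]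
    have e₁ : slot E ME f (2 * (i % E.h) + 1) + 1 = slot E ME f (2 * (i % E.h) + 1 + 1) := by
      simp only [slot]; omega
    have hXf : X = E.blk ρ i ↔ f' = f := by
      constructor
      · rintro rfl
        exact h.tag_inj _ _ (by dsimp only at hX; omega) (by dsimp only at hX; omega)
      · rintro rfl
        dsimp only at hX; omega
    rw [e₁]
    simp only [slot_inj (E := E) (ME := ME) (f := f') (f' := f) (o := o + 1)
      (o' := 2 * (i % E.h) + 1) (by omega) (by omega),
      slot_inj (E := E) (ME := ME) (f := f') (f' := f) (o := o + 1)
      (o' := 2 * (i % E.h) + 1 + 1) (by omega) (by omega), Nat.add_right_cancel_iff, hXf]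
    rw [h.frame f' hf' X hX o ho]
  · intro X hX o ho
    rw [word_setMem (α := α) hh hρ (n, α.acc) α.cache X o (by omega)]
    have : X ≠ E.blk ρ i := by rintro rfl; exact hX f htag
    rw [if_neg (by tauto), if_neg (by tauto),
      word_setMem (α := α) hh hρ (n, α.acc) α.cache X (E.h + o) (by omega),
      if_neg (by tauto), if_neg (by tauto)]
    exact h.onDisk X hX o ho
  · intro ρ₁ i₁
    simp only [setMem, update_apply]
    split_ifs with h₁
    · rw [update_apply]
      split_ifs
      · exact hn
      · exact h.num ρ i₁
    · exact h.num ρ₁ i₁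

/-- Every instruction is simulated. -/
theorem wp_translate (hs : SizeOk E ME) (i : AInstr) (h : Rel E ME io₀ α μ) (hok : i.ok E α) :
    Wp (mLang ME) (translate i) (Rel E ME io₀ (i.run E α)) μ := by
  have hh : 0 < E.h := by rw [hs.h]; exact cellsOf_pos _
  have hcap := hs.cap
  have hPB : paramAt ME.P 2 = ME.B := rfl
  have hidx : ∀ v : AVar, v.idx < ME.R := fun v => hs.lt_R (by have := v.idx_lt; omega)
  have hlift : ∀ (ρ : ℕ → ℕ) (α' : AState) (_ : ∀ v : AVar, ρ v.idx = α'.var v) (e : Expr AVar),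
      (liftE e).eval ME.P ρ = e.eval E.P α'.var := by
    intro ρ α' hρ e
    rw [liftE, Expr.eval_map, hs.P]
    simp only [hρ]
  have hoffW : ∀ (f o : ℕ), f < E.F → o < 2 * E.h →
      paramAt ME.P 2 + 1 + f * (2 * cellsOf ME.P + 1) + 1 + o < ME.M := by
    intro f o hf ho
    have := slot_lt hs hf (show o + 1 < 2 * E.h + 1 by omega)
    rw [slot, hs.h, ← hs.P] at this
    rw [hPB]; omega
  cases i with
  | set v e =>
    simp only [translate, wp_prim, mLang_ok, mLang_run, MInstr.ok, MInstr.run, h.eval_liftE hs]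
    exact ⟨⟨hidx v, by have := hok; simp only [AInstr.ok] at this; omega⟩, h.assign v _ h.var⟩
  | load s ρ e v =>
    obtain ⟨h₁, h₂, h₃⟩ := hok
    simp only [translate, wp_seq]
    refine (wp_access hs h (eval_cellBlkE hs h ρ e)
      (fun ρ' hρ' => hlift ρ' α (fun v => (hρ' v).trans (h.var v)) s) h₁ (blk_le E h₂ h₃)).mono ?_
    rintro μ' ⟨hR, hF, ht⟩
    have hm := Nat.mod_lt (e.eval E.P α.var) hh
    simp only [wp_seq, wp_prim, mLang_ok, mLang_run, MInstr.ok, MInstr.run]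
    rw [eval_off hs (α := α) hR.var]
    have hw₁ := hR.frame_word hs hF ht (o := 2 * (e.eval E.P α.var % E.h)) (by omega)
    have hw₂ := hR.frame_word hs hF ht (o := 2 * (e.eval E.P α.var % E.h) + 1) (by omega)
    rw [word_num h₂] at hw₁
    rw [word_key h₂] at hw₂
    have hM := hoffW _ (2 * (e.eval E.P α.var % E.h)) hF (by omega)
    set d := paramAt ME.P 2 + 1 + μ'.var vFrame * (2 * cellsOf ME.P + 1) + 1 +
      2 * (e.eval E.P α.var % E.h) with hd
    rw [← Nat.add_assoc] at hw₂
    have hnum := h.num (ρ.eval E.P α.var) (e.eval E.P α.var)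
    simp only [Expr.eval_var, update_self, Expr.eval_add, Expr.eval_one, Expr.eval_par]
    rw [hw₁]
    simp only [Word.toNum, true_and]
    refine ⟨⟨hs.lt_R (by decide), by omega⟩, ⟨hidx v, by omega⟩, ?_⟩
    rw [update_of_ne (idx_ne v (by decide)).symm, update_self]
    have hρ₁ : ∀ u : AVar, (update μ'.var vOff d) u.idx = α.var u := fun u => by
      rw [update_of_ne (idx_ne u (by decide))]; exact hR.var u
    exact (hR.set_acc hs hw₂ hρ₁).assign v _ hρ₁
  | store s ρ e n =>
    obtain ⟨h₁, h₂, h₃, h₄⟩ := hok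
    simp only [translate, wp_seq]
    refine (wp_access hs h (eval_cellBlkE hs h ρ e)
      (fun ρ' hρ' => hlift ρ' α (fun v => (hρ' v).trans (h.var v)) s) h₁ (blk_le E h₂ h₃)).mono ?_
    rintro μ' ⟨hR, hF, ht⟩
    have hm := Nat.mod_lt (e.eval E.P α.var) hh
    simp only [wp_seq, wp_prim, mLang_ok, mLang_run, MInstr.ok, MInstr.run]
    rw [eval_off hs (α := α) hR.var]
    have hM := hoffW _ (2 * (e.eval E.P α.var % E.h)) hF (by omega)
    set d := paramAt ME.P 2 + 1 + μ'.var vFrame * (2 * cellsOf ME.P + 1) + 1 +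
      2 * (e.eval E.P α.var % E.h) with hd
    have hρ₁ : ∀ u : AVar, (update μ'.var vOff d) u.idx = α.var u := fun u => by
      rw [update_of_ne (idx_ne u (by decide))]; exact hR.var u
    simp only [Expr.eval_var, update_self, Expr.eval_add, Expr.eval_one, Expr.eval_par,
      hlift _ α hρ₁, true_and]
    refine ⟨⟨hs.lt_R (by decide), by omega⟩, by omega, ?_⟩
    refine hR.write hs hh hF h₂ ht h₄ hρ₁ ?_
    rw [hd, slot, hs.h, ← hs.P, hPB]; omega
  | cmp v s ρ e =>
    obtain ⟨h₁, h₂, h₃⟩ := hok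
    simp only [translate, wp_seq]
    refine (wp_access hs h (eval_cellBlkE hs h ρ e)
      (fun ρ' hρ' => hlift ρ' α (fun v => (hρ' v).trans (h.var v)) s) h₁ (blk_le E h₂ h₃)).mono ?_
    rintro μ' ⟨hR, hF, ht⟩
    have hm := Nat.mod_lt (e.eval E.P α.var) hh
    simp only [wp_seq, wp_prim, mLang_ok, mLang_run, MInstr.ok, MInstr.run]
    rw [eval_off hs (α := α) hR.var]
    have hw₂ := hR.frame_word hs hF ht (o := 2 * (e.eval E.P α.var % E.h) + 1) (by omega)
    rw [word_key h₂] at hw₂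
    have hM := hoffW _ (2 * (e.eval E.P α.var % E.h)) hF (by omega)
    set d := paramAt ME.P 2 + 1 + μ'.var vFrame * (2 * cellsOf ME.P + 1) + 1 +
      2 * (e.eval E.P α.var % E.h) with hd
    rw [← Nat.add_assoc] at hw₂
    have hρ₁ : ∀ u : AVar, (update μ'.var vOff d) u.idx = α.var u := fun u => by
      rw [update_of_ne (idx_ne u (by decide))]; exact hR.var u
    simp only [Expr.eval_var, update_self, Expr.eval_add, Expr.eval_one, Expr.eval_par]
    rw [hw₂]
    have hacc : cellAt μ'.cells (paramAt ME.P 2) = α.acc := hR.acc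
    rw [hacc]
    exact ⟨⟨hs.lt_R (by decide), by omega⟩, ⟨hidx v, by omega⟩, hR.assign v _ hρ₁⟩
  | raw s e =>
    obtain ⟨h₁, h₂⟩ := hok
    have hX : (7 * (liftE e / (2 * cellsE)) + 6).eval ME.P μ.var =
        E.rawBlk (e.eval E.P α.var) := by
      simp only [Expr.eval_add, Expr.eval_mul, Expr.eval_div, Expr.eval_ofNat, eval_cellsE,
        h.eval_liftE hs]
      simp only [AEnv.rawBlk, hs.h, hs.P]
    simp only [translate, wp_seq]
    refine (wp_access hs h hX
      (fun ρ' hρ' => hlift ρ' α (fun v => (hρ' v).trans (h.var v)) s) h₁ ?_).mono ?_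
    · have := Nat.div_le_self (e.eval E.P α.var) (2 * E.h)
      simp only [AEnv.rawBlk]; omega
    rintro μ' ⟨hR, hF, ht⟩
    have hm := Nat.mod_lt (e.eval E.P α.var) (show 0 < 2 * E.h by omega)
    simp only [wp_seq, wp_prim, mLang_ok, mLang_run, MInstr.ok, MInstr.run]
    have hw₂ := hR.frame_word hs hF ht (o := e.eval E.P α.var % (2 * E.h)) hm
    rw [word_raw] at hw₂
    have hM := hoffW _ (e.eval E.P α.var % (2 * E.h)) hF hm
    simp only [Expr.eval_var, update_self, Expr.eval_add, Expr.eval_par,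
      Expr.eval_mod, Expr.eval_mul, eval_cellsE, Expr.eval_ofNat, eval_tagE, true_and,
      hlift _ α hR.var]
    have hc : cellsOf ME.P = E.h := by rw [hs.P, hs.h]
    rw [hc] at hw₂ hM ⊢
    set d := paramAt ME.P 2 + 1 + μ'.var vFrame * (2 * E.h + 1) + 1 +
      e.eval E.P α.var % (2 * E.h) with hd
    have hρ₁ : ∀ u : AVar, (update μ'.var vOff d) u.idx = α.var u := fun u => by
      rw [update_of_ne (idx_ne u (by decide))]; exact hR.var u
    exact ⟨⟨hs.lt_R (by decide), by omega⟩, hR.set_acc hs hw₂ hρ₁⟩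

/-- Simulation of programs. -/
theorem simulate (hs : SizeOk E ME) {p : Stmt AVar AInstr} {α' : AState}
    (h : Exec (aLang E) p α α') (hR : Rel E ME io₀ α μ) :
    Wp (mLang ME) (p.subst AVar.idx translate) (Rel E ME io₀ α') μ :=
  h.subst (Rel E ME io₀) (fun c _ _ h => h.eval_liftE hs c)
    (fun i _ _ h hok => wp_translate hs i h hok) hR

end

end Cached

/-! ### Implementation without buffers, for small memories -/

namespace Direct

open ExtMem.Expr (var par)
open Cached (liftE vOff cellBlkE baseE idx_ne blk_le)

/-- Address of the first word of a cell. -/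
def cellE (ρ e : Expr ℕ) : Expr ℕ := baseE + 2 * cellBlkE ρ e

/-- With h = 1 every word of the store has a disk block of its own, of which only the first cell
matters. Writing may therefore spoil the rest of a disk block, and streams play no role. -/
def translate : AInstr → Stmt ℕ MInstr
  | .set v e => .prim (.set v.idx (liftE e))
  | .load _ ρ e v =>
    .prim (.set vOff (cellE (liftE ρ) (liftE e))) ;;
    .prim (.io true (var vOff) 0) ;;
    .prim (.get v.idx 0) ;;
    .prim (.io true (var vOff + 1) 0) ;;
    .prim (.copy (par 2) 0 1)
  | .store _ ρ e n =>
    .prim (.set vOff (cellE (liftE ρ) (liftE e))) ;;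
    .prim (.num 0 (liftE n)) ;;
    .prim (.io false (var vOff) 0) ;;
    .prim (.copy 0 (par 2) 1) ;;
    .prim (.io false (var vOff + 1) 0)
  | .cmp v _ ρ e =>
    .prim (.io true (cellE (liftE ρ) (liftE e) + 1) 0) ;;
    .prim (.cmp v.idx (par 2) 0)
  | .raw _ e =>
    .prim (.io true (baseE + 2 * (7 * (liftE e / (2 * cellsE)) + 6) + liftE e % (2 * cellsE)) 0) ;;
    .prim (.copy (par 2) 0 1)

/-- The sizes fit. -/
structure SizeOk (E : AEnv) (ME : MEnv) : Prop where
  P : ME.P = E.P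
  R : 50 ≤ ME.R
  cells : E.h = cellsOf E.P
  h : E.h = 1
  block : 0 < ME.B
  memory : ME.B + 1 ≤ ME.M
  cap : E.cap + 10 ≤ ME.W
  addr : 2 * blocksOf E.P + 14 * E.cap + 20 ≤ ME.W
  access : E.β = 1

/-- The machine state `μ` represents the abstract state `α`. -/
structure Rel (E : AEnv) (ME : MEnv) (io₀ : ℕ) (α : AState) (μ : MState) : Prop where
  var : ∀ v, μ.var (AVar.idx v) = α.var v
  length : μ.cells.length = ME.M
  acc : cellAt μ.cells ME.B = α.acc
  onDisk : ∀ X, ∀ o < 2, cellAt (μ.disk (2 * blocksOf E.P + 2 * X + o)) 0 = α.word E X o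
  disk : ∀ a, (μ.disk a).length = ME.B
  num : ∀ ρ i, (α.mem ρ i).1 < E.cap
  cost : μ.io ≤ io₀ + 2 * α.cache.cost

variable {E : AEnv} {ME : MEnv} {io₀ : ℕ} {α : AState} {μ : MState}

theorem Rel.eval_liftE (hs : SizeOk E ME) (h : Rel E ME io₀ α μ) (e : Expr AVar) :
    (liftE e).eval ME.P μ.var = e.eval E.P α.var := by
  rw [liftE, Expr.eval_map, hs.P]
  simp only [h.var]

theorem eval_cellE (hs : SizeOk E ME) (h : Rel E ME io₀ α μ) (ρ e : Expr AVar) :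
    (cellE (liftE ρ) (liftE e)).eval ME.P μ.var =
      2 * blocksOf E.P + 2 * E.blk (ρ.eval E.P α.var) (e.eval E.P α.var) := by
  simp only [cellE, cellBlkE, Expr.eval_add, Expr.eval_mul, Expr.eval_div, Expr.eval_ofNat,
    eval_cellsE, h.eval_liftE hs, Cached.eval_baseE]
  simp only [AEnv.blk, hs.cells, hs.P]

theorem cost_touch (hs : SizeOk E ME) (κ : Cache) (s q : ℕ) :
    κ.cost + 1 ≤ (κ.touch E s q).cost := by
  have := hs.access
  simp only [Cache.touch]
  split_ifs <;> dsimp only <;> omega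

theorem length_read (hs : SizeOk E ME) (h : Rel E ME io₀ α μ) (a : ℕ) :
    (μ.cells.take 0 ++ μ.disk a ++ μ.cells.drop (0 + ME.B)).length = ME.M := by
  have hmem := hs.memory
  simp only [List.length_append, List.length_take, List.length_drop, h.disk, h.length]; omega

/-- Reading a block. -/
theorem Rel.read (hs : SizeOk E ME) (h : Rel E ME io₀ α μ) (a : ℕ) :
    Rel E ME (io₀ + 1) α { μ with
      cells := μ.cells.take 0 ++ μ.disk a ++ μ.cells.drop (0 + ME.B), io := μ.io + 1 } :=
  { h with
    length := length_read hs h a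
    acc := by rw [cellAt_read (h.disk a), if_neg (lt_irrefl _)]; exact h.acc
    cost := by have := h.cost; dsimp only; omega }

theorem Rel.set_acc (hs : SizeOk E ME) (h : Rel E ME io₀ α μ) {w : Word}
    (hd : cellAt μ.cells 0 = w) :
    Rel E ME io₀ { α with acc := w }
      { μ with cells := copyCells (.num 0) ME.M μ.cells ME.B 0 1 } :=
  { h with
    length := length_copyCells
    acc := by
      have := hs.memory
      rw [cellAt_copyCells h.length, if_pos (by omega), Nat.sub_self, hd] }

theorem Rel.congr_var (h : Rel E ME io₀ α μ) {ρ : ℕ → ℕ} (hρ : ∀ v : AVar, ρ v.idx = μ.var v.idx) :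
    Rel E ME io₀ α { μ with var := ρ } :=
  { h with var := fun v => (hρ v).trans (h.var v) }

theorem Rel.assign (h : Rel E ME io₀ α μ) (v : AVar) (x : ℕ) :
    Rel E ME io₀ { α with var := update α.var v x } { μ with var := update μ.var v.idx x } :=
  { h with
    var := fun u => by
      simp only [update_apply, AVar.idx_injective.eq_iff]
      split_ifs
      · rfl
      · exact h.var u }

/-- Each access costs at least `β = 1`, which pays for two transfers. -/
theorem Rel.charge (hs : SizeOk E ME) (h : Rel E ME (io₀ + 2) α μ) (s q : ℕ) :
    Rel E ME io₀ { α with cache := α.cache.touch E s q } μ :=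
  { h with
    cost := by have := h.cost; have := cost_touch hs α.cache s q; dsimp only; omega }

theorem Rel.weaken (h : Rel E ME io₀ α μ) : Rel E ME (io₀ + 1) α μ :=
  { h with cost := h.cost.trans (by omega) }

/-- Every instruction is simulated. -/
theorem wp_translate (hs : SizeOk E ME) (i : AInstr) (h : Rel E ME io₀ α μ) (hok : i.ok E α) :
    Wp (mLang ME) (translate i) (Rel E ME io₀ (i.run E α)) μ := by
  have hcap := hs.cap
  have haddr := hs.addr
  have hmem := hs.memory
  have hB := hs.block
  have hPB : paramAt ME.P 2 = ME.B := rfl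
  have hh : 0 < E.h := by rw [hs.h]; exact one_pos
  have hidx : ∀ v : AVar, v.idx < ME.R := fun v => by
    have := v.idx_lt; have := hs.R; omega
  have hoff : vOff < ME.R := lt_of_lt_of_le (by decide) hs.R
  cases i with
  | set v e =>
    simp only [translate, wp_prim, mLang_ok, mLang_run, MInstr.ok, MInstr.run, h.eval_liftE hs]
    exact ⟨⟨hidx v, by have := hok; simp only [AInstr.ok] at this; omega⟩, h.assign v _⟩
  | load s ρ e v =>
    obtain ⟨h₁, h₂, h₃⟩ := hok
    have hX := blk_le E h₂ h₃
    have hmod : e.eval E.P α.var % E.h = 0 := by rw [hs.h, Nat.mod_one]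
    have hw₁ := word_num (E := E) (α := α) (i := e.eval E.P α.var) h₂
    have hw₂ := word_key (E := E) (α := α) (i := e.eval E.P α.var) h₂
    rw [hmod] at hw₁ hw₂
    have hnum := h.num (ρ.eval E.P α.var) (e.eval E.P α.var)
    simp only [translate, wp_seq, wp_prim, mLang_ok, mLang_run, MInstr.ok, MInstr.run, true_and,
      eval_cellE hs h]
    set X := E.blk (ρ.eval E.P α.var) (e.eval E.P α.var) with hXdef
    set a := 2 * blocksOf E.P + 2 * X with ha
    have hr := h.congr_var (ρ := update μ.var vOff a)
      (fun v => update_of_ne (idx_ne v (by decide)) _ _)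
    have hr₁ := hr.read hs a
    have hval : cellAt (μ.cells.take 0 ++ μ.disk a ++ μ.cells.drop (0 + ME.B)) 0 =
        .num (α.mem (ρ.eval E.P α.var) (e.eval E.P α.var)).1 := by
      rw [cellAt_read (h.disk a), if_pos hB, ← hw₁]
      exact h.onDisk X 0 (by omega)
    simp only [Expr.eval_var, Expr.eval_add, Expr.eval_ofNat, update_self, Expr.eval_par, hval,
      Word.toNum, update_of_ne (idx_ne v (show 40 ≤ vOff by decide)).symm]
    have hr₂ := ((hr₁.assign v (α.mem (ρ.eval E.P α.var) (e.eval E.P α.var)).1).read hs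
      (a + 1)).set_acc hs (w := (α.mem (ρ.eval E.P α.var) (e.eval E.P α.var)).2) (by
        rw [cellAt_read (h.disk _), if_pos hB, ← hw₂]
        exact h.onDisk X 1 (by omega))
    refine ⟨⟨hoff, by omega⟩, ⟨by omega, by omega⟩, ⟨hidx v, by omega⟩, ⟨by omega, by omega⟩, ?_⟩
    exact hr₂.charge hs (s.eval E.P α.var) X
  | store s ρ e n =>
    obtain ⟨h₁, h₂, h₃, h₄⟩ := hok
    have hX := blk_le E h₂ h₃
    have hmod : e.eval E.P α.var % E.h = 0 := by rw [hs.h, Nat.mod_one]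
    simp only [translate, wp_seq, wp_prim, mLang_ok, mLang_run, MInstr.ok, MInstr.run, true_and,
      eval_cellE hs h]
    set X := E.blk (ρ.eval E.P α.var) (e.eval E.P α.var) with hXdef
    set a := 2 * blocksOf E.P + 2 * X with ha
    have hr := h.congr_var (ρ := update μ.var vOff a)
      (fun v => update_of_ne (idx_ne v (by decide)) _ _)
    simp only [Expr.eval_var, Expr.eval_add, Expr.eval_ofNat, update_self, Expr.eval_par,
      hr.eval_liftE hs]
    set x := n.eval E.P α.var with hx
    refine ⟨⟨hoff, by omega⟩, by omega, ⟨by omega, by omega⟩, ⟨by omega, by omega⟩, ?_⟩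
    have hl : (μ.cells.set 0 (.num x)).length = ME.M := by rw [List.length_set, h.length]
    have hc₁ : ∀ i, cellAt (μ.cells.set 0 (.num x)) i =
        if i = 0 then .num x else cellAt μ.cells i := fun i =>
      cellAt_set (by rw [h.length]; omega)
    have hc₂ : ∀ i, cellAt (copyCells (.num 0) ME.M (μ.cells.set 0 (.num x)) 0 ME.B 1) i =
        if i = 0 then α.acc else cellAt μ.cells i := by
      intro i
      rw [cellAt_copyCells hl]
      by_cases hi : i = 0
      · subst hi
        rw [if_pos (by omega), if_pos rfl, hc₁, if_neg (by omega)]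
        exact h.acc
      · rw [if_neg (by omega), if_neg hi, hc₁, if_neg hi]
    refine ⟨hr.var, length_copyCells, ?_, ?_, ?_, ?_, ?_⟩
    · rw [hc₂, if_neg (by omega)]; exact h.acc
    · intro Y o ho
      dsimp only
      rw [hPB]
      change _ = AState.word E { α with
        mem := setMem α.mem (ρ.eval E.P α.var) (e.eval E.P α.var) (x, α.acc)
        cache := _ } Y o
      rw [word_setMem hh h₂ _ _ _ _ (by rw [hs.h]; omega), hmod, ← hXdef]
      by_cases hY : Y = X
      · subst hY
        have : o = 0 ∨ o = 1 := by omega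
        rcases this with rfl | rfl
        · rw [if_pos ⟨rfl, rfl⟩, update_of_ne (by omega), Nat.add_zero, update_self,
            cellAt_write hB, hc₁, if_pos rfl]
        · rw [if_neg (by omega), if_pos ⟨rfl, rfl⟩, update_self, cellAt_write hB, hc₂, if_pos rfl]
      · rw [if_neg (by tauto), if_neg (by tauto), update_of_ne (by omega), update_of_ne (by omega)]
        exact h.onDisk Y o ho
    · intro b
      dsimp only
      rw [update_apply, update_apply]
      split_ifs
      · simp only [List.length_take, List.length_drop, length_copyCells]; omega
      · simp only [List.length_take, List.length_drop, hl]; omega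
      · exact h.disk b
    · intro ρ₁ i₁
      simp only [AInstr.run, setMem, update_apply]
      split_ifs with h₁
      · rw [update_apply]
        split_ifs
        · exact h₄
        · exact h.num _ i₁
      · exact h.num ρ₁ i₁
    · have := cost_touch hs α.cache (s.eval E.P α.var) X
      have := h.cost
      simp only [AInstr.run, ← hXdef]
      omega
  | cmp v s ρ e =>
    obtain ⟨h₁, h₂, h₃⟩ := hok
    have hX := blk_le E h₂ h₃
    have hmod : e.eval E.P α.var % E.h = 0 := by rw [hs.h, Nat.mod_one]
    have hw₂ := word_key (E := E) (α := α) (i := e.eval E.P α.var) h₂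
    rw [hmod] at hw₂
    simp only [translate, wp_seq, wp_prim, mLang_ok, mLang_run, MInstr.ok, MInstr.run,
      Expr.eval_add, Expr.eval_ofNat, Expr.eval_par, eval_cellE hs h]
    set X := E.blk (ρ.eval E.P α.var) (e.eval E.P α.var) with hXdef
    have hr := h.read hs (2 * blocksOf E.P + 2 * X + 1)
    have hacc := hr.acc
    dsimp only at hacc
    rw [hPB, hacc]
    rw [cellAt_read (h.disk _), if_pos hB, h.onDisk X 1 (by omega), hw₂]
    exact ⟨⟨by omega, by omega⟩, ⟨hidx v, by omega⟩, (hr.assign v _).weaken.charge hs _ _⟩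
  | raw s e =>
    obtain ⟨h₁, h₂⟩ := hok
    have hdl := Nat.div_le_self (e.eval E.P α.var) (2 * E.h)
    have hm := Nat.mod_lt (e.eval E.P α.var) (show 0 < 2 * E.h by omega)
    have hw := word_raw (E := E) (α := α) (i := e.eval E.P α.var)
    have haddr' : (baseE + 2 * (7 * (liftE e / (2 * cellsE)) + 6) +
        liftE e % (2 * cellsE)).eval ME.P μ.var = 2 * blocksOf E.P +
          2 * E.rawBlk (e.eval E.P α.var) + e.eval E.P α.var % (2 * E.h) := by
      simp only [Expr.eval_add, Expr.eval_mul, Expr.eval_div, Expr.eval_mod, Expr.eval_ofNat,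
        eval_cellsE, h.eval_liftE hs, Cached.eval_baseE]
      simp only [AEnv.rawBlk, hs.cells, hs.P]
    simp only [translate, wp_seq, wp_prim, mLang_ok, mLang_run, MInstr.ok, MInstr.run, true_and,
      Expr.eval_ofNat, Expr.eval_par, haddr']
    have hXle : E.rawBlk (e.eval E.P α.var) ≤ 7 * E.cap + 6 := by
      simp only [AEnv.rawBlk]; omega
    set X := E.rawBlk (e.eval E.P α.var) with hXdef
    have hh1 := hs.h
    have hr := h.read hs (2 * blocksOf E.P + 2 * X + e.eval E.P α.var % (2 * E.h))
    refine ⟨⟨by omega, by omega⟩, ?_⟩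
    exact ((hr.weaken.set_acc hs (w := E.raw (e.eval E.P α.var)) (by
      dsimp only
      rw [cellAt_read (h.disk _), if_pos hB, h.onDisk X _ (by omega), hw])).charge hs _ _)

/-- Simulation of programs. -/
theorem simulate (hs : SizeOk E ME) {p : Stmt AVar AInstr} {α' : AState}
    (h : Exec (aLang E) p α α') (hR : Rel E ME io₀ α μ) :
    Wp (mLang ME) (p.subst AVar.idx translate) (Rel E ME io₀ α') μ :=
  h.subst (Rel E ME io₀) (fun c _ _ h => h.eval_liftE hs c)
    (fun i _ _ h hok => wp_translate hs i h hok) hR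

end Direct

open ExtMem.Expr (var par)

/-! ### Copying the input into the store -/

/-- Copy the input, in pieces that are half as long as the blocks of the store. -/
def preamble : Stmt ℕ MInstr :=
  .loop ((var 0).lt (2 * blocksE * (strideE / cellsE)))
    (.prim (.io true (var 0 / (strideE / cellsE)) 0) ;;
     .prim (.copy 0 (cellsE * (var 0 % (strideE / cellsE))) cellsE) ;;
     .prim (.io false (2 * blocksE + 2 * (7 * (var 0 / 2) + 6) + var 0 % 2) 0) ;;
     .prim (.set 0 (var 0 + 1))) ;;
  .prim (.num (par 2) 0) ;;
  .prim (.set 0 0)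

/-- The words of the input as the program sees them. -/
def rawWords (P : Params) (disk : ℕ → List Word) (i : ℕ) : Word :=
  cellAt (disk (i / strideOf P)) (i % strideOf P)

theorem strideOf_eq (P : Params) : ∃ c, strideOf P = 2 * (c * cellsOf P) ∧
    strideOf P / cellsOf P = 2 * c := by
  refine ⟨(paramAt P 2 + 2 * cellsOf P - 1) / (2 * cellsOf P), ?_, ?_⟩
  · simp only [strideOf]; ring
  · rw [strideOf, show ∀ x, x * (2 * cellsOf P) = 2 * x * cellsOf P from fun x => by ring,
      Nat.mul_div_cancel _ (cellsOf_pos P)]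

theorem le_strideOf (P : Params) : paramAt P 2 ≤ strideOf P := by
  have hh := cellsOf_pos P
  have := Nat.div_add_mod' (paramAt P 2 + 2 * cellsOf P - 1) (2 * cellsOf P)
  have := Nat.mod_lt (paramAt P 2 + 2 * cellsOf P - 1) (show 0 < 2 * cellsOf P by omega)
  simp only [strideOf]; omega

theorem strideOf_lt (P : Params) : strideOf P < paramAt P 2 + 2 * cellsOf P := by
  have hh := cellsOf_pos P
  have := Nat.div_mul_le_self (paramAt P 2 + 2 * cellsOf P - 1) (2 * cellsOf P)
  simp only [strideOf]; omega

/-- The machine state after the preamble. -/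
structure Loaded (ME : MEnv) (disk : ℕ → List Word) (μ : MState) : Prop where
  var : ∀ v, μ.var v = 0
  length : μ.cells.length = ME.M
  zero : ∀ i, ME.B ≤ i → cellAt μ.cells i = .num 0
  length_disk : ∀ a, (μ.disk a).length = ME.B
  raw : ∀ i j, j < cellsOf ME.P →
    cellAt (μ.disk (2 * blocksOf ME.P + 2 * (7 * (i / 2) + 6) + i % 2)) j =
      rawWords ME.P disk (i * cellsOf ME.P + j)
  store : ∀ X, X % 7 < 6 → ∀ o < 2, ∀ j < cellsOf ME.P,
    cellAt (μ.disk (2 * blocksOf ME.P + 2 * X + o)) j = .num 0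
  io : μ.io ≤ 4 * blocksOf ME.P * (strideOf ME.P / cellsOf ME.P)

theorem wp_preamble {ME : MEnv} {disk : ℕ → List Word} (hR : 0 < ME.R)
    (hBM : ME.B < ME.M) (hh : cellsOf ME.P ≤ ME.B) (hdisk : ∀ a, (disk a).length = ME.B)
    (hzero : ∀ a j, 2 * blocksOf ME.P ≤ a → cellAt (disk a) j = .num 0)
    (hW : 18 * blocksOf ME.P * (strideOf ME.P / cellsOf ME.P) +
      2 * blocksOf ME.P + 20 ≤ ME.W) :
    Wp (mLang ME) preamble (Loaded ME disk)
      ⟨fun _ => 0, List.replicate ME.M (.num 0), disk, 0⟩ := by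
  obtain ⟨c, hc₁, hc₂⟩ := strideOf_eq ME.P
  set h := cellsOf ME.P with hdef
  set nb := blocksOf ME.P with hnb
  have hpos : 0 < h := cellsOf_pos _
  have hBpos : 0 < ME.B := by omega
  have hcpos : 0 < c := by
    rcases Nat.eq_zero_or_pos c with rfl | h₀
    · have := le_strideOf ME.P
      have : ME.B ≤ strideOf ME.P := this
      rw [hc₁] at this; omega
    · exact h₀
  rw [hc₂] at hW
  have hn : 18 * nb * (2 * c) = 36 * (nb * c) := by ring
  rw [hn] at hW
  set n := 2 * nb * (2 * c) with hn'
  have hn'' : n = 4 * (nb * c) := by rw [hn']; ring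
  set T : ℕ → ℕ := fun i => 2 * nb + 2 * (7 * (i / 2) + 6) + i % 2 with hT
  simp only [preamble, wp_seq]
  refine wp_for (fun i μ => μ.var = update (fun _ => 0) 0 i ∧ μ.cells.length = ME.M ∧
    (∀ j, ME.B ≤ j → cellAt μ.cells j = .num 0) ∧ (∀ a, (μ.disk a).length = ME.B) ∧
    (∀ i' < i, ∀ j < h, cellAt (μ.disk (T i')) j = rawWords ME.P disk (i' * h + j)) ∧
    (∀ a, (∀ i' < i, a ≠ T i') → μ.disk a = disk a) ∧ μ.io = 2 * i) n ?_ ?_ ?_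
  · refine ⟨by funext v; simp [update_apply], by simp, ?_, hdisk, by omega, fun _ _ => rfl, rfl⟩
    intro j _
    simp only [cellAt, List.getD_eq_getElem?_getD, List.getElem?_replicate]
    split_ifs <;> rfl
  · rintro i ⟨v, l, d, io⟩ hi ⟨hv, hl, hz, hd, hraw, hsame, hio⟩
    dsimp only at hv hl hz hd hraw hsame hio
    subst hv
    have hdiv : i / (2 * c) < 2 * nb := Nat.div_lt_of_lt_mul (by rw [Nat.mul_comm]; exact hi)
    have hdiv' : i / 2 ≤ 2 * (nb * c) := by omega
    have hW₁ : 2 * nb + 2 * (7 * (i / 2) + 6) + i % 2 < ME.W := by omega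
    simp only [mLang_test, Expr.eval_lt, Expr.eval_var, Expr.eval_mul, Expr.eval_ofNat,
      eval_blocksE, Expr.eval_div, eval_strideE, eval_cellsE, ← hdef, ← hnb, hc₂, update_self,
      ← hn', if_pos hi]
    refine ⟨one_ne_zero, ?_⟩
    have hblock : disk (i / (2 * c)) = d (i / (2 * c)) :=
      (hsame _ fun i' _ => by simp only [hT]; omega).symm
    simp only [wp_seq, wp_prim, mLang_ok, mLang_run, MInstr.ok, MInstr.run, Expr.eval_var,
      Expr.eval_mul, Expr.eval_add, Expr.eval_ofNat, Expr.eval_mod, eval_blocksE, Expr.eval_div,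
      eval_strideE, eval_cellsE, ← hdef, ← hnb, hc₂, update_self, true_and]
    refine ⟨⟨by omega, by omega⟩, ⟨hW₁, by omega⟩, ⟨hR, by omega⟩, ?_⟩
    set l₁ := l.take 0 ++ d (i / (2 * c)) ++ l.drop (0 + ME.B) with hl₁
    have hll₁ : l₁.length = ME.M := by
      simp only [hl₁, List.length_append, List.length_take, List.length_drop, hd, hl]; omega
    have hc₃ : ∀ j, cellAt l₁ j = if j < ME.B then cellAt (d (i / (2 * c))) j else cellAt l j :=
      fun j => cellAt_read (hd _)
    -- The last pieces of an input block may extend beyond its B words, because the stride is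
    -- rounded up. The memory behind the buffer is still 0, and so is the default for missing words,
    -- so both sides agree there as well.
    have hc₄ : ∀ j, cellAt l₁ j = cellAt (disk (i / (2 * c))) j := by
      intro j
      rw [hc₃, hblock]
      split_ifs with hj
      · rfl
      · rw [hz j (by omega), cellAt_of_length_le (by rw [hd]; omega)]
    have hTinj : ∀ i', T i' = T i → i' = i := by
      intro i'; simp only [hT]; omega
    refine ⟨by simp, length_copyCells, ?_, ?_, ?_, ?_, by omega⟩
    · intro j hj
      rw [cellAt_copyCells hll₁, if_neg (by omega), hc₃, if_neg (by omega), hz j hj]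
    · intro a
      rw [update_apply]
      split_ifs
      · simp only [List.length_take, List.length_drop, length_copyCells]; omega
      · exact hd a
    · intro i' hi' j hj
      by_cases hii : i' = i
      · subst hii
        rw [update_self, cellAt_write (by omega), cellAt_copyCells hll₁, if_pos (by omega), hc₄,
          rawWords, hc₁]
        have e : 2 * (c * h) = (2 * c) * h := by ring
        rw [e, Nat.mul_comm (2 * c) h, ← Nat.div_div_eq_div_mul _ h, Nat.mul_comm i' h,
          Nat.mul_add_div hpos, Nat.div_eq_of_lt hj, Nat.add_zero, Nat.mod_mul (a := h),
          Nat.mul_add_mod, Nat.mod_eq_of_lt hj, Nat.mul_add_div hpos, Nat.div_eq_of_lt hj]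
        congr 1
        rw [Nat.add_zero, Nat.sub_zero]
        exact Nat.add_comm _ _
      · rw [update_of_ne (fun e => hii (hTinj _ e))]
        exact hraw i' (by omega) j hj
    · intro a ha
      rw [update_of_ne (ha i (by omega))]
      exact hsame a fun i' hi' => ha i' (by omega)
  · rintro ⟨v, l, d, io⟩ ⟨hv, hl, hz, hd, hraw, hsame, hio⟩
    dsimp only at hv hl hz hd hraw hsame hio
    subst hv
    simp only [mLang_test, Expr.eval_lt, Expr.eval_var, Expr.eval_mul, Expr.eval_ofNat,
      eval_blocksE, Expr.eval_div, eval_strideE, eval_cellsE, ← hdef, ← hnb, hc₂, update_self,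
      ← hn', lt_irrefl, if_false, true_and, wp_seq, wp_prim, mLang_ok, mLang_run, MInstr.ok,
      MInstr.run, Expr.eval_par]
    refine ⟨by omega, ⟨hR, by omega⟩, ?_⟩
    refine ⟨fun v => ?_, by simp [hl], ?_, hd, ?_, ?_, ?_⟩
    · dsimp only
      rw [update_apply, update_apply]
      split_ifs <;> rfl
    · intro i hi
      dsimp only
      rw [cellAt_set (by rw [hl]; exact hBM)]
      split_ifs
      · rfl
      · exact hz i hi
    · intro i j hj
      rw [← hdef] at hj
      rw [← hdef, ← hnb]
      dsimp only
      by_cases hi : i < n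
      · exact hraw i hi j hj
      -- Pieces beyond the last one were never written; they correspond to disk blocks behind the
      -- input, which contain zeros.
      · have hdiv : 2 * nb ≤ (i * h + j) / strideOf ME.P := by
          rw [Nat.le_div_iff_mul_le (by rw [hc₁]; positivity), hc₁]
          have : n * h ≤ i * h := Nat.mul_le_mul_right _ (by omega)
          have : 2 * nb * (2 * (c * h)) = n * h := by rw [hn']; ring
          omega
        rw [hsame, hzero _ _ (by omega), rawWords, hzero _ _ hdiv]
        intro i' hi'
        simp only [hT]; omega
    · intro X hX o ho j hj
      rw [← hnb]
      dsimp only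
      rw [hsame, hzero _ _ (by omega)]
      intro i' _
      simp only [hT]; omega
    · rw [← hdef, ← hnb, hc₂]
      dsimp only
      rw [hio, hn'']
      exact le_of_eq (by ring)

/-- The initial state of the store. -/
def AState.init : AState := ⟨fun _ => 0, .num 0, fun _ _ => (0, .num 0), ⟨fun _ => 0, 0⟩⟩

theorem word_init (E : AEnv) (hE : E.h = cellsOf E.P) {disk : ℕ → List Word} {μ : MState}
    {ME : MEnv} (hP : ME.P = E.P)
    (hraw : E.raw = rawWords E.P disk) (h : Loaded ME disk μ) (X o : ℕ) (ho : o < 2) (j : ℕ)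
    (hj : j < E.h) :
    cellAt (μ.disk (2 * blocksOf E.P + 2 * X + o)) j = AState.init.word E X (o * E.h + j) := by
  rw [AState.word]
  split_ifs with h₁ h₂
  · rw [← hP, h.store X h₁ o ho j (by rw [hP, ← hE]; exact hj)]; rfl
  · rw [← hP, h.store X h₁ o ho j (by rw [hP, ← hE]; exact hj)]; rfl
  · have := h.raw (2 * (X / 7) + o) j (by rw [hP, ← hE]; exact hj)
    rw [show 2 * blocksOf ME.P + 2 * (7 * ((2 * (X / 7) + o) / 2) + 6) + (2 * (X / 7) + o) % 2 =
      2 * blocksOf ME.P + 2 * X + o by omega, hP, ← hE, ← hraw] at this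
    rw [this]
    congr 1
    ring

theorem Cached.Rel.init {E : AEnv} {ME : MEnv} (hs : Cached.SizeOk E ME) {disk : ℕ → List Word}
    {μ : MState} (hraw : E.raw = rawWords E.P disk) (h : Loaded ME disk μ) (hcap : 0 < E.cap) :
    Cached.Rel E ME μ.io AState.init μ where
  var v := h.var _
  length := h.length
  acc := h.zero _ le_rfl
  tag f _ := h.zero _ (by simp only [Cached.slot]; omega)
  tag_zero _ _ := rfl
  tag_inj _ _ _ h := absurd rfl h
  tag_le _ := Nat.zero_le _
  frame f _ X hX := absurd hX (by simp [AState.init])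
  onDisk X _ o ho := by
    have h₀ := word_init E hs.h hs.P hraw h X 0 (by omega) o ho
    have h₁ := word_init E hs.h hs.P hraw h X 1 (by omega) o ho
    rw [Nat.zero_mul, Nat.zero_add] at h₀
    rw [Nat.one_mul] at h₁
    exact ⟨h₀, h₁⟩
  disk := h.length_disk
  num _ _ := hcap
  cost := by simp

theorem Direct.Rel.init {E : AEnv} {ME : MEnv} (hs : Direct.SizeOk E ME) {disk : ℕ → List Word}
    {μ : MState} (hraw : E.raw = rawWords E.P disk) (h : Loaded ME disk μ) (hcap : 0 < E.cap) :
    Direct.Rel E ME μ.io AState.init μ where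
  var v := h.var _
  length := h.length
  acc := h.zero _ le_rfl
  onDisk X o ho := by
    have h₀ := word_init E hs.cells hs.P hraw h X o ho 0 (by rw [hs.h]; exact one_pos)
    rw [hs.h, Nat.mul_one] at h₀
    exact h₀
  disk := h.length_disk
  num _ _ := hcap
  cost := by simp

/-! ### Counting bad pairs in lists of coloured values -/

/-- A colour and a value. -/
abbrev Cell := Bool × ℝ

/-- The cell `y` dominates the cell `x`; the colour `f` is the dominating one. -/
def Bad (f : Bool) (y x : Cell) : Prop :=
  y.1 = f ∧ x.1 ≠ f ∧ if f then x.2 < y.2 else y.2 < x.2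

/-- Cells are sorted by value (descending for `f = false`), colour `f` first. -/
noncomputable def cellKey (f : Bool) (x : Cell) : ℝ ×ₗ Bool :=
  toLex (if f then x.2 else -x.2, x.1 != f)

theorem Bad.cellKey_lt {f : Bool} {y x : Cell} (h : Bad f y x) : cellKey f x < cellKey f y := by
  obtain ⟨-, -, h⟩ := h
  rw [cellKey, cellKey, Prod.Lex.toLex_lt_toLex]
  left
  cases f <;> simpa using h

/-- Domination is strict, and among equal values the colour f comes first. A cell of the other
colour that does not come after y in the order of keys therefore differs from y in value. -/
theorem bad_of_cellKey_le {f : Bool} {y x : Cell} (hy : y.1 = f) (hx : x.1 ≠ f)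
    (h : cellKey f x ≤ cellKey f y) : Bad f y x := by
  rw [cellKey, cellKey, Prod.Lex.toLex_le_toLex] at h
  refine ⟨hy, hx, ?_⟩
  rcases h with h | ⟨-, h⟩
  · cases f <;> simpa using h
  · obtain ⟨c, y⟩ := y
    obtain ⟨d, x⟩ := x
    dsimp only at *
    subst hy
    revert hx h
    cases d <;> cases c <;> simp

theorem bad_flip {f : Bool} {y x : Cell} : Bad (!f) x y ↔ Bad f y x := by
  obtain ⟨c, y⟩ := y
  obtain ⟨d, x⟩ := x
  cases f <;> cases c <;> cases d <;> simp [Bad]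

open Classical in
/-- Number of bad pairs with the first element in `A` and the second in `B`. -/
noncomputable def cross (f : Bool) (A B : List Cell) : ℕ :=
  (A.map fun y => B.countP fun x => Bad f y x).sum

open Classical in
/-- Number of bad pairs `(y, x)` with `y` before `x`. -/
noncomputable def inv (f : Bool) : List Cell → ℕ
  | [] => 0
  | y :: l => l.countP (fun x => Bad f y x) + inv f l

/-! ### Additivity and symmetry of the pair counts -/

section

variable {f : Bool} {A B C : List Cell} {x y : Cell}

@[simp] theorem cross_nil_left : cross f [] B = 0 := rfl

open Classical in
theorem countP_bad_left (hy : y.1 ≠ f) : A.countP (fun x => decide (Bad f y x)) = 0 := by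
  rw [List.countP_eq_zero]
  intro x _ h
  exact hy (of_decide_eq_true h).1

open Classical in
theorem countP_bad_right (hx : x.1 = f) : A.countP (fun y => decide (Bad f y x)) = 0 := by
  rw [List.countP_eq_zero]
  intro y _ h
  exact (of_decide_eq_true h).2.1 hx

open Classical in
theorem cross_cons_left :
    cross f (y :: A) B = B.countP (fun x => decide (Bad f y x)) + cross f A B := by
  simp [cross]

theorem cross_append_left : cross f (A ++ B) C = cross f A C + cross f B C := by
  simp [cross]

@[simp] theorem cross_nil_right : cross f A [] = 0 := by simp [cross]

theorem cross_append_right : cross f A (B ++ C) = cross f A B + cross f A C := by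
  simp [cross, List.sum_map_add]

open Classical in
theorem cross_singleton_right :
    cross f A [x] = A.countP (fun y => decide (Bad f y x)) := by
  induction A with
  | nil => rfl
  | cons a A ih => rw [cross_cons_left, ih, List.countP_cons, List.countP_cons, List.countP_nil]; omega

open Classical in
theorem cross_cons_right :
    cross f A (x :: B) = A.countP (fun y => decide (Bad f y x)) + cross f A B := by
  rw [← List.singleton_append, cross_append_right, cross_singleton_right]

theorem cross_perm_left (h : A.Perm B) : cross f A C = cross f B C :=
  (h.map _).sum_eq

theorem cross_perm_right (h : B.Perm C) : cross f A B = cross f A C := by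
  simp only [cross, h.countP_eq]

theorem inv_append : inv f (A ++ B) = inv f A + cross f A B + inv f B := by
  induction A with
  | nil => simp [inv]
  | cons y A ih =>
    rw [List.cons_append, inv, inv, ih, cross_cons_left, List.countP_append]
    omega

/-- Permuting a part of a list affects only the pairs inside this part. -/
theorem inv_perm_middle {G G' : List Cell} (h : G.Perm G') :
    inv f (A ++ (G ++ C)) + inv f G' = inv f (A ++ (G' ++ C)) + inv f G := by
  simp only [inv_append, cross_append_right]
  rw [cross_perm_left h, cross_perm_right h]
  omega

theorem cross_eq_zero (h : ∀ y ∈ A, ∀ x ∈ B, ¬ Bad f y x) : cross f A B = 0 := by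
  induction A with
  | nil => rfl
  | cons y A ih =>
    rw [cross_cons_left, ih fun y hy => h y (List.mem_cons_of_mem _ hy), List.countP_eq_zero.mpr]
    intro x hx
    simpa using h y List.mem_cons_self x hx

def SortedCells (f : Bool) (l : List Cell) : Prop :=
  l.Pairwise fun x y => cellKey f x ≤ cellKey f y

theorem SortedCells.inv_eq_zero (h : SortedCells f A) : inv f A = 0 := by
  induction A with
  | nil => rfl
  | cons y A ih =>
    rw [SortedCells, List.pairwise_cons] at h
    rw [inv, ih h.2, List.countP_eq_zero.mpr]
    intro x hx
    have := h.1 x hx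
    simpa using fun hb : Bad f y x => absurd hb.cellKey_lt (not_lt.mpr this)

open Classical in
/-- Splitting the dominated cells. -/
theorem inv_split (p : Cell → Prop) (G : List Cell) :
    inv f G = inv f (G.filter fun x => x.1 = f ∨ p x) +
      inv f (G.filter fun x => x.1 = f ∨ ¬ p x) := by
  induction G with
  | nil => rfl
  | cons y G ih =>
    have key : ∀ G : List Cell, G.countP (fun x => Bad f y x) =
        (G.filter fun x => x.1 = f ∨ p x).countP (fun x => Bad f y x) +
        (G.filter fun x => x.1 = f ∨ ¬ p x).countP (fun x => Bad f y x) := by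
      intro G
      induction G with
      | nil => rfl
      | cons x G ih' =>
        simp only [List.filter_cons, List.countP_cons, ih']
        by_cases hx : x.1 = f
        · have : ¬ Bad f y x := fun h => h.2.1 hx
          simp only [hx, true_or, decide_true, if_true, List.countP_cons, this, decide_false]
          simp
        · by_cases hp : p x <;> simp [hx, hp, List.countP_cons] <;> omega
    have key₂ : y.1 ≠ f → ∀ G : List Cell, G.countP (fun x => Bad f y x) = 0 := by
      intro hy G
      rw [List.countP_eq_zero]
      intro x _
      simpa using fun h : Bad f y x => hy h.1
    by_cases hy : y.1 = f
    · simp only [List.filter_cons, hy, true_or, decide_true, if_true, inv, ih, key G]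
      omega
    · by_cases hp : p y
      · simp [hy, hp, inv, ih, key₂ hy]
      · simp [hy, hp, inv, ih, key₂ hy]

open Classical in
theorem cross_split (p : Cell → Prop) (A G : List Cell) :
    cross f A G = cross f A (G.filter fun x => x.1 = f ∨ p x) +
      cross f A (G.filter fun x => x.1 = f ∨ ¬ p x) := by
  induction G with
  | nil => simp
  | cons x G ih =>
    rw [cross_cons_right, ih]
    by_cases hx : x.1 = f
    · have : A.countP (fun y => decide (Bad f y x)) = 0 := by
        rw [List.countP_eq_zero]
        intro y _
        simpa using fun h : Bad f y x => h.2.1 hx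
      simp [hx, cross_cons_right, this]
    · by_cases hp : p x <;> simp [hx, hp, cross_cons_right] <;> omega

open Classical in
/-- Only the cells of the dominating colour count on the left. -/
theorem cross_filter_left (p : Cell → Prop) (hp : ∀ y ∈ A, y.1 = f → p y) :
    cross f (A.filter fun y => p y) B = cross f A B := by
  induction A with
  | nil => rfl
  | cons y A ih =>
    have ih := ih fun y hy => hp y (List.mem_cons_of_mem _ hy)
    rw [cross_cons_left]
    by_cases h : p y
    · simp [h, cross_cons_left, ih]
    · have hy : y.1 ≠ f := fun e => h (hp y List.mem_cons_self e)
      have : B.countP (fun x => decide (Bad f y x)) = 0 := by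
        rw [List.countP_eq_zero]
        intro x _
        simpa using fun h : Bad f y x => hy h.1
      simp [h, ih, this]

/-- Exchanging the roles of the colours. -/
theorem inv_reverse : inv (!f) A.reverse = inv f A := by
  classical
  induction A with
  | nil => rfl
  | cons y A ih =>
    rw [List.reverse_cons, inv_append, ih, cross_singleton_right, List.countP_reverse]
    simp only [inv, List.countP_nil, bad_flip]
    omega

-- Every bad pair consists of two cells of different colours. This bounds the answer by N * N and
-- makes it vanish when a colour is absent.
open Classical in
theorem inv_le : inv f A ≤ A.countP (fun x => x.1 = f) * A.countP (fun x => ¬ x.1 = f) := by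
  induction A with
  | nil => simp [inv]
  | cons y A ih =>
    by_cases hy : y.1 = f
    · have : A.countP (fun x => decide (Bad f y x)) ≤ A.countP (fun x => ¬ x.1 = f) :=
        List.countP_mono_left fun x _ h => by
          simp only [decide_eq_true_eq] at h ⊢; exact h.2.1
      simp only [inv, List.countP_cons, hy, decide_true, if_true, not_true, decide_false]
      simp only [Nat.add_mul, Nat.one_mul, Bool.false_eq_true, if_false, Nat.add_zero] at ih ⊢
      omega
    · have : A.countP (fun x => decide (Bad f y x)) = 0 := by
        rw [List.countP_eq_zero]
        intro x _
        simpa using fun h : Bad f y x => hy h.1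
      simp only [inv, List.countP_cons, hy, decide_false, not_false_iff, decide_true, if_true, this]
      simp only [Bool.false_eq_true, if_false, Nat.add_zero, Nat.mul_add, Nat.mul_one] at ih ⊢
      omega

end

/-- In a list with `p` downward closed, the first `s` elements contain as many elements with
property `p` as possible. -/
theorem countP_take_of_pairwise {α : Type} (p : α → Bool) :
    ∀ (s : ℕ) (l : List α), l.Pairwise (fun a b => p b → p a) →
      (l.take s).countP p = min s (l.countP p)
  | 0, l, _ => by simp
  | s + 1, [], _ => by simp
  | s + 1, a :: l, h => by
    rw [List.pairwise_cons] at h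
    rw [List.take_succ_cons, List.countP_cons, List.countP_cons, countP_take_of_pairwise p s l h.2]
    split_ifs with ha
    · omega
    · have : l.countP p = 0 := by
        rw [List.countP_eq_zero]
        exact fun b hb hpb => ha (h.1 b hb hpb)
      omega

/-! ### Screening with the largest dominating cells -/

open Classical in
/-- `T` and `A` cannot be distinguished by counts up to `s`. -/
def TopEq (f : Bool) (s : ℕ) (T A : List Cell) : Prop :=
  ∀ x, min s (T.countP fun y => Bad f y x) = min s (A.countP fun y => Bad f y x)

section

variable {f : Bool} {s : ℕ} {T A G Y : List Cell}

open Classical in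
/-- The dominated cells that all of `T` dominates, if `T` is full. -/
noncomputable def Heavy (f : Bool) (s : ℕ) (T : List Cell) (x : Cell) : Prop :=
  x.1 ≠ f ∧ T.countP (fun y => Bad f y x) = s

open Classical in
/-- The cells that are kept for the next pass. -/
noncomputable def kept (f : Bool) (s : ℕ) (T G : List Cell) : List Cell :=
  G.filter fun x => x.1 = f ∨ Heavy f s T x

open Classical in
/-- The cells whose pairs are counted at once. -/
noncomputable def counted (f : Bool) (s : ℕ) (T G : List Cell) : List Cell :=
  G.filter fun x => x.1 = f ∨ ¬ Heavy f s T x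

-- A dominated cell that is not heavy has fewer than s dominators in T, since T has at most s cells.
-- The truncation in `TopEq` is then not effective, and the count in A is the same.
open Classical in
theorem cross_counted (hT : TopEq f s T A) (hs : T.length ≤ s) :
    cross f T (counted f s T G) = cross f A (counted f s T G) := by
  induction G with
  | nil => simp [counted]
  | cons x G ih =>
    rw [counted, List.filter_cons]
    split_ifs with h
    · rw [← counted, cross_cons_right, cross_cons_right, ih]
      congr 1
      simp only [decide_eq_true_eq] at h
      rcases h with h | h
      · have : ∀ L : List Cell, L.countP (fun y => decide (Bad f y x)) = 0 := by
          intro L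
          rw [List.countP_eq_zero]
          intro y _
          simpa using fun hb : Bad f y x => hb.2.1 h
        rw [this, this]
      · by_cases hx : x.1 = f
        · have : ∀ L : List Cell, L.countP (fun y => decide (Bad f y x)) = 0 := by
            intro L
            rw [List.countP_eq_zero]
            intro y _
            simpa using fun hb : Bad f y x => hb.2.1 hx
          rw [this, this]
        · have h₁ : T.countP (fun y => decide (Bad f y x)) ≠ s := fun e => h ⟨hx, e⟩
          have h₂ := List.countP_le_length (p := fun y => decide (Bad f y x)) (l := T)
          have := hT x
          omega
    · exact ih

open Classical in
/-- One step of the screening preserves the number of bad pairs. -/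
theorem inv_screen (hT : TopEq f s T A) (hs : T.length ≤ s) (hT₀ : inv f T = 0)
    (hY : ∀ B, cross f Y B = cross f A B) :
    inv f (A ++ G) + inv f Y =
      inv f A + inv f (T ++ counted f s T G) + inv f (Y ++ kept f s T G) := by
  -- Both parts of G contain all cells of colour f, so splitting G splits the pairs according to
  -- their dominated cell. In the kept part, Y may replace A because they have the same dominators.
  rw [inv_append, inv_append, inv_append, hT₀, cross_counted hT hs,
    inv_split (f := f) (Heavy f s T) G, cross_split (f := f) (Heavy f s T) A G, hY]
  simp only [kept, counted]
  omega

open Classical in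
/-- Every heavy cell accounts for at least `s` bad pairs. -/
theorem mul_countP_kept_le (hT : TopEq f s T A) (hY : ∀ B, cross f Y B = cross f A B) :
    s * (kept f s T G).countP (fun x => ¬ x.1 = f) ≤ cross f Y (kept f s T G) := by
  rw [hY]
  induction G with
  | nil => simp [kept]
  | cons x G ih =>
    rw [kept, List.filter_cons]
    split_ifs with h
    · rw [← kept, cross_cons_right, List.countP_cons]
      simp only [decide_eq_true_eq] at h ⊢
      rcases h with h | h
      · simp only [h, not_true, if_false, Nat.add_zero]; omega
      · have h₂ := hT x
        rw [h.2, min_self] at h₂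
        have := h.1
        simp only [this, not_false_iff, if_true, Nat.mul_add, Nat.mul_one]
        omega
    · exact ih

-- No cell of colour f is lost from G, so both numbers of dominators grow by the same amount, and
-- equality of the truncated counts persists.
open Classical in
theorem TopEq.append (hT : TopEq f s T A) (G : List Cell) :
    TopEq f s (T ++ counted f s T G) (A ++ G) := by
  intro x
  have hG : (counted f s T G).countP (fun y => decide (Bad f y x)) =
      G.countP (fun y => decide (Bad f y x)) := by
    rw [counted, List.countP_filter]
    refine List.countP_congr fun y _ => ?_
    simp only [Bool.and_eq_true, decide_eq_true_eq]
    exact ⟨fun h => h.1, fun h => ⟨h, Or.inl h.1⟩⟩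
  have := hT x
  rw [List.countP_append, List.countP_append, hG]
  omega

/-- The largest `s` dominating cells of a sorted list. -/
noncomputable def topCells (f : Bool) (s : ℕ) (l : List Cell) : List Cell :=
  (l.reverse.filter fun x => x.1 = f).take s

/-- The dominators of a cell are upward closed among the cells of colour f. Hence the s largest of
these contain all the dominators or s of them, which is all that counts up to s can see. -/
theorem TopEq.topCells {l : List Cell} (hT : TopEq f s T A) (hl : l.Perm T)
    (hsort : SortedCells f l) : TopEq f s (topCells f s l) A := by
  classical
  intro x
  rw [← hT x, ExtMem.topCells, countP_take_of_pairwise, ← min_assoc, min_self, List.countP_filter,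
    ← hl.countP_eq, List.countP_reverse]
  · congr 1
    refine List.countP_congr fun y _ => ?_
    simp only [Bool.and_eq_true, decide_eq_true_eq]
    exact ⟨fun h => h.1, fun h => ⟨h, h.1⟩⟩
  · rw [List.pairwise_filter, List.pairwise_reverse]
    refine hsort.imp fun {a b} hab h₁ h₂ hbad => ?_
    simp only [decide_eq_true_eq] at *
    exact bad_of_cellKey_le h₁ hbad.2.1 (hbad.cellKey_lt.le.trans hab)

theorem topCells_color {l : List Cell} : ∀ x ∈ topCells f s l, x.1 = f := by
  intro x hx
  simpa using (List.mem_filter.mp (List.mem_of_mem_take hx)).2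

theorem inv_eq_zero_of_color {l : List Cell} (h : ∀ x ∈ l, x.1 = f) : inv f l = 0 := by
  classical
  have := inv_le (f := f) (A := l)
  rw [List.countP_eq_zero (l := l) (p := fun x => decide ¬ x.1 = f) |>.mpr (by simpa using h)] at this
  omega

end

/-! ### Reasoning about abstract programs -/

/-- The variables that a program assigns. -/
def Stmt.writes : Stmt AVar AInstr → List AVar
  | skip => []
  | prim (.set v _) => [v]
  | prim (.load _ _ _ v) => [v]
  | prim (.store _ _ _ _) => []
  | prim (.cmp v _ _ _) => [v]
  | prim (.raw _ _) => []
  | seq p q => p.writes ++ q.writes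
  | ite _ p q => p.writes ++ q.writes
  | loop _ p => p.writes

/-- The variables that `p` does not assign agree. -/
def Frame (p : Stmt AVar AInstr) (σ τ : AState) : Prop :=
  ∀ v, v ∉ p.writes → τ.var v = σ.var v

/-! ### Programs change only the variables that they assign -/

section

variable {E : AEnv} {p q : Stmt AVar AInstr} {σ τ : AState} {Q : AState → Prop}

theorem Exec.frame (h : Exec (aLang E) p σ τ) : Frame p σ τ := by
  induction h with
  | skip => exact fun _ _ => rfl
  | prim i σ _ =>
    intro v hv
    cases i <;> simp only [Stmt.writes, List.mem_singleton] at hv <;>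
      simp only [aLang_run, AInstr.run]
    all_goals rw [update_of_ne hv]
  | seq _ _ ih₁ ih₂ =>
    intro v hv
    simp only [Stmt.writes, List.mem_append, not_or] at hv
    rw [ih₂ v hv.2, ih₁ v hv.1]
  | iteT _ _ ih =>
    intro v hv
    simp only [Stmt.writes, List.mem_append, not_or] at hv
    exact ih v hv.1
  | iteF _ _ ih =>
    intro v hv
    simp only [Stmt.writes, List.mem_append, not_or] at hv
    exact ih v hv.2
  | loopT _ _ _ ih₁ ih₂ =>
    intro v hv
    rw [ih₂ v hv, ih₁ v hv]
  | loopF => exact fun _ _ => rfl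

theorem Wp.frame (h : Wp (aLang E) p Q σ) : Wp (aLang E) p (fun τ => Q τ ∧ Frame p σ τ) σ :=
  let ⟨τ, h₁, h₂⟩ := h; ⟨τ, h₁, h₂, h₁.frame⟩

theorem Frame.trans {ρ : AState} (h₁ : Frame p σ τ) (h₂ : Frame p τ ρ) : Frame p σ ρ :=
  fun v hv => (h₂ v hv).trans (h₁ v hv)

/-- `wp_for`, with the variables that the body does not assign. -/
theorem wp_for_frame {c : Expr AVar} (I : ℕ → AState → Prop) (n : ℕ) (h₀ : I 0 σ)
    (hb : ∀ i τ, i < n → I i τ → Frame p σ τ →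
      (aLang E).test c τ ≠ 0 ∧ Wp (aLang E) p (I (i + 1)) τ)
    (he : ∀ τ, I n τ → Frame p σ τ → (aLang E).test c τ = 0 ∧ Q τ) :
    Wp (aLang E) (.loop c p) Q σ := by
  refine wp_for (fun i τ => I i τ ∧ Frame p σ τ) n ⟨h₀, fun _ _ => rfl⟩ ?_
    fun τ h => he τ h.1 h.2
  rintro i τ hi ⟨hI, hF⟩
  obtain ⟨h₁, h₂⟩ := hb i τ hi hI hF
  exact ⟨h₁, h₂.frame.mono fun _ h => ⟨h.1, hF.trans h.2⟩⟩

/-- `wp_loop`, with the variables that the body does not assign. -/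
theorem wp_loop_frame {c : Expr AVar} (I : AState → Prop) (μ : AState → ℕ) (h₀ : I σ)
    (hb : ∀ τ, I τ → Frame p σ τ → (aLang E).test c τ ≠ 0 →
      Wp (aLang E) p (fun τ' => I τ' ∧ μ τ' < μ τ) τ)
    (he : ∀ τ, I τ → Frame p σ τ → (aLang E).test c τ = 0 → Q τ) :
    Wp (aLang E) (.loop c p) Q σ := by
  refine wp_loop (fun τ => I τ ∧ Frame p σ τ) μ ⟨h₀, fun _ _ => rfl⟩ ?_
    fun τ h => he τ h.1 h.2
  rintro τ ⟨hI, hF⟩ hc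
  exact (hb τ hI hF hc).frame.mono fun _ h => ⟨⟨h.1.1, hF.trans h.2⟩, h.1.2⟩

end

section

variable {E : AEnv} {Q : AState → Prop} {V : AVar → ℕ} {acc : Word} {mem : ℕ → ℕ → ℕ × Word}
  {κ : Cache} {v : AVar} {s ρ e n : Expr AVar}

theorem wp_set : Wp (aLang E) (.prim (.set v e)) Q ⟨V, acc, mem, κ⟩ ↔
    e.eval E.P V < E.cap ∧ Q ⟨update V v (e.eval E.P V), acc, mem, κ⟩ := wp_prim

theorem wp_load : Wp (aLang E) (.prim (.load s ρ e v)) Q ⟨V, acc, mem, κ⟩ ↔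
    (s.eval E.P V < E.F ∧ ρ.eval E.P V < 6 ∧ e.eval E.P V < E.cap) ∧
    Q ⟨update V v (mem (ρ.eval E.P V) (e.eval E.P V)).1,
      (mem (ρ.eval E.P V) (e.eval E.P V)).2, mem,
      κ.touch E (s.eval E.P V) (E.blk (ρ.eval E.P V) (e.eval E.P V))⟩ := wp_prim

theorem wp_store : Wp (aLang E) (.prim (.store s ρ e n)) Q ⟨V, acc, mem, κ⟩ ↔
    (s.eval E.P V < E.F ∧ ρ.eval E.P V < 6 ∧ e.eval E.P V < E.cap ∧ n.eval E.P V < E.cap) ∧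
    Q ⟨V, acc, setMem mem (ρ.eval E.P V) (e.eval E.P V) (n.eval E.P V, acc),
      κ.touch E (s.eval E.P V) (E.blk (ρ.eval E.P V) (e.eval E.P V))⟩ := wp_prim

theorem wp_cmp : Wp (aLang E) (.prim (.cmp v s ρ e)) Q ⟨V, acc, mem, κ⟩ ↔
    (s.eval E.P V < E.F ∧ ρ.eval E.P V < 6 ∧ e.eval E.P V < E.cap) ∧
    Q ⟨update V v (acc.compare (mem (ρ.eval E.P V) (e.eval E.P V)).2), acc, mem,
      κ.touch E (s.eval E.P V) (E.blk (ρ.eval E.P V) (e.eval E.P V))⟩ := wp_prim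

theorem wp_raw : Wp (aLang E) (.prim (.raw s e)) Q ⟨V, acc, mem, κ⟩ ↔
    (s.eval E.P V < E.F ∧ e.eval E.P V < E.cap) ∧
    Q ⟨V, E.raw (e.eval E.P V), mem, κ.touch E (s.eval E.P V) (E.rawBlk (e.eval E.P V))⟩ :=
  wp_prim

end

/-! ### Potentials -/

/-- What the next access of block `X` through the stream `s` may cost. -/
def due (E : AEnv) (κ : Cache) (s X : ℕ) : ℕ := if κ.tag s = X + 1 then 0 else 2 * E.h

/-- Potential of a stream that reads or writes a region upwards. -/
def dueUp (E : AEnv) (κ : Cache) (s ρ i : ℕ) : ℕ := due E κ s (E.blk ρ i) + 2 * (i % E.h)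

/-- Potential of a stream that reads a region downwards, below `i`. -/
def dueDown (E : AEnv) (κ : Cache) (s ρ i : ℕ) : ℕ :=
  due E κ s (E.blk ρ (i - 1)) + 2 * (E.h - 1 - (i - 1) % E.h)

section

variable {E : AEnv} {κ : Cache} {s s' X X' ρ i : ℕ}

theorem due_le : due E κ s X ≤ 2 * E.h := by
  rw [due]; split_ifs <;> omega

/-- On a miss the due amount falls from `2 * h` to 0 and thereby pays for the load. On a hit the
tags do not change, even if another stream holds the block. -/
theorem cost_touch_self :
    (κ.touch E s X).cost + due E (κ.touch E s X) s X ≤ κ.cost + due E κ s X + E.β := by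
  simp only [Cache.touch]
  split_ifs with h
  · dsimp only [due]; omega
  · have : κ.tag s ≠ X + 1 := fun e => h ⟨s, e⟩
    simp only [due, update_self, if_true, if_neg this]; omega

theorem due_touch_of_ne (h : s' ≠ s) : due E (κ.touch E s X) s' X' = due E κ s' X' := by
  simp only [Cache.touch]
  split_ifs
  · rfl
  · simp only [due, update_of_ne h]

theorem dueUp_touch_of_ne (h : s' ≠ s) : dueUp E (κ.touch E s X) s' ρ i = dueUp E κ s' ρ i := by
  simp only [dueUp, due_touch_of_ne h]

theorem dueDown_touch_of_ne (h : s' ≠ s) :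
    dueDown E (κ.touch E s X) s' ρ i = dueDown E κ s' ρ i := by
  simp only [dueDown, due_touch_of_ne h]

theorem cost_touch_up : (κ.touch E s (E.blk ρ i)).cost + dueUp E (κ.touch E s (E.blk ρ i)) s ρ i ≤
    κ.cost + dueUp E κ s ρ i + E.β := by
  have := cost_touch_self (E := E) (κ := κ) (s := s) (X := E.blk ρ i)
  simp only [dueUp]; omega

theorem cost_touch_down :
    (κ.touch E s (E.blk ρ (i - 1))).cost + dueDown E (κ.touch E s (E.blk ρ (i - 1))) s ρ i ≤
      κ.cost + dueDown E κ s ρ i + E.β := by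
  have := cost_touch_self (E := E) (κ := κ) (s := s) (X := E.blk ρ (i - 1))
  simp only [dueDown]; omega

theorem dueUp_le (hh : 0 < E.h) : dueUp E κ s ρ i ≤ 4 * E.h := by
  have := due_le (E := E) (κ := κ) (s := s) (X := E.blk ρ i)
  have := Nat.mod_lt i hh
  simp only [dueUp]; omega

theorem dueDown_le : dueDown E κ s ρ i ≤ 4 * E.h := by
  have := due_le (E := E) (κ := κ) (s := s) (X := E.blk ρ (i - 1))
  simp only [dueDown]; omega

theorem succ_div_mod {h i : ℕ} (hh : 0 < h) :
    (i % h + 1 = h ∧ (i + 1) % h = 0) ∨ (i % h + 1 < h ∧ (i + 1) % h = i % h + 1 ∧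
      (i + 1) / h = i / h) := by
  have hlt := Nat.mod_lt i hh
  have hdm := Nat.div_add_mod i h
  rcases Nat.lt_or_ge (i % h + 1) h with hc | hc
  · right
    have e : i + 1 = (i % h + 1) + h * (i / h) := by omega
    refine ⟨hc, ?_, ?_⟩
    · rw [e, Nat.add_mul_mod_self_left, Nat.mod_eq_of_lt hc]
    · rw [e, Nat.add_mul_div_left _ _ hh, Nat.div_eq_of_lt hc, Nat.zero_add]
  · left
    have e : i + 1 = h * (i / h + 1) := by rw [Nat.mul_add, Nat.mul_one]; omega
    exact ⟨by omega, by rw [e, Nat.mul_mod_right]⟩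

/-- Each step within a block saves 2. At the end of the block, 2 * (h - 1) is available, and
together with the last 2 this covers the load of the next block. -/
theorem dueUp_succ (hh : 0 < E.h) : dueUp E κ s ρ (i + 1) ≤ dueUp E κ s ρ i + 2 := by
  have := due_le (E := E) (κ := κ) (s := s) (X := E.blk ρ (i + 1))
  rcases succ_div_mod (i := i) hh with ⟨h₁, h₂⟩ | ⟨h₁, h₂, h₃⟩
  · simp only [dueUp]; omega
  · simp only [dueUp, AEnv.blk, h₂, h₃]; omega

theorem dueDown_pred (hh : 0 < E.h) : dueDown E κ s ρ (i - 1) ≤ dueDown E κ s ρ i + 2 := by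
  have := due_le (E := E) (κ := κ) (s := s) (X := E.blk ρ (i - 1 - 1))
  rcases Nat.lt_or_ge 1 i with hi | hi
  · obtain ⟨j, rfl⟩ : ∃ j, i = j + 2 := ⟨i - 2, by omega⟩
    simp only [show j + 2 - 1 = j + 1 by omega, Nat.add_sub_cancel] at this ⊢
    rcases succ_div_mod (i := j) hh with ⟨h₁, h₂⟩ | ⟨h₁, h₂, h₃⟩
    · simp only [dueDown, show j + 2 - 1 = j + 1 by omega, Nat.add_sub_cancel, h₂]; omega
    · simp only [dueDown, show j + 2 - 1 = j + 1 by omega, Nat.add_sub_cancel, AEnv.blk, h₂, h₃]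
      omega
  -- At the lower end the truncated subtraction makes the stream stay at cell 0.
  · rw [show i - 1 = 0 by omega]
    simp only [dueDown, show i - 1 = 0 by omega, Nat.zero_sub]; omega

end

/-! ### Lists in the store -/

def Cell.enc (c : Cell) : ℕ × Word := (c.1.toNat, .key c.2)

/-- The list `l` is stored from position `o`. -/
def Seg (m : ℕ → ℕ × Word) (o : ℕ) (l : List Cell) : Prop :=
  ∀ (i : ℕ) (c : Cell), l[i]? = some c → m (o + i) = c.enc

section

variable {m m' : ℕ → ℕ × Word} {o i : ℕ} {l l' : List Cell} {c : Cell} {z : ℕ × Word}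

@[simp] theorem Seg.nil : Seg m o [] := by simp [Seg]

theorem Seg.congr (h : Seg m o l) (he : ∀ i, o ≤ i → i < o + l.length → m' i = m i) :
    Seg m' o l := by
  intro i c hc
  have : i < l.length := (List.getElem?_eq_some_iff.mp hc).1
  rw [he _ (by omega) (by omega)]
  exact h i c hc

theorem Seg.update (h : Seg m o l) (hi : i < o ∨ o + l.length ≤ i) :
    Seg (update m i z) o l :=
  h.congr fun j _ _ => update_of_ne (by omega) _ _

theorem seg_append : Seg m o (l ++ l') ↔ Seg m o l ∧ Seg m (o + l.length) l' := by
  constructor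
  · intro h
    refine ⟨fun i c hc => h i c ?_, fun i c hc => ?_⟩
    · rw [List.getElem?_append_left (List.getElem?_eq_some_iff.mp hc).1, hc]
    · rw [Nat.add_assoc]
      exact h _ c (by rw [List.getElem?_append_right (by omega), Nat.add_sub_cancel_left, hc])
  · rintro ⟨h₁, h₂⟩ i c hc
    rcases Nat.lt_or_ge i l.length with hi | hi
    · rw [List.getElem?_append_left hi] at hc
      exact h₁ i c hc
    · rw [List.getElem?_append_right hi] at hc
      have := h₂ _ c hc
      rwa [Nat.add_assoc, Nat.add_sub_cancel' hi] at this

theorem Seg.snoc (h : Seg m o l) (hi : i = o + l.length) :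
    Seg (Function.update m i c.enc) o (l ++ [c]) := by
  subst hi
  rw [seg_append]
  refine ⟨h.update (by omega), fun j c' hc => ?_⟩
  rcases j with _ | j
  · simp only [List.getElem?_cons_zero, Option.some.injEq] at hc
    subst hc
    exact update_self _ _ _
  · simp at hc

theorem seg_cons : Seg m o (c :: l) ↔ m o = c.enc ∧ Seg m (o + 1) l := by
  rw [← List.singleton_append, seg_append]
  constructor
  · rintro ⟨h₁, h₂⟩
    exact ⟨h₁ 0 c rfl, h₂⟩
  · rintro ⟨h₁, h₂⟩
    refine ⟨fun i c' hc => ?_, h₂⟩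
    rcases i with _ | i
    · simp only [List.getElem?_cons_zero, Option.some.injEq] at hc
      subst hc
      exact h₁
    · simp at hc

theorem Seg.take (h : Seg m o l) (k : ℕ) : Seg m o (l.take k) := by
  rw [← List.take_append_drop k l, seg_append] at h
  exact h.1

end

theorem setMem_same (mem : ℕ → ℕ → ℕ × Word) (ρ i : ℕ) (z : ℕ × Word) :
    setMem mem ρ i z ρ = update (mem ρ) i z := update_self _ _ _

theorem setMem_of_ne (mem : ℕ → ℕ → ℕ × Word) {ρ ρ' : ℕ} (h : ρ' ≠ ρ) (i : ℕ) (z : ℕ × Word) :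
    setMem mem ρ i z ρ' = mem ρ' := update_of_ne h _ _

theorem Bool.toNat_le_one (b : Bool) : b.toNat ≤ 1 := by cases b <;> decide

/-- The test by which the programs compare two cells. -/
theorem compare_cells (f : Bool) (x y : Cell) :
    (if (Word.key x.2).compare (.key y.2) = 2 - f.toNat then 1 else 0) +
      (if (Word.key x.2).compare (.key y.2) = 0 then 1 else 0) *
      (if x.1.toNat = f.toNat then 1 else 0) * (1 - if y.1.toNat = f.toNat then 1 else 0) =
    (if cellKey f x < cellKey f y then 1 else 0 : ℕ) := by
  obtain ⟨c, x⟩ := x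
  obtain ⟨d, y⟩ := y
  simp only [Word.compare, cellKey, Prod.Lex.toLex_lt_toLex]
  rcases lt_trichotomy x y with h | rfl | h
  · have h' := h.not_gt
    have h'' := h.ne
    cases f <;> simp [h, h', h'']
  · cases f <;> cases c <;> cases d <;> simp
  · have h' := h.not_gt
    have h'' := h.ne'
    cases f <;> simp [h, h', h'']

/-- The test by which the programs recognize dominated cells. -/
theorem compare_bad (f : Bool) (x y : Cell) (hy : y.1 = f) :
    (1 - if x.1.toNat = f.toNat then 1 else 0) *
      (if (Word.key x.2).compare (.key y.2) = 2 - f.toNat then 1 else 0) =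
    (open Classical in if Bad f y x then 1 else 0 : ℕ) := by
  obtain ⟨c, x⟩ := x
  obtain ⟨d, y⟩ := y
  dsimp only at hy
  subst hy
  simp only [Word.compare, Bad]
  rcases lt_trichotomy x y with h | rfl | h
  · have h' := h.not_gt
    cases d <;> cases c <;> simp [h, h']
  · cases d <;> cases c <;> simp
  · have h' := h.not_gt
    cases d <;> cases c <;> simp [h, h']

set_option linter.unusedSimpArgs false
set_option linter.constructorNameAsVariable false

/-! ### Sorting by multiway merging, and counting bad pairs on the way -/

notation:61 v:66 " ≔ " e:62 => Stmt.prim (AInstr.set v e)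

/-- A program variable as an expression. -/
abbrev rd (v : AVar) : Expr AVar := var v

/-- Find the run `best` whose next cell is smallest; `pb` is its position, `cb` its colour, and
`SB` the number of dominated cells taken so far from later runs. -/
def selectRun : Stmt AVar AInstr :=
  .q ≔ rd .nr ;; .best ≔ rd .nr ;; .S ≔ 0 ;; .SB ≔ 0 ;;
  .loop (rd .q)
    (.q ≔ rd .q - 1 ;;
     -- There are only a constant number of registers, so the positions of the runs are kept in
     -- region 4 and the numbers of dominated cells taken from them in region 5. The variable `sel`
     -- is 0 if all runs share three streams and 1 if each run has three of its own.
     .prim (.load (9 + 3 * rd .q * rd .sel) 4 (rd .q) .p) ;;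
     .ite ((rd .p).lt ((rd .o + (rd .q + 1) * rd .r).min (rd .len)))
       (.prim (.load (8 + 3 * rd .q * rd .sel) (rd .a) (rd .p) .c) ;;
        .t ≔ 1 ;;
        .ite ((rd .best).lt (rd .nr))
          (.prim (.cmp .t (8 + 3 * rd .best * rd .sel) (rd .a) (rd .pb)) ;;
           .t ≔ (rd .t).eq (2 - rd .f) +
             (rd .t).eq 0 * (rd .c).eq (rd .f) * (1 - (rd .cb).eq (rd .f))) .skip ;;
        .ite (rd .t) (.best ≔ rd .q ;; .pb ≔ rd .p ;; .cb ≔ rd .c ;; .SB ≔ rd .S) .skip)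
       .skip ;;
     .prim (.load (10 + 3 * rd .q * rd .sel) 5 (rd .q) .t) ;;
     .S ≔ rd .S + rd .t)

/-- Move the selected cell to the output. -/
def outputCell : Stmt AVar AInstr :=
  .prim (.load (8 + 3 * rd .best * rd .sel) (rd .a) (rd .pb) .c) ;;
  .prim (.store 4 (rd .d) (rd .o + rd .j) (rd .c)) ;;
  .prim (.store (9 + 3 * rd .best * rd .sel) 4 (rd .best) (rd .pb + 1)) ;;
  -- The dominated cells that come later in the list and are smaller than a dominating cell of the
  -- best run are those already taken from the later runs, apart from pairs within the run.
  .ite ((rd .c).eq (rd .f)) (.ans ≔ rd .ans + rd .SB)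
    (.prim (.load (10 + 3 * rd .best * rd .sel) 5 (rd .best) .t) ;;
     .prim (.store (10 + 3 * rd .best * rd .sel) 5 (rd .best) (rd .t + 1))) ;;
  .j ≔ rd .j + 1

def mergeRuns : Stmt AVar AInstr :=
  .j ≔ 0 ;; .loop ((rd .j).lt (rd .tot)) (selectRun ;; outputCell)

/-- The end of a run. -/
def runEnd (o r len q : ℕ) : ℕ := min (o + (q + 1) * r) len

/-- The variables that are fixed during merging. -/
structure MergeVars (V : AVar → ℕ) (f : Bool) (nr o r len a d sel tot : ℕ) : Prop where
  f : V .f = f.toNat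
  nr : V .nr = nr
  o : V .o = o
  r : V .r = r
  len : V .len = len
  a : V .a = a
  d : V .d = d
  sel : V .sel = sel
  tot : V .tot = tot

theorem MergeVars.congr {V V' : AVar → ℕ} {f : Bool} {nr o r len a d sel tot : ℕ}
    (h : MergeVars V f nr o r len a d sel tot)
    (he : ∀ v ∈ [AVar.f, .nr, .o, .r, .len, .a, .d, .sel, .tot], V' v = V v) :
    MergeVars V' f nr o r len a d sel tot :=
  ⟨(he _ (by decide)).trans h.f, (he _ (by decide)).trans h.nr, (he _ (by decide)).trans h.o,
    (he _ (by decide)).trans h.r, (he _ (by decide)).trans h.len, (he _ (by decide)).trans h.a,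
    (he _ (by decide)).trans h.d, (he _ (by decide)).trans h.sel, (he _ (by decide)).trans h.tot⟩

theorem MergeVars.frame {p : Stmt AVar AInstr} {σ τ : AState} {f : Bool}
    {nr o r len a d sel tot : ℕ} (h : MergeVars σ.var f nr o r len a d sel tot)
    (hF : Frame p σ τ)
    (hp : ∀ v ∈ [AVar.f, .nr, .o, .r, .len, .a, .d, .sel, .tot], v ∉ p.writes) :
    MergeVars τ.var f nr o r len a d sel tot :=
  h.congr fun v hv => hF v (hp v hv)

/-- The remaining parts of the runs, and the numbers of dominated cells taken from them. -/
structure RunsAt (mem : ℕ → ℕ → ℕ × Word) (a nr o r len : ℕ) (rem : ℕ → List Cell)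
    (cnt : ℕ → ℕ) : Prop where
  ptr : ∀ q < nr, (mem 4 q).1 + (rem q).length = runEnd o r len q
  low : ∀ q < nr, o ≤ (mem 4 q).1
  cnt : ∀ q < nr, (mem 5 q).1 = cnt q
  seg : ∀ q < nr, Seg (mem a) (mem 4 q).1 (rem q)

/-- The accesses during the selection are paid by the potential `ψ`. -/
structure SelectBound (E : AEnv) (a nr sel : ℕ) (e p : ℕ → ℕ) (ψ : Cache → ℕ) : Prop where
  data : ∀ κ q, q < nr → p q < e q →
    ψ (κ.touch E (8 + 3 * q * sel) (E.blk a (p q))) ≤ ψ κ + E.β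
  ptr : ∀ κ q, q < nr → ψ (κ.touch E (9 + 3 * q * sel) (E.blk 4 q)) ≤ ψ κ + E.β
  cnt : ∀ κ q, q < nr → ψ (κ.touch E (10 + 3 * q * sel) (E.blk 5 q)) ≤ ψ κ + E.β

/-- The variables describe the best of the runs from `lo` on. -/
def BestFrom (f : Bool) (nr : ℕ) (mem : ℕ → ℕ → ℕ × Word) (rem : ℕ → List Cell) (cnt : ℕ → ℕ)
    (lo : ℕ) (V : AVar → ℕ) : Prop :=
  (V .best = nr ∧ ∀ q, lo ≤ q → q < nr → rem q = []) ∨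
  ∃ b c l, V .best = b ∧ lo ≤ b ∧ b < nr ∧ rem b = c :: l ∧ V .pb = (mem 4 b).1 ∧
    V .cb = c.1.toNat ∧ V .SB = ∑ q ∈ Finset.Ico (b + 1) nr, cnt q ∧
    ∀ q, lo ≤ q → q < nr → ∀ c' l', rem q = c' :: l' → cellKey f c ≤ cellKey f c'

/-! ### Selecting the smallest head of the runs -/

section merge

variable {E : AEnv} {f : Bool} {nr o r len a d sel tot : ℕ}

/-- The runs are scanned from the last to the first, so that the sum over the later runs is at hand
when a run becomes the best one. Each run needs at most four accesses: its position, its head, the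
head of the best run so far, and its counter. -/
theorem wp_selectRun {σ : AState} {rem : ℕ → List Cell} {cnt : ℕ → ℕ} {ψ : Cache → ℕ}
    (hV : MergeVars σ.var f nr o r len a d sel tot) (hR : RunsAt σ.mem a nr o r len rem cnt)
    (ha : a < 6) (hF : ∀ q < nr, 10 + 3 * q * sel < E.F) (hcap : 3 ≤ E.cap) (hnr : nr < E.cap)
    (hlen : len ≤ E.cap) (hcnt : ∑ q ∈ Finset.range nr, cnt q < E.cap)
    (hψ : SelectBound E a nr sel (runEnd o r len) (fun q => (σ.mem 4 q).1) ψ) :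
    Wp (aLang E) selectRun (fun τ => τ.mem = σ.mem ∧
      BestFrom f nr σ.mem rem cnt 0 τ.var ∧ ψ τ.cache ≤ ψ σ.cache + 4 * E.β * nr) σ := by
  obtain ⟨V₀, acc₀, mem, κ₀⟩ := σ
  dsimp only at hV hR hψ ⊢
  simp only [selectRun, wp_seq, wp_set, Expr.eval_var, Expr.eval_zero, Expr.eval_ofNat,
    update_apply, reduceCtorEq, if_false, if_true, hV.nr]
  refine ⟨hnr, hnr, by omega, by omega, ?_⟩
  refine wp_for_frame (fun i τ => τ.mem = mem ∧ τ.var .q = nr - i ∧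
    τ.var .S = ∑ q ∈ Finset.Ico (nr - i) nr, cnt q ∧ BestFrom f nr mem rem cnt (nr - i) τ.var ∧
    ψ τ.cache ≤ ψ κ₀ + 4 * E.β * i) nr ?_ ?_ ?_
  · refine ⟨rfl, by simp, by simp, Or.inl ⟨by simp, fun q h₁ h₂ => by omega⟩, by simp⟩
  · rintro i ⟨V, acc, mem', κ⟩ hi ⟨hm, hq, hS, hbest, hcost⟩ hfr
    dsimp only at hm hq hS hbest hcost
    subst hm
    have hV' : MergeVars V f nr o r len a d sel tot :=
      MergeVars.frame (hV.congr (by simp [update_apply])) hfr (by decide)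
    obtain ⟨t, ht⟩ : ∃ t, t = nr - (i + 1) := ⟨_, rfl⟩
    have htnr : t < nr := by omega
    rw [← ht]
    rw [show nr - i = t + 1 by omega] at hq hS hbest
    have hIco : ∑ q ∈ Finset.Ico t nr, cnt q = cnt t + ∑ q ∈ Finset.Ico (t + 1) nr, cnt q :=
      Finset.sum_eq_sum_Ico_succ_bot htnr _
    have hIco' : ∑ q ∈ Finset.Ico t nr, cnt q ≤ ∑ q ∈ Finset.range nr, cnt q :=
      Finset.sum_le_sum_of_subset fun x hx => by simp at hx ⊢; omega
    simp only [aLang_test, Expr.eval_var, hq]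
    refine ⟨by omega, ?_⟩
    have hFt := hF t htnr
    have hptr := hR.ptr t htnr
    have hct := hR.cnt t htnr
    have hseg := hR.seg t htnr
    have hb1 := hψ.ptr κ t htnr
    set κ₁ := κ.touch E (9 + 3 * t * sel) (E.blk 4 t) with hκ₁
    have hfin : ∀ κ', ψ (κ'.touch E (10 + 3 * t * sel) (E.blk 5 t)) ≤ ψ κ' + E.β :=
      fun κ' => hψ.cnt κ' t htnr
    have hmul : 4 * E.β * (i + 1) = 4 * E.β * i + 4 * E.β := by ring
    have hrun : runEnd o r len t ≤ len := min_le_right _ _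
    rcases hrem : rem t with _ | ⟨c, l⟩
    · rw [hrem, List.length_nil, Nat.add_zero] at hptr
      simp only [wp_seq, wp_set, wp_load, wp_cmp, wp_ite, wp_skip, aLang_test, Expr.eval_var,
        Expr.eval_zero, Expr.eval_one, Expr.eval_ofNat, Expr.eval_add, Expr.eval_sub, Expr.eval_mul,
        Expr.eval_lt, Expr.eval_eq, Expr.eval_min, update_apply, reduceCtorEq, if_false, if_true,
        hq, hS, hV'.nr, hV'.o, hV'.r, hV'.len, hV'.a, hV'.sel, hV'.f, Nat.add_sub_cancel, hct]
      rw [if_neg (by rw [hptr, runEnd]; exact lt_irrefl _), ← hκ₁]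
      refine ⟨by omega, ⟨by omega, by omega, by omega⟩, fun h => absurd rfl h, fun _ =>
        ⟨⟨by omega, by omega, by omega⟩, by omega, trivial, trivial, by omega, ?_, ?_⟩⟩
      · rcases hbest with ⟨h₁, h₂⟩ | ⟨b, c, l, h₁, h₂, h₃, h₄, h₅, h₆, h₇, h₈⟩
        · refine Or.inl ⟨by simpa [update_apply] using h₁, fun q hq₁ hq₂ => ?_⟩
          rcases Nat.eq_or_lt_of_le hq₁ with rfl | hlt
          · exact hrem
          · exact h₂ q hlt hq₂
        · refine Or.inr ⟨b, c, l, by simpa [update_apply] using h₁, by omega, h₃, h₄,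
            by simpa [update_apply] using h₅, by simpa [update_apply] using h₆,
            by simpa [update_apply] using h₇, fun q hq₁ hq₂ c' l' hq' => ?_⟩
          rcases Nat.eq_or_lt_of_le hq₁ with rfl | hlt
          · rw [hrem] at hq'; cases hq'
          · exact h₈ q hlt hq₂ c' l' hq'
      · have := hfin κ₁
        omega
    · rw [hrem, List.length_cons] at hptr
      rw [hrem, seg_cons] at hseg
      have hb2 := hψ.data κ₁ t htnr (by omega)
      set κ₂ := κ₁.touch E (8 + 3 * t * sel) (E.blk a (mem' 4 t).1) with hκ₂
      have hcol := Bool.toNat_le_one c.1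
      have hsum : ∑ q ∈ Finset.Ico (t + 1) nr, cnt q < E.cap := by omega
      have hpcap : (mem' 4 t).1 < E.cap := by omega
      have hlt : (mem' 4 t).1 < min (o + (t + 1) * r) len := by
        rw [runEnd] at hptr; omega
      rcases hbest with ⟨h₁, h₂⟩ | ⟨b, c₀, l₀, h₁, h₂, h₃, h₄, h₅, h₆, h₇, h₈⟩
      · simp only [wp_seq, wp_set, wp_load, wp_cmp, wp_ite, wp_skip, aLang_test, Expr.eval_var,
          Expr.eval_zero, Expr.eval_one, Expr.eval_ofNat, Expr.eval_add, Expr.eval_sub,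
          Expr.eval_mul, Expr.eval_lt, Expr.eval_eq, Expr.eval_min, update_apply, reduceCtorEq,
          if_false, if_true, hq, hS, hV'.nr, hV'.o, hV'.r, hV'.len, hV'.a, hV'.sel, hV'.f,
          Nat.add_sub_cancel, hct, hseg.1, Cell.enc, h₁, lt_irrefl, ne_eq, not_true, false_implies,
          true_and, one_ne_zero, not_false_iff, true_implies, if_pos hlt, and_true, ← hκ₁, ← hκ₂]
        refine ⟨by omega, ⟨by omega, by omega, by omega⟩, ⟨by omega, ha, hpcap⟩, by omega,
          by omega, by omega, by omega, hsum, ⟨by omega, by omega, by omega⟩, by omega, by omega,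
          Or.inr ⟨t, c, l, by simp [update_apply], le_rfl, htnr, hrem,
            by simp [update_apply], by simp [update_apply], by simp [update_apply],
            fun q hq₁ hq₂ c' l' hq' => ?_⟩, ?_⟩
        · rcases Nat.eq_or_lt_of_le hq₁ with rfl | hlt
          · rw [hrem] at hq'; cases hq'; exact le_rfl
          · rw [h₂ q hlt hq₂] at hq'; cases hq'
        · have := hfin κ₂
          omega
      · have hseg₀ := hR.seg b h₃
        have hptr₀ := hR.ptr b h₃
        have hrun₀ : runEnd o r len b ≤ len := min_le_right _ _
        have hFb := hF b h₃
        rw [h₄, seg_cons] at hseg₀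
        rw [h₄, List.length_cons] at hptr₀
        have hb3 := hψ.data κ₂ b h₃ (by omega)
        set κ₃ := κ₂.touch E (8 + 3 * b * sel) (E.blk a (mem' 4 b).1) with hκ₃
        simp only [wp_seq, wp_set, wp_load, wp_cmp, wp_ite, wp_skip, aLang_test, Expr.eval_var,
          Expr.eval_zero, Expr.eval_one, Expr.eval_ofNat, Expr.eval_add, Expr.eval_sub,
          Expr.eval_mul, Expr.eval_lt, Expr.eval_eq, Expr.eval_min, update_apply, reduceCtorEq,
          if_false, if_true, hq, hS, hV'.nr, hV'.o, hV'.r, hV'.len, hV'.a, hV'.sel, hV'.f,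
          Nat.add_sub_cancel, hct, hseg.1, hseg₀.1, Cell.enc, h₁, h₃, h₅, h₆, ne_eq, not_true,
          false_implies, compare_cells,
          true_and, one_ne_zero, not_false_iff, true_implies, if_pos hlt, and_true, ← hκ₁, ← hκ₂,
          ← hκ₃]
        refine ⟨by omega, ⟨by omega, by omega, by omega⟩, ⟨by omega, ha, hpcap⟩, by omega,
          ⟨by omega, ha, by omega⟩, by split_ifs <;> omega, fun hkey => ?_, fun hkey => ?_⟩
        · have hkey : cellKey f c < cellKey f c₀ := by
            by_contra h; rw [if_neg h] at hkey; exact hkey rfl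
          refine ⟨by omega, by omega, by omega, hsum, ⟨by omega, by omega, by omega⟩, by omega,
            by omega, Or.inr ⟨t, c, l, by simp [update_apply], le_rfl, htnr, hrem,
            by simp [update_apply], by simp [update_apply], by simp [update_apply],
            fun q hq₁ hq₂ c' l' hq' => ?_⟩, ?_⟩
          · rcases Nat.eq_or_lt_of_le hq₁ with rfl | hlt
            · rw [hrem] at hq'; cases hq'; exact le_rfl
            · exact hkey.le.trans (h₈ q hlt hq₂ c' l' hq')
          · have := hfin κ₃
            omega
        · have hkey : ¬ cellKey f c < cellKey f c₀ := by
            intro h; rw [if_pos h] at hkey; exact one_ne_zero hkey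
          refine ⟨⟨by omega, by omega, by omega⟩, by omega,
            by omega, Or.inr ⟨b, c₀, l₀, by simpa [update_apply] using h₁, by omega, h₃, h₄,
            by simpa [update_apply] using h₅, by simpa [update_apply] using h₆,
            by simpa [update_apply] using h₇,
            fun q hq₁ hq₂ c' l' hq' => ?_⟩, ?_⟩
          · rcases Nat.eq_or_lt_of_le hq₁ with rfl | hlt
            · rw [hrem] at hq'; cases hq'; exact not_lt.mp hkey
            · exact h₈ q hlt hq₂ c' l' hq'
          · have := hfin κ₃
            omega
  · rintro ⟨V, acc, mem', κ⟩ ⟨hm, hq, hS, hbest, hcost⟩ hfr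
    rw [Nat.sub_self] at hq hbest
    exact ⟨hq, hm, hbest, hcost⟩

end merge

/-! ### Correctness of the multiway merge -/

section merge

variable {E : AEnv} {f : Bool} {nr o r len a d sel tot : ℕ}

/-- The accesses during merging are paid by the potential `Ψ`. -/
structure MergeBound (E : AEnv) (o nr a d sel tot : ℕ) (e : ℕ → ℕ)
    (Ψ : Cache → (ℕ → ℕ) → ℕ → ℕ) : Prop where
  select : ∀ p j, (∀ q < nr, o ≤ p q) → SelectBound E a nr sel e p fun κ => Ψ κ p j
  dst : ∀ κ p j, j < tot → Ψ (κ.touch E 4 (E.blk d (o + j))) p j ≤ Ψ κ p j + E.β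
  advance : ∀ κ p j q, q < nr → Ψ κ (update p q (p q + 1)) (j + 1) ≤ Ψ κ p j + 4

open Classical in
/-- Number of bad pairs between different runs that are still to be counted. -/
noncomputable def crossRuns (f : Bool) (nr : ℕ) (rem : ℕ → List Cell) (cnt : ℕ → ℕ) : ℕ :=
  ∑ t ∈ Finset.range nr, ∑ q ∈ Finset.range t,
    (cross f (rem q) (rem t) + (rem q).countP (fun x => x.1 = f) * cnt t)

/-- The smallest remaining cell, being of the dominated colour, is bad with every dominating cell
left in an earlier run. Taking it moves these pairs from the first summand to the second. -/
theorem crossRuns_dominated {rem : ℕ → List Cell} {cnt : ℕ → ℕ} {b : ℕ} {c : Cell} {l : List Cell}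
    (hb : rem b = c :: l) (hc : c.1 ≠ f)
    (hmin : ∀ q < nr, ∀ y ∈ rem q, cellKey f c ≤ cellKey f y) :
    crossRuns f nr (update rem b l) (update cnt b (cnt b + 1)) = crossRuns f nr rem cnt := by
  classical
  refine Finset.sum_congr rfl fun t ht => Finset.sum_congr rfl fun q hq => ?_
  rw [Finset.mem_range] at ht hq
  by_cases htb : t = b
  · subst htb
    rw [update_self, update_self, update_of_ne (by omega), hb, cross_cons_right,
      List.countP_congr (p := fun y => decide (Bad f y c)) (q := fun x => decide (x.1 = f)),
      Nat.mul_add, Nat.mul_one]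
    · omega
    · intro y hy
      simp only [decide_eq_true_eq]
      exact ⟨fun h => h.1, fun h => bad_of_cellKey_le h hc (hmin q (by omega) y hy)⟩
  · rw [update_of_ne htb, update_of_ne htb]
    by_cases hqb : q = b
    · subst hqb
      rw [update_self, hb, cross_cons_left, countP_bad_left hc, List.countP_cons]
      simp [hc]
    · rw [update_of_ne hqb]

/-- No remaining cell is smaller than c, so c has no pairs left with remaining cells. Its pairs with
cells already taken from later runs are counted now. -/
theorem crossRuns_dominating {rem : ℕ → List Cell} {cnt : ℕ → ℕ} {b : ℕ} {c : Cell}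
    {l : List Cell} (hb : rem b = c :: l) (hc : c.1 = f)
    (hmin : ∀ q < nr, ∀ y ∈ rem q, cellKey f c ≤ cellKey f y) :
    crossRuns f nr (update rem b l) cnt + ∑ t ∈ Finset.Ico (b + 1) nr, cnt t =
      crossRuns f nr rem cnt := by
  classical
  have hI : ∑ t ∈ Finset.Ico (b + 1) nr, cnt t =
      ∑ t ∈ Finset.range nr, ∑ q ∈ Finset.range t, if q = b then cnt t else 0 := by
    refine (Finset.sum_congr rfl fun t ht => ?_).trans
      (Finset.sum_subset (s₁ := Finset.Ico (b + 1) nr) (fun t ht => ?_) fun t ht ht' => ?_)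
    · rw [Finset.mem_Ico] at ht
      rw [Finset.sum_ite_eq', if_pos (by rw [Finset.mem_range]; omega)]
    · rw [Finset.mem_Ico] at ht
      rw [Finset.mem_range]
      omega
    · rw [Finset.mem_Ico] at ht'
      rw [Finset.mem_range] at ht
      rw [Finset.sum_ite_eq', if_neg (by rw [Finset.mem_range]; omega)]
  rw [hI, crossRuns, crossRuns, ← Finset.sum_add_distrib]
  refine Finset.sum_congr rfl fun t ht => ?_
  rw [← Finset.sum_add_distrib]
  refine Finset.sum_congr rfl fun q hq => ?_
  rw [Finset.mem_range] at ht hq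
  by_cases htb : t = b
  · subst htb
    rw [update_self, update_of_ne (by omega), hb, cross_cons_right, if_neg (by omega),
      countP_bad_right hc]
    omega
  · rw [update_of_ne htb]
    by_cases hqb : q = b
    · subst hqb
      have h₀ : (rem t).countP (fun x => decide (Bad f c x)) = 0 := by
        rw [List.countP_eq_zero]
        intro x hx h
        exact absurd (of_decide_eq_true h).cellKey_lt (not_lt.mpr (hmin t ht x hx))
      rw [update_self, hb, cross_cons_left, List.countP_cons, if_pos rfl, h₀]
      simp only [hc, decide_true, if_true, Nat.add_mul, Nat.one_mul]; omega
    · rw [update_of_ne hqb, if_neg hqb, Nat.add_zero]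

/-- The state after `out` has been merged. -/
structure Merging (f : Bool) (nr o r len a d j : ℕ) (mem₀ mem : ℕ → ℕ → ℕ × Word)
    (total : Multiset Cell) (rem : ℕ → List Cell) (cnt : ℕ → ℕ) (out : List Cell) : Prop where
  runs : RunsAt mem a nr o r len rem cnt
  length : out.length = j
  seg : Seg (mem d) o out
  sorted : SortedCells f out
  sorted_rem : ∀ q < nr, SortedCells f (rem q)
  le : ∀ x ∈ out, ∀ q < nr, ∀ y ∈ rem q, cellKey f x ≤ cellKey f y
  perm : (out : Multiset Cell) + ∑ q ∈ Finset.range nr, (rem q : Multiset Cell) = total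
  count : ∑ q ∈ Finset.range nr, cnt q ≤ j
  mem_eq : ∀ ρ, ρ ≠ d → ρ ≠ 4 → ρ ≠ 5 → mem ρ = mem₀ ρ
  mem_dst : ∀ i, i < o ∨ o + j ≤ i → mem d i = mem₀ d i

theorem toNat_injective : Injective Bool.toNat := by
  intro a b
  cases a <;> cases b <;> simp

theorem update_fst {α β : Type} (m : ℕ → α × β) (i : ℕ) (z : α × β) :
    (fun q => (update m i z q).1) = update (fun q => (m q).1) i z.1 := by
  funext q
  simp only [update_apply]
  split_ifs <;> rfl

theorem sum_update_add {M : Type} [AddCommMonoid M] {g : ℕ → M} {b : ℕ} {x y : M} (hb : b < nr)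
    (hg : g b = y + x) :
    y + ∑ q ∈ Finset.range nr, update g b x q = ∑ q ∈ Finset.range nr, g q := by
  rw [Finset.sum_update_of_mem (Finset.mem_range.mpr hb), ← add_assoc, ← hg,
    ← Finset.sum_eq_add_sum_sdiff_singleton_of_mem (Finset.mem_range.mpr hb)]

/-- The new counter `k` is `cnt b` for a dominating and `cnt b + 1` for a dominated cell; both cases
are covered by the bound on `k`. -/
theorem Merging.step {mem₀ mem : ℕ → ℕ → ℕ × Word} {total : Multiset Cell} {j b : ℕ}
    {rem : ℕ → List Cell} {cnt : ℕ → ℕ} {out : List Cell} {c : Cell} {l : List Cell} {k : ℕ}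
    {w w' : Word} (had : a ≠ d) (ha : a < 4)
    (h : Merging f nr o r len a d j mem₀ mem total rem cnt out) (hbn : b < nr)
    (hb : rem b = c :: l) (hk : k ≤ cnt b + 1)
    (hmin : ∀ q < nr, ∀ y ∈ rem q, cellKey f c ≤ cellKey f y)
    {mem' : ℕ → ℕ → ℕ × Word} (hd' : mem' d = update (mem d) (o + j) c.enc)
    (h4 : mem' 4 = update (mem 4) b ((mem 4 b).1 + 1, w)) (h5 : mem' 5 = update (mem 5) b (k, w'))
    (hρ : ∀ ρ, ρ ≠ d → ρ ≠ 4 → ρ ≠ 5 → mem' ρ = mem ρ) :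
    Merging f nr o r len a d (j + 1) mem₀ mem' total (update rem b l) (update cnt b k)
      (out ++ [c]) := by
  have hmem : ∀ q, ∀ y ∈ update rem b l q, y ∈ rem q := by
    intro q y hy
    rw [update_apply] at hy
    split_ifs at hy with hq
    · subst hq; rw [hb]; exact List.mem_cons_of_mem _ hy
    · exact hy
  have hma : mem' a = mem a := hρ a had (by omega) (by omega)
  refine ⟨⟨?_, ?_, ?_, ?_⟩, by simp [h.length], ?_, ?_, ?_, ?_, ?_, ?_, ?_, ?_⟩
  · intro q hq
    rw [h4, update_apply, update_apply]
    split_ifs with hqb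
    · subst hqb
      have := h.runs.ptr q hq
      rw [hb, List.length_cons] at this
      dsimp only
      omega
    · exact h.runs.ptr q hq
  · intro q hq
    rw [h4, update_apply]
    split_ifs with hqb
    · subst hqb
      exact (h.runs.low q hq).trans (Nat.le_succ _)
    · exact h.runs.low q hq
  · intro q hq
    rw [h5, update_apply, update_apply]
    split_ifs
    · rfl
    · exact h.runs.cnt q hq
  · intro q hq
    rw [hma, h4, update_apply, update_apply]
    split_ifs with hqb
    · subst hqb
      have := h.runs.seg q hq
      rw [hb, seg_cons] at this
      exact this.2
    · exact h.runs.seg q hq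
  · rw [hd']
    exact h.seg.snoc (by rw [h.length])
  · rw [SortedCells, List.pairwise_append]
    refine ⟨h.sorted, List.pairwise_singleton _ _, fun x hx y hy => ?_⟩
    rw [List.mem_singleton] at hy
    subst hy
    exact h.le x hx b hbn _ (by rw [hb]; exact List.mem_cons_self)
  · intro q hq
    rw [update_apply]
    split_ifs with hqb
    · have := h.sorted_rem b hbn
      rw [hb, SortedCells, List.pairwise_cons] at this
      exact this.2
    · exact h.sorted_rem q hq
  · intro x hx q hq y hy
    rw [List.mem_append, List.mem_singleton] at hx
    rcases hx with hx | rfl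
    · exact h.le x hx q hq y (hmem q y hy)
    · exact hmin q hq y (hmem q y hy)
  · rw [← h.perm, ← Multiset.coe_add, add_assoc]
    congr 1
    have e : (fun q => (update rem b l q : Multiset Cell)) =
        update (fun q => (rem q : Multiset Cell)) b l := by
      funext q
      simp only [update_apply]
      split_ifs <;> rfl
    rw [e]
    refine sum_update_add hbn ?_
    rw [hb, Multiset.coe_add]
    rfl
  · have h₁ : ∑ q ∈ Finset.range nr, update cnt b k q ≤
        ∑ q ∈ Finset.range nr, update cnt b (cnt b + 1) q := by
      refine Finset.sum_le_sum fun q _ => ?_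
      simp only [update_apply]
      split_ifs <;> omega
    have h₂ : ∑ q ∈ Finset.range nr, update cnt b (cnt b + 1) q =
        1 + ∑ q ∈ Finset.range nr, cnt q := by
      rw [Finset.sum_update_of_mem (Finset.mem_range.mpr hbn),
        Finset.sum_eq_add_sum_sdiff_singleton_of_mem (Finset.mem_range.mpr hbn) cnt]
      omega
    have := h.count
    omega
  · intro ρ h₁ h₂ h₃
    rw [hρ ρ h₁ h₂ h₃, h.mem_eq ρ h₁ h₂ h₃]
  · intro i hi
    rw [hd', update_of_ne (by omega), h.mem_dst i (by omega)]

/-- The sum of `ans` and `crossRuns` is invariant, and `crossRuns` vanishes once the runs are empty.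
A cell costs one selection, at most five further accesses, and 4 for advancing its run and the
output. -/
theorem wp_mergeRuns {σ : AState} {rem : ℕ → List Cell} {cnt : ℕ → ℕ} {total : Multiset Cell}
    {Ψ : Cache → (ℕ → ℕ) → ℕ → ℕ}
    (hV : MergeVars σ.var f nr o r len a d sel tot) (had : a ≠ d) (ha : a < 4) (hd : d < 4)
    (hM : Merging f nr o r len a d 0 σ.mem σ.mem total rem cnt [])
    (htot : Multiset.card total = tot)
    (hF : ∀ q < nr, 10 + 3 * q * sel < E.F) (hF4 : 4 < E.F) (hcap : 3 ≤ E.cap) (hnr : nr < E.cap)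
    (hlen : len < E.cap) (hot : o + tot < E.cap)
    (hans : σ.var .ans + crossRuns f nr rem cnt < E.cap)
    (hΨ : MergeBound E o nr a d sel tot (runEnd o r len) Ψ) :
    Wp (aLang E) mergeRuns (fun τ => ∃ out : List Cell, (out : Multiset Cell) = total ∧
      SortedCells f out ∧ Seg (τ.mem d) o out ∧
      τ.var .ans = σ.var .ans + crossRuns f nr rem cnt ∧
      (∀ ρ, ρ ≠ d → ρ ≠ 4 → ρ ≠ 5 → τ.mem ρ = σ.mem ρ) ∧
      (∀ i, i < o ∨ o + tot ≤ i → τ.mem d i = σ.mem d i) ∧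
      Ψ τ.cache (fun q => (τ.mem 4 q).1) tot ≤ Ψ σ.cache (fun q => (σ.mem 4 q).1) 0 +
        (4 * E.β * nr + 5 * E.β + 4) * tot) σ := by
  obtain ⟨V₀, acc₀, mem₀, κ₀⟩ := σ
  dsimp only at hV hM hans ⊢
  obtain ⟨A, hA⟩ : ∃ A, A = V₀ .ans + crossRuns f nr rem cnt := ⟨_, rfl⟩
  rw [← hA] at hans ⊢
  simp only [mergeRuns, wp_seq, wp_set, Expr.eval_zero]
  refine ⟨by omega, ?_⟩
  refine wp_for_frame (fun j τ => τ.var .j = j ∧ ∃ rem cnt out,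
    Merging f nr o r len a d j mem₀ τ.mem total rem cnt out ∧
    τ.var .ans + crossRuns f nr rem cnt = A ∧
    Ψ τ.cache (fun q => (τ.mem 4 q).1) j ≤ Ψ κ₀ (fun q => (mem₀ 4 q).1) 0 +
        (4 * E.β * nr + 5 * E.β + 4) * j) tot ?_ ?_ ?_
  · refine ⟨by simp, rem, cnt, [], hM, ?_, by simp⟩
    simp [update_apply, hA]
  · clear hA hM rem cnt
    rintro j σ hj ⟨hjv, rem, cnt, out, hM, hA, hcost⟩ hfr
    have hV' : MergeVars σ.var f nr o r len a d sel tot :=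
      MergeVars.frame (hV.congr (by simp [update_apply])) hfr (by decide)
    simp only [aLang_test, Expr.eval_lt, Expr.eval_var, hjv, hV'.tot, if_pos hj]
    refine ⟨one_ne_zero, ?_⟩
    rw [wp_seq]
    have hcnt := hM.count
    have hsel := (wp_selectRun hV' hM.runs (by omega) hF hcap hnr hlen.le (by omega)
      (hΨ.select _ j hM.runs.low)).frame
    refine hsel.mono ?_
    rintro ⟨V, acc, mem, κ⟩ ⟨⟨hmem, hbest, hψ⟩, hfr'⟩
    have hV'' := hV'.frame hfr' (by decide)
    have hj'' : V .j = j := (hfr' .j (by decide)).trans hjv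
    have hans'' : V .ans = σ.var .ans := hfr' .ans (by decide)
    dsimp only at hmem hbest hψ hV''
    rw [← hmem] at hM hbest hcost hψ
    rw [← hans''] at hA
    clear hmem hsel hfr' hjv hans'' hV'
    rcases hbest with ⟨-, hempty⟩ | ⟨b, c, l, hb, -, hbn, hrem, hpb, hcb, hSB, hmin⟩
    -- If all runs were exhausted, the output would already contain all `tot` cells, contrary to `j
    -- < tot`.
    · have : ∑ q ∈ Finset.range nr, (rem q : Multiset Cell) = 0 :=
        Finset.sum_eq_zero fun q hq => by
          rw [hempty q (Nat.zero_le _) (Finset.mem_range.mp hq)]; rfl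
      have hp := hM.perm
      rw [this, add_zero] at hp
      have := congrArg Multiset.card hp
      rw [htot, Multiset.coe_card, hM.length] at this
      omega
    -- The selection compares only heads; since the runs are sorted, the smallest head is the
    -- smallest remaining cell.
    · have hmin : ∀ q < nr, ∀ y ∈ rem q, cellKey f c ≤ cellKey f y := by
        intro q hq y hy
        have hs := hM.sorted_rem q hq
        rcases hr : rem q with _ | ⟨c', l'⟩
        · rw [hr] at hy; cases hy
        · have h₁ := hmin q (Nat.zero_le _) hq c' l' hr
          rw [hr, SortedCells, List.pairwise_cons] at hs
          rw [hr, List.mem_cons] at hy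
          rcases hy with rfl | hy
          · exact h₁
          · exact h₁.trans (hs.1 y hy)
      have hseg := hM.runs.seg b hbn
      rw [hrem, seg_cons] at hseg
      have hptr := hM.runs.ptr b hbn
      rw [hrem, List.length_cons] at hptr
      have hrun : runEnd o r len b ≤ len := min_le_right _ _
      have hct := hM.runs.cnt b hbn
      have hFb := hF b hbn
      have hs := hΨ.select _ j hM.runs.low
      have hb1 := hs.data κ b hbn (by omega)
      set κ₁ := κ.touch E (8 + 3 * b * sel) (E.blk a (mem 4 b).1) with hκ₁
      have hb2 := hΨ.dst κ₁ (fun q => (mem 4 q).1) j hj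
      set κ₂ := κ₁.touch E 4 (E.blk d (o + j)) with hκ₂
      have hb3 := hs.ptr κ₂ b hbn
      set κ₃ := κ₂.touch E (9 + 3 * b * sel) (E.blk 4 b) with hκ₃
      have hcol := Bool.toNat_le_one c.1
      have hcntb : cnt b ≤ ∑ q ∈ Finset.range nr, cnt q :=
        Finset.single_le_sum (f := cnt) (fun _ _ => Nat.zero_le _) (Finset.mem_range.mpr hbn)
      have hmul : (4 * E.β * nr + 5 * E.β + 4) * (j + 1) = (4 * E.β * nr + 5 * E.β + 4) * j +
          4 * E.β * nr + 5 * E.β + 4 := by ring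
      have hpupd : ∀ x : ℕ × Word, x.1 = (mem 4 b).1 + 1 →
          (fun q => (update (mem 4) b x q).1) = update (fun q => (mem 4 q).1) b ((mem 4 b).1 + 1) := by
        intro x hx
        rw [update_fst, hx]
      simp only [outputCell, wp_seq, wp_set, wp_load, wp_store, wp_ite, wp_skip, aLang_test,
        Expr.eval_var, Expr.eval_zero, Expr.eval_one, Expr.eval_ofNat, Expr.eval_add,
        Expr.eval_sub, Expr.eval_mul, Expr.eval_eq, update_apply, reduceCtorEq,
        if_false, if_true, hV''.o, hV''.a, hV''.d, hV''.sel, hV''.f, hb, hpb, hseg.1, Cell.enc,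
        ← hκ₁, ← hκ₂, ← hκ₃, hj'']
      refine ⟨⟨by omega, by omega, by omega⟩, ⟨hF4, by omega, by omega, by omega⟩,
        ⟨by omega, by omega, by omega, by omega⟩, fun hcf => ?_, fun hcf => ?_⟩
      · have hcf : c.1 = f := by
          by_contra h
          rw [if_neg fun e => h (toNat_injective e)] at hcf
          exact hcf rfl
        have hcr := crossRuns_dominating (nr := nr) (cnt := cnt) hrem hcf hmin
        have hadv := hΨ.advance κ₃ (fun q => (mem 4 q).1) j b hbn
        rw [hSB]
        refine ⟨by omega, by omega, trivial, update rem b l, cnt, out ++ [c], ?_, by omega, ?_⟩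
        · have := hM.step had ha (k := cnt b) (w := .key c.2) (w' := (mem 5 b).2)
            hbn hrem (by omega) hmin
            (mem' := setMem (setMem mem d (o + j) (c.1.toNat, .key c.2)) 4 b
              ((mem 4 b).1 + 1, .key c.2)) ?_ ?_ ?_ ?_
          · rwa [update_eq_self] at this
          · rw [setMem_of_ne _ (by omega), setMem_same]; rfl
          · rw [setMem_same, setMem_of_ne _ (by omega)]
          · rw [setMem_of_ne _ (by omega), setMem_of_ne _ (by omega), ← hct, update_eq_self]
          · intro ρ h₁ h₂ h₃
            rw [setMem_of_ne _ h₂, setMem_of_ne _ h₁]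
        · rw [setMem_same, setMem_of_ne _ (show 4 ≠ d by omega), hpupd _ rfl]
          omega
      · have hcf : c.1 ≠ f := by
          intro h
          rw [if_pos (congrArg _ h)] at hcf
          exact one_ne_zero hcf
        have hcr := crossRuns_dominated (nr := nr) (cnt := cnt) hrem hcf hmin
        have hb4 := hs.cnt κ₃ b hbn
        set κ₄ := κ₃.touch E (10 + 3 * b * sel) (E.blk 5 b) with hκ₄
        have hb5 := hs.cnt κ₄ b hbn
        have hadv := hΨ.advance (κ₄.touch E (10 + 3 * b * sel) (E.blk 5 b))
          (fun q => (mem 4 q).1) j b hbn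
        simp only [setMem_of_ne _ (show 5 ≠ 4 by decide), setMem_of_ne _ (show 5 ≠ d by omega), hct]
        refine ⟨⟨by omega, by omega, by omega⟩, ⟨by omega, by omega, by omega, by omega⟩,
          by omega, trivial, update rem b l, update cnt b (cnt b + 1), out ++ [c], ?_, by omega, ?_⟩
        · refine hM.step had ha (w := .key c.2) (w' := (mem 5 b).2) hbn hrem le_rfl hmin
            ?_ ?_ ?_ ?_
          · rw [setMem_of_ne _ (by omega), setMem_of_ne _ (by omega), setMem_same]; rfl
          · rw [setMem_of_ne _ (by omega), setMem_same, setMem_of_ne _ (by omega)]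
          · rw [setMem_same, setMem_of_ne _ (by omega), setMem_of_ne _ (by omega)]
          · intro ρ h₁ h₂ h₃
            rw [setMem_of_ne _ h₃, setMem_of_ne _ h₂, setMem_of_ne _ h₁]
        · rw [setMem_of_ne _ (show 4 ≠ 5 by omega), setMem_same,
            setMem_of_ne _ (show 4 ≠ d by omega), hpupd _ rfl]
          omega
  · rintro σ ⟨hjv, rem, cnt, out, hM, hA, hcost⟩ hfr
    have hV' : MergeVars σ.var f nr o r len a d sel tot :=
      MergeVars.frame (hV.congr (by simp [update_apply])) hfr (by decide)
    simp only [aLang_test, Expr.eval_lt, Expr.eval_var, hjv, hV'.tot, lt_irrefl, if_false, true_and]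
    have hcard := congrArg Multiset.card hM.perm
    rw [htot, Multiset.card_add, Multiset.coe_card, hM.length] at hcard
    have hz : Multiset.card (∑ q ∈ Finset.range nr, (rem q : Multiset Cell)) = 0 := by omega
    rw [Multiset.card_eq_zero] at hz
    have hrem : ∀ q < nr, rem q = [] := by
      intro q hq
      have h₁ : (rem q : Multiset Cell) ≤ ∑ q ∈ Finset.range nr, (rem q : Multiset Cell) :=
        Finset.single_le_sum (f := fun q => (rem q : Multiset Cell)) (fun _ _ => Multiset.zero_le _)
          (Finset.mem_range.mpr hq)
      rw [hz] at h₁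
      exact Multiset.coe_eq_zero _ |>.mp (Multiset.le_zero.mp h₁)
    have hcr : crossRuns f nr rem cnt = 0 := by
      refine Finset.sum_eq_zero fun t ht => Finset.sum_eq_zero fun q hq => ?_
      rw [Finset.mem_range] at ht hq
      rw [hrem q (by omega)]
      simp
    have hp := hM.perm
    rw [hz, add_zero] at hp
    refine ⟨out, hp, hM.sorted, hM.seg, by omega, hM.mem_eq, hM.mem_dst, hcost⟩

end merge

/-! ### Lists that consist of sorted runs -/

/-- The run with number `q` of length `r`. -/
def chunk (r : ℕ) (l : List Cell) (q : ℕ) : List Cell := (l.drop (q * r)).take r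

def RunSorted (f : Bool) (r : ℕ) (l : List Cell) : Prop := ∀ q, SortedCells f (chunk r l q)

section chunk

variable {f : Bool} {r : ℕ} {l : List Cell}

theorem take_succ_chunk (r : ℕ) (l : List Cell) (n : ℕ) :
    l.take ((n + 1) * r) = l.take (n * r) ++ chunk r l n := by
  rw [Nat.succ_mul, List.take_add]; rfl

theorem sum_chunk (r : ℕ) (l : List Cell) (n : ℕ) :
    ∑ q ∈ Finset.range n, (chunk r l q : Multiset Cell) = (l.take (n * r) : Multiset Cell) := by
  induction n with
  | zero => simp
  | succ n ih => rw [Finset.sum_range_succ, ih, take_succ_chunk, Multiset.coe_add]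

theorem cross_take_chunk (f : Bool) (r : ℕ) (l B : List Cell) (n : ℕ) :
    cross f (l.take (n * r)) B = ∑ q ∈ Finset.range n, cross f (chunk r l q) B := by
  induction n with
  | zero => simp
  | succ n ih => rw [Finset.sum_range_succ, ← ih, take_succ_chunk, cross_append_left]

/-- A sorted run has no bad pairs inside, so merging finds all of them. -/
theorem RunSorted.inv_take (h : RunSorted f r l) (n : ℕ) :
    inv f (l.take (n * r)) = crossRuns f n (chunk r l) 0 := by
  simp only [crossRuns, Pi.zero_apply, Nat.mul_zero, Nat.add_zero]
  induction n with
  | zero => simp [inv]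
  | succ n ih =>
    rw [Finset.sum_range_succ, ← ih, take_succ_chunk, inv_append, (h n).inv_eq_zero,
      cross_take_chunk, Nat.add_zero]

theorem RunSorted.drop (h : RunSorted f r l) (g : ℕ) : RunSorted f r (l.drop (g * r)) := by
  intro q
  have := h (g + q)
  rwa [chunk, Nat.add_mul, ← List.drop_drop] at this

theorem runSorted_one (f : Bool) (l : List Cell) : RunSorted f 1 l := by
  intro q
  have : (chunk 1 l q).length ≤ 1 := by simp [chunk]
  rcases hc : chunk 1 l q with _ | ⟨c, _ | ⟨c', t⟩⟩
  · exact List.Pairwise.nil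
  · exact List.pairwise_singleton _ _
  · rw [hc] at this; simp at this

theorem RunSorted.sorted (h : RunSorted f r l) (hr : l.length ≤ r) : SortedCells f l := by
  have := h 0
  rwa [chunk, Nat.zero_mul, List.drop_zero, List.take_of_length_le hr] at this

theorem RunSorted.append {A B : List Cell} {g : ℕ} (h : RunSorted f r A) (hA : A.length = g * r)
    (hB : SortedCells f B) (hBr : B.length ≤ r) : RunSorted f r (A ++ B) := by
  intro q
  rw [chunk]
  rcases Nat.lt_or_ge q g with hq | hq
  · have hm : (q + 1) * r ≤ g * r := Nat.mul_le_mul_right r hq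
    rw [Nat.succ_mul] at hm
    rw [List.drop_append_of_le_length (by omega), List.take_append_of_le_length
      (by rw [List.length_drop]; omega)]
    exact h q
  · have hm : g * r ≤ q * r := Nat.mul_le_mul_right r hq
    have e : (A ++ B).drop (q * r) = B.drop (q * r - A.length) := by
      rw [List.drop_append, List.drop_of_length_le (by omega), List.nil_append]
    rw [e]
    exact hB.sublist ((List.take_sublist _ _).trans (List.drop_sublist _ _))

end chunk

/-! ### Merging in groups -/

def initRun : Stmt AVar AInstr :=
  .q ≔ rd .q - 1 ;;
  .prim (.store (9 + 3 * rd .q * rd .sel) 4 (rd .q) (rd .o + rd .q * rd .r)) ;;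
  .prim (.store (10 + 3 * rd .q * rd .sel) 5 (rd .q) 0)

def mergeGroup : Stmt AVar AInstr :=
  .nr ≔ (rd .kk).min ((rd .len - rd .o + rd .r - 1) / rd .r) ;;
  .tot ≔ (rd .len - rd .o).min (rd .kk * rd .r) ;;
  .q ≔ rd .nr ;; .loop (rd .q) initRun ;;
  mergeRuns ;; .o ≔ rd .o + rd .kk * rd .r

/-- Merge each group of `kk` runs of length `r` from the region `a` to the region `d`. -/
def mergeLevel : Stmt AVar AInstr :=
  .o ≔ 0 ;; .loop ((rd .o).lt (rd .len)) mergeGroup ;;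
  .a ≔ 5 - rd .a ;; .d ≔ 5 - rd .d ;; .r ≔ rd .r * rd .kk ;; .kk ≔ fanE ;; .sel ≔ 1

/-- Sort the region `a` and count its bad pairs. -/
def sortCells : Stmt AVar AInstr :=
  .r ≔ 1 ;; .kk ≔ cellsE ;; .sel ≔ 0 ;; .loop ((rd .r).lt (rd .len)) mergeLevel

structure LevelVars (V : AVar → ℕ) (f : Bool) (r len a d sel kk : ℕ) : Prop where
  f : V .f = f.toNat
  r : V .r = r
  len : V .len = len
  a : V .a = a
  d : V .d = d
  sel : V .sel = sel
  kk : V .kk = kk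

theorem LevelVars.congr {V V' : AVar → ℕ} {f : Bool} {r len a d sel kk : ℕ}
    (h : LevelVars V f r len a d sel kk)
    (he : ∀ v ∈ [AVar.f, .r, .len, .a, .d, .sel, .kk], V' v = V v) :
    LevelVars V' f r len a d sel kk :=
  ⟨(he _ (by decide)).trans h.f, (he _ (by decide)).trans h.r, (he _ (by decide)).trans h.len,
    (he _ (by decide)).trans h.a, (he _ (by decide)).trans h.d, (he _ (by decide)).trans h.sel,
    (he _ (by decide)).trans h.kk⟩

theorem LevelVars.frame {p : Stmt AVar AInstr} {σ τ : AState} {f : Bool}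
    {r len a d sel kk : ℕ} (h : LevelVars σ.var f r len a d sel kk)
    (hF : Frame p σ τ) (hp : ∀ v ∈ [AVar.f, .r, .len, .a, .d, .sel, .kk], v ∉ p.writes) :
    LevelVars τ.var f r len a d sel kk :=
  h.congr fun v hv => hF v (hp v hv)

/-- What sorting requires of the parameters. -/
structure SortEnv (E : AEnv) : Prop where
  cells : E.h = cellsOf E.P
  streams : 3 * fanOf E.P + 8 ≤ E.F
  access : E.β * (fanOf E.P + E.h) ≤ 4

theorem SortEnv.h_pos {E : AEnv} (hE : SortEnv E) : 0 < E.h := hE.cells ▸ cellsOf_pos _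

/-- The first level forms runs of one block, and the others merge longer runs. -/
def Phase (E : AEnv) (r sel kk : ℕ) : Prop :=
  (sel = 0 ∧ r = 1 ∧ kk = E.h) ∨ (sel = 1 ∧ E.h ≤ r ∧ kk = fanOf E.P)

theorem add_sum_le {g g' : ℕ → ℕ} {c c' δ n q : ℕ} (hq : q < n) (hg : ∀ t, t ≠ q → g' t = g t)
    (h : c' + g' q ≤ c + g q + δ) :
    c' + ∑ t ∈ Finset.range n, g' t ≤ c + ∑ t ∈ Finset.range n, g t + δ := by
  have hq' := Finset.mem_range.mpr hq
  have : ∑ t ∈ Finset.range n \ {q}, g' t = ∑ t ∈ Finset.range n \ {q}, g t :=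
    Finset.sum_congr rfl fun t ht => hg t (by simp at ht; exact ht.2)
  rw [Finset.sum_eq_add_sum_sdiff_singleton_of_mem hq' g',
    Finset.sum_eq_add_sum_sdiff_singleton_of_mem hq' g, this]
  omega

/-! ### Potentials for merging one group -/

section group

variable {E : AEnv} {f : Bool} {r len a d sel kk o nr tot : ℕ}

/-- The potential of a merge in which every run has streams of its own. -/
def streamsDue (E : AEnv) (o nr a d : ℕ) (κ : Cache) (p : ℕ → ℕ) (j : ℕ) : ℕ :=
  κ.cost + ∑ q ∈ Finset.range nr, (dueUp E κ (8 + 3 * q) a (p q) +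
    due E κ (9 + 3 * q) (E.blk 4 q) + due E κ (10 + 3 * q) (E.blk 5 q)) + dueUp E κ 4 d (o + j)

theorem streamsDue_bound (hh : 0 < E.h) :
    MergeBound E o nr a d 1 tot (runEnd o r len) (streamsDue E o nr a d) := by
  refine ⟨fun p j _ => ⟨fun κ q hq _ => ?_, fun κ q hq => ?_, fun κ q hq => ?_⟩,
    fun κ p j _ => ?_, fun κ p j q hq => ?_⟩
  · rw [Nat.mul_one]
    simp only [streamsDue]
    rw [dueUp_touch_of_ne (by omega)]
    have := add_sum_le (c := κ.cost) (c' := (κ.touch E (8 + 3 * q) (E.blk a (p q))).cost)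
      (δ := E.β) (g := fun q => dueUp E κ (8 + 3 * q) a (p q) +
        due E κ (9 + 3 * q) (E.blk 4 q) + due E κ (10 + 3 * q) (E.blk 5 q))
      (g' := fun t => dueUp E (κ.touch E (8 + 3 * q) (E.blk a (p q))) (8 + 3 * t) a (p t) +
        due E (κ.touch E (8 + 3 * q) (E.blk a (p q))) (9 + 3 * t) (E.blk 4 t) +
        due E (κ.touch E (8 + 3 * q) (E.blk a (p q))) (10 + 3 * t) (E.blk 5 t)) hq
      (fun t ht => by
        rw [dueUp_touch_of_ne (by omega), due_touch_of_ne (by omega),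
          due_touch_of_ne (by omega)])
      (by
        have := cost_touch_up (E := E) (κ := κ) (s := 8 + 3 * q) (ρ := a) (i := p q)
        rw [due_touch_of_ne (by omega), due_touch_of_ne (by omega)]
        omega)
    omega
  · rw [Nat.mul_one]
    simp only [streamsDue]
    rw [dueUp_touch_of_ne (by omega)]
    have := add_sum_le (c := κ.cost) (c' := (κ.touch E (9 + 3 * q) (E.blk 4 q)).cost)
      (δ := E.β) (g := fun q => dueUp E κ (8 + 3 * q) a (p q) +
        due E κ (9 + 3 * q) (E.blk 4 q) + due E κ (10 + 3 * q) (E.blk 5 q))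
      (g' := fun t => dueUp E (κ.touch E (9 + 3 * q) (E.blk 4 q)) (8 + 3 * t) a (p t) +
        due E (κ.touch E (9 + 3 * q) (E.blk 4 q)) (9 + 3 * t) (E.blk 4 t) +
        due E (κ.touch E (9 + 3 * q) (E.blk 4 q)) (10 + 3 * t) (E.blk 5 t)) hq
      (fun t ht => by
        rw [dueUp_touch_of_ne (by omega), due_touch_of_ne (by omega),
          due_touch_of_ne (by omega)])
      (by
        have := cost_touch_self (E := E) (κ := κ) (s := 9 + 3 * q) (X := E.blk 4 q)
        rw [dueUp_touch_of_ne (by omega), due_touch_of_ne (s' := 10 + 3 * q) (by omega)]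
        omega)
    omega
  · rw [Nat.mul_one]
    simp only [streamsDue]
    rw [dueUp_touch_of_ne (by omega)]
    have := add_sum_le (c := κ.cost) (c' := (κ.touch E (10 + 3 * q) (E.blk 5 q)).cost)
      (δ := E.β) (g := fun q => dueUp E κ (8 + 3 * q) a (p q) +
        due E κ (9 + 3 * q) (E.blk 4 q) + due E κ (10 + 3 * q) (E.blk 5 q))
      (g' := fun t => dueUp E (κ.touch E (10 + 3 * q) (E.blk 5 q)) (8 + 3 * t) a (p t) +
        due E (κ.touch E (10 + 3 * q) (E.blk 5 q)) (9 + 3 * t) (E.blk 4 t) +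
        due E (κ.touch E (10 + 3 * q) (E.blk 5 q)) (10 + 3 * t) (E.blk 5 t)) hq
      (fun t ht => by
        rw [dueUp_touch_of_ne (by omega), due_touch_of_ne (by omega),
          due_touch_of_ne (by omega)])
      (by
        have := cost_touch_self (E := E) (κ := κ) (s := 10 + 3 * q) (X := E.blk 5 q)
        rw [dueUp_touch_of_ne (by omega), due_touch_of_ne (by omega)]
        omega)
    omega
  · simp only [streamsDue]
    have h₁ := cost_touch_up (E := E) (κ := κ) (s := 4) (ρ := d) (i := o + j)
    have h₂ : ∑ q ∈ Finset.range nr,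
        (dueUp E (κ.touch E 4 (E.blk d (o + j))) (8 + 3 * q) a (p q) +
          due E (κ.touch E 4 (E.blk d (o + j))) (9 + 3 * q) (E.blk 4 q) +
          due E (κ.touch E 4 (E.blk d (o + j))) (10 + 3 * q) (E.blk 5 q)) =
        ∑ q ∈ Finset.range nr, (dueUp E κ (8 + 3 * q) a (p q) +
          due E κ (9 + 3 * q) (E.blk 4 q) + due E κ (10 + 3 * q) (E.blk 5 q)) :=
      Finset.sum_congr rfl fun q _ => by
        rw [dueUp_touch_of_ne (by omega), due_touch_of_ne (by omega), due_touch_of_ne (by omega)]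
    omega
  · simp only [streamsDue]
    have h₁ := dueUp_succ (κ := κ) (s := 4) (ρ := d) (i := o + j) hh
    have h₂ := add_sum_le (c := κ.cost) (c' := κ.cost) (δ := 2)
      (g := fun q => dueUp E κ (8 + 3 * q) a (p q) +
        due E κ (9 + 3 * q) (E.blk 4 q) + due E κ (10 + 3 * q) (E.blk 5 q))
      (g' := fun t => dueUp E κ (8 + 3 * t) a (update p q (p q + 1) t) +
        due E κ (9 + 3 * t) (E.blk 4 t) + due E κ (10 + 3 * t) (E.blk 5 t)) hq
      (fun t ht => by rw [update_of_ne ht])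
      (by
        have := dueUp_succ (κ := κ) (s := 8 + 3 * q) (ρ := a) (i := p q) hh
        rw [update_self]
        omega)
    rw [← Nat.add_assoc]
    omega

theorem streamsDue_le (hh : 0 < E.h) (κ : Cache) (p : ℕ → ℕ) (j : ℕ) :
    streamsDue E o nr a d κ p j ≤ κ.cost + 8 * E.h * nr + 4 * E.h := by
  have h₁ : ∑ q ∈ Finset.range nr, (dueUp E κ (8 + 3 * q) a (p q) +
      due E κ (9 + 3 * q) (E.blk 4 q) + due E κ (10 + 3 * q) (E.blk 5 q)) ≤
      ∑ q ∈ Finset.range nr, 8 * E.h := by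
    refine Finset.sum_le_sum fun q _ => ?_
    have h₁ := dueUp_le (κ := κ) (s := 8 + 3 * q) (ρ := a) (i := p q) hh
    have h₂ := due_le (E := E) (κ := κ) (s := 9 + 3 * q) (X := E.blk 4 q)
    have h₃ := due_le (E := E) (κ := κ) (s := 10 + 3 * q) (X := E.blk 5 q)
    omega
  rw [Finset.sum_const, Finset.card_range, smul_eq_mul, Nat.mul_comm] at h₁
  have h₂ := dueUp_le (κ := κ) (s := 4) (ρ := d) (i := o + j) hh
  rw [streamsDue]
  omega

/-- The potential of a merge within a block. -/
def blockDue (E : AEnv) (o a d : ℕ) (κ : Cache) (_ : ℕ → ℕ) (_ : ℕ) : ℕ :=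
  κ.cost + due E κ 8 (E.blk a o) + due E κ 9 (E.blk 4 0) + due E κ 10 (E.blk 5 0) +
    due E κ 4 (E.blk d o)

theorem blk_eq {ρ i g : ℕ} (h₁ : g * E.h ≤ i) (h₂ : i < g * E.h + E.h) :
    E.blk ρ i = E.blk ρ (g * E.h) := by
  have e : i / E.h = g := Nat.div_eq_of_lt_le h₁ (by rw [Nat.succ_mul]; exact h₂)
  have hh : 0 < E.h := by omega
  rw [AEnv.blk, AEnv.blk, e, Nat.mul_div_cancel _ hh]

/-- The group lies within one block of each region, so the four streams load at most one block each,
in whatever order the cells are visited. -/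
theorem blockDue_bound {g : ℕ} (ho : o = g * E.h) (hnr : nr ≤ E.h) (htot : tot ≤ E.h) :
    MergeBound E o nr a d 0 tot (runEnd o 1 len) (blockDue E o a d) := by
  subst ho
  refine ⟨fun p j hp => ⟨fun κ q hq hlt => ?_, fun κ q hq => ?_, fun κ q hq => ?_⟩,
    fun κ p j hj => ?_, fun κ p j q hq => by simp [blockDue]⟩
  · have : runEnd (g * E.h) 1 len q ≤ g * E.h + (q + 1) * 1 := min_le_left _ _
    have hpq := hp q hq
    rw [Nat.mul_zero, Nat.add_zero, blk_eq hpq (by omega)]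
    have := cost_touch_self (E := E) (κ := κ) (s := 8) (X := E.blk a (g * E.h))
    simp only [blockDue]
    rw [due_touch_of_ne (s' := 9) (by omega), due_touch_of_ne (s' := 10) (by omega),
      due_touch_of_ne (s' := 4) (by omega)]
    omega
  · have e : E.blk 4 q = E.blk 4 0 := by
      have := blk_eq (E := E) (ρ := 4) (i := q) (g := 0) (by omega) (by omega)
      rwa [Nat.zero_mul] at this
    rw [Nat.mul_zero, Nat.add_zero, e]
    have := cost_touch_self (E := E) (κ := κ) (s := 9) (X := E.blk 4 0)
    simp only [blockDue]
    rw [due_touch_of_ne (s' := 8) (by omega), due_touch_of_ne (s' := 10) (by omega),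
      due_touch_of_ne (s' := 4) (by omega)]
    omega
  · have e : E.blk 5 q = E.blk 5 0 := by
      have := blk_eq (E := E) (ρ := 5) (i := q) (g := 0) (by omega) (by omega)
      rwa [Nat.zero_mul] at this
    rw [Nat.mul_zero, Nat.add_zero, e]
    have := cost_touch_self (E := E) (κ := κ) (s := 10) (X := E.blk 5 0)
    simp only [blockDue]
    rw [due_touch_of_ne (s' := 8) (by omega), due_touch_of_ne (s' := 9) (by omega),
      due_touch_of_ne (s' := 4) (by omega)]
    omega
  · rw [blk_eq (i := g * E.h + j) (g := g) (by omega) (by omega)]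
    have := cost_touch_self (E := E) (κ := κ) (s := 4) (X := E.blk d (g * E.h))
    simp only [blockDue]
    rw [due_touch_of_ne (s' := 8) (by omega), due_touch_of_ne (s' := 9) (by omega),
      due_touch_of_ne (s' := 10) (by omega)]
    omega

theorem blockDue_le (κ : Cache) (p : ℕ → ℕ) (j : ℕ) :
    blockDue E o a d κ p j ≤ κ.cost + 8 * E.h := by
  have h₁ := due_le (E := E) (κ := κ) (s := 8) (X := E.blk a o)
  have h₂ := due_le (E := E) (κ := κ) (s := 9) (X := E.blk 4 0)
  have h₃ := due_le (E := E) (κ := κ) (s := 10) (X := E.blk 5 0)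
  have h₄ := due_le (E := E) (κ := κ) (s := 4) (X := E.blk d o)
  rw [blockDue]
  omega

/-- The runs of a group. -/
def groupRuns (kk r len o : ℕ) : ℕ := min kk ((len - o + r - 1) / r)

theorem groupRuns_mul_lt {q : ℕ} (hr : 0 < r) (hq : q < groupRuns kk r len o) :
    o + q * r < len := by
  have h : q + 1 ≤ (len - o + r - 1) / r := (lt_min_iff.mp hq).2
  rw [Nat.le_div_iff_mul_le hr, Nat.succ_mul] at h
  omega

theorem le_groupRuns_mul (hr : 0 < r) :
    groupRuns kk r len o = kk ∨ len - o ≤ groupRuns kk r len o * r := by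
  rw [groupRuns]
  rcases le_total kk ((len - o + r - 1) / r) with h | h
  · exact Or.inl (min_eq_left h)
  · right
    rw [min_eq_right h]
    have h₁ := Nat.div_add_mod (len - o + r - 1) r
    have h₂ := Nat.mod_lt (len - o + r - 1) hr
    rw [Nat.mul_comm] at h₁
    omega

/-- All runs but the last have full length r ≥ h. The overhead of O(h) for opening the streams of a
run is thus paid by the cells of the run. -/
theorem h_mul_groupRuns_le (hr : E.h ≤ r) (hr' : 0 < r) (ho : o < len) :
    E.h * groupRuns kk r len o ≤ min (len - o) (kk * r) + E.h := by
  have h₁ : (groupRuns kk r len o - 1) * r ≤ min (len - o) (kk * r) := by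
    rcases Nat.eq_zero_or_pos (groupRuns kk r len o) with h | h
    · simp [h]
    · have := groupRuns_mul_lt (kk := kk) (len := len) (o := o) (q := groupRuns kk r len o - 1) hr' (by omega)
      have h₂ : groupRuns kk r len o ≤ kk := min_le_left _ _
      have : (groupRuns kk r len o - 1) * r ≤ kk * r := Nat.mul_le_mul_right r (by omega)
      exact le_min (by omega) this
  have h₂ : (groupRuns kk r len o - 1) * E.h ≤ (groupRuns kk r len o - 1) * r :=
    Nat.mul_le_mul_left _ hr
  rcases Nat.eq_zero_or_pos (groupRuns kk r len o) with h | h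
  · simp [h]
  · obtain ⟨n, hn⟩ : ∃ n, groupRuns kk r len o = n + 1 := ⟨_, (Nat.sub_add_cancel h).symm⟩
    rw [hn, Nat.add_sub_cancel] at h₁ h₂
    rw [hn, Nat.mul_succ, Nat.mul_comm]
    omega

/-- Merging a group can be paid by a potential. -/
theorem exists_mergeBound {g : ℕ} (hE : SortEnv E) (hP : Phase E r sel kk) (ho : o = g * (kk * r))
    (hlt : o < len) : ∃ Ψ, MergeBound E o (groupRuns kk r len o) a d sel
      (min (len - o) (kk * r)) (runEnd o r len) Ψ ∧ (∀ κ p j, κ.cost ≤ Ψ κ p j) ∧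
      (∀ κ p p' j, (∀ q < groupRuns kk r len o, p q = p' q) → Ψ κ p j = Ψ κ p' j) ∧
      ∀ κ p j, Ψ κ p j + 2 * E.β * groupRuns kk r len o +
        (4 * E.β * groupRuns kk r len o + 5 * E.β + 4) * min (len - o) (kk * r) ≤
        κ.cost + 48 * min (len - o) (kk * r) + 20 * E.h := by
  have hh := hE.h_pos
  have hacc := hE.access
  have hβ : E.β ≤ 4 := by nlinarith [two_le_fanOf E.P]
  have hle : groupRuns kk r len o ≤ kk := min_le_left _ _
  have hβn : E.β * groupRuns kk r len o ≤ 4 := by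
    refine le_trans (Nat.mul_le_mul_left _ ?_) hacc
    rcases hP with ⟨_, _, rfl⟩ | ⟨_, _, rfl⟩ <;> omega
  -- Here 40 = 4 * 4 + 5 * 4 + 4, because β and β times the number of runs are at most 4.
  have hm : (4 * E.β * groupRuns kk r len o + 5 * E.β + 4) * min (len - o) (kk * r) ≤
      40 * min (len - o) (kk * r) := Nat.mul_le_mul_right _ (by nlinarith)
  have hm' : 2 * E.β * groupRuns kk r len o = 2 * (E.β * groupRuns kk r len o) := by ring
  rcases hP with ⟨rfl, rfl, rfl⟩ | ⟨rfl, hr, rfl⟩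
  · rw [Nat.mul_one] at ho
    refine ⟨blockDue E o a d, blockDue_bound ho hle (by omega), fun κ p j => by
      simp only [blockDue]; omega, fun κ p p' j _ => rfl, fun κ p j => ?_⟩
    have := blockDue_le (E := E) (o := o) (a := a) (d := d) κ p j
    omega
  · refine ⟨streamsDue E o _ a d, streamsDue_bound hh, fun κ p j => by
      simp only [streamsDue]; omega, fun κ p p' j hp => ?_, fun κ p j => ?_⟩
    · simp only [streamsDue]
      rw [Finset.sum_congr rfl fun q hq => by rw [hp q (Finset.mem_range.mp hq)]]
    have h₁ := streamsDue_le (nr := groupRuns (fanOf E.P) r len o) (o := o) (a := a) (d := d)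
      hh κ p j
    have h₂ := h_mul_groupRuns_le (kk := fanOf E.P) hr (by omega) hlt
    rw [Nat.mul_assoc] at h₁
    omega

end group

/-! ### Levels of merging and the complete sort -/

section sort

variable {E : AEnv} {f : Bool} {r len a d sel kk o : ℕ}

theorem phase_streams {q : ℕ} (hE : SortEnv E) (hP : Phase E r sel kk)
    (hq : q < groupRuns kk r len o) : 10 + 3 * q * sel < E.F := by
  have h₁ := hE.streams
  have h₂ := two_le_fanOf E.P
  have h₃ : q < kk := lt_of_lt_of_le hq (min_le_left _ _)
  rcases hP with ⟨rfl, _, _⟩ | ⟨rfl, _, rfl⟩ <;> omega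

theorem wp_mergeGroup {σ : AState} {l : List Cell} {g : ℕ} (hE : SortEnv E)
    (hP : Phase E r sel kk) (hV : LevelVars σ.var f r len a d sel kk) (had : a ≠ d)
    (ha : a < 4) (hd : d < 4) (ho : σ.var .o = g * (kk * r)) (hlt : g * (kk * r) < len)
    (hl : l.length = len) (hseg : Seg (σ.mem a) 0 l) (hrun : RunSorted f r l)
    (hcap : 3 ≤ E.cap) (hkk : kk < E.cap) (hlen : len + kk * r < E.cap)
    (hans : σ.var .ans + inv f ((l.drop (g * (kk * r))).take (kk * r)) < E.cap) :
    Wp (aLang E) mergeGroup (fun τ => ∃ out : List Cell,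
      out.Perm ((l.drop (g * (kk * r))).take (kk * r)) ∧ SortedCells f out ∧
      Seg (τ.mem d) (g * (kk * r)) out ∧ τ.var .o = g * (kk * r) + kk * r ∧
      τ.var .ans = σ.var .ans + inv f ((l.drop (g * (kk * r))).take (kk * r)) ∧
      (∀ ρ, ρ ≠ d → ρ ≠ 4 → ρ ≠ 5 → τ.mem ρ = σ.mem ρ) ∧
      (∀ i < g * (kk * r), τ.mem d i = σ.mem d i) ∧
      τ.cache.cost ≤ σ.cache.cost + 48 * min (len - g * (kk * r)) (kk * r) + 20 * E.h) σ := by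
  have hr : 0 < r := by
    have := hE.h_pos
    rcases hP with ⟨_, rfl, _⟩ | ⟨_, h, _⟩ <;> omega
  obtain ⟨o, hog⟩ : ∃ o, o = g * (kk * r) := ⟨_, rfl⟩
  obtain ⟨Ψ, hΨ, hΨc, hΨp, hΨle⟩ := exists_mergeBound (a := a) (d := d) hE hP hog (hog ▸ hlt)
  rw [← hog] at ho hlt hans ⊢
  obtain ⟨tot, htot⟩ : ∃ tot, tot = min (len - o) (kk * r) := ⟨_, rfl⟩
  obtain ⟨nr, hnr⟩ : ∃ nr, nr = groupRuns kk r len o := ⟨_, rfl⟩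
  have hnrk : nr ≤ kk := hnr ▸ min_le_left _ _
  -- The last group may have fewer than `kk` runs, but then they reach the end of the list.
  have htake : (l.drop o).take (nr * r) = (l.drop o).take (kk * r) := by
    rcases le_groupRuns_mul (kk := kk) (len := len) (o := o) hr with h | h
    · rw [hnr, h]
    · rw [← hnr] at h
      have : nr * r ≤ kk * r := Nat.mul_le_mul_right r hnrk
      rw [List.take_of_length_le (by rw [List.length_drop]; omega),
        List.take_of_length_le (by rw [List.length_drop]; omega)]
  have hrun' : RunSorted f r (l.drop o) := by
    have := hrun.drop (g * kk)
    rwa [Nat.mul_assoc, ← hog] at this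
  have hinv := hrun'.inv_take nr
  rw [htake] at hinv
  have hdiv : (len - o + r - 1) / r ≤ len := by
    rw [Nat.div_le_iff_le_mul_add_pred hr]
    have : len ≤ r * len := Nat.le_mul_of_pos_left _ hr
    omega
  rw [← htot, ← hnr] at hΨ hΨle
  rw [← hnr] at hΨp
  rw [← htot]
  obtain ⟨V₀, acc₀, mem₀, κ₀⟩ := σ
  dsimp only at hV ho hseg hans ⊢
  simp only [mergeGroup, wp_seq, wp_set, Expr.eval_var, Expr.eval_zero, Expr.eval_one,
    Expr.eval_add, Expr.eval_sub, Expr.eval_mul, Expr.eval_div, Expr.eval_min,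
    update_apply, reduceCtorEq, if_false, if_true, hV.kk, hV.len, hV.r, ho]
  rw [show min kk ((len - o + r - 1) / r) = nr from hnr.symm, ← htot]
  refine ⟨by omega, by omega, by omega, ?_⟩
  set V₁ := update (update (update V₀ .nr nr) .tot tot) .q nr with hV₁
  have hL₁ : LevelVars V₁ f r len a d sel kk := hV.congr (by simp [hV₁, update_apply])
  have hbound := hΨ.select (fun q => o + q * r) 0 fun q _ => Nat.le_add_right _ _
  refine wp_for_frame (fun i τ => τ.var .q = nr - i ∧
    (∀ q, nr - i ≤ q → q < nr → (τ.mem 4 q).1 = o + q * r ∧ (τ.mem 5 q).1 = 0) ∧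
    (∀ ρ, ρ ≠ 4 → ρ ≠ 5 → τ.mem ρ = mem₀ ρ) ∧
    Ψ τ.cache (fun q => o + q * r) 0 ≤ Ψ κ₀ (fun q => o + q * r) 0 + 2 * E.β * i) nr ?_ ?_ ?_
  · exact ⟨by simp [hV₁], fun q h₁ h₂ => by omega, fun _ _ _ => rfl, by simp⟩
  · rintro i ⟨V, acc, mem, κ⟩ hi ⟨hq, hini, hmem, hcost⟩ hfr
    dsimp only at hq hini hmem hcost
    have hL := hL₁.frame hfr (by decide)
    have hoV : V .o = o := (hfr .o (by decide)).trans (by simpa [hV₁, update_apply] using ho)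
    dsimp only at hL
    have hlt' : o + (nr - i - 1) * r < len := groupRuns_mul_lt (kk := kk) hr (by omega)
    have hF := phase_streams (q := nr - i - 1) (len := len) (o := o) hE hP (by omega)
    have hb₁ := hbound.ptr κ (nr - i - 1) (by omega)
    have hb₂ := hbound.cnt (κ.touch E (9 + 3 * (nr - i - 1) * sel) (E.blk 4 (nr - i - 1)))
      (nr - i - 1) (by omega)
    have hmul : 2 * E.β * (i + 1) = 2 * E.β * i + 2 * E.β := by ring
    simp only [aLang_test, initRun, wp_seq, wp_set, wp_store, Expr.eval_var, Expr.eval_zero,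
      Expr.eval_one, Expr.eval_ofNat, Expr.eval_add, Expr.eval_sub, Expr.eval_mul,
      update_apply, reduceCtorEq, if_false, if_true, hq, hL.sel, hL.r, hoV]
    refine ⟨by omega, by omega, ⟨by omega, by omega, by omega, by omega⟩,
      ⟨by omega, by omega, by omega, by omega⟩, by omega, fun q hq₁ hq₂ => ?_,
      fun ρ h₁ h₂ => ?_, by omega⟩
    · rw [setMem_of_ne _ (show 4 ≠ 5 by decide), setMem_same, setMem_same,
        setMem_of_ne _ (show 5 ≠ 4 by decide), update_apply, update_apply]
      split_ifs with hqe
      · subst hqe; exact ⟨rfl, rfl⟩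
      · exact hini q (by omega) hq₂
    · rw [setMem_of_ne _ h₂, setMem_of_ne _ h₁, hmem ρ h₁ h₂]
  · rintro σ ⟨hq, hini, hmem, hcost⟩ hfr
    refine ⟨by simp only [aLang_test, Expr.eval_var, hq, Nat.sub_self], ?_⟩
    rw [Nat.sub_self] at hini
    have hL := hL₁.frame hfr (by decide)
    have hVo : ∀ v ∈ [AVar.o, .nr, .tot, .ans], σ.var v = V₁ v := fun v hv =>
      hfr v (by revert v; decide)
    have hoV : σ.var .o = o := (hVo .o (by decide)).trans (by simpa [hV₁, update_apply] using ho)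
    have hM : MergeVars σ.var f nr o r len a d sel tot :=
      ⟨hL.f, (hVo .nr (by decide)).trans (by simp [hV₁, update_apply]), hoV, hL.r, hL.len, hL.a,
        hL.d, hL.sel, (hVo .tot (by decide)).trans (by simp [hV₁, update_apply])⟩
    have hansV : σ.var .ans = V₀ .ans :=
      (hVo .ans (by decide)).trans (by simp [hV₁, update_apply])
    have hma : σ.mem a = mem₀ a := hmem a (by omega) (by omega)
    have hmd : σ.mem d = mem₀ d := hmem d (by omega) (by omega)
    have hq' : ∀ q < nr, o + q * r < len := fun q hq => groupRuns_mul_lt hr (hnr ▸ hq)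
    have hlenc : ∀ q < nr, o + q * r + (chunk r (l.drop o) q).length = runEnd o r len q := by
      intro q hq
      have := hq' q hq
      rw [chunk, List.length_take, List.length_drop, List.length_drop, runEnd, Nat.succ_mul, hl]
      omega
    have hmg : Merging f nr o r len a d 0 σ.mem σ.mem ((l.drop o).take (kk * r))
        (chunk r (l.drop o)) 0 [] := by
      refine ⟨⟨fun q hq => ?_, fun q hq => ?_, fun q hq => ?_, fun q hq => ?_⟩, rfl, Seg.nil,
        List.Pairwise.nil, fun q _ => hrun' q, by simp, ?_, by simp, fun _ _ _ _ => rfl,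
        fun _ _ => rfl⟩
      · rw [(hini q (Nat.zero_le _) hq).1, hlenc q hq]
      · rw [(hini q (Nat.zero_le _) hq).1]; exact Nat.le_add_right _ _
      · exact (hini q (Nat.zero_le _) hq).2
      · rw [(hini q (Nat.zero_le _) hq).1, hma, chunk, List.drop_drop]
        refine Seg.take ?_ _
        rw [← List.take_append_drop (o + q * r) l, seg_append] at hseg
        have := hseg.2
        have hlt := hq' q hq
        rwa [List.length_take, min_eq_left (by omega), Nat.zero_add] at this
      · rw [← htake, ← sum_chunk]; simp
    have hcard : Multiset.card ((l.drop o).take (kk * r) : Multiset Cell) = tot := by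
      rw [Multiset.coe_card, List.length_take, List.length_drop, hl, htot, min_comm]
    rw [wp_seq]
    have hmain := (wp_mergeRuns hM had ha hd hmg hcard
      (fun q hq => phase_streams hE hP (hnr ▸ hq)) (by have := hE.streams; omega)
      hcap (by omega) (by omega) (by omega) (by rw [hansV, ← hinv]; exact hans) hΨ).frame
    refine hmain.mono ?_
    rintro ⟨V, acc, mem, κ⟩ ⟨⟨out, hperm, hsorted, hseg', hans', hmem', hmd', hΨ'⟩, hfr'⟩
    dsimp only at hseg' hans' hmem' hmd' hΨ'
    have hL' := hL.frame hfr' (by decide)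
    dsimp only at hL'
    have hoV' : V .o = o := (hfr' .o (by decide)).trans hoV
    have e₁ := hΨp σ.cache (fun q => (σ.mem 4 q).1) (fun q => o + q * r) 0
      fun q hq => (hini q (Nat.zero_le _) hq).1
    have e₂ := hΨc κ (fun q => (mem 4 q).1) tot
    have e₃ := hΨle κ₀ (fun q => o + q * r) 0
    simp only [wp_set, Expr.eval_var, Expr.eval_add, Expr.eval_mul, hL'.kk, hL'.r, hoV']
    refine ⟨by omega, out, Multiset.coe_eq_coe.mp hperm, hsorted, hseg', by simp, ?_, ?_, ?_, ?_⟩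
    · simp only [update_apply, reduceCtorEq, if_false]
      rw [hans', hansV, hinv]
    · intro ρ h₁ h₂ h₃
      rw [hmem' ρ h₁ h₂ h₃, hmem ρ h₂ h₃]
    · intro i hi
      rw [hmd' i (Or.inl hi), hmd]
    · omega

/-- Sorting a group affects only the pairs inside it (`inv_perm_middle`), and these are what the
merge adds to `ans`. A complete group of R ≥ h cells costs 48 * R + 20 * h ≤ 68 * R; only a last,
incomplete group leaves an extra 20 * h. -/
theorem wp_mergeLevel {σ : AState} {l : List Cell} (hE : SortEnv E)
    (hP : Phase E r sel kk) (hV : LevelVars σ.var f r len a d sel kk) (had : a + d = 5)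
    (ha : a < 4) (hd : d < 4) (hl : l.length = len) (hseg : Seg (σ.mem a) 0 l)
    (hrun : RunSorted f r l) (hcap : 3 ≤ E.cap) (hkk : kk < E.cap) (hfan : fanOf E.P < E.cap)
    (hlen : len + kk * r < E.cap) (hans : σ.var .ans + inv f l < E.cap) (had' : 5 < E.cap) :
    Wp (aLang E) mergeLevel (fun τ => ∃ l' : List Cell, l'.Perm l ∧ RunSorted f (kk * r) l' ∧
      Seg (τ.mem d) 0 l' ∧ LevelVars τ.var f (kk * r) len d a 1 (fanOf E.P) ∧
      τ.var .ans + inv f l' = σ.var .ans + inv f l ∧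
      (∀ ρ, ρ ≠ d → ρ ≠ 4 → ρ ≠ 5 → τ.mem ρ = σ.mem ρ) ∧
      τ.cache.cost ≤ σ.cache.cost + 68 * len + 20 * E.h) σ := by
  obtain ⟨R, hR⟩ : ∃ R, R = kk * r := ⟨_, rfl⟩
  have hh := hE.h_pos
  have hRh : E.h ≤ R := by
    have := two_le_fanOf E.P
    rcases hP with ⟨_, rfl, rfl⟩ | ⟨_, h, rfl⟩
    · omega
    · rw [hR]; exact h.trans (Nat.le_mul_of_pos_left _ (by omega))
  rw [← hR] at hlen ⊢
  obtain ⟨V₀, acc₀, mem₀, κ₀⟩ := σ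
  dsimp only at hV hseg hans ⊢
  simp only [mergeLevel, wp_seq, wp_set, Expr.eval_zero]
  refine ⟨by omega, ?_⟩
  refine wp_loop_frame (fun τ => ∃ g done, τ.var .o = g * R ∧
    done.length = min (g * R) len ∧ done.Perm (l.take (g * R)) ∧ RunSorted f R done ∧
    Seg (τ.mem d) 0 done ∧ τ.var .ans + inv f (done ++ l.drop (g * R)) = V₀ .ans + inv f l ∧
    (∀ ρ, ρ ≠ d → ρ ≠ 4 → ρ ≠ 5 → τ.mem ρ = mem₀ ρ) ∧
    τ.cache.cost ≤ κ₀.cost + 68 * min (g * R) len + if len < g * R then 20 * E.h else 0)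
    (fun τ => len - τ.var .o) ?_ ?_ ?_
  · exact ⟨0, [], by simp, by simp, by simp, fun q => by simp [chunk, SortedCells], Seg.nil,
      by simp [update_apply], fun _ _ _ _ => rfl, by simp⟩
  · rintro σ ⟨g, done, ho, hdl, hdp, hdr, hds, hda, hmem, hcost⟩ hfr htest
    have hL : LevelVars σ.var f r len a d sel kk :=
      LevelVars.frame (hV.congr (by simp [update_apply])) hfr (by decide)
    have hlt : g * R < len := by
      simp only [aLang_test, Expr.eval_lt, Expr.eval_var, ho, hL.len] at htest
      by_contra h
      exact htest (if_neg h)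
    have hma : σ.mem a = mem₀ a := hmem a (by omega) (by omega) (by omega)
    have hsplit : l.drop (g * R) = (l.drop (g * R)).take R ++ l.drop ((g + 1) * R) := by
      rw [Nat.succ_mul, ← List.drop_drop, List.take_append_drop]
    obtain ⟨G, hG⟩ : ∃ G, G = (l.drop (g * R)).take R := ⟨_, rfl⟩
    obtain ⟨Y, hY⟩ : ∃ Y, Y = l.drop ((g + 1) * R) := ⟨_, rfl⟩
    rw [← hG, ← hY] at hsplit
    rw [hsplit] at hda
    have hGle : inv f G ≤ inv f (done ++ (G ++ Y)) := by
      rw [inv_append, inv_append]; omega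
    have hmain := wp_mergeGroup hE hP hL (by omega) ha hd (g := g) (by rw [ho, hR])
      (by rw [← hR]; exact hlt) hl (hma ▸ hseg) hrun hcap hkk (by rw [← hR]; exact hlen)
      (by rw [← hR, ← hG]; omega)
    rw [← hR, ← hG] at hmain
    refine hmain.mono ?_
    rintro τ ⟨out, hperm, hsorted, hseg', ho', hans', hmem', hmd', hcost'⟩
    have hout : out.length = min (len - g * R) R := by
      rw [hperm.length_eq, hG, List.length_take, List.length_drop, hl, min_comm]
    have hpm := inv_perm_middle (f := f) (A := done) (C := Y) hperm
    rw [hsorted.inv_eq_zero] at hpm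
    refine ⟨⟨g + 1, done ++ out, by rw [ho', Nat.succ_mul], ?_, ?_, ?_, ?_, ?_, ?_, ?_⟩, ?_⟩
    · rw [List.length_append, hdl, hout, Nat.succ_mul]; omega
    · rw [Nat.succ_mul, List.take_add]
      exact hdp.append (hG ▸ hperm)
    · exact hdr.append (g := g) (by omega) hsorted (by omega)
    · rw [seg_append]
      refine ⟨hds.congr fun i _ hi => hmd' i (by omega), ?_⟩
      rw [Nat.zero_add, hdl, min_eq_left hlt.le]
      exact hseg'
    · rw [List.append_assoc, ← hY]; omega
    · intro ρ h₁ h₂ h₃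
      rw [hmem' ρ h₁ h₂ h₃, hmem ρ h₁ h₂ h₃]
    · rw [if_neg (by omega)] at hcost
      rw [Nat.succ_mul g R]
      split_ifs <;> omega
    · rw [ho', ho]; omega
  · rintro ⟨V, acc, mem, κ⟩ ⟨g, done, ho, hdl, hdp, hdr, hds, hda, hmem, hcost⟩ hfr htest
    have hL : LevelVars V f r len a d sel kk :=
      LevelVars.frame (hV.congr (by simp [update_apply])) hfr (by decide)
    dsimp only at ho hds hda hmem hcost
    have hge : len ≤ g * R := by
      simp only [aLang_test, Expr.eval_lt, Expr.eval_var, ho, hL.len] at htest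
      by_contra h
      rw [if_pos (by omega)] at htest
      exact one_ne_zero htest
    rw [List.take_of_length_le (by omega)] at hdp
    rw [List.drop_of_length_le (by omega), List.append_nil] at hda
    rw [Nat.mul_comm] at hR
    simp only [wp_seq, wp_set, Expr.eval_var, Expr.eval_one, Expr.eval_ofNat, Expr.eval_sub,
      Expr.eval_mul, eval_fanE, update_apply, reduceCtorEq, if_false, if_true, hL.a, hL.d, hL.r,
      hL.kk, ← hR]
    refine ⟨by omega, by omega, by omega, by omega, by omega, done, hdp, hdr, hds,
      ⟨?_, ?_, ?_, ?_, ?_, ?_, ?_⟩, ?_, hmem, ?_⟩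
    · simpa [update_apply] using hL.f
    · simp [update_apply]
    · simpa [update_apply] using hL.len
    · simp [update_apply]; omega
    · simp [update_apply]; omega
    · simp [update_apply]
    · simp [update_apply]
    · simpa [update_apply] using hda
    · split_ifs at hcost <;> omega

/-- One level forms runs of h cells within the blocks. Each further level multiplies the length of
the runs by the fan-in, so at most L more levels are needed. -/
theorem wp_sortCells {σ : AState} {l : List Cell} {L : ℕ} (hE : SortEnv E)
    (hf : σ.var .f = f.toNat) (hVa : σ.var .a = a) (hVd : σ.var .d = d) (hVl : σ.var .len = len)
    (had : a + d = 5) (ha : a < 4) (hd : d < 4) (hl : l.length = len) (hseg : Seg (σ.mem a) 0 l)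
    (hcap : 5 < E.cap) (hlen : (len + 1) * (fanOf E.P + E.h + 1) < E.cap)
    (hans : σ.var .ans + inv f l < E.cap) (hL : len ≤ E.h * fanOf E.P ^ L) :
    Wp (aLang E) sortCells (fun τ => ∃ l' : List Cell, l'.Perm l ∧ SortedCells f l' ∧
      Seg (τ.mem (τ.var .a)) 0 l' ∧ τ.var .a + τ.var .d = 5 ∧ τ.var .a < 4 ∧ τ.var .d < 4 ∧
      τ.var .ans = σ.var .ans + inv f l ∧
      (∀ ρ < 2, τ.mem ρ = σ.mem ρ) ∧
      τ.cache.cost ≤ σ.cache.cost + (L + 1) * (68 * len + 20 * E.h)) σ := by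
  have hh := hE.h_pos
  have hk := two_le_fanOf E.P
  have hx : (len + 1) * (fanOf E.P + E.h + 1) =
    len * fanOf E.P + len * E.h + len + fanOf E.P + E.h + 1 := by ring
  rw [hx] at hlen
  obtain ⟨V₀, acc₀, mem₀, κ₀⟩ := σ
  dsimp only at hf hVa hVd hVl hseg hans ⊢
  simp only [sortCells, wp_seq, wp_set, Expr.eval_zero, Expr.eval_one, eval_cellsE]
  rw [← hE.cells]
  refine ⟨by omega, by omega, by omega, ?_⟩
  refine wp_loop (fun τ => ∃ r a d sel kk i l', LevelVars τ.var f r len a d sel kk ∧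
    ((sel = 0 ∧ r = 1 ∧ kk = E.h ∧ i = 0) ∨
      (sel = 1 ∧ kk = fanOf E.P ∧ ∃ t ≤ L, r = E.h * fanOf E.P ^ t ∧ i = t + 1)) ∧
    a + d = 5 ∧ a < 4 ∧ d < 4 ∧ l'.Perm l ∧ RunSorted f r l' ∧ Seg (τ.mem a) 0 l' ∧
    τ.var .ans + inv f l' = V₀ .ans + inv f l ∧ (∀ ρ < 2, τ.mem ρ = mem₀ ρ) ∧
    τ.cache.cost ≤ κ₀.cost + i * (68 * len + 20 * E.h))
    -- For h = 1 the first level does not lengthen the runs; then the change of `sel` from 0 to 1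
    -- makes the variant decrease.
    (fun τ => 2 * (len - τ.var .r) + (1 - τ.var .sel)) ?_ ?_ ?_
  · refine ⟨1, a, d, 0, E.h, 0, l, ⟨?_, ?_, ?_, ?_, ?_, ?_, ?_⟩, Or.inl ⟨rfl, rfl, rfl, rfl⟩, had,
      ha, hd, List.Perm.refl _, runSorted_one f l, hseg, ?_, fun _ _ => rfl, by simp⟩ <;>
    simp [update_apply, *]
  · rintro σ ⟨r, a, d, sel, kk, i, l', hV, hi, had, ha, hd, hp, hrun, hseg, hans', hmem, hcost⟩ htest
    have hlt : r < len := by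
      simp only [aLang_test, Expr.eval_lt, Expr.eval_var, hV.r, hV.len] at htest
      by_contra h
      exact htest (if_neg h)
    have hP : Phase E r sel kk := by
      rcases hi with ⟨h₁, h₂, h₃, _⟩ | ⟨h₁, h₂, t, _, h₃, _⟩
      · exact Or.inl ⟨h₁, h₂, h₃⟩
      · exact Or.inr ⟨h₁, h₃ ▸ Nat.le_mul_of_pos_right _ (by positivity), h₂⟩
    have hkr : kk * r ≤ len * fanOf E.P + len * E.h := by
      rw [← Nat.mul_add, Nat.mul_comm]
      refine Nat.mul_le_mul hlt.le ?_
      rcases hP with ⟨_, _, rfl⟩ | ⟨_, _, rfl⟩ <;> omega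
    have hkk : kk ≤ fanOf E.P + E.h := by
      rcases hP with ⟨_, _, rfl⟩ | ⟨_, _, rfl⟩ <;> omega
    have hl' : l'.length = len := hp.length_eq.trans hl
    refine (wp_mergeLevel hE hP hV had ha hd hl' hseg hrun (by omega) (by omega) (by omega)
      (by omega) (by omega) (by omega)).mono ?_
    rintro τ ⟨l'', hp', hrun', hseg', hV', hans'', hmem', hcost'⟩
    refine ⟨⟨kk * r, d, a, 1, fanOf E.P, i + 1, l'', hV', Or.inr ⟨rfl, rfl, ?_⟩, by omega, hd, ha,
      hp'.trans hp, hrun', hseg', by omega, ?_, ?_⟩, ?_⟩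
    · rcases hi with ⟨rfl, rfl, rfl, rfl⟩ | ⟨rfl, rfl, t, ht, rfl, rfl⟩
      · exact ⟨0, Nat.zero_le _, by simp, rfl⟩
      · refine ⟨t + 1, ?_, by ring, rfl⟩
        by_contra h
        have : t = L := by omega
        subst this
        omega
    · intro ρ hρ
      rw [hmem' ρ (by omega) (by omega) (by omega), hmem ρ hρ]
    · rw [Nat.succ_mul]; omega
    · rw [hV.r, hV'.r, hV.sel, hV'.sel]
      rcases hP with ⟨rfl, rfl, rfl⟩ | ⟨rfl, _, rfl⟩
      · omega
      · have : 2 * r ≤ fanOf E.P * r := Nat.mul_le_mul_right r hk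
        omega
  · rintro σ ⟨r, a, d, sel, kk, i, l', hV, hi, had, ha, hd, hp, hrun, hseg, hans', hmem, hcost⟩ htest
    have hge : len ≤ r := by
      simp only [aLang_test, Expr.eval_lt, Expr.eval_var, hV.r, hV.len] at htest
      by_contra h
      rw [if_pos (by omega)] at htest
      exact one_ne_zero htest
    have hs := hrun.sorted (by rw [hp.length_eq, hl]; exact hge)
    rw [hs.inv_eq_zero] at hans'
    have hiL : i * (68 * len + 20 * E.h) ≤ (L + 1) * (68 * len + 20 * E.h) := by
      refine Nat.mul_le_mul_right _ ?_
      rcases hi with ⟨_, _, _, rfl⟩ | ⟨_, _, t, ht, _, rfl⟩ <;> omega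
    refine ⟨l', hp, hs, by rwa [hV.a], by rw [hV.a, hV.d, had], by rwa [hV.a], by rwa [hV.d],
      by omega, hmem, by omega⟩

end sort

/-! ### Screening a list -/

/-- Set `w` if the current cell is heavy. -/
def heavyTest : Stmt AVar AInstr :=
  .w ≔ 0 ;;
  .ite ((rd .tn).eq (rd .s))
    (.prim (.cmp .t 2 (rd .a) (rd .tn - 1)) ;;
     .w ≔ (1 - (rd .c).eq (rd .f)) * (rd .t).eq (2 - rd .f)) .skip

/-- Distribute the next cell. -/
def screenCell : Stmt AVar AInstr :=
  .i ≔ rd .i - 1 ;; .g ≔ rd .g + 1 ;; .prim (.load 0 (rd .x) (rd .i) .c) ;;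
  heavyTest ;;
  .ite (rd .w + (rd .c).eq (rd .f))
    (.prim (.store 1 (rd .y) (rd .m) (rd .c)) ;; .m ≔ rd .m + 1) .skip ;;
  .ite (rd .w) (.hv ≔ rd .hv + 1)
    (.prim (.store 3 (rd .a) (rd .len) (rd .c)) ;; .len ≔ rd .len + 1)

def screenGroup : Stmt AVar AInstr :=
  .loop ((rd .g).lt (rd .s) * Expr.lt 0 (rd .i)) screenCell

/-- The potential of screening. -/
def screenDue (E : AEnv) (x y a tn : ℕ) (κ : Cache) (i m len : ℕ) : ℕ :=
  κ.cost + dueDown E κ 0 x i + dueUp E κ 1 y m + due E κ 2 (E.blk a (tn - 1)) + dueUp E κ 3 a len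

/-! ### Recognizing heavy cells -/

section

variable {E : AEnv} {f : Bool} {x y a tn s i m len : ℕ} {κ : Cache} {T : List Cell}

theorem screenDue_le (hh : 0 < E.h) :
    screenDue E x y a tn κ i m len ≤ κ.cost + 14 * E.h := by
  have h₁ := dueDown_le (E := E) (κ := κ) (s := 0) (ρ := x) (i := i)
  have h₂ := dueUp_le (κ := κ) (s := 1) (ρ := y) (i := m) hh
  have h₃ := due_le (E := E) (κ := κ) (s := 2) (X := E.blk a (tn - 1))
  have h₄ := dueUp_le (κ := κ) (s := 3) (ρ := a) (i := len) hh
  rw [screenDue]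
  omega

theorem screenDue_read :
    screenDue E x y a tn (κ.touch E 0 (E.blk x (i - 1))) i m len ≤
      screenDue E x y a tn κ i m len + E.β := by
  have := cost_touch_down (E := E) (κ := κ) (s := 0) (ρ := x) (i := i)
  simp only [screenDue]
  rw [dueUp_touch_of_ne (by omega), due_touch_of_ne (by omega), dueUp_touch_of_ne (by omega)]
  omega

theorem screenDue_keep :
    screenDue E x y a tn (κ.touch E 1 (E.blk y m)) i m len ≤
      screenDue E x y a tn κ i m len + E.β := by
  have := cost_touch_up (E := E) (κ := κ) (s := 1) (ρ := y) (i := m)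
  simp only [screenDue]
  rw [dueDown_touch_of_ne (by omega), due_touch_of_ne (by omega),
    dueUp_touch_of_ne (s' := 3) (by omega)]
  omega

theorem screenDue_test :
    screenDue E x y a tn (κ.touch E 2 (E.blk a (tn - 1))) i m len ≤
      screenDue E x y a tn κ i m len + E.β := by
  have := cost_touch_self (E := E) (κ := κ) (s := 2) (X := E.blk a (tn - 1))
  simp only [screenDue]
  rw [dueDown_touch_of_ne (by omega), dueUp_touch_of_ne (by omega),
    dueUp_touch_of_ne (by omega)]
  omega

theorem screenDue_count :
    screenDue E x y a tn (κ.touch E 3 (E.blk a len)) i m len ≤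
      screenDue E x y a tn κ i m len + E.β := by
  have := cost_touch_up (E := E) (κ := κ) (s := 3) (ρ := a) (i := len)
  simp only [screenDue]
  rw [dueDown_touch_of_ne (by omega), dueUp_touch_of_ne (s' := 1) (by omega),
    due_touch_of_ne (by omega)]
  omega

theorem screenDue_next (hh : 0 < E.h) :
    screenDue E x y a tn κ (i - 1) m len ≤ screenDue E x y a tn κ i m len + 2 ∧
    screenDue E x y a tn κ i (m + 1) len ≤ screenDue E x y a tn κ i m len + 2 ∧
    screenDue E x y a tn κ i m (len + 1) ≤ screenDue E x y a tn κ i m len + 2 := by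
  have h₁ := dueDown_pred (κ := κ) (s := 0) (ρ := x) (i := i) hh
  have h₂ := dueUp_succ (κ := κ) (s := 1) (ρ := y) (i := m) hh
  have h₄ := dueUp_succ (κ := κ) (s := 3) (ρ := a) (i := len) hh
  simp only [screenDue]
  omega

/-- The cells that serve to recognize heavy cells: the dominating ones, the largest first. -/
structure Screen (f : Bool) (s : ℕ) (T : List Cell) : Prop where
  length : T.length ≤ s
  color : ∀ c ∈ T, c.1 = f
  sorted : T.Pairwise fun c c' => cellKey f c' ≤ cellKey f c

/-- The last cell of T is the smallest. If it dominates a cell, then all of T does, so one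
comparison suffices. -/
theorem Screen.heavy_iff (h : Screen f s T) (hs : T.length = s) {c t : Cell} {T' : List Cell}
    (ht : T = T' ++ [t]) : Heavy f s T c ↔ Bad f t c := by
  subst hs
  rw [Heavy, List.countP_eq_length]
  simp only [decide_eq_true_eq]
  constructor
  · rintro ⟨-, h'⟩
    exact h' t (by rw [ht]; simp)
  · intro hb
    refine ⟨hb.2.1, fun y hy => ?_⟩
    have hle : cellKey f t ≤ cellKey f y := by
      have hs := h.sorted
      rw [ht, List.pairwise_append] at hs
      rw [ht, List.mem_append, List.mem_singleton] at hy
      rcases hy with hy | rfl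
      · exact hs.2.2 y hy t (by simp)
      · exact le_rfl
    exact bad_of_cellKey_le (h.color y hy) hb.2.1 (hb.cellKey_lt.le.trans hle)

theorem not_heavy (h : T.length < s) (c : Cell) : ¬ Heavy f s T c := by
  rintro ⟨-, h'⟩
  rw [← h'] at h
  exact absurd List.countP_le_length (not_le.mpr h)

open Classical in
theorem wp_heavyTest {σ : AState} {c : Cell} (hT : Screen f s T) (hs : 0 < s)
    (hseg : Seg (σ.mem a) 0 T) (hf : σ.var .f = f.toNat) (htn : σ.var .tn = T.length)
    (hVs : σ.var .s = s) (hVa : σ.var .a = a) (ha : a < 6) (hc : σ.var .c = c.1.toNat)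
    (hacc : σ.acc = .key c.2) (hF : 8 ≤ E.F) (hcap : 3 ≤ E.cap) (hT' : T.length < E.cap) :
    Wp (aLang E) heavyTest (fun τ => τ.mem = σ.mem ∧ τ.acc = σ.acc ∧
      τ.var .w = (if Heavy f s T c then 1 else 0) ∧
      screenDue E x y a T.length τ.cache i m len ≤
        screenDue E x y a T.length σ.cache i m len + E.β) σ := by
  obtain ⟨V, acc, mem, κ⟩ := σ
  dsimp only at hf htn hVs hVa hc hacc hseg ⊢
  subst hacc
  rcases hT.length.lt_or_eq with hlt | heq
  · simp only [heavyTest, wp_seq, wp_set, wp_load, wp_cmp, wp_ite, wp_skip, aLang_test,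
      Expr.eval_var, Expr.eval_zero, Expr.eval_one, Expr.eval_ofNat, Expr.eval_sub, Expr.eval_mul,
      Expr.eval_eq, update_apply, reduceCtorEq, if_false, if_true, htn, hVs, hlt.ne,
      not_heavy hlt c]
    exact ⟨by omega, by simp, fun _ => ⟨trivial, trivial, trivial, by omega⟩⟩
  · obtain ⟨T', t, rfl⟩ : ∃ T' t, T = T' ++ [t] :=
      ⟨T.dropLast, T.getLast (by rintro rfl; simp at heq; omega), (List.dropLast_append_getLast _).symm⟩
    have hlen : (T' ++ [t]).length = T'.length + 1 := by simp
    have ht : mem a T'.length = t.enc := by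
      rw [seg_append] at hseg
      have := (seg_cons.mp hseg.2).1
      rwa [Nat.zero_add] at this
    have hb := compare_bad f c t (hT.color t (by simp))
    have hcost := screenDue_test (E := E) (x := x) (y := y) (a := a) (tn := (T' ++ [t]).length)
      (κ := κ) (i := i) (m := m) (len := len)
    rw [hlen] at heq htn hT' hcost ⊢
    rw [← heq] at hVs
    rw [Nat.add_sub_cancel] at hcost
    simp only [heavyTest, wp_seq, wp_set, wp_load, wp_cmp, wp_ite, wp_skip, aLang_test,
      Expr.eval_var, Expr.eval_zero, Expr.eval_one, Expr.eval_ofNat, Expr.eval_sub, Expr.eval_mul,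
      Expr.eval_eq, update_apply, reduceCtorEq, if_false, if_true, htn, hVs, hVa, hc, hf,
      Nat.add_sub_cancel, ht, Cell.enc, hb, hT.heavy_iff (hlen.trans heq) rfl]
    refine ⟨by omega, fun _ => ⟨⟨by omega, ha, by omega⟩, by split_ifs <;> omega, trivial,
      trivial, trivial, hcost⟩, fun h => h.elim⟩

end

structure ScreenVars (V : AVar → ℕ) (f : Bool) (x y a s tn : ℕ) : Prop where
  f : V .f = f.toNat
  x : V .x = x
  y : V .y = y
  a : V .a = a
  s : V .s = s
  tn : V .tn = tn

theorem ScreenVars.congr {V V' : AVar → ℕ} {f : Bool} {x y a s tn : ℕ}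
    (h : ScreenVars V f x y a s tn)
    (he : ∀ v ∈ [AVar.f, .x, .y, .a, .s, .tn], V' v = V v) : ScreenVars V' f x y a s tn :=
  ⟨(he _ (by decide)).trans h.f, (he _ (by decide)).trans h.x, (he _ (by decide)).trans h.y,
    (he _ (by decide)).trans h.a, (he _ (by decide)).trans h.s, (he _ (by decide)).trans h.tn⟩

theorem ScreenVars.frame {p : Stmt AVar AInstr} {σ τ : AState} {f : Bool} {x y a s tn : ℕ}
    (h : ScreenVars σ.var f x y a s tn) (hF : Frame p σ τ)
    (hp : ∀ v ∈ [AVar.f, .x, .y, .a, .s, .tn], v ∉ p.writes) : ScreenVars τ.var f x y a s tn :=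
  h.congr fun v hv => hF v (hp v hv)

/-! ### Screening a group -/

section

variable {E : AEnv} {f : Bool} {x y a s : ℕ} {T G : List Cell}

open Classical in
/-- The state after screening the group `G`. -/
structure Screened (σ : AState) (f : Bool) (y a s : ℕ) (T Y G : List Cell) (i g hv : ℕ)
    (mem₀ : ℕ → ℕ → ℕ × Word) : Prop where
  i : σ.var .i = i
  g : σ.var .g = g
  m : σ.var .m = (Y ++ kept f s T G).length
  len : σ.var .len = (T ++ counted f s T G).length
  hv : σ.var .hv = hv + (kept f s T G).countP fun x => ¬ x.1 = f
  seg_y : Seg (σ.mem y) 0 (Y ++ kept f s T G)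
  seg_a : Seg (σ.mem a) 0 (T ++ counted f s T G)
  mem : ∀ ρ, ρ ≠ y → ρ ≠ a → σ.mem ρ = mem₀ ρ

open Classical in
theorem kept_snoc (c : Cell) : kept f s T (G ++ [c]) =
    kept f s T G ++ if c.1 = f ∨ Heavy f s T c then [c] else [] := by
  rw [kept, kept, List.filter_append, List.filter_singleton]
  simp only [Bool.cond_decide]

open Classical in
theorem counted_snoc (c : Cell) : counted f s T (G ++ [c]) =
    counted f s T G ++ if c.1 = f ∨ ¬ Heavy f s T c then [c] else [] := by
  rw [counted, counted, List.filter_append, List.filter_singleton]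
  simp only [Bool.cond_decide]

-- There are at most four accesses (reading, testing, and two stores), and three positions move by
-- one, at 2 each.
open Classical in
theorem wp_screenCell {σ : AState} {Y : List Cell} {c : Cell} {i g hv : ℕ}
    {mem₀ : ℕ → ℕ → ℕ × Word} (hh : 0 < E.h) (hT : Screen f s T) (hs : 0 < s)
    (hV : ScreenVars σ.var f x y a s T.length)
    (hx : x < 2) (hy : y < 2) (hxy : x ≠ y) (ha : 2 ≤ a) (ha' : a < 4)
    (hσ : Screened σ f y a s T Y G (i + 1) g hv mem₀) (hc : mem₀ x i = c.enc) (hF : 8 ≤ E.F)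
    (hcap : 3 ≤ E.cap) (hi : i < E.cap) (hg : g + 1 < E.cap)
    (hm : (Y ++ kept f s T G).length + 1 < E.cap)
    (hlen : (T ++ counted f s T G).length + 1 < E.cap)
    (hhv : hv + (kept f s T G).length + 1 < E.cap) :
    Wp (aLang E) screenCell (fun τ => Screened τ f y a s T Y (G ++ [c]) i (g + 1) hv mem₀ ∧
      screenDue E x y a T.length τ.cache i (τ.var .m) (τ.var .len) ≤
        screenDue E x y a T.length σ.cache (i + 1) (σ.var .m) (σ.var .len) + (4 * E.β + 6)) σ := by
  have hmx : σ.mem x = mem₀ x := hσ.mem x hxy (by omega)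
  obtain ⟨V₀, acc₀, mem, κ⟩ := σ
  obtain ⟨hVi, hVg, hVm, hVlen, hVhv, hsegy, hsega, hmem⟩ := hσ
  dsimp only at hV hVi hVg hVm hVlen hVhv hsegy hsega hmem hmx ⊢
  have hTle : T.length ≤ (T ++ counted f s T G).length := by simp
  have hkle : (kept f s T G).countP (fun x => ¬ x.1 = f) ≤ (kept f s T G).length :=
    List.countP_le_length
  obtain ⟨p, hp⟩ : ∃ p, p = (Y ++ kept f s T G).length := ⟨_, rfl⟩
  obtain ⟨l, hl⟩ : ∃ l, l = (T ++ counted f s T G).length := ⟨_, rfl⟩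
  rw [← hp] at hVm hm
  rw [← hl] at hVlen hlen hTle
  rw [hVm, hVlen]
  have hcol := Bool.toNat_le_one c.1
  have hcol' := Bool.toNat_le_one f
  have hb₁ := screenDue_read (E := E) (x := x) (y := y) (a := a) (tn := T.length) (κ := κ)
    (i := i + 1) (m := p) (len := l)
  rw [Nat.add_sub_cancel] at hb₁
  obtain ⟨hb₂, -, -⟩ := screenDue_next (E := E) (x := x) (y := y) (a := a) (tn := T.length)
    (κ := κ.touch E 0 (E.blk x i)) (i := i + 1) (m := p) (len := l) hh
  rw [Nat.add_sub_cancel] at hb₂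
  simp only [screenCell]
  simp only [wp_seq (p := .prim _), wp_set, wp_load,
    Expr.eval_var, Expr.eval_zero, Expr.eval_one, Expr.eval_ofNat, Expr.eval_sub, Expr.eval_add,
    update_apply, reduceCtorEq, if_false, if_true, hVi, hVg, hV.x, Nat.add_sub_cancel, hmx, hc,
    Cell.enc]
  refine ⟨hi, hg, ⟨by omega, by omega, hi⟩, ?_⟩
  set V₁ := update (update (update V₀ .i i) .g (g + 1)) .c c.1.toNat with hV₁
  have hS₁ : ScreenVars V₁ f x y a s T.length := hV.congr (by simp [hV₁, update_apply])
  rw [wp_seq]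
  have htest := (wp_heavyTest (E := E) (x := x) (y := y) (i := i) (m := p) (len := l)
    (σ := ⟨V₁, .key c.2, mem, κ.touch E 0 (E.blk x i)⟩) hT hs (seg_append.mp hsega).1 hS₁.f hS₁.tn
    hS₁.s hS₁.a (by omega) (by simp [hV₁]) rfl hF hcap (by omega)).frame
  refine htest.mono ?_
  rintro ⟨V, acc, mem', κ'⟩ ⟨⟨rfl, hacc, hw, hcost⟩, hfr⟩
  have hS := hS₁.frame hfr (by decide)
  have hVv : ∀ v ∈ [AVar.i, .g, .m, .len, .hv, .c], V v = V₁ v := fun v hv =>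
    hfr v (by revert v; decide)
  have hi' : V .i = i := (hVv _ (by decide)).trans (by simp [hV₁, update_apply])
  have hg' : V .g = g + 1 := (hVv _ (by decide)).trans (by simp [hV₁, update_apply])
  have hm' : V .m = p := (hVv _ (by decide)).trans (by simpa [hV₁, update_apply] using hVm)
  have hlen' : V .len = l :=
    (hVv _ (by decide)).trans (by simpa [hV₁, update_apply] using hVlen)
  have hhv' := ((hVv .hv (by decide)).trans
    (show V₁ .hv = V₀ .hv by simp [hV₁, update_apply])).trans hVhv
  have hc' : V .c = c.1.toNat := (hVv _ (by decide)).trans (by simp [hV₁, update_apply])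
  dsimp only at hS hw hcost hacc hmx hsegy hsega hmem
  subst hacc
  clear hfr hVv htest hS₁ hV₁ hVi hVg hVm hVlen hVhv hV V₁ V₀
  have hk₁ := screenDue_keep (E := E) (x := x) (y := y) (a := a) (tn := T.length) (κ := κ')
    (i := i) (m := p) (len := l)
  obtain ⟨-, hk₂, -⟩ := screenDue_next (E := E) (x := x) (y := y) (a := a) (tn := T.length)
    (κ := κ'.touch E 1 (E.blk y p)) (i := i) (m := p) (len := l) hh
  have hl₁ : ∀ κ p, screenDue E x y a T.length (κ.touch E 3 (E.blk a l)) i p (l + 1) ≤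
      screenDue E x y a T.length κ i p l + E.β + 2 := by
    intro κ p
    have h₁ := screenDue_count (E := E) (x := x) (y := y) (a := a) (tn := T.length) (κ := κ)
      (i := i) (m := p) (len := l)
    obtain ⟨-, -, h₂⟩ := screenDue_next (E := E) (x := x) (y := y) (a := a) (tn := T.length)
      (κ := κ.touch E 3 (E.blk a l)) (i := i) (m := p) (len := l) hh
    omega
  have hl₂ := hl₁ κ' p
  have hl₃ := hl₁ (κ'.touch E 1 (E.blk y p)) (p + 1)
  have hya : y ≠ a := by omega
  by_cases hcf : c.1 = f
  · have hnh : ¬ Heavy f s T c := fun h => h.1 hcf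
    rw [if_neg hnh] at hw
    simp only [wp_seq, wp_set, wp_store, wp_ite, wp_skip, aLang_test,
      Expr.eval_var, Expr.eval_zero, Expr.eval_one, Expr.eval_ofNat, Expr.eval_add, Expr.eval_eq,
      update_apply, reduceCtorEq, if_false, if_true, hw, hc', hcf, hS.f, hS.y, hS.a, hm', hlen']
    refine ⟨fun _ => ⟨⟨by omega, by omega, by omega, by omega⟩, by omega,
      fun h => absurd rfl h, fun _ => ⟨⟨by omega, by omega, by omega, by omega⟩, by omega, ?_,
        by omega⟩⟩, fun h => by simp at h⟩
    constructor
    · simp [update_apply, hi']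
    · simp [update_apply, hg']
    · simp [update_apply, kept_snoc, hcf, hp]; omega
    · simp [update_apply, counted_snoc, hcf, hl]; omega
    · simp [update_apply, kept_snoc, hcf, hhv']
    · dsimp only
      rw [setMem_of_ne _ hya, setMem_same, kept_snoc, if_pos (Or.inl hcf), ← List.append_assoc,
        show (f.toNat, Word.key c.2) = c.enc by rw [Cell.enc, hcf]]
      exact hsegy.snoc (hp.trans (Nat.zero_add _).symm)
    · dsimp only
      rw [setMem_same, setMem_of_ne _ hya.symm, counted_snoc, if_pos (Or.inl hcf),
        ← List.append_assoc, show (f.toNat, Word.key c.2) = c.enc by rw [Cell.enc, hcf]]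
      exact hsega.snoc (hl.trans (Nat.zero_add _).symm)
    · intro ρ h₁ h₂
      dsimp only
      rw [setMem_of_ne _ h₂, setMem_of_ne _ h₁, hmem ρ h₁ h₂]
  · have hcf' : c.1.toNat ≠ f.toNat := fun e => hcf (toNat_injective e)
    by_cases hH : Heavy f s T c
    · rw [if_pos hH] at hw
      simp only [wp_seq, wp_set, wp_store, wp_ite, wp_skip, aLang_test,
        Expr.eval_var, Expr.eval_zero, Expr.eval_one, Expr.eval_ofNat, Expr.eval_add, Expr.eval_eq,
        update_apply, reduceCtorEq, if_false, if_true, hw, hc', hcf', hS.f, hS.y, hS.a, hm', hlen',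
        hhv']
      refine ⟨fun _ => ⟨⟨by omega, by omega, by omega, by omega⟩, by omega,
        fun _ => ⟨by omega, ?_, by omega⟩, fun h => h.elim⟩, fun h => by simp at h⟩
      constructor
      · simp [update_apply, hi']
      · simp [update_apply, hg']
      · simp [update_apply, kept_snoc, hH, hp]; omega
      · simp [update_apply, counted_snoc, hH, hcf, hl, hlen']
      · simp [update_apply, kept_snoc, hH, hcf]; omega
      · dsimp only
        rw [setMem_same, kept_snoc, if_pos (Or.inr hH), ← List.append_assoc]
        exact hsegy.snoc (hp.trans (Nat.zero_add _).symm)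
      · dsimp only
        rw [setMem_of_ne _ hya.symm, counted_snoc, if_neg (by simp [hcf, hH]), List.append_nil]
        exact hsega
      · intro ρ h₁ h₂
        dsimp only
        rw [setMem_of_ne _ h₁, hmem ρ h₁ h₂]
    · rw [if_neg hH] at hw
      simp only [wp_seq, wp_set, wp_store, wp_ite, wp_skip, aLang_test,
        Expr.eval_var, Expr.eval_zero, Expr.eval_one, Expr.eval_ofNat, Expr.eval_add, Expr.eval_eq,
        update_apply, reduceCtorEq, if_false, if_true, hw, hc', hcf', hS.f, hS.y, hS.a, hm', hlen',
        hhv']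
      refine ⟨fun h => absurd rfl h, fun _ => ⟨fun h => absurd rfl h, fun _ =>
        ⟨⟨by omega, by omega, by omega, by omega⟩, by omega, ?_, by omega⟩⟩⟩
      constructor
      · simp [update_apply, hi']
      · simp [update_apply, hg']
      · simp [update_apply, kept_snoc, hH, hcf, hp, hm']
      · simp [update_apply, counted_snoc, hH, hl]; omega
      · simp [update_apply, kept_snoc, hH, hcf, hhv']
      · dsimp only
        rw [setMem_of_ne _ hya, kept_snoc, if_neg (by simp [hcf, hH]), List.append_nil]
        exact hsegy
      · dsimp only
        rw [setMem_same, counted_snoc, if_pos (Or.inr hH), ← List.append_assoc]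
        exact hsega.snoc (hl.trans (Nat.zero_add _).symm)
      · intro ρ h₁ h₂
        dsimp only
        rw [setMem_of_ne _ h₂, hmem ρ h₁ h₂]

/-- The list is stored in reverse and read downwards; the number of cells still to come after c is
the position of c. -/
theorem Seg.reverse_get {m : ℕ → ℕ × Word} {P R : List Cell} {c : Cell}
    (h : Seg m 0 (P ++ c :: R).reverse) : m R.length = c.enc := by
  rw [List.reverse_append, List.reverse_cons, List.append_assoc, seg_append] at h
  have := (seg_cons.mp h.2).1
  rwa [Nat.zero_add, List.length_reverse] at this

theorem length_kept_le (G : List Cell) : (kept f s T G).length ≤ G.length :=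
  List.length_filter_le _ _

theorem length_counted_le (G : List Cell) : (counted f s T G).length ≤ G.length :=
  List.length_filter_le _ _

open Classical in
theorem wp_screenGroup {σ : AState} {A R Y : List Cell} {hv n : ℕ} (hh : 0 < E.h)
    (hT : Screen f s T) (hs : 0 < s) (hV : ScreenVars σ.var f x y a s T.length)
    (hx : x < 2) (hy : y < 2) (hxy : x ≠ y) (ha : 2 ≤ a) (ha' : a < 4)
    (hi : σ.var .i = R.length) (hg : σ.var .g = 0) (hm : σ.var .m = Y.length)
    (hlen : σ.var .len = T.length) (hhv : σ.var .hv = hv)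
    (hsegx : Seg (σ.mem x) 0 (A ++ R).reverse) (hsegy : Seg (σ.mem y) 0 Y)
    (hsega : Seg (σ.mem a) 0 T) (hn : A.length + R.length = n) (hYA : Y.length ≤ A.length)
    (hTA : T.length ≤ A.length) (hvA : hv ≤ A.length) (hF : 8 ≤ E.F)
    (hcap : n + 3 < E.cap) :
    Wp (aLang E) screenGroup (fun τ =>
      Screened τ f y a s T Y (R.take s) (R.length - (R.take s).length) (R.take s).length hv σ.mem ∧
      τ.cache.cost ≤ σ.cache.cost + 14 * E.h + (4 * E.β + 6) * (R.take s).length) σ := by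
  have hle := screenDue_le (E := E) (x := x) (y := y) (a := a) (tn := T.length) (κ := σ.cache)
    (i := R.length) (m := Y.length) (len := T.length) hh
  rw [List.length_take]
  refine wp_for_frame (fun j τ => Screened τ f y a s T Y (R.take j) (R.length - j) j hv σ.mem ∧
    screenDue E x y a T.length τ.cache (R.length - j) (τ.var .m) (τ.var .len) ≤
      σ.cache.cost + 14 * E.h + (4 * E.β + 6) * j) (min s R.length) ?_ ?_ ?_
  · refine ⟨⟨?_, ?_, ?_, ?_, ?_, ?_, ?_, fun _ _ _ => rfl⟩, ?_⟩
    · simpa using hi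
    · exact hg
    · simpa [kept] using hm
    · simpa [counted] using hlen
    · simpa [kept] using hhv
    · simpa [kept] using hsegy
    · simpa [counted] using hsega
    · rw [hm, hlen, Nat.sub_zero]; omega
  · rintro j τ hj ⟨hσ, hcost⟩ hfr
    have hV' := hV.frame hfr (by decide)
    obtain ⟨i, hi'⟩ : ∃ i, R.length - j = i + 1 := ⟨R.length - j - 1, by omega⟩
    have hjR : j < R.length := by omega
    have htake : R.take (j + 1) = R.take j ++ [R[j]] := by
      rw [List.take_add_one, List.getElem?_eq_getElem hjR]; rfl
    have hsplit : (A ++ R) = (A ++ R.take j) ++ R[j] :: R.drop (j + 1) := by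
      rw [List.append_assoc, ← List.drop_eq_getElem_cons hjR, List.take_append_drop]
    have hget := hsegx
    rw [hsplit] at hget
    have hget := hget.reverse_get
    rw [List.length_drop, show R.length - (j + 1) = i by omega] at hget
    have hk := length_kept_le (f := f) (s := s) (T := T) (R.take j)
    have hc := length_counted_le (f := f) (s := s) (T := T) (R.take j)
    rw [List.length_take] at hk hc
    refine ⟨?_, ?_⟩
    · rw [hi'] at hσ
      simp only [aLang_test, Expr.eval_mul, Expr.eval_lt, Expr.eval_var, Expr.eval_zero, hσ.g,
        hV'.s, hσ.i]
      rw [if_pos (by omega), if_pos (by omega)]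
      omega
    · rw [hi'] at hσ hcost
      rw [show R.length - (j + 1) = i by omega, htake]
      refine (wp_screenCell hh hT hs hV' hx hy hxy ha ha' hσ hget hF (by omega) (by omega)
        (by omega) (by rw [List.length_append]; omega) (by rw [List.length_append]; omega)
        (by omega)).mono ?_
      rintro τ' ⟨h₁, h₂⟩
      refine ⟨h₁, ?_⟩
      have : (4 * E.β + 6) * (j + 1) = (4 * E.β + 6) * j + (4 * E.β + 6) := by ring
      omega
  · rintro τ ⟨hσ, hcost⟩ hfr
    have hV' := hV.frame hfr (by decide)
    refine ⟨?_, ?_, ?_⟩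
    · simp only [aLang_test, Expr.eval_mul, Expr.eval_lt, Expr.eval_var, Expr.eval_zero, hσ.g,
        hV'.s, hσ.i]
      rcases Nat.lt_or_ge s R.length with h | h
      · rw [if_neg (by omega), Nat.zero_mul]
      · rw [if_neg (c := 0 < _) (by omega), Nat.mul_zero]
    · have e : R.take (min s R.length) = R.take s := by
        rw [← List.take_take, List.take_length]
      rw [e] at hσ
      exact hσ
    · have : τ.cache.cost ≤ screenDue E x y a T.length τ.cache (R.length - min s R.length)
        (τ.var .m) (τ.var .len) := by simp only [screenDue]; omega
      omega

end

/-- Move the largest `s` dominating cells to the region `d`, and exchange `a` and `d`. -/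
def takeTop : Stmt AVar AInstr :=
  .tn ≔ 0 ;; .j ≔ rd .len ;;
  .loop (Expr.lt 0 (rd .j) * (rd .tn).lt (rd .s))
    (.j ≔ rd .j - 1 ;; .prim (.load 5 (rd .a) (rd .j) .c) ;;
     .ite ((rd .c).eq (rd .f))
       (.prim (.store 6 (rd .d) (rd .tn) (rd .c)) ;; .tn ≔ rd .tn + 1) .skip) ;;
  .t ≔ rd .a ;; .a ≔ rd .d ;; .d ≔ rd .t

/-- Count the pairs of all but the dominating and the heavy cells of the region `x`, and keep
these in the region `y`. -/
def screenPass : Stmt AVar AInstr :=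
  .m ≔ 0 ;; .hv ≔ 0 ;; .tn ≔ 0 ;; .i ≔ rd .n ;;
  .loop (rd .i) (.len ≔ rd .tn ;; .g ≔ 0 ;; screenGroup ;; sortCells ;; takeTop)

/-! ### Extracting the top cells, and a complete pass -/

section

variable {E : AEnv} {f : Bool} {x y a d s n : ℕ}

theorem wp_takeTop {σ : AState} {l : List Cell} (hh : 0 < E.h) (hf : σ.var .f = f.toNat)
    (hs : σ.var .s = s) (ha : σ.var .a = a) (hd : σ.var .d = d) (hlen : σ.var .len = l.length)
    (hseg : Seg (σ.mem a) 0 l) (had : a ≠ d) (ha' : a < 6) (hd' : d < 6) (hF : 8 ≤ E.F)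
    (hcap : l.length < E.cap) (hcap' : 6 < E.cap) :
    Wp (aLang E) takeTop (fun τ => τ.var .tn = (topCells f s l).length ∧ τ.var .a = d ∧
      τ.var .d = a ∧ Seg (τ.mem d) 0 (topCells f s l) ∧ (∀ ρ, ρ ≠ d → τ.mem ρ = σ.mem ρ) ∧
      τ.cache.cost ≤ σ.cache.cost + 8 * E.h + (2 * E.β + 4) * l.length) σ := by
  classical
  obtain ⟨V₀, acc₀, mem₀, κ₀⟩ := σ
  dsimp only at hf hs ha hd hlen hseg ⊢
  simp only [takeTop, wp_seq, wp_set, Expr.eval_var, Expr.eval_zero, update_apply, reduceCtorEq,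
    if_false, if_true, hlen]
  refine ⟨by omega, hcap, ?_⟩
  refine wp_loop_frame (fun τ => ∃ Q P, l.reverse = Q ++ P ∧ τ.var .j = P.length ∧
    τ.var .tn = (Q.filter fun c => c.1 = f).length ∧ (Q.filter fun c => c.1 = f).length ≤ s ∧
    Seg (τ.mem d) 0 (Q.filter fun c => c.1 = f) ∧ (∀ ρ, ρ ≠ d → τ.mem ρ = mem₀ ρ) ∧
    τ.cache.cost + dueDown E τ.cache 5 a P.length + dueUp E τ.cache 6 d (τ.var .tn) ≤
      κ₀.cost + 8 * E.h + (2 * E.β + 4) * Q.length) (fun τ => τ.var .j) ?_ ?_ ?_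
  · refine ⟨[], l.reverse, rfl, by simp, by simp, by simp, Seg.nil, fun _ _ => rfl, ?_⟩
    have h₁ := dueDown_le (E := E) (κ := κ₀) (s := 5) (ρ := a) (i := l.reverse.length)
    have h₂ := dueUp_le (κ := κ₀) (s := 6) (ρ := d) (i := 0) hh
    simp only [update_apply, reduceCtorEq, if_false, if_true]
    omega
  · rintro ⟨V, acc, mem, κ⟩ ⟨Q, P, hQP, hj, htn, hle, hsegd, hmem, hcost⟩ hfr htest
    have hV : ∀ v ∈ [AVar.f, .s, .a, .d], V v = V₀ v := fun v hv =>
      (hfr v (by revert v; decide)).trans (by revert v; simp [update_apply])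
    have hVf := (hV .f (by decide)).trans hf
    have hVs := (hV .s (by decide)).trans hs
    have hVa := (hV .a (by decide)).trans ha
    have hVd := (hV .d (by decide)).trans hd
    dsimp only at hj htn hsegd hmem hcost
    simp only [aLang_test, Expr.eval_mul, Expr.eval_lt, Expr.eval_var, Expr.eval_zero, hj, htn,
      hVs] at htest
    have hlt : (Q.filter fun c => c.1 = f).length < s := by
      by_contra h
      rw [if_neg (c := _ < s) h, Nat.mul_zero] at htest
      exact htest rfl
    rcases P with _ | ⟨c, P⟩
    · simp at htest
    have hget : mem a P.length = c.enc := by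
      rw [hmem a had]
      refine Seg.reverse_get (P := Q) ?_
      rwa [← hQP, List.reverse_reverse]
    have hPl : Q.length + (P.length + 1) = l.length := by
      have := congrArg List.length hQP
      simpa using this.symm
    have hQl := List.length_filter_le (fun c : Cell => c.1 = f) Q
    have hsplit : l.reverse = (Q ++ [c]) ++ P := by rw [hQP]; simp
    rw [List.length_cons] at hj hcost
    have hb₁ := cost_touch_down (E := E) (κ := κ) (s := 5) (ρ := a) (i := P.length + 1)
    have hb₂ := dueDown_pred (κ := κ.touch E 5 (E.blk a P.length)) (s := 5) (ρ := a)
      (i := P.length + 1) hh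
    rw [Nat.add_sub_cancel] at hb₁ hb₂
    have hb₃ := dueUp_touch_of_ne (E := E) (κ := κ) (s := 5) (s' := 6) (X := E.blk a P.length)
      (ρ := d) (i := V .tn) (by omega)
    set κ₁ := κ.touch E 5 (E.blk a P.length) with hκ₁
    have hb₄ := cost_touch_up (E := E) (κ := κ₁) (s := 6) (ρ := d) (i := V .tn)
    have hb₅ := dueDown_touch_of_ne (E := E) (κ := κ₁) (s := 6) (s' := 5)
      (X := E.blk d (V .tn)) (ρ := a) (i := P.length) (by omega)
    have hb₆ := dueUp_succ (κ := κ₁.touch E 6 (E.blk d (V .tn))) (s := 6) (ρ := d) (i := V .tn) hh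
    have hmul : (2 * E.β + 4) * (Q ++ [c]).length =
      (2 * E.β + 4) * Q.length + (2 * E.β + 4) := by simp; ring
    rw [htn] at hb₃ hb₄ hb₅ hb₆ hcost
    have hcol := Bool.toNat_le_one c.1
    by_cases hcf : c.1 = f
    · have hfil : (Q ++ [c]).filter (fun c => c.1 = f) = Q.filter (fun c => c.1 = f) ++ [c] := by
        simp [List.filter_append, hcf]
      simp only [wp_seq, wp_set, wp_load, wp_store, wp_ite, wp_skip, aLang_test, Expr.eval_var,
        Expr.eval_one, Expr.eval_ofNat, Expr.eval_add, Expr.eval_sub, Expr.eval_eq,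
        update_apply, reduceCtorEq, if_false, if_true, hj, htn, hVf, hVa, hVd, Nat.add_sub_cancel,
        hget, Cell.enc, hcf, ← hκ₁]
      refine ⟨by omega, ⟨by omega, ha', by omega⟩, fun _ => ⟨⟨by omega, hd', by omega,
        hcf ▸ (by omega)⟩, by omega, ⟨Q ++ [c], P, hsplit, rfl, ?_, ?_, ?_, ?_, ?_⟩, by omega⟩,
        fun h => h.elim⟩
      · rw [hfil]; simp
      · rw [hfil]; simpa using hlt
      · rw [hfil, setMem_same, show (f.toNat, Word.key c.2) = c.enc by rw [Cell.enc, hcf]]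
        exact hsegd.snoc (Nat.zero_add _).symm
      · intro ρ hρ
        rw [setMem_of_ne _ hρ, hmem ρ hρ]
      · rw [hmul]; omega
    · have hfil : (Q ++ [c]).filter (fun c => c.1 = f) = Q.filter (fun c => c.1 = f) := by
        simp [List.filter_append, hcf]
      have hcf' : c.1.toNat ≠ f.toNat := fun e => hcf (toNat_injective e)
      simp only [wp_seq, wp_set, wp_load, wp_store, wp_ite, wp_skip, aLang_test, Expr.eval_var,
        Expr.eval_one, Expr.eval_ofNat, Expr.eval_add, Expr.eval_sub, Expr.eval_eq,
        update_apply, reduceCtorEq, if_false, if_true, hj, htn, hVf, hVa, hVd, Nat.add_sub_cancel,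
        hget, Cell.enc, hcf', ← hκ₁]
      refine ⟨by omega, ⟨by omega, ha', by omega⟩, fun h => absurd rfl h, fun _ =>
        ⟨⟨Q ++ [c], P, hsplit, rfl, ?_, ?_, ?_, hmem, ?_⟩, by omega⟩⟩
      · rw [hfil]
      · rw [hfil]; exact hle
      · rw [hfil]; exact hsegd
      · rw [hmul]; omega
  · rintro ⟨V, acc, mem, κ⟩ ⟨Q, P, hQP, hj, htn, hle, hsegd, hmem, hcost⟩ hfr htest
    have hV : ∀ v ∈ [AVar.s, .a, .d], V v = V₀ v := fun v hv =>
      (hfr v (by revert v; decide)).trans (by revert v; simp [update_apply])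
    have hVs := (hV .s (by decide)).trans hs
    have hVa := (hV .a (by decide)).trans ha
    have hVd := (hV .d (by decide)).trans hd
    dsimp only at hj htn hsegd hmem hcost
    simp only [aLang_test, Expr.eval_mul, Expr.eval_lt, Expr.eval_var, Expr.eval_zero, hj, htn,
      hVs] at htest
    have htop : topCells f s l = Q.filter fun c => c.1 = f := by
      rw [topCells, hQP, List.filter_append]
      rcases P with _ | ⟨c, P⟩
      · rw [List.filter_nil, List.append_nil, List.take_of_length_le hle]
      · have : (Q.filter fun c => c.1 = f).length = s := by
          by_contra h
          rw [if_pos (by simp), if_pos (by omega)] at htest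
          exact one_ne_zero htest
        rw [List.take_append_of_le_length this.ge, List.take_of_length_le hle]
    have hQl : Q.length ≤ l.length := by
      have := congrArg List.length hQP
      rw [List.length_reverse, List.length_append] at this
      omega
    have hmul : (2 * E.β + 4) * Q.length ≤ (2 * E.β + 4) * l.length := Nat.mul_le_mul_left _ hQl
    simp only [wp_seq, wp_set, Expr.eval_var, update_apply, reduceCtorEq, if_false, if_true, hVa,
      hVd, htop]
    exact ⟨by omega, by omega, by omega, htn, trivial, trivial, hsegd, hmem, by omega⟩

theorem Screen.topCells {l : List Cell} (h : SortedCells f l) : Screen f s (topCells f s l) := by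
  refine ⟨List.length_take_le _ _, topCells_color, ?_⟩
  exact ((List.pairwise_reverse.mpr h).sublist List.filter_sublist).sublist (List.take_sublist _ _)

-- The prefix A read so far is represented by T for counts up to s, and by Y for its dominating
-- cells. What is counted and what remains in Y add up to the pairs of A. A list of at most s cells
-- forms a single group, which is screened with empty T, so nothing is heavy; this ends the
-- iteration of passes.
open Classical in
theorem wp_screenPass {σ : AState} {X : List Cell} {L : ℕ} (hE : SortEnv E)
    (hV : σ.var .f = f.toNat) (hVx : σ.var .x = x) (hVy : σ.var .y = y) (hVs : σ.var .s = s)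
    (hVn : σ.var .n = X.length) (had : σ.var .a + σ.var .d = 5) (ha : σ.var .a < 4)
    (hd : σ.var .d < 4) (hx : x < 2) (hy : y < 2) (hxy : x ≠ y)
    (hseg : Seg (σ.mem x) 0 X.reverse) (hs : E.h ≤ s) (hL : 2 * s ≤ E.h * fanOf E.P ^ L)
    (hcap : (X.length + 4) * (fanOf E.P + E.h + 1) < E.cap) (hscap : s + 6 < E.cap)
    (hans : σ.var .ans + inv f X < E.cap) :
    Wp (aLang E) screenPass (fun τ => ∃ Y : List Cell, Seg (τ.mem y) 0 Y ∧
      τ.var .m = Y.length ∧ τ.var .hv = Y.countP (fun c => ¬ c.1 = f) ∧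
      Y.countP (fun c => c.1 = f) = X.countP (fun c => c.1 = f) ∧
      τ.var .ans + inv f Y = σ.var .ans + inv f X ∧ s * τ.var .hv ≤ inv f Y ∧
      (X.length ≤ s → τ.var .hv = 0) ∧
      τ.var .a + τ.var .d = 5 ∧ τ.var .a < 4 ∧ τ.var .d < 4 ∧
      τ.cache.cost ≤ σ.cache.cost + (L + 1) * (274 * X.length + 42 * E.h)) σ := by
  have hh := hE.h_pos
  have hk := two_le_fanOf E.P
  have hst := hE.streams
  have hβ : E.β ≤ 1 := by nlinarith [hE.access]
  have hmul : (X.length + 4) * (fanOf E.P + E.h + 1) =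
    (X.length + 1) * (fanOf E.P + E.h + 1) + 3 * (fanOf E.P + E.h + 1) := by ring
  have hmul' : X.length + 1 ≤ (X.length + 1) * (fanOf E.P + E.h + 1) :=
    Nat.le_mul_of_pos_right _ (by omega)
  obtain ⟨V₀, acc₀, mem₀, κ₀⟩ := σ
  dsimp only at hV hVx hVy hVs hVn had ha hd hseg hans ⊢
  simp only [screenPass, wp_seq, wp_set, Expr.eval_var, Expr.eval_zero, update_apply, reduceCtorEq,
    if_false, if_true, hVn]
  refine ⟨by omega, by omega, by omega, by omega, ?_⟩
  refine wp_loop_frame (fun τ => ∃ A R Y T, A ++ R = X ∧ τ.var .i = R.length ∧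
    Seg (τ.mem x) 0 X.reverse ∧ Seg (τ.mem y) 0 Y ∧ Seg (τ.mem (τ.var .a)) 0 T ∧
    τ.var .m = Y.length ∧ τ.var .tn = T.length ∧ Screen f s T ∧ TopEq f s T A ∧
    T.length ≤ A.length ∧ (∀ B, cross f Y B = cross f A B) ∧ Y.length ≤ A.length ∧
    τ.var .hv = Y.countP (fun c => ¬ c.1 = f) ∧
    Y.countP (fun c => c.1 = f) = A.countP (fun c => c.1 = f) ∧
    τ.var .ans + inv f Y = V₀ .ans + inv f A ∧ s * τ.var .hv ≤ inv f Y ∧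
    (X.length ≤ s → τ.var .hv = 0) ∧
    τ.var .a + τ.var .d = 5 ∧ τ.var .a < 4 ∧ τ.var .d < 4 ∧
    τ.cache.cost ≤ κ₀.cost + (L + 1) * (200 * A.length +
      if R = [] then 42 * E.h + 74 * X.length else 0)) (fun τ => τ.var .i) ?_ ?_ ?_
  · refine ⟨[], X, [], [], rfl, ?_, hseg, Seg.nil, Seg.nil, ?_, ?_, ⟨by simp, by simp,
      List.Pairwise.nil⟩, fun _ => rfl, le_rfl, fun _ => rfl, le_rfl, ?_, rfl, ?_, ?_, ?_, ?_, ?_,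
      ?_, ?_⟩ <;> simp [update_apply, *]
  · rintro ⟨V, acc, mem, κ⟩ ⟨A, R, Y, T, hAR, hi, hsegx, hsegy, hsega, hm, htn, hT, hTA, hTl, hYA,
      hYl, hhv, hcnt, hans', hshv, hsmall, had', ha', hd', hcost⟩ hfr htest
    dsimp only at hi hsegx hsegy hsega hm htn hhv hans' hshv hsmall had' ha' hd' hcost
    have hvV : ∀ v ∈ [AVar.f, .x, .y, .s], V v = V₀ v := fun v hv =>
      (hfr v (by revert v; decide)).trans (by revert v; simp [update_apply])
    have hVf := (hvV .f (by decide)).trans hV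
    have hVx := (hvV .x (by decide)).trans hVx
    have hVy := (hvV .y (by decide)).trans hVy
    have hVs := (hvV .s (by decide)).trans hVs
    have hRpos : 0 < R.length := by
      simp only [aLang_test, Expr.eval_var, hi] at htest
      omega
    have hARl : A.length + R.length = X.length := by rw [← hAR, List.length_append]
    obtain ⟨a, hVa⟩ : ∃ a, V .a = a := ⟨_, rfl⟩
    obtain ⟨d, hVd⟩ : ∃ d, V .d = d := ⟨_, rfl⟩
    rw [hVa] at hsega ha' had'
    rw [hVd] at hd' had'
    have hvle : V .hv ≤ A.length := by
      rw [hhv]; exact List.countP_le_length.trans hYl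
    simp only [wp_seq (p := .prim _), wp_set, Expr.eval_var, Expr.eval_zero, update_apply,
      reduceCtorEq, if_false, if_true, htn]
    refine ⟨by omega, by omega, ?_⟩
    rw [wp_seq]
    have hV₁ : ScreenVars (update (update V .len T.length) .g 0) f x y a s T.length := by
      constructor <;> simp [update_apply, *]
    have hgroup := (wp_screenGroup (σ := ⟨update (update V .len T.length) .g 0, acc, mem, κ⟩)
      (A := A) (R := R) (Y := Y) (n := X.length) hh hT (by omega) hV₁ hx hy hxy (by omega) ha'
      (by simp [update_apply, hi]) (by simp [update_apply]) (by simp [update_apply, hm])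
      (by simp [update_apply]) (by simp [update_apply]) (hAR ▸ hsegx) hsegy hsega hARl
      hYl hTl hvle (by omega) (by omega)).frame
    refine hgroup.mono ?_
    rintro σ₁ ⟨⟨hσ₁, hc₁⟩, hfr₁⟩
    obtain ⟨G, hG⟩ : ∃ G, G = R.take s := ⟨_, rfl⟩
    rw [← hG] at hσ₁ hc₁
    dsimp only at hc₁
    have hGl : G.length = min s R.length := by rw [hG, List.length_take]
    have hRl : R.length - G.length = (R.drop s).length := by rw [hGl, List.length_drop]; omega
    have hV₁' := hV₁.frame hfr₁ (by decide)
    have hVd₁ : σ₁.var .d = d := (hfr₁ .d (by decide)).trans (by simp [update_apply, hVd])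
    have hVans₁ : σ₁.var .ans = V .ans := (hfr₁ .ans (by decide)).trans (by simp [update_apply])
    have hkl := length_kept_le (f := f) (s := s) (T := T) G
    have hcl := length_counted_le (f := f) (s := s) (T := T) G
    have hTs := hT.length
    have hscreen := inv_screen (G := G) (Y := Y) hTA hT.length (inv_eq_zero_of_color hT.color) hYA
    -- Together with `hscreen` this bounds the counter during the sort, so that it stays a legal
    -- number.
    have hXle : inv f (A ++ G) ≤ inv f X := by
      rw [← hAR, ← List.take_append_drop s R, ← hG, ← List.append_assoc, inv_append (A := A ++ G)]
      omega
    have hlenl : (T ++ counted f s T G).length ≤ X.length := by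
      rw [List.length_append]; omega
    rw [wp_seq]
    have hmulc : ((T ++ counted f s T G).length + 1) * (fanOf E.P + E.h + 1) ≤
      (X.length + 1) * (fanOf E.P + E.h + 1) := Nat.mul_le_mul_right _ (by omega)
    have hsort := (wp_sortCells (L := L) hE hV₁'.f hV₁'.a hVd₁ hσ₁.len had' ha' hd' rfl hσ₁.seg_a
      (by omega) (by omega) (by omega) (by rw [List.length_append]; omega)).frame
    refine hsort.mono ?_
    rintro σ₂ ⟨⟨l, hperm, hsorted, hseg₂, had₂, ha₂, hd₂, hans₂, hmem₂, hc₂⟩, hfr₂⟩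
    have hv₂ : ∀ v ∈ [AVar.f, .s, .len, .i, .m, .hv], σ₂.var v = σ₁.var v := fun v hv =>
      hfr₂ v (by revert v; decide)
    have htop := (wp_takeTop (σ := σ₂) (l := l) hh ((hv₂ _ (by decide)).trans hV₁'.f)
      ((hv₂ _ (by decide)).trans hV₁'.s) rfl rfl
      ((hv₂ _ (by decide)).trans (hσ₁.len.trans hperm.length_eq.symm)) hseg₂ (by omega) (by omega)
      (by omega) (by omega) (by rw [hperm.length_eq]; omega) (by omega)).frame
    refine htop.mono ?_
    rintro ⟨V₃, acc₃, mem₃, κ₃⟩ ⟨⟨htn₃, ha₃, hd₃, hseg₃, hmem₃, hc₃⟩, hfr₃⟩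
    have hv₃ : ∀ v ∈ [AVar.i, .m, .hv, .ans], V₃ v = σ₂.var v := fun v hv =>
      hfr₃ v (by revert v; decide)
    have hi₃ := (hv₃ .i (by decide)).trans ((hv₂ .i (by decide)).trans hσ₁.i)
    have hm₃ := (hv₃ .m (by decide)).trans ((hv₂ .m (by decide)).trans hσ₁.m)
    have hhv₃ := (hv₃ .hv (by decide)).trans ((hv₂ .hv (by decide)).trans hσ₁.hv)
    have hans₃ := (hv₃ .ans (by decide)).trans hans₂
    have hmemρ : ∀ ρ < 2, mem₃ ρ = σ₁.mem ρ := fun ρ hρ =>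
      (hmem₃ ρ (by omega)).trans (hmem₂ ρ hρ)
    dsimp only at htn₃ ha₃ hd₃ hseg₃ hc₃ hi₃ hm₃ hhv₃ hans₃
    have hcntY : (Y ++ kept f s T G).countP (fun c => ¬ c.1 = f) = V₃ .hv := by
      rw [hhv₃, List.countP_append, hhv]
    have hmulkept : s * (kept f s T G).countP (fun c => ¬ c.1 = f) ≤
      cross f Y (kept f s T G) := mul_countP_kept_le hTA hYA
    refine ⟨⟨A ++ G, R.drop s, Y ++ kept f s T G, topCells f s l, ?_, ?_, ?_, ?_, ?_, hm₃, htn₃,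
      Screen.topCells hsorted, (hTA.append G).topCells hperm hsorted, ?_, ?_, ?_, hcntY.symm, ?_,
      ?_, ?_, ?_, ?_, ?_, ?_, ?_⟩, ?_⟩
    · rw [List.append_assoc, hG, List.take_append_drop, hAR]
    · exact hi₃.trans hRl
    · dsimp only; rw [hmemρ x hx, hσ₁.mem x hxy (by omega)]; exact hsegx
    · dsimp only; rw [hmemρ y hy]; exact hσ₁.seg_y
    · dsimp only; rw [ha₃]; exact hseg₃
    · have h₁ : (topCells f s l).length ≤ l.length :=
        (List.length_take_le' _ _).trans ((List.length_filter_le _ _).trans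
          (List.length_reverse).le)
      rw [hperm.length_eq, List.length_append] at h₁
      rw [List.length_append]; omega
    · intro B
      rw [cross_append_left, cross_append_left, hYA, kept]
      congr 1
      convert cross_filter_left (A := G) (fun c => c.1 = f ∨ Heavy f s T c)
        fun y _ hy => Or.inl hy
    · rw [List.length_append, List.length_append]; omega
    · rw [List.countP_append, List.countP_append, hcnt, kept, List.countP_filter]
      congr 1
      refine List.countP_congr fun c _ => ?_
      simp only [Bool.and_eq_true, decide_eq_true_eq]
      exact ⟨fun h => h.1, fun h => ⟨h, Or.inl h⟩⟩
    · dsimp only; omega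
    · dsimp only
      rw [hhv₃, Nat.mul_add, inv_append (A := Y)]
      omega
    · intro hXs
      dsimp only
      rw [hhv₃, hsmall hXs, Nat.zero_add, List.countP_eq_zero]
      intro c hc
      rw [kept, List.mem_filter] at hc
      have := not_heavy (f := f) (s := s) (T := T) (by omega) c
      simpa [this] using hc.2
    · dsimp only; omega
    · dsimp only; omega
    · dsimp only; omega
    · dsimp only
      rw [if_neg (by rintro rfl; simp at hRpos), Nat.add_zero (200 * _)] at hcost
      rw [hperm.length_eq] at hc₃
      obtain ⟨len, hlen⟩ : ∃ len, len = (T ++ counted f s T G).length := ⟨_, rfl⟩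
      have hlen' : len ≤ T.length + G.length := by rw [hlen, List.length_append]; omega
      rw [← hlen] at hc₂ hc₃ hlenl
      have h₁ : (4 * E.β + 6) * G.length ≤ 10 * G.length := Nat.mul_le_mul_right _ (by omega)
      have h₂ : (2 * E.β + 4) * len ≤ 6 * len := Nat.mul_le_mul_right _ (by omega)
      -- Sums of the costs of screening, sorting and extracting: 42 = 14 + 20 + 8 and 74 = 68 + 6. A
      -- complete group has s ≥ h cells and the sorted list at most 2 * s, hence 200 = 42 + 10 + 2 *
      -- 74; only the last group needs the additional term.
      have h₃ : 42 * E.h + 10 * G.length + 74 * len ≤ 200 * G.length +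
          (if R.drop s = [] then 42 * E.h + 74 * X.length else 0) := by
        split_ifs with hR
        · omega
        · rw [List.drop_eq_nil_iff] at hR
          omega
      have h₄ := Nat.mul_le_mul_left (L + 1) h₃
      have h₅ : (L + 1) * (42 * E.h + 10 * G.length + 74 * len) =
        (L + 1) * (68 * len + 20 * E.h) + L * (22 * E.h + 10 * G.length + 6 * len) +
          (22 * E.h + 10 * G.length + 6 * len) := by ring
      have h₆ : (L + 1) * (200 * (A ++ G).length +
          if R.drop s = [] then 42 * E.h + 74 * X.length else 0) = (L + 1) * (200 * A.length) +
          (L + 1) * (200 * G.length + if R.drop s = [] then 42 * E.h + 74 * X.length else 0) := by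
        rw [List.length_append]; ring
      omega
    · dsimp only; omega
  · rintro ⟨V, acc, mem, κ⟩ ⟨A, R, Y, T, hAR, hi, hsegx, hsegy, hsega, hm, htn, hT, hTA, hTl, hYA,
      hYl, hhv, hcnt, hans', hshv, hsmall, had', ha', hd', hcost⟩ hfr htest
    dsimp only at hi hsegx hsegy hm hhv hans' hshv hsmall had' ha' hd' hcost
    simp only [aLang_test, Expr.eval_var, hi, List.length_eq_zero_iff] at htest
    subst htest
    rw [List.append_nil] at hAR
    subst hAR
    rw [if_pos rfl] at hcost
    refine ⟨Y, hsegy, hm, hhv, hcnt, hans', hshv, hsmall, had', ha', hd', hcost.trans_eq ?_⟩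
    ring

end

/-! ### The input as a list of cells -/

/-- The points from left to right; blue has the colour `false`. -/
def interleave (b r : ℕ → ℝ) : ℕ → List Cell
  | 0 => []
  | n + 1 => interleave b r n ++ [(false, b n), (true, r n)]

section interleave

variable (b r : ℕ → ℝ)

theorem length_interleave (n : ℕ) : (interleave b r n).length = 2 * n := by
  induction n with
  | zero => rfl
  | succ n ih => rw [interleave, List.length_append, ih]; simp; omega

theorem countP_interleave (c : Bool) (n : ℕ) :
    (interleave b r n).countP (fun x => x.1 = c) = n := by
  induction n with
  | zero => rfl
  | succ n ih => rw [interleave, List.countP_append, ih]; cases c <;> simp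

open Classical in
theorem countP_bad_interleave (y : ℝ) (n : ℕ) :
    (interleave b r n).countP (fun x => Bad true x (false, y)) =
      ∑ i ∈ Finset.range n, if y < r i then 1 else 0 := by
  induction n with
  | zero => rfl
  | succ n ih =>
    rw [interleave, List.countP_append, ih, Finset.sum_range_succ]
    congr 1
    simp [Bad, List.countP_cons]

/-- Blue precedes red at the same abscissa, so points with equal first coordinate form no pair, as
domination requires. -/
theorem inv_interleave (n : ℕ) : inv true (interleave b r n) =
    ∑ j ∈ Finset.range n, ∑ i ∈ Finset.range j, if b j < r i then 1 else 0 := by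
  classical
  induction n with
  | zero => rfl
  | succ n ih =>
    have h₁ : inv true [(false, b n), (true, r n)] = 0 := by simp [inv, Bad]
    have h₂ : cross true (interleave b r n) [(true, r n)] = 0 :=
      cross_eq_zero fun y _ x hx hb => hb.2.1 (by rw [List.mem_singleton] at hx; rw [hx])
    rw [interleave, inv_append, ih, h₁, Finset.sum_range_succ,
      show [(false, b n), (true, r n)] = [(false, b n)] ++ [(true, r n)] from rfl,
      cross_append_right, h₂, cross_singleton_right, countP_bad_interleave]
    simp

end interleave

/-- Extension of a finite list by zeros. -/
noncomputable def extend {N : ℕ} (L : Fin N → ℝ) (i : ℕ) : ℝ := if h : i < N then L ⟨i, h⟩ else 0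

theorem dominationCount_eq {N : ℕ} (red blue : Fin N → ℝ) :
    dominationCount red blue = inv true (interleave (extend blue) (extend red) N) := by
  classical
  rw [dominationCount, Nat.card_eq_fintype_card, Fintype.card_subtype, Finset.card_filter,
    Fintype.sum_prod_type_right, inv_interleave]
  rw [← Fin.sum_univ_eq_sum_range (fun j => ∑ i ∈ Finset.range j,
    if extend blue j < extend red i then 1 else 0)]
  refine Finset.sum_congr rfl fun j _ => ?_
  calc (∑ i : Fin N, if (i, j).1 < (i, j).2 ∧ blue (i, j).2 < red (i, j).1 then 1 else 0)
      = ∑ i : Fin N, (fun i : ℕ => if i < j.1 ∧ extend blue j < extend red i then 1 else 0) i :=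
        Finset.sum_congr rfl fun i _ => by simp [extend]
    _ = ∑ i ∈ Finset.range N, if i < j.1 ∧ extend blue j < extend red i then 1 else 0 :=
        Fin.sum_univ_eq_sum_range
          (fun i => if i < j.1 ∧ extend blue j < extend red i then 1 else 0) N
    _ = ∑ i ∈ Finset.range j, if i < j.1 ∧ extend blue j < extend red i then 1 else 0 :=
        (Finset.sum_subset (Finset.range_subset_range.2 j.2.le) fun i _ hi =>
          if_neg fun h => hi (Finset.mem_range.2 h.1)).symm
    _ = _ := Finset.sum_congr rfl fun i hi => by simp [Finset.mem_range.1 hi]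

/-! ### The complete program -/

/-- Store the input as one list of cells in the region `0`. -/
def loadInput : Stmt AVar AInstr :=
  .i ≔ 0 ;;
  .loop ((rd .i).lt (par 0))
    (.prim (.raw 1 (blocksE * strideE + (rd .i / par 2 * strideE + rd .i % par 2))) ;;
     .prim (.store 0 0 (2 * rd .i) 0) ;;
     .prim (.raw 2 (rd .i / par 2 * strideE + rd .i % par 2)) ;;
     .prim (.store 0 0 (2 * rd .i + 1) 1) ;;
     .i ≔ rd .i + 1)

/-- The initial number of dominating cells that serve to recognize heavy cells. -/
def screenSize (P : Params) : ℕ :=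
  -- With s > K/N, a number of heavy cells above N would prove that K is exceeded. The bound N keeps
  -- s a legal number when K is huge, and at least h cells make a group fill a block.
  max (cellsOf P) (min (paramAt P 3 / paramAt P 0 + 1) (paramAt P 0))

/-- The heavy cells lie in at least `hv * s` pairs, which never exceeds N * N; hence the test can
succeed only if K is exceeded. Otherwise the kept list, written upwards, is read downwards in the
next pass, that is, reversed and with exchanged colours. -/
def screenLoop : Stmt AVar AInstr :=
  .loop (rd .hv)
    (screenPass ;;
     .ite (((par 3).min (par 0 * par 0)).lt (rd .hv * rd .s)) (.fail ≔ 1 ;; .hv ≔ 0)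
       (.n ≔ rd .m ;; .t ≔ rd .x ;; .x ≔ rd .y ;; .y ≔ rd .t ;; .f ≔ 1 - rd .f ;;
        .s ≔ 2 * rd .s))

/-- Region 0 holds the points from left to right and is read backwards, so blue is the dominating
colour of the first pass. The value 1 of `hv` only lets the loop start. -/
def countDomination : Stmt AVar AInstr :=
  loadInput ;;
  .n ≔ 2 * par 0 ;; .s ≔ cellsE.max ((par 3 / par 0 + 1).min (par 0)) ;;
  .a ≔ 2 ;; .d ≔ 3 ;; .x ≔ 0 ;; .y ≔ 1 ;; .f ≔ 0 ;; .hv ≔ 1 ;; .ans ≔ 0 ;; .fail ≔ 0 ;;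
  screenLoop ;;
  .out ≔ (1 - rd .fail) * (rd .ans + 1)

/-! ### Loading the input -/

/-- Potential of a stream that reads an input list. -/
def dueRaw (E : AEnv) (κ : Cache) (s B st base i : ℕ) : ℕ :=
  due E κ s (E.rawBlk (base + (i / B * st + i % B))) + (base + (i / B * st + i % B)) % (2 * E.h) +
    2 * (i % B)

section

variable {E : AEnv} {κ : Cache} {s s' X B st base i : ℕ}

theorem dueRaw_touch_of_ne (h : s' ≠ s) :
    dueRaw E (κ.touch E s X) s' B st base i = dueRaw E κ s' B st base i := by
  simp only [dueRaw, due_touch_of_ne h]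

theorem cost_touch_raw (κ : Cache) :
    (κ.touch E s (E.rawBlk (base + (i / B * st + i % B)))).cost +
      dueRaw E (κ.touch E s (E.rawBlk (base + (i / B * st + i % B)))) s B st base i ≤
    κ.cost + dueRaw E κ s B st base i + E.β := by
  have := cost_touch_self (E := E) (κ := κ) (s := s)
    (X := E.rawBlk (base + (i / B * st + i % B)))
  simp only [dueRaw]; omega

/-- Of the 3 units for a word, one is saved for the end of the current block of `2 * h` words. The
other two are saved for the jump over the padding at the end of an input block; as h ≤ B, they
suffice to load the block behind it. -/
theorem dueRaw_succ (hh : 0 < E.h) (hB : E.h ≤ B) (hst : 2 * E.h ∣ st) (hbase : 2 * E.h ∣ base) :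
    dueRaw E κ s B st base (i + 1) ≤ dueRaw E κ s B st base i + 3 := by
  simp only [dueRaw]
  have hdue := due_le (E := E) (κ := κ) (s := s)
    (X := E.rawBlk (base + ((i + 1) / B * st + (i + 1) % B)))
  rcases succ_div_mod (i := i) (show 0 < B by omega) with ⟨h₁, h₂⟩ | ⟨h₁, h₂, h₃⟩
  · have : (base + ((i + 1) / B * st + (i + 1) % B)) % (2 * E.h) = 0 := by
      rw [h₂, Nat.add_zero]
      exact Nat.mod_eq_zero_of_dvd (dvd_add hbase (Dvd.dvd.mul_left hst _))
    omega
  · obtain ⟨w, hw⟩ : ∃ w, w = base + (i / B * st + i % B) := ⟨_, rfl⟩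
    have hw' : base + ((i + 1) / B * st + (i + 1) % B) = w + 1 := by rw [h₂, h₃, hw]; omega
    rw [hw'] at hdue ⊢
    rw [← hw, h₂]
    rcases succ_div_mod (i := w) (show 0 < 2 * E.h by omega) with ⟨h₄, h₅⟩ | ⟨h₄, h₅, h₆⟩
    · omega
    · rw [AEnv.rawBlk, AEnv.rawBlk, h₅, h₆]; omega

theorem wp_loadInput {b r : ℕ → ℝ} {N : ℕ} {σ : AState} (hh : 0 < E.h) (hN : N = paramAt E.P 0)
    (hB : E.h ≤ paramAt E.P 2) (hst : 2 * E.h ∣ strideOf E.P) (hβ : E.β ≤ 1)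
    (hb : ∀ i < N, E.raw (blocksOf E.P * strideOf E.P +
      (i / paramAt E.P 2 * strideOf E.P + i % paramAt E.P 2)) = .key (b i))
    (hr : ∀ i < N, E.raw (0 + (i / paramAt E.P 2 * strideOf E.P + i % paramAt E.P 2)) = .key (r i))
    (hF : 8 ≤ E.F) (hcap : 2 * N + 4 < E.cap)
    (hcap' : ∀ i < N, blocksOf E.P * strideOf E.P +
      (i / paramAt E.P 2 * strideOf E.P + i % paramAt E.P 2) < E.cap) :
    Wp (aLang E) loadInput (fun τ => Seg (τ.mem 0) 0 (interleave b r N) ∧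
      τ.cache.cost ≤ σ.cache.cost + 8 * E.h + 14 * N) σ := by
  obtain ⟨V₀, acc₀, mem₀, κ₀⟩ := σ
  obtain ⟨B, hBe⟩ : ∃ B, B = paramAt E.P 2 := ⟨_, rfl⟩
  obtain ⟨st, hste⟩ : ∃ st, st = strideOf E.P := ⟨_, rfl⟩
  obtain ⟨nb, hnb⟩ : ∃ nb, nb = blocksOf E.P := ⟨_, rfl⟩
  rw [← hBe] at hB
  rw [← hste] at hst
  simp only [← hBe, ← hste, ← hnb] at hb hr hcap'
  simp only [loadInput, wp_seq, wp_set, Expr.eval_zero]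
  refine ⟨by omega, ?_⟩
  refine wp_for_frame (fun i τ => τ.var .i = i ∧ Seg (τ.mem 0) 0 (interleave b r i) ∧
    τ.cache.cost + dueRaw E τ.cache 1 B st (nb * st) i + dueRaw E τ.cache 2 B st 0 i +
      dueUp E τ.cache 0 0 (2 * i) ≤ κ₀.cost + 8 * E.h + 14 * i) N ?_ ?_ ?_
  · refine ⟨by simp, Seg.nil, ?_⟩
    have h₁ : ∀ s base, 2 * E.h ∣ base → dueRaw E κ₀ s B st base 0 ≤ 2 * E.h := by
      intro s base hbase
      have := due_le (E := E) (κ := κ₀) (s := s) (X := E.rawBlk (base + (0 / B * st + 0 % B)))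
      simp only [dueRaw]
      rw [Nat.zero_div, Nat.zero_mul, Nat.zero_mod, Nat.add_zero, Nat.add_zero,
        Nat.mod_eq_zero_of_dvd hbase] at *
      omega
    have h₂ := h₁ 1 (nb * st) (Dvd.dvd.mul_left hst _)
    have h₃ := h₁ 2 0 (dvd_zero _)
    have h₄ := dueUp_le (κ := κ₀) (s := 0) (ρ := 0) (i := 2 * 0) hh
    dsimp only
    omega
  · rintro i ⟨V, acc, mem, κ⟩ hi ⟨hVi, hseg, hcost⟩ hfr
    dsimp only at hVi hseg hcost
    have hcap'' := hcap' i hi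
    have hbi := hb i hi
    have hri := hr i hi
    rw [Nat.zero_add] at hri
    obtain ⟨w, hw⟩ : ∃ w, w = i / B * st + i % B := ⟨_, rfl⟩
    have hb₁ := cost_touch_raw (E := E) (s := 1) (B := B) (st := st) (base := nb * st) (i := i) κ
    have hb₁' := dueRaw_touch_of_ne (E := E) (κ := κ) (s := 1) (s' := 2)
      (X := E.rawBlk (nb * st + (i / B * st + i % B))) (B := B) (st := st) (base := 0) (i := i)
      (by omega)
    have hb₁'' := dueUp_touch_of_ne (E := E) (κ := κ) (s := 1) (s' := 0)
      (X := E.rawBlk (nb * st + (i / B * st + i % B))) (ρ := 0) (i := 2 * i) (by omega)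
    rw [← hw] at hb₁ hb₁' hb₁'' hcap'' hbi hri
    set κ₁ := κ.touch E 1 (E.rawBlk (nb * st + w)) with hκ₁
    have hb₂ := cost_touch_up (E := E) (κ := κ₁) (s := 0) (ρ := 0) (i := 2 * i)
    set κ₂ := κ₁.touch E 0 (E.blk 0 (2 * i)) with hκ₂
    have hb₂' : dueRaw E κ₂ 1 B st (nb * st) i = _ := dueRaw_touch_of_ne (by omega)
    have hb₂'' : dueRaw E κ₂ 2 B st 0 i = _ := dueRaw_touch_of_ne (by omega)
    have hb₃ := cost_touch_raw (E := E) (s := 2) (B := B) (st := st) (base := 0) (i := i) κ₂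
    rw [← hw, Nat.zero_add] at hb₃
    set κ₃ := κ₂.touch E 2 (E.rawBlk w) with hκ₃
    have hb₃' : dueRaw E κ₃ 1 B st (nb * st) i = _ := dueRaw_touch_of_ne (by omega)
    have hb₃'' : dueUp E κ₃ 0 0 (2 * i) = _ := dueUp_touch_of_ne (by omega)
    have hb₄ := dueUp_succ (κ := κ₃) (s := 0) (ρ := 0) (i := 2 * i) hh
    have hb₅ := cost_touch_up (E := E) (κ := κ₃) (s := 0) (ρ := 0) (i := 2 * i + 1)
    set κ₄ := κ₃.touch E 0 (E.blk 0 (2 * i + 1)) with hκ₄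
    have hb₅' : dueRaw E κ₄ 1 B st (nb * st) i = _ := dueRaw_touch_of_ne (by omega)
    have hb₅'' : dueRaw E κ₄ 2 B st 0 i = _ := dueRaw_touch_of_ne (by omega)
    have hb₆ := dueRaw_succ (κ := κ₄) (s := 1) (i := i) hh hB hst (Dvd.dvd.mul_left hst nb)
    have hb₇ := dueRaw_succ (κ := κ₄) (s := 2) (i := i) hh hB hst (dvd_zero _)
    have hb₈ := dueUp_succ (κ := κ₄) (s := 0) (ρ := 0) (i := 2 * i + 1) hh
    simp only [aLang_test, wp_seq, wp_set, wp_raw, wp_store, Expr.eval_var, Expr.eval_zero,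
      Expr.eval_one, Expr.eval_ofNat, Expr.eval_add, Expr.eval_mul, Expr.eval_div, Expr.eval_mod,
      Expr.eval_lt, Expr.eval_par, eval_blocksE, eval_strideE, hVi, ← hN, ← hBe, ← hste, ← hnb,
      ← hw, if_pos hi, hbi, hri, ← hκ₁, ← hκ₂, ← hκ₃, ← hκ₄]
    refine ⟨one_ne_zero, ⟨by omega, by omega⟩, ⟨by omega, by omega, by omega, by omega⟩,
      ⟨by omega, by omega⟩, ⟨by omega, by omega, by omega, by omega⟩, by omega, by simp, ?_, ?_⟩
    · have h₁ : Seg (setMem mem 0 (2 * i) (0, Word.key (b i)) 0) 0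
          (interleave b r i ++ [(false, b i)]) := by
        rw [setMem_same]
        exact hseg.snoc (c := (false, b i)) (by rw [length_interleave, Nat.zero_add])
      rw [setMem_same, interleave, show interleave b r i ++ [(false, b i), (true, r i)] =
        (interleave b r i ++ [(false, b i)]) ++ [(true, r i)] by simp]
      exact h₁.snoc (c := (true, r i)) (by rw [List.length_append, length_interleave]; simp)
    · rw [show 2 * (i + 1) = 2 * i + 1 + 1 by ring]
      omega
  · rintro τ ⟨hVi, hseg, hcost⟩ hfr
    refine ⟨?_, hseg, by omega⟩
    simp only [aLang_test, Expr.eval_lt, Expr.eval_var, Expr.eval_par, hVi, ← hN, lt_irrefl,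
      if_false]

end

/-! ### Correctness and cost of the complete program -/

/-! ### Number of heavy cells and total cost of the passes -/

section

/-- If hv * 2 ^ p exceeded N, then multiplying it by s₀ would exceed K when s₀ > K/N, and N * N when
s₀ ≥ N. -/
theorem mul_pow_le_of_screen {N K hv s₀ p : ℕ} (hs : min (K / N + 1) N ≤ s₀) (h₀ : 0 < s₀)
    (h : hv * (s₀ * 2 ^ p) ≤ min K (N * N)) : hv * 2 ^ p ≤ N := by
  have h' : s₀ * (hv * 2 ^ p) ≤ min K (N * N) := by
    rwa [Nat.mul_left_comm]
  obtain ⟨z, hz⟩ : ∃ z, z = hv * 2 ^ p := ⟨_, rfl⟩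
  rw [← hz] at h' ⊢
  by_contra hlt
  rw [not_le] at hlt
  rcases Nat.eq_zero_or_pos N with rfl | hN
  · have := Nat.mul_pos h₀ hlt
    omega
  · rcases min_le_iff.mp hs with h₁ | h₁
    · have h₂ := Nat.mul_le_mul h₁ hlt.le
      have h₃ := Nat.lt_div_mul_add (a := K) hN
      have h₄ : (K / N + 1) * N = K / N * N + N := by ring
      omega
    · have h₂ := Nat.mul_le_mul h₁ (Nat.succ_le_of_lt hlt)
      have h₄ : N * (N + 1) = N * N + N := by ring
      rw [Nat.succ_eq_add_one] at h₂
      omega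

/-- Telescoping of the costs of the passes. -/
theorem pass_cost_le {c c' c₁ h N Λ p n : ℕ}
    (hc : 2 ^ p * c + 4296 * N * (Λ + p + 3) ≤
      2 ^ p * (c₁ + 42 * h * (Λ + 2)) + 2 ^ p * (4296 * N * (Λ + 3)))
    (hc₀ : p = 0 → c ≤ c₁) (hn : n * 2 ^ p ≤ 6 * N) (hp : p = 0 ∨ h * 2 ^ p ≤ 12 * N)
    (hpass : c' ≤ c + (Λ + p + 1 + 1) * (274 * n + 42 * h)) :
    2 ^ (p + 1) * c' + 4296 * N * (Λ + (p + 1) + 3) ≤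
      2 ^ (p + 1) * (c₁ + 42 * h * (Λ + 2)) + 2 ^ (p + 1) * (4296 * N * (Λ + 3)) := by
  -- Divided by 2 ^ p, the term 4296 * N * (Λ + p + 3) is the sum of 2148 * N * (Λ + q + 2) / 2 ^ q
  -- over all q ≥ p, that is, a reserve for all passes to come. In the first pass h may be large
  -- compared with N, so its share 42 * h * (Λ + 2) is listed separately.
  rcases hp with rfl | hp
  · have := hc₀ rfl
    simp only [pow_zero, Nat.mul_one, Nat.one_mul, Nat.zero_add, Nat.add_zero, pow_one] at *
    have h₁ : (Λ + 1 + 1) * (274 * n + 42 * h) ≤ (Λ + 1 + 1) * (1644 * N + 42 * h) :=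
      Nat.mul_le_mul_left _ (by omega)
    nlinarith
  -- Here 2148 = 274 * 6 + 42 * 12.
  · have h₁ : 2 ^ p * ((Λ + p + 1 + 1) * (274 * n + 42 * h)) ≤
        (Λ + p + 2) * (2148 * N) := by
      calc _ = (Λ + p + 2) * (274 * (n * 2 ^ p) + 42 * (h * 2 ^ p)) := by ring
        _ ≤ _ := Nat.mul_le_mul_left _ (by omega)
    have h₂ := Nat.mul_le_mul_left (2 ^ p) hpass
    rw [Nat.mul_add] at h₂
    have h₃ : (Λ + p + 2) * (2148 * N) = 2148 * (N * (Λ + p)) + 4296 * N := by ring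
    have h₄ : 4296 * N * (Λ + p + 3) = 4296 * (N * (Λ + p)) + 12888 * N := by ring
    have h₅ : 4296 * N * (Λ + (p + 1) + 3) = 4296 * (N * (Λ + p)) + 17184 * N := by ring
    rw [h₄] at hc
    have h₆ : ∀ z, 2 ^ (p + 1) * z = 2 * (2 ^ p * z) := fun z => by ring
    rw [h₅, h₆, h₆, h₆]
    omega

variable {E : AEnv} {N K s₀ Λ D c₁ : ℕ}

/-- Invariant of the main loop; `p` passes are complete. -/
structure ScreenLoop (E : AEnv) (N K s₀ Λ D c₁ p : ℕ) (f : Bool) (X : List Cell) (τ : AState) :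
    Prop where
  flag : τ.var .f = f.toNat
  xy : τ.var .x + τ.var .y = 1
  seg : Seg (τ.mem (τ.var .x)) 0 X.reverse
  n : τ.var .n = X.length
  ans : τ.var .ans + inv f X = D
  s : τ.var .s = s₀ * 2 ^ p
  own : X.countP (fun c => c.1 = f) * 2 ^ p ≤ 2 * N
  other : X.countP (fun c => ¬ c.1 = f) * 2 ^ p ≤ 4 * N
  ad : τ.var .a + τ.var .d = 5
  a : τ.var .a < 4
  d : τ.var .d < 4
  fail : τ.var .fail = 0
  done : τ.var .hv = 0 → inv f X = 0
  s_le : τ.var .hv ≠ 0 → s₀ * 2 ^ p ≤ 12 * N + E.h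
  small : τ.var .hv ≠ 0 → p = 0 ∨ E.h * 2 ^ p ≤ 12 * N
  first : p = 0 → τ.cache.cost ≤ c₁
  cost : 2 ^ p * τ.cache.cost + 4296 * N * (Λ + p + 3) ≤
    2 ^ p * (c₁ + 42 * E.h * (Λ + 2)) + 2 ^ p * (4296 * N * (Λ + 3))

theorem ScreenLoop.length_le {p f X} {τ : AState} (h : ScreenLoop E N K s₀ Λ D c₁ p f X τ) :
    X.length * 2 ^ p ≤ 6 * N := by
  have h₁ := h.own
  have h₂ := h.other
  have h₃ := List.length_eq_countP_add_countP (fun c : Cell => decide (c.1 = f)) (l := X)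
  simp only [decide_eq_true_eq] at h₃
  rw [h₃, Nat.add_mul]
  omega

/-- A pass leaves at most N/2^p dominated cells and all dominating ones. After the exchange of
colours the former are the dominating cells, and the next pass thins out the latter, so each colour
is bounded by a geometric sequence although only one shrinks at a time. Since 2 * s₀ * 2 ^ p is at
most h times the fan-in to the power Λ + p + 1, each doubling of s needs at most one more level. -/
theorem wp_screenLoop {σ : AState} {X : List Cell} (hE : SortEnv E) (hN : N = paramAt E.P 0)
    (hK : K = paramAt E.P 3) (hs₀ : s₀ = screenSize E.P) (hΛ : s₀ ≤ E.h * fanOf E.P ^ Λ)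
    (hD : D ≤ N * N) (hcap : (6 * N + 4) * (fanOf E.P + E.h + 1) < E.cap)
    (hcap' : 24 * N + 2 * E.h + 8 < E.cap) (hcapD : N * N + 1 < E.cap)
    (hσ : ScreenLoop E N K s₀ Λ D c₁ 0 false X σ) :
    Wp (aLang E) screenLoop (fun τ =>
      ((τ.var .fail = 1 ∧ K < D) ∨ (τ.var .fail = 0 ∧ τ.var .ans = D)) ∧
      τ.cache.cost ≤ c₁ + 42 * E.h * (Λ + 2) + 4296 * N * (Λ + 3)) σ := by
  have hh := hE.h_pos
  have hk := two_le_fanOf E.P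
  have hs₀h : E.h ≤ s₀ := by rw [hs₀, hE.cells, screenSize]; omega
  have hs₀K : min (K / N + 1) N ≤ s₀ := by rw [hs₀, screenSize, hN, hK]; omega
  refine wp_loop (fun τ => (∃ p f X, ScreenLoop E N K s₀ Λ D c₁ p f X τ) ∨
      (τ.var .hv = 0 ∧ τ.var .fail = 1 ∧ K < D ∧
        τ.cache.cost ≤ c₁ + 42 * E.h * (Λ + 2) + 4296 * N * (Λ + 3)))
    -- The parameter s doubles in each pass that continues, and by `s_le` it is at most 12 * N + h.
    (fun τ => if τ.var .hv = 0 then 0 else 12 * N + E.h + 2 - τ.var .s) (Or.inl ⟨_, _, _, hσ⟩)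
    ?_ ?_
  · rintro τ (⟨p, f, X, hI⟩ | ⟨hv, -⟩) htest
    swap
    · exact absurd hv htest
    simp only [aLang_test, Expr.eval_var] at htest
    obtain ⟨x, hx⟩ : ∃ x, τ.var .x = x := ⟨_, rfl⟩
    obtain ⟨y, hy⟩ : ∃ y, τ.var .y = y := ⟨_, rfl⟩
    have hxy := hI.xy
    rw [hx, hy] at hxy
    have hpow : 0 < 2 ^ p := by positivity
    have hXp := hI.length_le
    have hX : X.length ≤ 6 * N := (Nat.le_mul_of_pos_right _ hpow).trans hXp
    have hss := hI.s_le htest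
    have hsp : s₀ ≤ s₀ * 2 ^ p := Nat.le_mul_of_pos_right _ hpow
    have hans := hI.ans
    have hfr₀ : ∀ τ', Frame screenPass τ τ' → ∀ v ∈ [AVar.x, .y, .f, .s, .n, .fail],
        τ'.var v = τ.var v := fun τ' hfr v hv => hfr v (by revert v; decide)
    have hseg := hI.seg
    rw [hx] at hseg
    have hpass := (wp_screenPass (L := Λ + p + 1) hE hI.flag hx hy hI.s hI.n hI.ad hI.a hI.d (by omega)
      (by omega) (by omega) hseg (by omega) (by
        calc 2 * (s₀ * 2 ^ p) = s₀ * 2 ^ (p + 1) := by ring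
          _ ≤ E.h * fanOf E.P ^ Λ * fanOf E.P ^ (p + 1) :=
            Nat.mul_le_mul hΛ (Nat.pow_le_pow_left hk _)
          _ = _ := by ring) (lt_of_le_of_lt (Nat.mul_le_mul_right _ (by omega)) hcap) (by omega)
      (by omega)).frame
    rw [wp_seq]
    refine hpass.mono ?_
    rintro ⟨V, acc, mem, κ⟩ ⟨⟨Y, hsegY, hm, hhv', hown, hans', hle, hsmall, had, ha, hd, hcost⟩, hfr⟩
    have hv := hfr₀ _ hfr
    have hVx := (hv .x (by decide)).trans hx
    have hVy := (hv .y (by decide)).trans hy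
    have hVf := (hv .f (by decide)).trans hI.flag
    have hVs := (hv .s (by decide)).trans hI.s
    have hVfail := (hv .fail (by decide)).trans hI.fail
    dsimp only at hsegY hm hhv' hans' hle hsmall had ha hd hcost hVx hVy hVf hVs hVfail
    have hstep := pass_cost_le hI.cost hI.first hXp (hI.small htest) hcost
    simp only [wp_ite, wp_seq, wp_set, aLang_test, Expr.eval_var, Expr.eval_zero, Expr.eval_one,
      Expr.eval_ofNat, Expr.eval_sub, Expr.eval_mul, Expr.eval_lt, Expr.eval_par, Expr.eval_min,
      update_apply, reduceCtorEq, if_false, if_true, hVx, hVy, hVf, hVs, ← hN, ← hK]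
    have hf1 : f.toNat ≤ 1 := by cases f <;> decide
    by_cases hc : min K (N * N) < V .hv * (s₀ * 2 ^ p)
    · rw [if_pos hc]
      rw [Nat.mul_comm (V .hv)] at hc
      refine ⟨fun _ => ⟨by omega, by omega, Or.inr ⟨trivial, trivial, by omega, ?_⟩, ?_⟩,
        fun h => absurd h one_ne_zero⟩
      swap
      · rw [if_neg htest, hI.s]; omega
      rw [← Nat.mul_add] at hstep
      exact Nat.le_of_mul_le_mul_left (hstep.trans' (Nat.le_add_right _ _)) (by positivity)
    · rw [if_neg hc]
      rw [not_lt] at hc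
      have hhvp := mul_pow_le_of_screen hs₀K (by omega) hc
      have hYs : Y.length = Y.countP (fun c => c.1 = f) + Y.countP (fun c => ¬ c.1 = f) := by
        have h₃ := List.length_eq_countP_add_countP (fun c : Cell => decide (c.1 = f)) (l := Y)
        simpa only [decide_eq_true_eq] using h₃
      -- A heavy cell requires a list of more than s cells, and the list has at most 6 * N / 2 ^ p.
      have hbig : V .hv ≠ 0 → 2 * (s₀ * 2 ^ p) ≤ 12 * N ∧ E.h * 2 ^ (p + 1) ≤ 12 * N := by
        intro hv0
        have h₁ : s₀ * 2 ^ p < X.length := by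
          by_contra hcon
          exact hv0 (hsmall (by omega))
        refine ⟨by omega, ?_⟩
        have h₂ : E.h * 2 ^ p ≤ s₀ * 2 ^ p := Nat.mul_le_mul_right _ hs₀h
        have h₃ : X.length ≤ X.length * 2 ^ p := Nat.le_mul_of_pos_right _ hpow
        rw [pow_succ, ← Nat.mul_assoc]
        omega
      have hX0 : Y.countP (fun c => c.1 = f) ≤ 2 * N := by
        rw [hown]
        exact (Nat.le_mul_of_pos_right _ hpow).trans hI.own
      have hY0 : V .hv ≤ N := (Nat.le_mul_of_pos_right _ hpow).trans hhvp
      refine ⟨fun h => absurd rfl h, fun _ => ⟨by omega, by omega, by omega, by omega, by omega,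
        by omega, Or.inl ⟨p + 1, !f, Y.reverse, ?_⟩, ?_⟩⟩
      · constructor
        · cases f <;> rfl
        · simp only [update_apply, reduceCtorEq, if_false, if_true]; omega
        · simpa only [update_apply, reduceCtorEq, if_false, if_true, List.reverse_reverse]
            using hsegY
        · simpa only [update_apply, reduceCtorEq, if_false, if_true, List.length_reverse] using hm
        · simp only [update_apply, reduceCtorEq, if_false, if_true, inv_reverse]; omega
        · simp only [update_apply, reduceCtorEq, if_false, if_true]; ring
        · rw [List.countP_reverse, show (fun c : Cell => decide (c.1 = !f)) =
            fun c => decide (¬ c.1 = f) by ext c; cases c.1 <;> cases f <;> rfl, ← hhv', pow_succ,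
            ← Nat.mul_assoc]
          omega
        · rw [List.countP_reverse, show (fun c : Cell => decide (¬ c.1 = !f)) =
            fun c => decide (c.1 = f) by ext c; cases c.1 <;> cases f <;> rfl, hown, pow_succ,
            ← Nat.mul_assoc]
          have := hI.own
          omega
        · simpa only [update_apply, reduceCtorEq, if_false, if_true] using had
        · simpa only [update_apply, reduceCtorEq, if_false, if_true] using ha
        · simpa only [update_apply, reduceCtorEq, if_false, if_true] using hd
        · simpa only [update_apply, reduceCtorEq, if_false, if_true] using hVfail
        · simp only [update_apply, reduceCtorEq, if_false, if_true]
          intro h0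
          rw [inv_reverse]
          have := inv_le (f := f) (A := Y)
          rw [← hhv', h0, Nat.mul_zero] at this
          omega
        · simp only [update_apply, reduceCtorEq, if_false, if_true]
          intro h0
          have := hbig h0
          rw [pow_succ, ← Nat.mul_assoc]
          omega
        · simp only [update_apply, reduceCtorEq, if_false, if_true]
          exact fun h0 => Or.inr (hbig h0).2
        · omega
        · exact hstep
      · simp only [if_neg htest]
        rw [hI.s]
        split_ifs with h0
        · omega
        · have := hbig h0
          omega
  · rintro τ (⟨p, f, X, hI⟩ | ⟨hv, hf, hKD, hc⟩) htest
    · simp only [aLang_test, Expr.eval_var] at htest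
      have h₁ := hI.done htest
      have h₂ := hI.ans
      refine ⟨Or.inr ⟨hI.fail, by omega⟩, ?_⟩
      have h₃ := hI.cost
      rw [← Nat.mul_add] at h₃
      exact Nat.le_of_mul_le_mul_left (h₃.trans' (Nat.le_add_right _ _)) (by positivity)
    · exact ⟨Or.inl ⟨hf, hKD⟩, hc⟩

theorem wp_countDomination {b r : ℕ → ℝ} {σ : AState} (hE : SortEnv E) (hN : N = paramAt E.P 0)
    (hK : K = paramAt E.P 3) (hΛ : screenSize E.P ≤ E.h * fanOf E.P ^ Λ)
    (hB : E.h ≤ paramAt E.P 2) (hst : 2 * E.h ∣ strideOf E.P)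
    (hb : ∀ i < N, E.raw (blocksOf E.P * strideOf E.P +
      (i / paramAt E.P 2 * strideOf E.P + i % paramAt E.P 2)) = .key (b i))
    (hr : ∀ i < N, E.raw (i / paramAt E.P 2 * strideOf E.P + i % paramAt E.P 2) = .key (r i))
    (hcap : (6 * N + 4) * (fanOf E.P + E.h + 1) < E.cap) (hcap' : 24 * N + 2 * E.h + 8 < E.cap)
    (hcapD : N * N + 1 < E.cap)
    (hcapR : ∀ i < N, blocksOf E.P * strideOf E.P +
      (i / paramAt E.P 2 * strideOf E.P + i % paramAt E.P 2) < E.cap) :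
    Wp (aLang E) countDomination (fun τ =>
      ((τ.var .out = 0 ∧ K < inv true (interleave b r N)) ∨
        τ.var .out = inv true (interleave b r N) + 1) ∧
      τ.cache.cost ≤ σ.cache.cost + 8 * E.h + 14 * N + 42 * E.h * (Λ + 2) +
        4296 * N * (Λ + 3)) σ := by
  have hh := hE.h_pos
  have hk := two_le_fanOf E.P
  have hst' := hE.streams
  have hβ : E.β ≤ 1 := by nlinarith [hE.access]
  have hs₀ : screenSize E.P ≤ E.h + N := by rw [screenSize, hE.cells, ← hN]; omega
  obtain ⟨D, hDe⟩ : ∃ D, D = inv true (interleave b r N) := ⟨_, rfl⟩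
  have hD : D ≤ N * N := by
    have := inv_le (f := true) (A := interleave b r N)
    rwa [countP_interleave, show (fun c : Cell => decide (¬ c.1 = true)) =
      fun c => decide (c.1 = false) by ext c; cases c.1 <;> rfl, countP_interleave, ← hDe] at this
  rw [← hDe]
  rw [countDomination, wp_seq]
  refine (wp_loadInput hh hN hB hst hβ hb (by simpa only [Nat.zero_add] using hr) (by omega)
    (by omega) hcapR).mono ?_
  rintro ⟨V, acc, mem, κ⟩ ⟨hseg, hcost⟩
  dsimp only at hseg hcost
  simp only [wp_seq (p := .prim _), wp_set, Expr.eval_zero, Expr.eval_one, Expr.eval_ofNat,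
    Expr.eval_mul, Expr.eval_par, Expr.eval_max, Expr.eval_min, Expr.eval_div, Expr.eval_add,
    eval_cellsE, ← hN, ← hK]
  have hsc : max (cellsOf E.P) (min (K / N + 1) N) = screenSize E.P := by
    rw [screenSize, ← hN, ← hK]
  rw [hsc]
  refine ⟨by omega, by omega, by omega, by omega, by omega, by omega, by omega, by omega, by omega,
    by omega, ?_⟩
  rw [wp_seq]
  refine (wp_screenLoop (X := (interleave b r N).reverse) (D := D)
    (c₁ := σ.cache.cost + 8 * E.h + 14 * N) hE hN hK rfl hΛ hD hcap hcap' hcapD ?_).mono ?_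
  · constructor <;> simp only [update_apply, reduceCtorEq, if_false, if_true, List.reverse_reverse,
      List.length_reverse, length_interleave, List.countP_reverse, countP_interleave, pow_zero,
      Nat.mul_one, Nat.one_mul, Nat.add_zero, Nat.zero_add]
    case ans => rw [hDe, ← inv_reverse (f := true)]; rfl
    case other =>
      rw [show (fun c : Cell => decide (¬ c.1 = false)) =
        fun c => decide (c.1 = true) by ext c; cases c.1 <;> rfl, countP_interleave]
      omega
    case done => exact fun h => h.elim
    case small => exact fun _ => Or.inl trivial
    case seg => exact hseg
    all_goals first | rfl | omega
  · rintro ⟨V, acc, mem, κ⟩ ⟨hres, hcost'⟩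
    dsimp only at hres hcost'
    simp only [wp_set, Expr.eval_one, Expr.eval_var, Expr.eval_sub, Expr.eval_mul, Expr.eval_add,
      update_apply, reduceCtorEq, if_false, if_true]
    rcases hres with ⟨h₁, h₂⟩ | ⟨h₁, h₂⟩
    · rw [h₁]
      exact ⟨by omega, Or.inl ⟨by omega, h₂⟩, hcost'⟩
    · rw [h₁, h₂, Nat.sub_zero, Nat.one_mul]
      exact ⟨by omega, Or.inr rfl, hcost'⟩

end

/-! ### Sizes -/

section

variable {N M B K : ℕ}

theorem cellsOf_le (hB : 1 ≤ B) : cellsOf (N, M, B, K) ≤ B := by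
  simp only [cellsOf, paramAt]; omega

theorem le_mul_cellsOf : B ≤ 256 * cellsOf (N, M, B, K) := by
  simp only [cellsOf, paramAt]; omega

theorem stride_div_cells_le : strideOf (N, M, B, K) / cellsOf (N, M, B, K) ≤ 258 := by
  have h₁ := strideOf_lt (N, M, B, K)
  have h₂ := le_mul_cellsOf (N := N) (M := M) (B := B) (K := K)
  have h₃ : paramAt (N, M, B, K) 2 = B := rfl
  refine Nat.div_le_of_le_mul ?_
  omega

theorem blocksOf_eq : blocksOf (N, M, B, K) = numBlocks N B :=
  (Nat.ceilDiv_eq_add_pred_div _ _).symm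

theorem le_blocksOf_mul (hB : 1 ≤ B) : N ≤ blocksOf (N, M, B, K) * B := by
  have := Nat.div_add_mod' (N + B - 1) B
  have := Nat.mod_lt (N + B - 1) hB
  simp only [blocksOf, paramAt]; omega

theorem blocksOf_mul_le (hB : 1 ≤ B) : blocksOf (N, M, B, K) * B ≤ N + B := by
  have := Nat.div_mul_le_self (N + B - 1) B
  simp only [blocksOf, paramAt]; omega

theorem blocksOf_le (hB : 1 ≤ B) : blocksOf (N, M, B, K) ≤ N := by
  change (N + B - 1) / B ≤ N
  rw [← Nat.lt_succ_iff, Nat.div_lt_iff_lt_mul hB, Nat.succ_mul]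
  have := Nat.le_mul_of_pos_right N hB
  omega

/-- The product of h and the fan-in is a small fraction of M unless one of them has its minimal
value 1 or 2; the condition M ≥ 256 covers the constants in these cases. -/
theorem frames_le (hB : 1 ≤ B) (hM : 2 * B ≤ M) (h : 256 ≤ M) :
    B + 1 + (3 * fanOf (N, M, B, K) + 8) * (2 * cellsOf (N, M, B, K) + 1) ≤ M := by
  have hh := cellsOf_pos (N, M, B, K)
  have hc : cellsOf (N, M, B, K) = 1 ∨ 128 * cellsOf (N, M, B, K) ≤ B := by
    simp only [cellsOf, paramAt]; omega
  have hk : fanOf (N, M, B, K) = 2 ∨ 64 * (B * fanOf (N, M, B, K)) ≤ M := by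
    have := Nat.div_mul_le_self M (64 * B)
    simp only [fanOf, paramAt]
    rcases le_total 2 (M / (64 * B)) with h | h
    · rw [max_eq_right h]; right; linarith
    · rw [max_eq_left h]; left; rfl
  obtain ⟨k, hk'⟩ : ∃ k, k = fanOf (N, M, B, K) := ⟨_, rfl⟩
  obtain ⟨c, hc'⟩ : ∃ c, c = cellsOf (N, M, B, K) := ⟨_, rfl⟩
  rw [← hc'] at hh hc ⊢
  rw [← hk'] at hk ⊢
  clear hk' hc'
  rcases hc with rfl | hc
  · have := Nat.le_mul_of_pos_left k hB
    omega
  · have h₁ : (3 * k + 8) * (2 * c + 1) ≤ (3 * k + 8) * (3 * c) := Nat.mul_le_mul_left _ (by omega)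
    have h₂ : (3 * k + 8) * (3 * c) = 9 * (c * k) + 24 * c := by ring
    have h₃ : 128 * (c * k) ≤ B * k := by
      rw [← Nat.mul_assoc]; exact Nat.mul_le_mul_right _ hc
    rcases hk with rfl | hk <;> omega

/-- The bound for the indices of cells. -/
abbrev capOf (N M : ℕ) : ℕ := (N + M) ^ 10

theorem mul_sq_le_capOf (h : 2 ≤ N + M) : 256 * (N + M) ^ 2 ≤ capOf N M := by
  calc 256 * (N + M) ^ 2 = 2 ^ 8 * (N + M) ^ 2 := by norm_num
    _ ≤ (N + M) ^ 8 * (N + M) ^ 2 := Nat.mul_le_mul_right _ (Nat.pow_le_pow_left h 8)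
    _ = _ := by rw [capOf]; ring

theorem mul_capOf_le {e : ℕ} (h : 2 ≤ N + M) (he : 20 ≤ e) : 1024 * capOf N M ≤ (N + M) ^ e := by
  calc 1024 * capOf N M = 2 ^ 10 * (N + M) ^ 10 := by norm_num
    _ ≤ (N + M) ^ 10 * (N + M) ^ 10 := Nat.mul_le_mul_right _ (Nat.pow_le_pow_left h 10)
    _ = (N + M) ^ 20 := by ring
    _ ≤ _ := Nat.pow_le_pow_right (by omega) he

/-! ### The words of the input -/

variable {red blue : Fin N → ℝ}

theorem cellAt_inputDisk {a j : ℕ} (hj : j < B) : cellAt (inputDisk B red blue a) j =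
    if a < numBlocks N B then listWord red (a * B + j)
    else listWord blue ((a - numBlocks N B) * B + j) := by
  rw [cellAt, inputDisk, List.getD_eq_getElem?_getD, List.getElem?_map,
    List.getElem?_range hj]
  rfl

theorem listWord_of_lt {L : Fin N → ℝ} {i : ℕ} (h : i < N) : listWord L i = .key (extend L i) := by
  rw [listWord, dif_pos h, extend, dif_pos h]

theorem rawWords_add {disk : ℕ → List Word} {q j : ℕ} (hj : j < B) :
    rawWords (N, M, B, K) disk (q * strideOf (N, M, B, K) + j) = cellAt (disk q) j := by
  have hlt : j < strideOf (N, M, B, K) := hj.trans_le (le_strideOf (N, M, B, K))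
  rw [rawWords, Nat.mul_add_mod_self_right, Nat.mod_eq_of_lt hlt, Nat.mul_comm,
    Nat.mul_add_div (Nat.zero_lt_of_lt hlt), Nat.div_eq_of_lt hlt, Nat.add_zero]

theorem rawWords_red (hB : 1 ≤ B) {i : ℕ} (hi : i < N) :
    rawWords (N, M, B, K) (inputDisk B red blue)
      (i / B * strideOf (N, M, B, K) + i % B) = .key (extend red i) := by
  have h₁ := le_blocksOf_mul (N := N) (M := M) (K := K) hB
  rw [blocksOf_eq] at h₁
  have hlt := Nat.mod_lt i hB
  rw [rawWords_add hlt, cellAt_inputDisk hlt,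
    if_pos ((Nat.div_lt_iff_lt_mul hB).2 (hi.trans_le h₁)), Nat.div_add_mod', listWord_of_lt hi]

theorem rawWords_blue (hB : 1 ≤ B) {i : ℕ} (hi : i < N) :
    rawWords (N, M, B, K) (inputDisk B red blue)
      (blocksOf (N, M, B, K) * strideOf (N, M, B, K) +
        (i / B * strideOf (N, M, B, K) + i % B)) = .key (extend blue i) := by
  have hlt := Nat.mod_lt i hB
  rw [← Nat.add_assoc, ← Nat.add_mul, rawWords_add hlt, cellAt_inputDisk hlt, blocksOf_eq,
    if_neg (Nat.not_lt.2 (Nat.le_add_right _ _)), Nat.add_sub_cancel_left, Nat.div_add_mod', listWord_of_lt hi]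

theorem cellAt_inputDisk_of_le (hB : 1 ≤ B) {a j : ℕ} (ha : 2 * blocksOf (N, M, B, K) ≤ a) :
    cellAt (inputDisk B red blue a) j = .num 0 := by
  have h₁ := le_blocksOf_mul (N := N) (M := M) (K := K) hB
  rw [blocksOf_eq] at *
  rcases Nat.lt_or_ge j B with hj | hj
  · rw [cellAt_inputDisk hj]
    have h₂ : numBlocks N B * B ≤ (a - numBlocks N B) * B := Nat.mul_le_mul_right _ (by omega)
    split_ifs with h
    · rw [listWord, dif_neg (by nlinarith)]
    · rw [listWord, dif_neg (by omega)]
  · exact List.getD_eq_default _ _ (by simpa [inputDisk] using hj)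

end

/-! ### The algorithm -/

/-- A memory of less than 256 cells may be too small for the frames. But then h = 1 and the fan-in
is at most 3, so one transfer for every access to a word is affordable. -/
def program : Stmt ℕ MInstr :=
  preamble ;;
  .ite ((par 1).lt 256) (countDomination.subst AVar.idx Direct.translate)
    (countDomination.subst AVar.idx Cached.translate)

def workBound (h N Λ : ℕ) : ℕ := 8 * h + 14 * N + 42 * h * (Λ + 2) + 4296 * N * (Λ + 3)

section

variable {N M B K Λ : ℕ} {red blue : Fin N → ℝ}

theorem exec_countDomination {E : AEnv} (hE : SortEnv E) (hP : E.P = (N, M, B, K))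
    (hB : 1 ≤ B) (hM : 2 * B ≤ M) (hcap : E.cap = capOf N M)
    (hraw : E.raw = rawWords E.P (inputDisk B red blue))
    (hΛ : screenSize E.P ≤ E.h * fanOf E.P ^ Λ) :
    ∃ α, Exec (aLang E) countDomination AState.init α ∧
      ((α.var .out = 0 ∧ K < dominationCount red blue) ∨
        α.var .out = dominationCount red blue + 1) ∧
      α.cache.cost ≤ workBound E.h N Λ := by
  have hh := hE.cells
  rw [hP] at hh hraw
  have hk : fanOf E.P ≤ N + M := by
    have : M / (64 * B) ≤ M := Nat.div_le_self _ _
    rw [hP]; simp only [fanOf, paramAt]; omega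
  have hcells := cellsOf_le (N := N) (M := M) (K := K) hB
  have hst := strideOf_lt (N, M, B, K)
  have hst' := le_strideOf (N, M, B, K)
  have hnb := blocksOf_le (N := N) (M := M) (K := K) hB
  have h2 : 2 ≤ N + M := by omega
  have hbig := mul_sq_le_capOf h2
  rw [← hcap] at hbig
  obtain ⟨c, hc, -⟩ := strideOf_eq (N, M, B, K)
  rw [dominationCount_eq]
  obtain ⟨S, hS⟩ : ∃ S, S = N + M := ⟨_, rfl⟩
  rw [← hS] at hbig h2 hk
  obtain ⟨α, hex, hout, hcost⟩ := wp_countDomination (b := extend blue) (r := extend red)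
    (σ := AState.init) (N := N) (K := K) (Λ := Λ) hE (by rw [hP]; rfl) (by rw [hP]; rfl) hΛ
    (by rw [hP, hh]; exact hcells) (by rw [hP, hh, hc]; exact ⟨c, by ring⟩)
    (fun i hi => by rw [hP, hraw]; exact rawWords_blue hB hi)
    (fun i hi => by rw [hP, hraw]; exact rawWords_red hB hi)
    (by
      have h₁ : (6 * N + 4) * (fanOf E.P + E.h + 1) ≤ (8 * S) * (3 * S) :=
        Nat.mul_le_mul (by omega) (by omega)
      nlinarith)
    (by nlinarith) (by nlinarith)
    (fun i hi => by
      rw [hP]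
      change blocksOf (N, M, B, K) * strideOf (N, M, B, K) +
        (i / B * strideOf (N, M, B, K) + i % B) < E.cap
      have h₁ : blocksOf (N, M, B, K) * strideOf (N, M, B, K) ≤ S * (2 * S) :=
        Nat.mul_le_mul (by omega) (by simp only [paramAt] at hst; omega)
      have h₂ : i / B * strideOf (N, M, B, K) ≤ S * (2 * S) :=
        Nat.mul_le_mul ((Nat.div_le_self _ _).trans (by omega))
          (by simp only [paramAt] at hst; omega)
      have h₃ := Nat.mod_lt i hB
      nlinarith)
  refine ⟨α, hex, hout, hcost.trans_eq ?_⟩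
  simp only [AState.init, workBound, Nat.zero_add]

theorem cappedAnswer_outOf {μ : MState}
    (h : (μ.var 0 = 0 ∧ K < dominationCount red blue) ∨ μ.var 0 = dominationCount red blue + 1) :
    CappedAnswer K red blue (outOf μ) := by
  rcases h with ⟨h, hK⟩ | h
  · exact Or.inr ⟨by rw [outOf, if_pos h], hK⟩
  · exact Or.inl (by rw [outOf, h, if_neg (by omega), Nat.add_sub_cancel])

/-- The constant 1032 = 4 * 258 accounts for the preamble, since the stride is at most 258 times h.
-/
theorem wp_program {e : ℕ} (he : 20 ≤ e) (hB : 1 ≤ B) (hM : 2 * B ≤ M)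
    (hΛ : screenSize (N, M, B, K) ≤ cellsOf (N, M, B, K) * fanOf (N, M, B, K) ^ Λ) :
    Wp (mLang ⟨(N, M, B, K), 50, (N + M) ^ e⟩) program (fun μ =>
      CappedAnswer K red blue (outOf μ) ∧
      cellsOf (N, M, B, K) * μ.io ≤ cellsOf (N, M, B, K) * (1032 * blocksOf (N, M, B, K)) +
        2 * workBound (cellsOf (N, M, B, K)) N Λ)
      ⟨fun _ => 0, List.replicate M (.num 0), inputDisk B red blue, 0⟩ := by
  set ME : MEnv := ⟨(N, M, B, K), 50, (N + M) ^ e⟩ with hME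
  have h2 : 2 ≤ N + M := by omega
  have hbig := mul_sq_le_capOf h2
  have hbig' := mul_capOf_le h2 he
  have hcells := cellsOf_le (N := N) (M := M) (K := K) hB
  have hratio := stride_div_cells_le (N := N) (M := M) (B := B) (K := K)
  have hnb := blocksOf_le (N := N) (M := M) (K := K) hB
  have hW : ME.W = (N + M) ^ e := rfl
  have hsq : N + M ≤ (N + M) ^ 2 := Nat.le_self_pow two_ne_zero _
  obtain ⟨cap, hcap⟩ : ∃ cap, cap = capOf N M := ⟨_, rfl⟩
  rw [← hcap, ← hW] at hbig'
  rw [← hcap] at hbig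
  have hmul : blocksOf (N, M, B, K) * (strideOf (N, M, B, K) / cellsOf (N, M, B, K)) ≤
      blocksOf (N, M, B, K) * 258 := Nat.mul_le_mul_left _ hratio
  rw [program, wp_seq]
  refine (wp_preamble (ME := ME) (disk := inputDisk B red blue) (show 0 < 50 by omega)
    (show B < M by omega) hcells
    (fun a => by rw [inputDisk, List.length_map, List.length_range]; rfl)
    (fun a j => cellAt_inputDisk_of_le hB) ?_).mono ?_
  · change 18 * blocksOf (N, M, B, K) * (strideOf (N, M, B, K) / cellsOf (N, M, B, K)) +
      2 * blocksOf (N, M, B, K) + 20 ≤ ME.W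
    rw [Nat.mul_assoc]
    omega
  intro μ hμ
  have hio : μ.io ≤ 1032 * blocksOf (N, M, B, K) := by
    have := hμ.io
    change μ.io ≤ 4 * blocksOf (N, M, B, K) *
      (strideOf (N, M, B, K) / cellsOf (N, M, B, K)) at this
    rw [Nat.mul_assoc] at this
    omega
  have hio' := Nat.mul_le_mul_left (cellsOf (N, M, B, K)) hio
  rw [wp_ite]
  have htest : (mLang ME).test ((par 1).lt 256) μ = if M < 256 then 1 else 0 := rfl
  rw [htest]
  constructor
  · intro hlt
    replace hlt : M < 256 := by by_contra h; exact hlt (if_neg h)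
    have hc1 : cellsOf (N, M, B, K) = 1 := by simp only [cellsOf, paramAt]; omega
    have hfan : fanOf (N, M, B, K) ≤ 3 := by
      have : M / (64 * B) ≤ M / 64 := Nat.div_le_div_left (by omega) (by omega)
      simp only [fanOf, paramAt]; omega
    set E : AEnv := ⟨(N, M, B, K), 1, 3 * fanOf (N, M, B, K) + 8, cap, 1,
      rawWords (N, M, B, K) (inputDisk B red blue)⟩ with hE
    have hs : Direct.SizeOk E ME :=
      ⟨rfl, le_rfl, hc1.symm, rfl, hB, show B + 1 ≤ M by omega, show cap + 10 ≤ ME.W by omega,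
        show 2 * blocksOf (N, M, B, K) + 14 * cap + 20 ≤ ME.W by omega, rfl⟩
    obtain ⟨α, hex, hout, hcost⟩ := exec_countDomination (E := E) (Λ := Λ)
      ⟨hc1.symm, le_rfl, show 1 * (fanOf (N, M, B, K) + 1) ≤ 4 by omega⟩ rfl hB hM hcap rfl
      (by rw [hc1] at hΛ; exact hΛ)
    refine (Direct.simulate hs hex (Direct.Rel.init hs rfl hμ
      (show 0 < cap by omega))).mono fun μ' hR => ?_
    have h₁ : μ'.var 0 = α.var .out := hR.var .out
    refine ⟨cappedAnswer_outOf (by rw [h₁]; exact hout), ?_⟩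
    have h₂ := hR.cost
    change α.cache.cost ≤ workBound 1 N Λ at hcost
    rw [hc1] at *
    omega
  · intro hge
    replace hge : 256 ≤ M := by
      by_contra h
      rw [if_pos (by omega)] at hge
      exact one_ne_zero hge
    set E : AEnv := ⟨(N, M, B, K), cellsOf (N, M, B, K), 3 * fanOf (N, M, B, K) + 8, cap, 0,
      rawWords (N, M, B, K) (inputDisk B red blue)⟩ with hE
    have hs : Cached.SizeOk E ME :=
      ⟨rfl, le_rfl, rfl, rfl, hcells, frames_le hB hM hge, show cap + M + 10 ≤ ME.W by omega,
        show 2 * blocksOf (N, M, B, K) + 14 * cap + 20 ≤ ME.W by omega, rfl⟩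
    obtain ⟨α, hex, hout, hcost⟩ := exec_countDomination (E := E) (Λ := Λ)
      ⟨rfl, le_rfl, show 0 * _ ≤ 4 by omega⟩ rfl hB hM hcap rfl hΛ
    refine (Cached.simulate hs hex (Cached.Rel.init hs rfl hμ
      (show 0 < cap by omega))).mono fun μ' hR => ?_
    have h₁ : μ'.var 0 = α.var .out := hR.var .out
    refine ⟨cappedAnswer_outOf (by rw [h₁]; exact hout), ?_⟩
    have h₂ := hR.cost
    change 2 * cellsOf (N, M, B, K) * μ'.io ≤ 2 * cellsOf (N, M, B, K) * μ.io +
      4 * α.cache.cost at h₂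
    change α.cache.cost ≤ workBound (cellsOf (N, M, B, K)) N Λ at hcost
    rw [Nat.mul_assoc, Nat.mul_assoc] at h₂
    omega

end

/-! ### The number of levels -/

section

variable {N M B K : ℕ}

/-- For the fan-in k ≥ 2, M/B is at most 64 * (k + 1) ≤ 128 * k, and 128 ≤ k ^ 7. Passing from
logarithms to base M/B to those to base k thus costs at most a factor 8. -/
theorem div_le_fanOf_pow (hB : 1 ≤ B) : (M : ℝ) / B ≤ (fanOf (N, M, B, K) : ℝ) ^ 8 := by
  have hk := two_le_fanOf (N, M, B, K)
  have h₁ : M < (M / (64 * B) + 1) * (64 * B) := by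
    have := Nat.lt_div_mul_add (a := M) (b := 64 * B) (by omega)
    rw [Nat.add_mul]; omega
  have h₂ : M / (64 * B) ≤ fanOf (N, M, B, K) := le_max_right _ _
  obtain ⟨k, hk'⟩ : ∃ k, k = fanOf (N, M, B, K) := ⟨_, rfl⟩
  rw [← hk'] at hk h₂ ⊢
  have h₃ : 128 ≤ k ^ 7 := by simpa using Nat.pow_le_pow_left hk 7
  have h₄ : M ≤ k ^ 8 * B := by
    calc M ≤ (M / (64 * B) + 1) * (64 * B) := h₁.le
      _ ≤ (2 * k) * (64 * B) := Nat.mul_le_mul_right _ (by omega)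
      _ = 128 * k * B := by ring
      _ ≤ k ^ 7 * k * B := Nat.mul_le_mul_right _ (Nat.mul_le_mul_right _ h₃)
      _ = _ := by ring
  rw [div_le_iff₀ (by exact_mod_cast hB)]
  exact_mod_cast h₄

/-- Take the least possible Λ. If it is positive, one level fewer is too small, so h * k ^ (Λ - 1)
is less than both K/N + 1 and N, which bounds the power of k by K/(N * h). The first bound gives the
logarithm, the second gives h ≤ N. -/
theorem exists_levels (hB : 1 ≤ B) (hM : 2 * B ≤ M) : ∃ Λ : ℕ,
    screenSize (N, M, B, K) ≤ cellsOf (N, M, B, K) * fanOf (N, M, B, K) ^ Λ ∧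
    (Λ = 0 ∨ cellsOf (N, M, B, K) ≤ N) ∧
    (Λ : ℝ) ≤ 9 + 8 * max 0 (Real.logb ((M : ℝ) / B) ((K : ℝ) / ((N : ℝ) * B))) := by
  classical
  have hk := two_le_fanOf (N, M, B, K)
  have hh := cellsOf_pos (N, M, B, K)
  have hMB := div_le_fanOf_pow (N := N) (M := M) (K := K) hB
  have hBh := le_mul_cellsOf (N := N) (M := M) (B := B) (K := K)
  have hs : screenSize (N, M, B, K) = max (cellsOf (N, M, B, K)) (min (K / N + 1) N) := rfl
  obtain ⟨k, hk'⟩ : ∃ k, k = fanOf (N, M, B, K) := ⟨_, rfl⟩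
  obtain ⟨h, hh'⟩ : ∃ h, h = cellsOf (N, M, B, K) := ⟨_, rfl⟩
  rw [← hk'] at hk hMB ⊢
  rw [← hh'] at hh hBh hs ⊢
  have hex : ∃ Λ, screenSize (N, M, B, K) ≤ h * k ^ Λ := by
    refine ⟨screenSize (N, M, B, K), (Nat.lt_pow_self (by omega : 1 < k)).le.trans ?_⟩
    exact Nat.le_mul_of_pos_left _ hh
  refine ⟨Nat.find hex, Nat.find_spec hex, ?_⟩
  rcases hΛ : Nat.find hex with _ | Λ
  · exact ⟨Or.inl rfl, by push_cast; positivity⟩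
  have hlt : h * k ^ Λ < screenSize (N, M, B, K) := by
    have := Nat.find_min hex (m := Λ) (by omega)
    omega
  have hle : h ≤ h * k ^ Λ := Nat.le_mul_of_pos_right _ (by positivity)
  rw [hs] at hlt
  refine ⟨Or.inr (by omega), ?_⟩
  have hN : 0 < N := by omega
  have hK : N * (h * k ^ Λ) ≤ K := by
    have : h * k ^ Λ ≤ K / N := by omega
    rw [Nat.mul_comm]
    exact (Nat.le_div_iff_mul_le hN).1 this
  have hBpos : (0 : ℝ) < B := by exact_mod_cast hB
  have hNpos : (0 : ℝ) < N := by exact_mod_cast hN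
  push_cast
  rcases Nat.lt_or_ge Λ 8 with h8 | h8
  · have : (Λ : ℝ) ≤ 8 := by exact_mod_cast h8.le
    have := le_max_left 0 (Real.logb ((M : ℝ) / B) ((K : ℝ) / ((N : ℝ) * B)))
    linarith
  -- Eight levels absorb the factor 256 between B and h, since k ^ 8 ≥ 256.
  obtain ⟨l, rfl⟩ := Nat.exists_eq_add_of_le' h8
  have hpow : (k : ℝ) ^ l ≤ (K : ℝ) / ((N : ℝ) * B) := by
    rw [le_div_iff₀ (by positivity)]
    have : k ^ l * (N * B) ≤ K := by
      refine le_trans ?_ hK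
      have h256 : 256 ≤ k ^ 8 := by simpa using Nat.pow_le_pow_left hk 8
      calc k ^ l * (N * B) ≤ k ^ l * (N * (k ^ 8 * h)) :=
            Nat.mul_le_mul_left _ (Nat.mul_le_mul_left _ (hBh.trans (Nat.mul_le_mul_right _ h256)))
        _ = _ := by ring
    exact_mod_cast this
  have hk1 : (1 : ℝ) < k := by exact_mod_cast hk
  have hMB2 : (1 : ℝ) < (M : ℝ) / B := by
    rw [lt_div_iff₀ hBpos]
    exact_mod_cast (by omega : 1 * B < M)
  have hlogM : Real.log ((M : ℝ) / B) ≤ 8 * Real.log k := by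
    have := Real.log_le_log (by linarith) hMB
    rwa [Real.log_pow] at this
  have hlogK : l * Real.log k ≤ Real.log ((K : ℝ) / ((N : ℝ) * B)) := by
    have := Real.log_le_log (by positivity) hpow
    rwa [Real.log_pow] at this
  have hlogpos := Real.log_pos hMB2
  have hmain : (l : ℝ) / 8 ≤ Real.logb ((M : ℝ) / B) ((K : ℝ) / ((N : ℝ) * B)) := by
    rw [Real.logb, le_div_iff₀ hlogpos]
    have : (l : ℝ) * Real.log ((M : ℝ) / B) ≤ l * (8 * Real.log k) :=
      mul_le_mul_of_nonneg_left hlogM (Nat.cast_nonneg _)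
    linarith
  have := le_max_right 0 (Real.logb ((M : ℝ) / B) ((K : ℝ) / ((N : ℝ) * B)))
  push_cast
  linarith

/-- The bound is divided by h, and h is replaced by B at the price of a factor 256 in front of the
terms with N. -/
theorem transfers_le {h nb N B Λ t : ℕ} {x : ℝ} (hB : 1 ≤ B) (hBh : B ≤ 256 * h)
    (hnb : nb * B ≤ N + B) (hΛ : Λ = 0 ∨ h ≤ N) (hx : 0 ≤ x) (hΛx : (Λ : ℝ) ≤ 9 + 8 * x)
    (ht : h * t ≤ h * (1032 * nb) + 2 * workBound h N Λ) :
    (t : ℝ) ≤ 100000000 * (1 + (N : ℝ) / B + (N : ℝ) / B * x) := by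
  have h₁ : h * Λ ≤ N * Λ := by
    rcases hΛ with rfl | h
    · simp
    · exact Nat.mul_le_mul_right _ h
  have h₂ : h * t ≤ h * (1032 * nb + 184) + N * (25804 + 8676 * Λ) := by
    rw [workBound] at ht
    nlinarith
  have h₃ : B * t ≤ B * (1032 * nb + 184) + 256 * (N * (25804 + 8676 * Λ)) := by
    obtain ⟨z, hz⟩ : ∃ z, z = N * (25804 + 8676 * Λ) := ⟨_, rfl⟩
    obtain ⟨y, hy⟩ : ∃ y, y = 1032 * nb + 184 := ⟨_, rfl⟩
    rw [← hz, ← hy] at h₂ ⊢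
    by_contra hcon
    rw [not_le] at hcon
    have hyt : y < t := by
      by_contra hle
      have := Nat.mul_le_mul_left B (not_lt.1 hle)
      omega
    obtain ⟨d, rfl⟩ := Nat.exists_eq_add_of_lt hyt
    have := Nat.mul_le_mul_right (d + 1) hBh
    nlinarith
  have h₄ : B * t ≤ 1216 * B + N * (6606856 + 2221056 * Λ) := by nlinarith
  have hBpos : (0 : ℝ) < B := by exact_mod_cast hB
  have h₅ : (B : ℝ) * t ≤ 1216 * B + N * (6606856 + 2221056 * Λ) := by exact_mod_cast h₄
  have h₆ : (N : ℝ) * (6606856 + 2221056 * Λ) ≤ N * (100000000 + 100000000 * x) :=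
    mul_le_mul_of_nonneg_left (by linarith) (Nat.cast_nonneg _)
  have h₇ : 100000000 * (1 + (N : ℝ) / B + (N : ℝ) / B * x) =
      (100000000 * B + N * (100000000 + 100000000 * x)) / B := by
    field_simp
    ring
  rw [h₇, le_div_iff₀ hBpos]
  linarith

end

end ExtMem

theorem theorem4 :
    ∃ (A : ExtMem.Algorithm) (C : ℝ), ∀ (N M B K : ℕ), 1 ≤ B → 2 * B ≤ M →
      ∀ red blue : Fin N → ℝ, ∃ (t : ℕ) (out : Option ℕ),
        A.Run N M B K t (ExtMem.initial A.regs M B red blue) out ∧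
        CappedAnswer K red blue out ∧
        (t : ℝ) ≤ C * (1 + (N : ℝ) / B +
          (N : ℝ) / B * max 0 (Real.logb ((M : ℝ) / B) ((K : ℝ) / ((N : ℝ) * B)))) := by
  -- The exponent 20 makes room for disk addresses and counters, and the size of the program for the
  -- program counter.
  refine ⟨ExtMem.algorithmOf (ExtMem.program.code 0) 50 (max 20 ExtMem.program.size), 100000000,
    fun N M B K hB hM red blue => ?_⟩
  obtain ⟨Λ, hΛ, hΛ₀, hΛx⟩ := ExtMem.exists_levels (N := N) (K := K) hB hM
  obtain ⟨μ, hex, hans, hio⟩ := ExtMem.wp_program (red := red) (blue := blue)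
    (le_max_left 20 ExtMem.program.size) hB hM hΛ
  exact ⟨μ.io, _, ExtMem.run_of_exec (by omega)
    (Nat.lt_two_pow_self.trans_le (Nat.pow_le_pow_right two_pos (le_max_right _ _))) hex, hans,
    ExtMem.transfers_le hB ExtMem.le_mul_cellsOf
      (ExtMem.blocksOf_mul_le hB) hΛ₀ (le_max_left _ _) hΛx hio⟩
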